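/- **Proposition 3.3.** Let $d\in\{1,2\}$. Let $Q$ be the ground state, i.e. the positive spherically symmetric $H^1(\mathbb R^d)$ solution of $\Delta Q-Q+Q^{1+4/d}=0$, and let $\rho$ be the spherically symmetric $H^1$ solution of $-\Delta\rho+\rho-(1+\tfrac4d)Q^{4/d}\rho=-|x|^2Q$. Let $B_1,\dots,B_N$ be independent real Brownian motions on a probability space, and let $\phi_1,\dots,\phi_N\in C_b^\infty(\mathbb R^d,\mathbb R)$ satisfy - (A0) $\lim_{|x|\to\infty}(1+|x|^2)\,|\partial^\nu\phi_k(x)|=0$ for every multi-index $\nu\neq0$; - (A1) $\partial^\nu\phi_k(0)=0$ for every multi-index with $0\le|\nu|\le5$. Put $b=2i\sum_k\nabla\phi_k B_k$, $\;c=-\sum_{j=1}^d\big(\sum_k\partial_j\phi_kB_k\big)^2+i\sum_k\Delta\phi_k B_k$, and $$S_T(t,x)=(T-t)^{-d/2}\,Q\!\left(\tfrac{x}{T-t}\right)\exp\!\Big(\tfrac{i}{T-t}-i\tfrac{|x|^2}{4(T-t)}\Big),\qquad t<T .$$ Then for almost every $\omega$ and every $T>0$ there exist $\delta>0$ and $C>0$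 such that the following holds. Let $(t_n)$ be any increasing sequence with $t_n<T$ and $t_n\to T$, let $n$ be any index, let $0\le t_n^*<t_n$, and let $u_n\in C([t_n^*,t_n];H^1)$ solve (in $H^{-1}$) $$i\partial_tu_n+\Delta u_n+|u_n|^{4/d}u_n+b\cdot\nabla u_n+c\,u_n=0,\qquad u_n(t_n)=S_T(t_n).$$ Let $(\lambda_n,\alpha_n,\beta_n,\gamma_n,\theta_n)\in C^1((t_n^*,t_n);\mathbb R^{2d+3})$, with all five functions defined on $[t_n^*,t_n]$ and $\lambda_n>0$ there. For a real function $g$ write $$g_{\mathcal P_n}(t,y)=g(y)\,e^{i\beta_n(t)\cdot y-\frac i4\gamma_n(t)|y|^2},$$ and define $\varepsilon_n$, $w_n$, $R_n$, $\tilde\rho_n$ by $$u_n(t,x)=\lambda_n^{-d/2}\,(Q_{\mathcal P_n}+\varepsilon_n)\!\left(t,\tfrac{x-\alpha_n}{\lambda_n}\right)e^{i\theta_n},$$ $$w_n(t,x)=\lambda_n^{-d/2}\,Q_{\mathcal P_n}\!\left(t,\tfrac{x-\alpha_n}{\lambda_n}\right)e^{i\theta_n},\qquad R_n=u_n-w_n,\qquad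 \tilde\rho_n(t,x)=\lambda_n^{-d/2}\,\rho_{\mathcal P_n}\!\left(t,\tfrac{x-\alpha_n}{\lambda_n}\right)e^{i\theta_n}.$$ Suppose that on $[t_n^*,t_n]$ the orthogonality conditions $$\mathrm{Re}\!\int(x-\alpha_n)w_n\overline{R_n}\,dx=0,\qquad \mathrm{Re}\!\int|x-\alpha_n|^2w_n\overline{R_n}\,dx=0,$$ $$\mathrm{Im}\!\int\big(\tfrac d2w_n+(x-\alpha_n)\cdot\nabla w_n\big)\overline{R_n}\,dx=0,\qquad \mathrm{Im}\!\int\nabla w_n\overline{R_n}\,dx=0,\qquad \mathrm{Im}\!\int\tilde\rho_n\overline{R_n}\,dx=0$$ hold, and that $P_n+\|\varepsilon_n\|_{L^2}\le\delta$ on $[t_n^*,t_n]$, where $P_n=|\lambda_n|+|\alpha_n|+|\beta_n|+|\gamma_n|$. Then for all $t\in[t_n^*,t_n]$ $$Mod_n(t)\le C\Big(P_n^2(t)\|\varepsilon_n(t)\|_{L^2}+\|\varepsilon_n(t)\|_{L^2}^2+\sum_{k=3}^{1+4/d}\|\varepsilon_n(t)\|_{H^1}^k+P_n^6(t)\Big),$$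 where $$Mod_n=|\lambda_n\dot\lambda_n+\gamma_n|+|\lambda_n^2\dot\gamma_n+\gamma_n^2|+|\lambda_n\dot\alpha_n-2\beta_n|+|\lambda_n^2\dot\beta_n+\gamma_n\beta_n|+\big|\lambda_n^2\dot\theta_n-1-|\beta_n|^2\big| .$$ At the end points $t=t_n^*$ and $t=t_n$ the dots denote one-sided derivatives, and the bound is asserted there whenever these exist. In particular $C$ and $\delta$ do not depend on $n$ or on $t$. -/

import Mathlib

open MeasureTheory ProbabilityTheory Filter Topology Set
open scoped NNReal ENNReal

namespace RNLS

section

open scoped ContDiff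

noncomputable section

/-- The Euclidean space `ℝ^d`. -/
abbrev E (d : ℕ) : Type := EuclideanSpace ℝ (Fin d)

/-- The `j`-th vector of the standard basis of `ℝ^d`. -/
def stdVec {d : ℕ} (j : Fin d) : E d := EuclideanSpace.single j (1 : ℝ)

/-- The critical power `4 / d`. The division of natural numbers is exact in the two dimensions
`d = 1` and `d = 2` that are considered. -/
abbrev crit (d : ℕ) : ℕ := 4 / d

/-! ### The Sobolev space `H¹(ℝ^d; ℂ)` -/

/-- The norm of `L²(ℝ^d; ℂ)`. -/
def l2Norm {d : ℕ} (f : E d → ℂ) : ℝ := (eLpNorm f 2 volume).toReal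

/-- `g` is an `L²` weak `j`-th partial derivative of `f`. -/
def IsWeakPartial {d : ℕ} (j : Fin d) (f g : E d → ℂ) : Prop :=
  MemLp g 2 volume ∧
    ∀ ψ : E d → ℝ, ContDiff ℝ ∞ ψ → HasCompactSupport ψ →
      ∫ x, f x * ((fderiv ℝ ψ x (stdVec j) : ℝ) : ℂ) = - ∫ x, g x * (ψ x : ℂ)

/-- `f` belongs to `H¹(ℝ^d; ℂ)`. -/
def MemH1 {d : ℕ} (f : E d → ℂ) : Prop :=
  MemLp f 2 volume ∧ ∀ j : Fin d, ∃ g : E d → ℂ, IsWeakPartial j f g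

open Classical in
/-- The weak `j`-th partial derivative of an `H¹` function (unique up to null sets). -/
def weakPartial {d : ℕ} (j : Fin d) (f : E d → ℂ) : E d → ℂ :=
  if h : ∃ g : E d → ℂ, IsWeakPartial j f g then h.choose else 0

/-- The norm of `H¹(ℝ^d; ℂ)`. -/
def h1Norm {d : ℕ} (f : E d → ℂ) : ℝ :=
  Real.sqrt (l2Norm f ^ 2 + ∑ j : Fin d, l2Norm (weakPartial j f) ^ 2)

/-! ### The ground state and the associated profiles -/

/-- `Q` is the ground state: the positive, spherically symmetric `H¹` solution of
`ΔQ - Q + Q^{1 + 4/d} = 0`. -/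
structure IsGroundState {d : ℕ} (Q : E d → ℝ) : Prop where
  smooth : ContDiff ℝ ∞ Q
  pos : ∀ x, 0 < Q x
  radial : ∀ x y : E d, ‖x‖ = ‖y‖ → Q x = Q y
  memH1 : MemH1 (fun x => (Q x : ℂ))
  eqn : ∀ x, Laplacian.laplacian Q x - Q x + Q x ^ (1 + crit d) = 0

/-- `ρ` is the spherically symmetric `H¹` solution of `L₊ ρ = -|x|² Q`, where
`L₊ = -Δ + 1 - (1 + 4/d) Q^{4/d}`. -/
structure IsRho {d : ℕ} (Q ρ : E d → ℝ) : Prop where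
  smooth : ContDiff ℝ 2 ρ
  radial : ∀ x y : E d, ‖x‖ = ‖y‖ → ρ x = ρ y
  memH1 : MemH1 (fun x => (ρ x : ℂ))
  eqn : ∀ x, - Laplacian.laplacian ρ x + ρ x
    - (1 + 4 / (d : ℝ)) * Q x ^ crit d * ρ x = - ‖x‖ ^ 2 * Q x

/-- The pseudo-conformal blow-up solution
`S_T(t, x) = (T - t)^{-d/2} Q(x / (T - t)) exp(i / (T - t) - i |x|² / (4 (T - t)))`. -/
def pseudoConformal {d : ℕ} (Q : E d → ℝ) (T t : ℝ) (x : E d) : ℂ :=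
  (((T - t) ^ (-(d : ℝ) / 2) * Q ((T - t)⁻¹ • x) : ℝ) : ℂ) *
    Complex.exp (((1 / (T - t) - ‖x‖ ^ 2 / (4 * (T - t)) : ℝ) : ℂ) * Complex.I)

/-! ### The noise and the rescaled equation -/

/-- `φ ∈ C_b^∞(ℝ^d; ℝ)`: smooth, and bounded together with all its derivatives. -/
def IsCbInfty {d : ℕ} (φ : E d → ℝ) : Prop :=
  ContDiff ℝ ∞ φ ∧ ∀ m : ℕ, ∃ K : ℝ, ∀ x, ‖iteratedFDeriv ℝ m φ x‖ ≤ K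

/-- Asymptotical flatness: `⟨x⟩² |∂^ν φ(x)| → 0` as `|x| → ∞`, for every `ν ≠ 0`. -/
def AsymptoticallyFlat {d : ℕ} (φ : E d → ℝ) : Prop :=
  ∀ m : ℕ, 1 ≤ m →
    Tendsto (fun x : E d => (1 + ‖x‖ ^ 2) * ‖iteratedFDeriv ℝ m φ x‖) (cocompact (E d)) (𝓝 0)

/-- Flatness at the origin: `∂^ν φ(0) = 0` for every `|ν| ≤ 5`. -/
def FlatAtOrigin {d : ℕ} (φ : E d → ℝ) : Prop :=
  ∀ m : ℕ, m ≤ 5 → iteratedFDeriv ℝ m φ 0 = 0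

/-- The `j`-th component of `b(t, x) = 2 i ∑ₖ ∇φₖ(x) Bₖ(t)`; `β k t` is the value at time `t` of
the `k`-th driving path. -/
def bCoef {d N : ℕ} (φ : Fin N → E d → ℝ) (β : Fin N → ℝ → ℝ) (t : ℝ) (x : E d) (j : Fin d) : ℂ :=
  2 * Complex.I * ((∑ k, fderiv ℝ (φ k) x (stdVec j) * β k t : ℝ) : ℂ)

/-- `c(t, x) = -∑ⱼ (∑ₖ ∂ⱼφₖ(x) Bₖ(t))² + i ∑ₖ Δφₖ(x) Bₖ(t)`. -/
def cCoef {d N : ℕ} (φ : Fin N → E d → ℝ) (β : Fin N → ℝ → ℝ) (t : ℝ) (x : E d) : ℂ :=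
  - ((∑ j : Fin d, (∑ k, fderiv ℝ (φ k) x (stdVec j) * β k t) ^ 2 : ℝ) : ℂ)
    + Complex.I * ((∑ k, Laplacian.laplacian (φ k) x * β k t : ℝ) : ℂ)

/-- `u ∈ C([t₀, t₁]; H¹)` solves `i ∂ₜu + Δu + |u|^{4/d} u + b·∇u + c u = 0` on `[t₀, t₁]`: the
integrated equation
`u(t) - u(s) = ∫ₛᵗ (iΔu + i|u|^{4/d}u + i(b·∇u + c u)) dr` holds in `H⁻¹`, that is, after pairing
with test functions. -/
structure IsSolutionOn {d N : ℕ} (φ : Fin N → E d → ℝ) (β : Fin N → ℝ → ℝ) (t₀ t₁ : ℝ)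
    (u : ℝ → E d → ℂ) : Prop where
  memH1 : ∀ t ∈ Icc t₀ t₁, MemH1 (u t)
  cont : ∀ s ∈ Icc t₀ t₁,
    Tendsto (fun t => h1Norm (fun x => u t x - u s x)) (𝓝[Icc t₀ t₁] s) (𝓝 0)
  eqn : ∀ ψ : E d → ℝ, ContDiff ℝ ∞ ψ → HasCompactSupport ψ →
    ∀ s ∈ Icc t₀ t₁, ∀ t ∈ Icc t₀ t₁,
      (∫ x, u t x * (ψ x : ℂ)) - ∫ x, u s x * (ψ x : ℂ) =
        ∫ r in s..t,
          (- Complex.I * ∑ j : Fin d,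
              ∫ x, weakPartial j (u r) x * ((fderiv ℝ ψ x (stdVec j) : ℝ) : ℂ))
            + Complex.I * (∫ x, (‖u r x‖ ^ crit d : ℝ) * u r x * (ψ x : ℂ))
            + Complex.I * ∫ x, ((∑ j : Fin d, bCoef φ β r x j * weakPartial j (u r) x)
                + cCoef φ β r x * u r x) * (ψ x : ℂ)

/-! ### Modulation parameters and the geometrical decomposition -/

/-- The modulation parameters `(λ, α, β, γ, θ)` as functions of time. -/
structure ModPath (d : ℕ) where
  lam : ℝ → ℝ
  al : ℝ → E d
  be : ℝ → E d
  ga : ℝ → ℝ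
  th : ℝ → ℝ

namespace ModPath

variable {d : ℕ}

/-- The parameters are continuously differentiable on the set `s`. -/
structure C1On (p : ModPath d) (s : Set ℝ) : Prop where
  lam : ContDiffOn ℝ 1 p.lam s
  al : ContDiffOn ℝ 1 p.al s
  be : ContDiffOn ℝ 1 p.be s
  ga : ContDiffOn ℝ 1 p.ga s
  th : ContDiffOn ℝ 1 p.th s

/-- The parameters are differentiable at `t` within the set `s`. -/
structure DiffWithinAt (p : ModPath d) (s : Set ℝ) (t : ℝ) : Prop where
  lam : DifferentiableWithinAt ℝ p.lam s t
  al : DifferentiableWithinAt ℝ p.al s t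
  be : DifferentiableWithinAt ℝ p.be s t
  ga : DifferentiableWithinAt ℝ p.ga s t
  th : DifferentiableWithinAt ℝ p.th s t

/-- The phase `β(t)·y - γ(t)|y|²/4`. -/
def phase (p : ModPath d) (t : ℝ) (y : E d) : ℝ :=
  inner ℝ (p.be t) y - p.ga t / 4 * ‖y‖ ^ 2

/-- For a real profile `g`, the function `g_𝒫(t, y) = g(y) exp(i β(t)·y - i γ(t)|y|²/4)`. -/
def deform (p : ModPath d) (g : E d → ℝ) (t : ℝ) (y : E d) : ℂ :=
  (g y : ℂ) * Complex.exp ((p.phase t y : ℂ) * Complex.I)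

/-- For a real profile `g`, the function `λ^{-d/2} g_𝒫(t, (x - α)/λ) e^{iθ}`.
It is `w` for `g = Q`, and `ρ̃` for `g = ρ`. -/
def bubble (p : ModPath d) (g : E d → ℝ) (t : ℝ) (x : E d) : ℂ :=
  ((p.lam t ^ (-(d : ℝ) / 2) : ℝ) : ℂ) * p.deform g t ((p.lam t)⁻¹ • (x - p.al t)) *
    Complex.exp ((p.th t : ℂ) * Complex.I)

/-- The remainder `R = u - w` in the original variables. -/
def bigR (p : ModPath d) (Q : E d → ℝ) (u : ℝ → E d → ℂ) (t : ℝ) (x : E d) : ℂ :=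
  u t x - p.bubble Q t x

/-- The remainder `ε` in the rescaled variables, that is, the function determined by
`u(t, x) = λ^{-d/2} (Q_𝒫 + ε)(t, (x - α)/λ) e^{iθ}`. -/
def eps (p : ModPath d) (Q : E d → ℝ) (u : ℝ → E d → ℂ) (t : ℝ) (y : E d) : ℂ :=
  ((p.lam t ^ ((d : ℝ) / 2) : ℝ) : ℂ) * u t (p.lam t • y + p.al t) *
    Complex.exp (-(p.th t : ℂ) * Complex.I) - p.deform Q t y

/-- `P(t) = |λ| + |α| + |β| + |γ|`. -/
def size (p : ModPath d) (t : ℝ) : ℝ :=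
  |p.lam t| + ‖p.al t‖ + ‖p.be t‖ + |p.ga t|

/-- The vector of modulation equations, with time derivatives taken within the time interval `s`
(so they are one-sided at its end points). -/
def modEq (p : ModPath d) (s : Set ℝ) (t : ℝ) : ℝ :=
  |p.lam t * derivWithin p.lam s t + p.ga t|
    + |p.lam t ^ 2 * derivWithin p.ga s t + p.ga t ^ 2|
    + ‖p.lam t • derivWithin p.al s t - (2 : ℝ) • p.be t‖
    + ‖p.lam t ^ 2 • derivWithin p.be s t + p.ga t • p.be t‖
    + |p.lam t ^ 2 * derivWithin p.th s t - 1 - ‖p.be t‖ ^ 2|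

/-- The orthogonality conditions at time `t`, where `w = p.bubble Q t`, `ρ̃ = p.bubble ρ t`,
`R = p.bigR Q u t` and `Λw = (d/2) w + (x - α)·∇w`. -/
structure Orthogonal (p : ModPath d) (Q ρ : E d → ℝ) (u : ℝ → E d → ℂ) (t : ℝ) : Prop where
  x_w : ∀ j : Fin d,
    (∫ x, ((x j - p.al t j : ℝ) : ℂ) * p.bubble Q t x * star (p.bigR Q u t x)).re = 0
  sq_w :
    (∫ x, ((‖x - p.al t‖ ^ 2 : ℝ) : ℂ) * p.bubble Q t x * star (p.bigR Q u t x)).re = 0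
  lambda_w :
    (∫ x, ((d : ℂ) / 2 * p.bubble Q t x + fderiv ℝ (p.bubble Q t) x (x - p.al t))
      * star (p.bigR Q u t x)).im = 0
  grad_w : ∀ j : Fin d,
    (∫ x, fderiv ℝ (p.bubble Q t) x (stdVec j) * star (p.bigR Q u t x)).im = 0
  rho :
    (∫ x, p.bubble ρ t x * star (p.bigR Q u t x)).im = 0

/-- `p` gives the geometrical decomposition of `u` on `[t₀, t₁]`: the parameters are `C¹` on
`(t₀, t₁)`, the scale `λ` is positive, and the orthogonality conditions hold on `[t₀, t₁]`.
The decomposition `u = w + R` itself is the definition of `bigR` and `eps`. -/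
structure Decomposes (p : ModPath d) (Q ρ : E d → ℝ) (u : ℝ → E d → ℂ) (t₀ t₁ : ℝ) : Prop where
  c1 : p.C1On (Ioo t₀ t₁)
  lam_pos : ∀ t ∈ Icc t₀ t₁, 0 < p.lam t
  orth : ∀ t ∈ Icc t₀ t₁, p.Orthogonal Q ρ u t

end ModPath

end

end

end RNLS

open RNLS

namespace RNLS

open scoped ContDiff

/-! ### The `L²` norm -/

section L2

variable {d : ℕ} {f g h : E d → ℂ}

/-! The modulation is undone first. With y = (x - α)/λ, the function z = `p.resc t (u t)` removes
scaling, translation and the whole phase, so that z = Q + η with |η| = |ε| pointwise. For a real,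
rapidly decaying profile g, the pairing ⟨g, z⟩ = ∫ g z is differentiable in time as soon as the
parameters are, although u itself only solves the equation weakly: all space derivatives are moved
to the modulated profile. Write a, e, v, w, m for the defects of the laws of λ, γ, α, β, θ, and Λ =
d/2 + y·∇. The equation, expanded around Q, gives (`exists_linearized`) λ² Re d/dt ⟨g, z⟩ = Im ⟨L₋g,
η⟩ + a ∫ gΛQ + ∑ v_j ∫ g ∂_jQ + error, λ² Im d/dt ⟨g, z⟩ = -Re ⟨L₊g, η⟩ - m ∫ gQ - ∑ w_j ∫ y_j gQ +
(e/4) ∫ |y|² gQ + error. The error is bounded by ‖ε‖² + ∑ ‖ε‖_{H¹}^k (nonlinear remainder,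
`exists_integral_nlRem_le`), by (P + ‖ε‖) Mod (a defect times a parameter or times η), and by P⁶
(noise, `exists_norm_noise_pairing_le`).

The noise is of sixth order because its coefficients are small near the origin: a gradient of φ is
O(|x|⁵) and a Laplacian O(|x|⁴), while |x| ≤ P(1 + |y|). After integration by parts against the
concentrated profile, the factor λ² supplies the missing powers of P.

The five families of orthogonality conditions single out profiles on which the linearized operators
act explicitly: g = y_jQ: L₋g = -2∂_jQ, which yields v; g = |y|²Q: L₋g = -4ΛQ, which yields a; g =
ΛQ: L₊g = -2Q, which yields e; g = ∂_jQ: L₊g = 0, which yields w; g = ρ: L₊g = -|y|²Q, which yields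
m once e is known. For all of them except ∂_jQ the relevant part of ⟨g, η⟩ vanishes identically, so
its derivative is zero. For ∂_jQ, the derivative of the phase in ∇w leaves Im ⟨∂_jQ, η⟩ = β_j Re ⟨Q,
η⟩. The term in η on the right is again one of the pairings controlled by orthogonality, or is Re
⟨Q, η⟩. Mass conservation (`IsSolutionOn.l2Norm_eq`), together with ‖S_T(t_n)‖ = ‖Q‖, gives 2 Re ⟨Q,
η⟩ = -‖ε‖² (`two_mul_re_pair_eta`), which is quadratic. The coefficients to be inverted are ‖Q‖² and
‖yQ‖² up to numerical factors; in particular ∫ ρQ = -‖yQ‖²/2.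

Hence Mod ≤ C (good terms + (P + ‖ε‖) Mod), and smallness of P + ‖ε‖ absorbs the last term. The
constants depend on Q, ρ, φ and on a bound for the Brownian paths on [0, T], hence only on ω and T.

The analytic support consists of density of test functions in H¹, the Sobolev embeddings in
dimensions one and two, and rapid decay of Q and ρ. The decay follows from a barrier argument for
the radial equation in the variable |x|² (`rapidOn_of_ode`). -/

lemma l2Norm_nonneg (f : E d → ℂ) : 0 ≤ l2Norm f := ENNReal.toReal_nonneg

lemma l2Norm_eq_norm_toLp (hf : MemLp f 2 volume) : l2Norm f = ‖hf.toLp f‖ :=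
  (Lp.norm_toLp f hf).symm

lemma l2Norm_congr (hfg : f =ᵐ[volume] g) : l2Norm f = l2Norm g := by
  unfold l2Norm; rw [eLpNorm_congr_ae hfg]

lemma l2Norm_congr_norm (hfg : ∀ x, ‖f x‖ = ‖g x‖) : l2Norm f = l2Norm g := by
  unfold l2Norm; rw [eLpNorm_congr_norm_ae (Eventually.of_forall hfg)]

lemma l2Norm_add_le (hf : MemLp f 2 volume) (hg : MemLp g 2 volume) :
    l2Norm (fun x => f x + g x) ≤ l2Norm f + l2Norm g := by
  have := norm_add_le (hf.toLp f) (hg.toLp g)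
  rw [← MemLp.toLp_add, ← l2Norm_eq_norm_toLp, ← l2Norm_eq_norm_toLp, ← l2Norm_eq_norm_toLp] at this
  exact this

lemma l2Norm_sub_comm (f g : E d → ℂ) :
    l2Norm (fun x => f x - g x) = l2Norm (fun x => g x - f x) :=
  l2Norm_congr_norm fun _ => norm_sub_rev _ _

lemma l2Norm_sub_triangle (hf : MemLp f 2 volume) (hg : MemLp g 2 volume)
    (hh : MemLp h 2 volume) :
    l2Norm (fun x => f x - h x) ≤ l2Norm (fun x => f x - g x) + l2Norm (fun x => g x - h x) := by
  have := l2Norm_add_le (hf.sub hg) (hg.sub hh)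
  simp only [Pi.sub_apply, sub_add_sub_cancel] at this
  exact this

lemma l2Norm_const_mul (c : ℂ) (f : E d → ℂ) :
    l2Norm (fun x => c * f x) = ‖c‖ * l2Norm f := by
  unfold l2Norm
  have : (fun x => c * f x) = c • f := rfl
  rw [this, eLpNorm_const_smul]
  simp

lemma l2Norm_zero : l2Norm (fun _ : E d => (0 : ℂ)) = 0 := by
  simp [l2Norm]

lemma l2Norm_mono (hg : MemLp g 2 volume) (h : ∀ᵐ x, ‖f x‖ ≤ ‖g x‖) :
    l2Norm f ≤ l2Norm g :=
  ENNReal.toReal_mono hg.2.ne (eLpNorm_mono_ae h)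

lemma l2Norm_sq (hf : MemLp f 2 volume) : l2Norm f ^ 2 = ∫ x, ‖f x‖ ^ 2 := by
  rw [l2Norm, hf.eLpNorm_eq_integral_rpow_norm (by simp) (by simp)]
  have h0 : 0 ≤ ∫ x, ‖f x‖ ^ 2 := integral_nonneg fun x => by positivity
  simp only [ENNReal.toReal_ofNat, Real.rpow_ofNat]
  rw [ENNReal.toReal_ofReal (by positivity), ← one_div, ← Real.sqrt_eq_rpow, Real.sq_sqrt h0]

lemma integrable_mul_of_memLp (hf : MemLp f 2 volume) (hg : MemLp g 2 volume) :
    Integrable (fun x => f x * g x) volume :=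
  MemLp.integrable_mul hf hg

lemma integrable_norm_mul_of_memLp (hf : MemLp f 2 volume) (hg : MemLp g 2 volume) :
    Integrable (fun x => ‖f x‖ * ‖g x‖) volume := by
  simpa using (integrable_mul_of_memLp hf hg).norm

lemma integral_norm_mul_le (hf : MemLp f 2 volume) (hg : MemLp g 2 volume) :
    ∫ x, ‖f x‖ * ‖g x‖ ≤ l2Norm f * l2Norm g := by
  have := integral_mul_norm_le_Lp_mul_Lq (μ := (volume : Measure (E d))) (f := f) (g := g)
    (p := 2) (q := 2) (Real.HolderConjugate.two_two) (by simpa using hf) (by simpa using hg)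
  simp only [Real.rpow_ofNat] at this
  rw [← Real.sqrt_eq_rpow, ← Real.sqrt_eq_rpow, ← l2Norm_sq hf, ← l2Norm_sq hg,
    Real.sqrt_sq (l2Norm_nonneg _), Real.sqrt_sq (l2Norm_nonneg _)] at this
  exact this

lemma norm_integral_mul_le (hf : MemLp f 2 volume) (hg : MemLp g 2 volume) :
    ‖∫ x, f x * g x‖ ≤ l2Norm f * l2Norm g :=
  (norm_integral_le_integral_norm _).trans (by simpa using integral_norm_mul_le hf hg)

lemma _root_.MeasureTheory.MemLp.conj_fun (hf : MemLp f 2 volume) :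
    MemLp (fun x => star (f x)) 2 volume := hf.star

lemma l2Norm_star (f : E d → ℂ) : l2Norm (fun x => star (f x)) = l2Norm f :=
  l2Norm_congr_norm fun _ => norm_star _

/-- Convergence of `L²` pairings. -/
lemma tendsto_integral_mul {ι : Type*} {l : Filter ι} {F G : ι → E d → ℂ}
    (hF : ∀ᶠ i in l, MemLp (F i) 2 volume) (hG : ∀ᶠ i in l, MemLp (G i) 2 volume)
    (hf : MemLp f 2 volume) (hg : MemLp g 2 volume)
    (hFf : Tendsto (fun i => l2Norm (fun x => F i x - f x)) l (𝓝 0))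
    (hGg : Tendsto (fun i => l2Norm (fun x => G i x - g x)) l (𝓝 0)) :
    Tendsto (fun i => ∫ x, F i x * G i x) l (𝓝 (∫ x, f x * g x)) := by
  rw [tendsto_iff_norm_sub_tendsto_zero]
  have hlim : Tendsto (fun i => l2Norm (fun x => F i x - f x) * l2Norm (fun x => G i x - g x)
      + l2Norm (fun x => F i x - f x) * l2Norm g
      + l2Norm f * l2Norm (fun x => G i x - g x)) l (𝓝 0) := by
    simpa using ((hFf.mul hGg).add (hFf.mul_const (l2Norm g))).add (hGg.const_mul (l2Norm f))
  refine squeeze_zero' (Eventually.of_forall fun _ => norm_nonneg _) ?_ hlim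
  filter_upwards [hF, hG] with i h1 h2
  have e : (∫ x, F i x * G i x) - ∫ x, f x * g x
      = (∫ x, (F i x - f x) * (G i x - g x)) + (∫ x, (F i x - f x) * g x)
        + ∫ x, f x * (G i x - g x) := by
    have i1 := integrable_mul_of_memLp (h1.sub hf) (h2.sub hg)
    have i2 := integrable_mul_of_memLp (h1.sub hf) hg
    have i3 := integrable_mul_of_memLp hf (h2.sub hg)
    simp only [Pi.sub_apply] at i1 i2 i3
    rw [← integral_sub (integrable_mul_of_memLp h1 h2) (integrable_mul_of_memLp hf hg),
      ← integral_add i1 i2, ← integral_add (f := fun x => (F i x - f x) * (G i x - g x) + (F i x - f x) * g x) (i1.add i2) i3]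
    congr 1; ext x; ring
  rw [e]
  refine (norm_add₃_le).trans ?_
  gcongr
  · exact norm_integral_mul_le (h1.sub hf) (h2.sub hg)
  · exact norm_integral_mul_le (h1.sub hf) hg
  · exact norm_integral_mul_le hf (h2.sub hg)

/-- Continuous functions with compact support are square integrable. -/
lemma memLp_of_hasCompactSupport (hc : Continuous f) (hs : HasCompactSupport f) :
    MemLp f 2 volume := hc.memLp_of_hasCompactSupport hs

end L2

/-! ### Partial derivatives -/

section Partial

variable {d : ℕ}

/-- The classical `j`-th partial derivative. -/
noncomputable def pd {F : Type*} [NormedAddCommGroup F] [NormedSpace ℝ F] (j : Fin d)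
    (f : E d → F) (x : E d) : F := fderiv ℝ f x (stdVec j)

lemma pd_contDiff {F : Type*} [NormedAddCommGroup F] [NormedSpace ℝ F] (j : Fin d)
    {f : E d → F} {m n : WithTop ℕ∞} (hf : ContDiff ℝ n f) (h : m + 1 ≤ n) :
    ContDiff ℝ m (pd j f) :=
  (hf.fderiv_right h).clm_apply contDiff_const

lemma pd_hasCompactSupport {F : Type*} [NormedAddCommGroup F] [NormedSpace ℝ F] (j : Fin d)
    {f : E d → F} (hf : HasCompactSupport f) : HasCompactSupport (pd j f) :=
  hf.fderiv_apply (𝕜 := ℝ) (stdVec j)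

lemma norm_stdVec (j : Fin d) : ‖(stdVec j : E d)‖ = 1 := by
  simp [stdVec]

lemma norm_pd_le {F : Type*} [NormedAddCommGroup F] [NormedSpace ℝ F] (j : Fin d)
    (f : E d → F) (x : E d) : ‖pd j f x‖ ≤ ‖fderiv ℝ f x‖ := by
  simpa [norm_stdVec, pd] using (fderiv ℝ f x).le_opNorm (stdVec j)

lemma pd_mul (j : Fin d) {f g : E d → ℂ} {x : E d} (hf : DifferentiableAt ℝ f x)
    (hg : DifferentiableAt ℝ g x) :
    pd j (fun x => f x * g x) x = pd j f x * g x + f x * pd j g x := by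
  unfold pd
  rw [fderiv_fun_mul hf hg]
  simp [mul_comm]
  ring

lemma pd_ofReal (j : Fin d) {f : E d → ℝ} {x : E d} (hf : DifferentiableAt ℝ f x) :
    pd j (fun x => (f x : ℂ)) x = ((pd j f x : ℝ) : ℂ) := by
  unfold pd
  have := (Complex.ofRealCLM.hasFDerivAt.comp x hf.hasFDerivAt).fderiv
  have h2 : (fun x => (f x : ℂ)) = Complex.ofRealCLM ∘ f := rfl
  rw [h2, this]; rfl

lemma pd_star (j : Fin d) {f : E d → ℂ} {x : E d} (hf : DifferentiableAt ℝ f x) :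
    pd j (fun x => star (f x)) x = star (pd j f x) := by
  unfold pd
  have := (Complex.conjCLE.toContinuousLinearMap.hasFDerivAt.comp x hf.hasFDerivAt).fderiv
  have h2 : (fun x => star (f x)) = Complex.conjCLE.toContinuousLinearMap ∘ f := rfl
  rw [h2, this]; rfl

end Partial

/-! ### Weak derivatives -/

section Weak

variable {d : ℕ} {j : Fin d} {f g f' g' : E d → ℂ}

lemma IsWeakPartial.unique (h : IsWeakPartial j f g) (h' : IsWeakPartial j f g') :
    g =ᵐ[volume] g' := by
  refine ae_eq_of_integral_contDiff_smul_eq (h.1.locallyIntegrable (by norm_num))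
    (h'.1.locallyIntegrable (by norm_num)) fun ψ h1 h2 => ?_
  have e1 := h.2 ψ h1 h2
  rw [h'.2 ψ h1 h2, neg_inj] at e1
  simpa [mul_comm] using e1.symm

lemma MemH1.isWeakPartial (hf : MemH1 f) (j : Fin d) : IsWeakPartial j f (weakPartial j f) := by
  unfold weakPartial
  rw [dif_pos (hf.2 j)]
  exact (hf.2 j).choose_spec

/-- `weakPartial` is a choice and is determined only up to null sets; this passes from it to any
concrete representative. -/
lemma IsWeakPartial.ae_eq (h : IsWeakPartial j f g) : weakPartial j f =ᵐ[volume] g := by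
  have h' : ∃ g, IsWeakPartial j f g := ⟨g, h⟩
  unfold weakPartial
  rw [dif_pos h']
  exact h'.choose_spec.unique h

lemma MemH1.memLp_weakPartial (hf : MemH1 f) (j : Fin d) : MemLp (weakPartial j f) 2 volume :=
  (hf.isWeakPartial j).1

lemma memLp_ofReal_test {ψ : E d → ℝ} (h : Continuous ψ) (hs : HasCompactSupport ψ) :
    MemLp (fun x => (ψ x : ℂ)) 2 volume :=
  memLp_of_hasCompactSupport (Complex.continuous_ofReal.comp h) (hs.comp_left Complex.ofReal_zero)

lemma memLp_ofReal_fderiv_test {ψ : E d → ℝ} (h : ContDiff ℝ ∞ ψ) (hs : HasCompactSupport ψ)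
    (j : Fin d) : MemLp (fun x => ((fderiv ℝ ψ x (stdVec j) : ℝ) : ℂ)) 2 volume :=
  memLp_ofReal_test (pd_contDiff (m := 0) j h (by simp)).continuous (pd_hasCompactSupport j hs)

lemma IsWeakPartial.congr_left (h : IsWeakPartial j f g) (e : f =ᵐ[volume] f') :
    IsWeakPartial j f' g := by
  refine ⟨h.1, fun ψ h1 h2 => ?_⟩
  rw [← h.2 ψ h1 h2]
  exact integral_congr_ae (e.symm.mono fun x hx => by simp only [hx])

lemma IsWeakPartial.add (hfm : MemLp f 2 volume) (hfm' : MemLp f' 2 volume)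
    (h : IsWeakPartial j f g) (h' : IsWeakPartial j f' g') :
    IsWeakPartial j (fun x => f x + f' x) (fun x => g x + g' x) := by
  refine ⟨h.1.add h'.1, fun ψ h1 h2 => ?_⟩
  have m1 := memLp_ofReal_test h1.continuous h2
  have m2 := memLp_ofReal_fderiv_test h1 h2 j
  simp only [add_mul]
  rw [integral_add (integrable_mul_of_memLp hfm m2) (integrable_mul_of_memLp hfm' m2),
    integral_add (integrable_mul_of_memLp h.1 m1) (integrable_mul_of_memLp h'.1 m1),
    h.2 ψ h1 h2, h'.2 ψ h1 h2]
  ring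

lemma IsWeakPartial.const_mul (c : ℂ) (h : IsWeakPartial j f g) :
    IsWeakPartial j (fun x => c * f x) (fun x => c * g x) := by
  refine ⟨h.1.const_mul c, fun ψ h1 h2 => ?_⟩
  simp only [mul_assoc]
  rw [integral_const_mul, integral_const_mul, h.2 ψ h1 h2]
  ring

lemma IsWeakPartial.neg (h : IsWeakPartial j f g) :
    IsWeakPartial j (fun x => - f x) (fun x => - g x) := by
  simpa using h.const_mul (-1)

lemma IsWeakPartial.sub (hfm : MemLp f 2 volume) (hfm' : MemLp f' 2 volume)
    (h : IsWeakPartial j f g) (h' : IsWeakPartial j f' g') :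
    IsWeakPartial j (fun x => f x - f' x) (fun x => g x - g' x) := by
  simpa [sub_eq_add_neg] using IsWeakPartial.add hfm hfm'.neg h h'.neg

lemma IsWeakPartial.conj (h : IsWeakPartial j f g) :
    IsWeakPartial j (fun x => star (f x)) (fun x => star (g x)) := by
  refine ⟨h.1.star, fun ψ h1 h2 => ?_⟩
  have := congrArg (starRingEnd ℂ) (h.2 ψ h1 h2)
  rw [map_neg, ← integral_conj, ← integral_conj] at this
  simpa using this

/-- Product of an `H¹` function with a bounded smooth function. -/
lemma IsWeakPartial.real_mul {a : E d → ℝ} (ha : ContDiff ℝ ∞ a) {K : ℝ} (haK : ∀ x, ‖a x‖ ≤ K)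
    (haK' : ∀ x, ‖pd j a x‖ ≤ K) (hfm : MemLp f 2 volume) (h : IsWeakPartial j f g) :
    IsWeakPartial j (fun x => (a x : ℂ) * f x) (fun x => ((pd j a x : ℝ) : ℂ) * f x + (a x : ℂ) * g x) := by
  have hpa : ContDiff ℝ ∞ (pd j a) := pd_contDiff j ha (by simp)
  have mul_mem : ∀ {b : E d → ℝ} {f : E d → ℂ}, Continuous b → (∀ x, ‖b x‖ ≤ K) →
      MemLp f 2 volume → MemLp (fun x => (b x : ℂ) * f x) 2 volume := fun {b f} hb hbK hf =>
    hf.of_le_mul ((Complex.continuous_ofReal.comp hb).aestronglyMeasurable.mul hf.1)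
      (Eventually.of_forall fun x => by
        simp only [norm_mul, Complex.norm_real]; gcongr; exact hbK x) (c := K)
  have A := mul_mem hpa.continuous haK' hfm
  have B := mul_mem ha.continuous haK h.1
  refine ⟨A.add B, fun ψ h1 h2 => ?_⟩
  have m1 := memLp_ofReal_test h1.continuous h2
  have m2 := memLp_ofReal_fderiv_test h1 h2 j
  have h3 : ContDiff ℝ ∞ (fun x => a x * ψ x) := ha.mul h1
  have h4 : HasCompactSupport (fun x => a x * ψ x) := h2.mul_left
  have key := h.2 _ h3 h4
  have e1 : ∀ x, fderiv ℝ (fun x => a x * ψ x) x (stdVec j)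
      = pd j a x * ψ x + a x * fderiv ℝ ψ x (stdVec j) := fun x => by
    rw [fderiv_fun_mul (ha.differentiable (by simp) x) (h1.differentiable (by simp) x)]
    simp [pd]; ring
  simp only [e1] at key
  have i1 := integrable_mul_of_memLp A m1
  have i2 := integrable_mul_of_memLp (mul_mem ha.continuous haK hfm) m2
  have i3 := integrable_mul_of_memLp B m1
  have : ∫ x, f x * ((pd j a x * ψ x + a x * fderiv ℝ ψ x (stdVec j) : ℝ) : ℂ)
      = (∫ x, ((pd j a x : ℝ) : ℂ) * f x * (ψ x : ℂ))
        + ∫ x, (a x : ℂ) * f x * ((fderiv ℝ ψ x (stdVec j) : ℝ) : ℂ) := by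
    rw [← integral_add i1 i2]
    congr 1; ext x; push_cast; ring
  rw [this] at key
  simp only [add_mul]
  rw [integral_add i1 i3]
  have e2 : ∫ x, (a x : ℂ) * g x * (ψ x : ℂ) = ∫ x, g x * ((a x * ψ x : ℝ) : ℂ) := by
    congr 1; ext x; push_cast; ring
  rw [e2, ← neg_eq_iff_eq_neg.mpr key]
  ring_nf

lemma MemH1.of_isWeakPartial {G : Fin d → E d → ℂ} (hf : MemLp f 2 volume)
    (h : ∀ j, IsWeakPartial j f (G j)) : MemH1 f := ⟨hf, fun j => ⟨G j, h j⟩⟩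

lemma MemH1.add (hf : MemH1 f) (hg : MemH1 g) : MemH1 (fun x => f x + g x) :=
  .of_isWeakPartial (hf.1.add hg.1) fun j => .add hf.1 hg.1 (hf.isWeakPartial j) (hg.isWeakPartial j)

lemma MemH1.sub (hf : MemH1 f) (hg : MemH1 g) : MemH1 (fun x => f x - g x) :=
  .of_isWeakPartial (hf.1.sub hg.1) fun j => .sub hf.1 hg.1 (hf.isWeakPartial j) (hg.isWeakPartial j)

lemma MemH1.const_mul (c : ℂ) (hf : MemH1 f) : MemH1 (fun x => c * f x) :=
  .of_isWeakPartial (hf.1.const_mul c) fun j => (hf.isWeakPartial j).const_mul c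

lemma MemH1.conj (hf : MemH1 f) : MemH1 (fun x => star (f x)) :=
  .of_isWeakPartial hf.1.star fun j => (hf.isWeakPartial j).conj

lemma MemH1.congr_ae (hf : MemH1 f) (e : f =ᵐ[volume] g) : MemH1 g :=
  .of_isWeakPartial (hf.1.ae_eq e) fun j => (hf.isWeakPartial j).congr_left e

lemma MemH1.weakPartial_add (hf : MemH1 f) (hg : MemH1 g) (j : Fin d) :
    weakPartial j (fun x => f x + g x) =ᵐ[volume] fun x => weakPartial j f x + weakPartial j g x :=
  (IsWeakPartial.add hf.1 hg.1 (hf.isWeakPartial j) (hg.isWeakPartial j)).ae_eq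

lemma MemH1.weakPartial_sub (hf : MemH1 f) (hg : MemH1 g) (j : Fin d) :
    weakPartial j (fun x => f x - g x) =ᵐ[volume] fun x => weakPartial j f x - weakPartial j g x :=
  (IsWeakPartial.sub hf.1 hg.1 (hf.isWeakPartial j) (hg.isWeakPartial j)).ae_eq

lemma MemH1.weakPartial_const_mul (c : ℂ) (hf : MemH1 f) (j : Fin d) :
    weakPartial j (fun x => c * f x) =ᵐ[volume] fun x => c * weakPartial j f x :=
  ((hf.isWeakPartial j).const_mul c).ae_eq

lemma MemH1.weakPartial_conj (hf : MemH1 f) (j : Fin d) :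
    weakPartial j (fun x => star (f x)) =ᵐ[volume] fun x => star (weakPartial j f x) :=
  (hf.isWeakPartial j).conj.ae_eq

/-- A `C¹` function that is square integrable together with its partial derivative. -/
lemma isWeakPartial_of_contDiff (hf : ContDiff ℝ 1 f) (hm : MemLp f 2 volume)
    (hp : MemLp (pd j f) 2 volume) : IsWeakPartial j f (pd j f) := by
  refine ⟨hp, fun ψ h1 h2 => ?_⟩
  have m1 := memLp_ofReal_test h1.continuous h2
  have m2 := memLp_ofReal_fderiv_test h1 h2 j
  have e : ∀ x, ((fderiv ℝ ψ x (stdVec j) : ℝ) : ℂ)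
      = fderiv ℝ (fun x => (ψ x : ℂ)) x (stdVec j) := fun x =>
    (pd_ofReal j (h1.differentiable (by simp) x)).symm
  simp only [e] at m2 ⊢
  exact integral_mul_fderiv_eq_neg_fderiv_mul_of_integrable (integrable_mul_of_memLp hp m1)
    (integrable_mul_of_memLp hm m2) (integrable_mul_of_memLp hm m1)
    (fun x _ => hf.differentiable (by simp) x)
    (fun x _ => (Complex.ofRealCLM.differentiable.comp (h1.differentiable (by simp))) x)

lemma memH1_of_contDiff (hf : ContDiff ℝ 1 f) (hm : MemLp f 2 volume)
    (hp : ∀ j, MemLp (pd j f) 2 volume) : MemH1 f :=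
  .of_isWeakPartial hm fun j => isWeakPartial_of_contDiff hf hm (hp j)

lemma memH1_of_hasCompactSupport (hf : ContDiff ℝ 1 f) (hs : HasCompactSupport f) : MemH1 f :=
  memH1_of_contDiff hf (memLp_of_hasCompactSupport hf.continuous hs) fun j =>
    memLp_of_hasCompactSupport (pd_contDiff (m := 0) j hf (by simp)).continuous
      (pd_hasCompactSupport j hs)

lemma weakPartial_of_hasCompactSupport (hf : ContDiff ℝ 1 f) (hs : HasCompactSupport f)
    (j : Fin d) : weakPartial j f =ᵐ[volume] pd j f :=
  (isWeakPartial_of_contDiff hf (memLp_of_hasCompactSupport hf.continuous hs)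
    (memLp_of_hasCompactSupport (pd_contDiff (m := 0) j hf (by simp)).continuous
      (pd_hasCompactSupport j hs))).ae_eq

lemma l2Norm_le_h1Norm (f : E d → ℂ) : l2Norm f ≤ h1Norm f := by
  refine Real.le_sqrt_of_sq_le ?_
  have : 0 ≤ ∑ j : Fin d, l2Norm (weakPartial j f) ^ 2 := Finset.sum_nonneg fun _ _ => sq_nonneg _
  linarith

lemma l2Norm_weakPartial_le_h1Norm (f : E d → ℂ) (j : Fin d) :
    l2Norm (weakPartial j f) ≤ h1Norm f := by
  refine Real.le_sqrt_of_sq_le ?_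
  have := Finset.single_le_sum (f := fun j => l2Norm (weakPartial j f) ^ 2)
    (fun _ _ => sq_nonneg _) (Finset.mem_univ j)
  have h2 := sq_nonneg (l2Norm f)
  linarith

lemma h1Norm_nonneg (f : E d → ℂ) : 0 ≤ h1Norm f := Real.sqrt_nonneg _

/-- A norm equivalent to the norm of `H¹`. -/
noncomputable def sobNorm (f : E d → ℂ) : ℝ := l2Norm f + ∑ j : Fin d, l2Norm (weakPartial j f)

lemma sobNorm_nonneg (f : E d → ℂ) : 0 ≤ sobNorm f :=
  add_nonneg (l2Norm_nonneg _) (Finset.sum_nonneg fun _ _ => l2Norm_nonneg _)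

lemma sobNorm_le_h1Norm (f : E d → ℂ) : sobNorm f ≤ (d + 1) * h1Norm f := by
  have : ∑ j : Fin d, l2Norm (weakPartial j f) ≤ ∑ _j : Fin d, h1Norm f :=
    Finset.sum_le_sum fun j _ => l2Norm_weakPartial_le_h1Norm f j
  simp only [Finset.sum_const, Finset.card_univ, Fintype.card_fin, nsmul_eq_mul] at this
  unfold sobNorm
  linarith [l2Norm_le_h1Norm f]

lemma l2Norm_le_sobNorm (f : E d → ℂ) : l2Norm f ≤ sobNorm f :=
  le_add_of_nonneg_right (Finset.sum_nonneg fun _ _ => l2Norm_nonneg _)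

lemma l2Norm_weakPartial_le_sobNorm (f : E d → ℂ) (j : Fin d) :
    l2Norm (weakPartial j f) ≤ sobNorm f :=
  (Finset.single_le_sum (f := fun j => l2Norm (weakPartial j f))
    (fun _ _ => l2Norm_nonneg _) (Finset.mem_univ j)).trans
    (le_add_of_nonneg_left (l2Norm_nonneg _))

lemma sobNorm_add_le (hf : MemH1 f) (hg : MemH1 g) :
    sobNorm (fun x => f x + g x) ≤ sobNorm f + sobNorm g := by
  have h1 := l2Norm_add_le hf.1 hg.1
  have h2 : ∑ j, l2Norm (weakPartial j fun x => f x + g x)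
      ≤ ∑ j, (l2Norm (weakPartial j f) + l2Norm (weakPartial j g)) :=
    Finset.sum_le_sum fun j _ => (l2Norm_congr (hf.weakPartial_add hg j)).le.trans
      (l2Norm_add_le (hf.memLp_weakPartial j) (hg.memLp_weakPartial j))
  rw [Finset.sum_add_distrib] at h2
  unfold sobNorm; linarith

lemma sobNorm_const_mul (c : ℂ) (hf : MemH1 f) : sobNorm (fun x => c * f x) = ‖c‖ * sobNorm f := by
  unfold sobNorm
  rw [l2Norm_const_mul, mul_add, Finset.mul_sum]
  congr 1
  refine Finset.sum_congr rfl fun j _ => ?_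
  rw [l2Norm_congr (hf.weakPartial_const_mul c j), l2Norm_const_mul]

lemma sobNorm_neg (hf : MemH1 f) : sobNorm (fun x => - f x) = sobNorm f := by
  have := sobNorm_const_mul (-1) hf
  simpa only [neg_mul, one_mul, norm_neg, norm_one] using this

lemma sobNorm_sub_comm (hf : MemH1 f) (hg : MemH1 g) :
    sobNorm (fun x => f x - g x) = sobNorm (fun x => g x - f x) := by
  refine (sobNorm_neg (hf.sub hg)).symm.trans (congrArg sobNorm ?_)
  ext x; ring

lemma sobNorm_conj (hf : MemH1 f) : sobNorm (fun x => star (f x)) = sobNorm f := by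
  unfold sobNorm
  rw [l2Norm_star]
  congr 1
  exact Finset.sum_congr rfl fun j _ => by rw [l2Norm_congr (hf.weakPartial_conj j), l2Norm_star]

end Weak

end RNLS

namespace RNLS

open scoped ContDiff

/-! ### Density of test functions in `H¹` -/

section Density

variable {d : ℕ} {f g : E d → ℂ}

/-- Dominated convergence for the squared moduli. It serves both the spatial cutoffs and the
difference quotients in time of modulated profiles. -/
lemma tendsto_l2Norm_zero_of_dominated {ι : Type*} {l : Filter ι} [l.IsCountablyGenerated]
    {F : ι → E d → ℂ} {G : E d → ℂ} (hG : MemLp G 2 volume)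
    (hF : ∀ᶠ i in l, AEStronglyMeasurable (F i) volume)
    (hb : ∀ᶠ i in l, ∀ᵐ x, ‖F i x‖ ≤ ‖G x‖) (hlim : ∀ᵐ x, Tendsto (fun i => F i x) l (𝓝 0)) :
    Tendsto (fun i => l2Norm (F i)) l (𝓝 0) := by
  have key : Tendsto (fun i => ∫ x, ‖F i x‖ ^ 2) l (𝓝 (∫ _x : E d, (0 : ℝ))) := by
    refine tendsto_integral_filter_of_dominated_convergence (fun x => ‖G x‖ ^ 2) ?_ ?_ ?_ ?_
    · filter_upwards [hF] with i hi using (hi.norm.pow 2)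
    · filter_upwards [hb] with i hi
      filter_upwards [hi] with x hx
      rw [Real.norm_of_nonneg (by positivity)]
      gcongr
    · simpa using hG.integrable_norm_pow (p := 2) (by norm_num)
    · filter_upwards [hlim] with x hx
      simpa using (hx.norm.pow 2)
  rw [integral_zero] at key
  have h2 := key.sqrt
  rw [Real.sqrt_zero] at h2
  refine h2.congr' ?_
  filter_upwards [hF, hb] with i h3 h4
  rw [← l2Norm_sq (hG.of_le h3 h4), Real.sqrt_sq (l2Norm_nonneg _)]

/-- Mollification by a normalized bump function. -/
noncomputable def mollify (φ : ContDiffBump (0 : E d)) (f : E d → ℂ) : E d → ℂ :=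
  convolution (φ.normed volume) f (ContinuousLinearMap.lsmul ℝ ℝ) volume

lemma mollify_apply (φ : ContDiffBump (0 : E d)) (f : E d → ℂ) (x : E d) :
    mollify φ f x = ∫ t, (φ.normed volume (x - t)) • f t := by
  unfold mollify
  rw [convolution_eq_swap]
  rfl

lemma mollify_contDiff (φ : ContDiffBump (0 : E d)) (hf : LocallyIntegrable f volume) :
    ContDiff ℝ ∞ (mollify φ f) :=
  φ.hasCompactSupport_normed.contDiff_convolution_left _ φ.contDiff_normed hf

lemma mollify_hasCompactSupport (φ : ContDiffBump (0 : E d)) (hf : HasCompactSupport f) :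
    HasCompactSupport (mollify φ f) :=
  φ.hasCompactSupport_normed.convolution _ hf

lemma mollify_sub (φ : ContDiffBump (0 : E d)) (hf : LocallyIntegrable f volume)
    (hg : LocallyIntegrable g volume) (x : E d) :
    mollify φ (fun x => f x - g x) x = mollify φ f x - mollify φ g x := by
  have h1 := φ.hasCompactSupport_normed.convolutionExists_left
    (ContinuousLinearMap.lsmul ℝ ℝ : ℝ →L[ℝ] ℂ →L[ℝ] ℂ) (φ.continuous_normed (μ := volume)) hf x
  have h2 := φ.hasCompactSupport_normed.convolutionExists_left
    (ContinuousLinearMap.lsmul ℝ ℝ : ℝ →L[ℝ] ℂ →L[ℝ] ℂ) (φ.continuous_normed (μ := volume)) hg x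
  unfold mollify convolution
  rw [← integral_sub h1 h2]
  simp [smul_sub]

/-- Young's inequality for a probability density: writing the kernel as the square of its square
root, Cauchy–Schwarz bounds |φ ∗ f|² by φ ∗ |f|², and Tonelli with translation invariance integrates
the latter. -/
lemma lintegral_enorm_mollify_sq_le (φ : ContDiffBump (0 : E d)) (hf : MemLp f 2 volume) :
    ∫⁻ x, ‖mollify φ f x‖ₑ ^ (2 : ℝ) ≤ ∫⁻ x, ‖f x‖ₑ ^ (2 : ℝ) := by
  set w : E d → ℝ≥0∞ := fun t => ENNReal.ofReal (φ.normed volume t) with hw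
  have hwm : Measurable w := (φ.continuous_normed (μ := volume)).measurable.ennreal_ofReal
  have hw1 : ∫⁻ t, w t = 1 := by
    rw [← ofReal_integral_eq_lintegral_ofReal φ.integrable_normed
      (Eventually.of_forall fun x => φ.nonneg_normed x), φ.integral_normed, ENNReal.ofReal_one]
  have hsm : AEMeasurable (fun p : E d × E d => ‖f (p.1 - p.2)‖ₑ) (volume.prod volume) :=
    (hf.1.comp_quasiMeasurePreserving
      (quasiMeasurePreserving_sub_of_right_invariant volume volume)).enorm
  have hx : ∀ x : E d, AEMeasurable (fun t => ‖f (x - t)‖ₑ) volume := fun x =>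
    (hf.1.comp_quasiMeasurePreserving
      (quasiMeasurePreserving_sub_left_of_right_invariant volume x)).enorm
  have pt : ∀ x, ‖mollify φ f x‖ₑ ^ (2 : ℝ) ≤ ∫⁻ t, w t * ‖f (x - t)‖ₑ ^ (2 : ℝ) := by
    intro x
    have h1 : ‖mollify φ f x‖ₑ ≤ ∫⁻ t, w t * ‖f (x - t)‖ₑ := by
      refine (enorm_integral_le_lintegral_enorm _).trans_eq (lintegral_congr fun t => ?_)
      simp only [ContinuousLinearMap.lsmul_apply, enorm_smul, hw]
      rw [Real.enorm_eq_ofReal (φ.nonneg_normed t)]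
    have h2 : ∫⁻ t, w t * ‖f (x - t)‖ₑ
        = ∫⁻ t, ((fun t => w t ^ (1 / 2 : ℝ)) * fun t => w t ^ (1 / 2 : ℝ) * ‖f (x - t)‖ₑ) t := by
      refine lintegral_congr fun t => ?_
      simp only [Pi.mul_apply]
      rw [← mul_assoc, ← ENNReal.rpow_add_of_nonneg _ _ (by norm_num) (by norm_num)]
      norm_num
    have h3 := ENNReal.lintegral_mul_le_Lp_mul_Lq volume Real.HolderConjugate.two_two
      (f := fun t => w t ^ (1 / 2 : ℝ)) (g := fun t => w t ^ (1 / 2 : ℝ) * ‖f (x - t)‖ₑ)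
      (hwm.pow_const _).aemeasurable ((hwm.pow_const _).aemeasurable.mul (hx x))
    have e1 : ∀ t, (w t ^ (1 / 2 : ℝ)) ^ (2 : ℝ) = w t := fun t => by
      rw [← ENNReal.rpow_mul]; norm_num
    have e2 : ∀ t, (w t ^ (1 / 2 : ℝ) * ‖f (x - t)‖ₑ) ^ (2 : ℝ)
        = w t * ‖f (x - t)‖ₑ ^ (2 : ℝ) := fun t => by
      rw [ENNReal.mul_rpow_of_nonneg _ _ (by norm_num), e1]
    simp only [e1, e2, hw1, ENNReal.one_rpow, one_mul] at h3
    calc ‖mollify φ f x‖ₑ ^ (2 : ℝ) ≤ ((∫⁻ t, w t * ‖f (x - t)‖ₑ ^ (2 : ℝ)) ^ (1 / 2 : ℝ)) ^ (2 : ℝ) := by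
          gcongr; exact h1.trans (h2.le.trans h3)
      _ = _ := by rw [← ENNReal.rpow_mul]; norm_num
  calc ∫⁻ x, ‖mollify φ f x‖ₑ ^ (2 : ℝ) ≤ ∫⁻ x, ∫⁻ t, w t * ‖f (x - t)‖ₑ ^ (2 : ℝ) :=
        lintegral_mono pt
    _ = ∫⁻ t, ∫⁻ x, w t * ‖f (x - t)‖ₑ ^ (2 : ℝ) :=
        lintegral_lintegral_swap ((hwm.comp measurable_snd).aemeasurable.mul (hsm.pow_const _))
    _ = ∫⁻ t, w t * ∫⁻ x, ‖f x‖ₑ ^ (2 : ℝ) := by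
        refine lintegral_congr fun t => ?_
        rw [lintegral_const_mul' _ _ ENNReal.ofReal_ne_top,
          lintegral_sub_right_eq_self (fun x => ‖f x‖ₑ ^ (2 : ℝ)) t]
    _ = ∫⁻ x, ‖f x‖ₑ ^ (2 : ℝ) := by
        rw [lintegral_mul_const _ hwm, hw1, one_mul]

lemma eLpNorm_two_eq_lintegral (f : E d → ℂ) :
    eLpNorm f 2 volume = (∫⁻ x, ‖f x‖ₑ ^ (2 : ℝ)) ^ (1 / 2 : ℝ) := by
  rw [eLpNorm_eq_lintegral_rpow_enorm_toReal (by simp) (by simp)]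
  simp

lemma eLpNorm_mollify_le (φ : ContDiffBump (0 : E d)) (hf : MemLp f 2 volume) :
    eLpNorm (mollify φ f) 2 volume ≤ eLpNorm f 2 volume := by
  rw [eLpNorm_two_eq_lintegral, eLpNorm_two_eq_lintegral]
  exact ENNReal.rpow_le_rpow (lintegral_enorm_mollify_sq_le φ hf) (by norm_num)

lemma memLp_mollify (φ : ContDiffBump (0 : E d)) (hf : MemLp f 2 volume) :
    MemLp (mollify φ f) 2 volume :=
  ⟨(mollify_contDiff φ (hf.locallyIntegrable (by norm_num))).continuous.aestronglyMeasurable,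
    (eLpNorm_mollify_le φ hf).trans_lt hf.2⟩

lemma l2Norm_mollify_le (φ : ContDiffBump (0 : E d)) (hf : MemLp f 2 volume) :
    l2Norm (mollify φ f) ≤ l2Norm f :=
  ENNReal.toReal_mono hf.2.ne (eLpNorm_mollify_le φ hf)

/-- Uniform continuity makes the difference at most η on the unit neighbourhood of the support;
kernels of radius below one leave nothing outside it. -/
lemma exists_l2Norm_mollify_sub_le_of_continuous (hc : Continuous g) (hs : HasCompactSupport g)
    {ε : ℝ} (hε : 0 < ε) :
    ∃ r > 0, ∀ φ : ContDiffBump (0 : E d), φ.rOut < r →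
      l2Norm (fun x => mollify φ g x - g x) ≤ ε := by
  set K : Set (E d) := Metric.cthickening 1 (tsupport g) with hK
  have hKc : IsCompact K := IsCompact.cthickening hs
  set V : ℝ := (volume K).toReal ^ (1 / 2 : ℝ) with hV
  have hV0 : 0 ≤ V := by positivity
  -- A constant η on the neighbourhood `K` has `L²` norm ηV, and ηV ≤ ε for this choice; the added
  -- one avoids a division by zero.
  set η : ℝ := ε / (V + 1) with hη
  have hη0 : 0 < η := by positivity
  obtain ⟨r, hr, hrg⟩ := Metric.uniformContinuous_iff.mp (hs.uniformContinuous_of_continuous hc) η hη0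
  refine ⟨min r 1, by positivity, fun φ hφ => ?_⟩
  have pt : ∀ x, ‖mollify φ g x - g x‖ ≤ ‖K.indicator (fun _ => (η : ℂ)) x‖ := by
    intro x
    rw [← dist_eq_norm]
    refine φ.dist_normed_convolution_le hc.aestronglyMeasurable fun y hy => ?_
    have hyr : dist y x < min r 1 := (Metric.mem_ball.mp hy).trans hφ
    by_cases hx : x ∈ K
    · rw [indicator_of_mem hx]
      simpa [abs_of_pos hη0] using (hrg (hyr.trans_le (min_le_left _ _))).le
    · have hgx : g x = 0 := by
        refine image_eq_zero_of_notMem_tsupport fun h => hx ?_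
        exact Metric.self_subset_cthickening _ h
      have hgy : g y = 0 := by
        refine image_eq_zero_of_notMem_tsupport fun h => hx ?_
        refine Metric.mem_cthickening_of_dist_le x y 1 _ h ?_
        rw [dist_comm]
        exact (hyr.trans_le (min_le_right _ _)).le
      simp [hgx, hgy, hx]
  have hm : MemLp (K.indicator (fun _ => (η : ℂ))) 2 (volume : Measure (E d)) :=
    memLp_indicator_const 2 hKc.measurableSet _ (Or.inr hKc.measure_lt_top.ne)
  refine (l2Norm_mono hm (Eventually.of_forall pt)).trans ?_
  unfold l2Norm
  rw [eLpNorm_indicator_const hKc.measurableSet (by simp) (by simp), ENNReal.toReal_mul,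
    ← ENNReal.toReal_rpow]
  simp only [toReal_enorm, Complex.norm_real, Real.norm_eq_abs, abs_of_pos hη0, ENNReal.toReal_ofNat]
  rw [← hV, hη, div_mul_eq_mul_div, div_le_iff₀ (by positivity)]
  nlinarith

/-- Mollification contracts `L²`, so approximation by continuous functions of compact support costs
ε/3 twice and their own mollification ε/3. -/
lemma exists_l2Norm_mollify_sub_le (hf : MemLp f 2 volume) {ε : ℝ} (hε : 0 < ε) :
    ∃ r > 0, ∀ φ : ContDiffBump (0 : E d), φ.rOut < r →
      l2Norm (fun x => mollify φ f x - f x) ≤ ε := by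
  obtain ⟨g, hgs, hfg, hgc, hgm⟩ := hf.exists_hasCompactSupport_eLpNorm_sub_le (by simp)
    (ε := ENNReal.ofReal (ε / 3)) (by simpa using hε)
  obtain ⟨r, hr, H⟩ := exists_l2Norm_mollify_sub_le_of_continuous hgc hgs
    (show (0 : ℝ) < ε / 3 by positivity)
  refine ⟨r, hr, fun φ hφ => ?_⟩
  have hfg' : l2Norm (fun x => f x - g x) ≤ ε / 3 :=
    ENNReal.toReal_le_of_le_ofReal (by positivity) hfg
  have h1 := l2Norm_mollify_le φ (hf.sub hgm)
  have h2 := H φ hφ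
  have e : ∀ x, mollify φ (f - g) x = mollify φ f x - mollify φ g x :=
    mollify_sub φ (hf.locallyIntegrable (by norm_num)) (hgm.locallyIntegrable (by norm_num))
  have h1' : l2Norm (fun x => mollify φ f x - mollify φ g x) ≤ ε / 3 := by
    simp only [← e]; exact h1.trans hfg'
  have t1 := l2Norm_sub_triangle (memLp_mollify φ hf) (memLp_mollify φ hgm) hf
  have t2 := l2Norm_sub_triangle (memLp_mollify φ hgm) hgm hf
  rw [l2Norm_sub_comm g f] at t2
  linarith

/-- The derivative falls on the kernel. For fixed x the reflected kernel t ↦ φ(x - t) is a test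
function, and the sign from the reflection cancels the sign in the definition of the weak
derivative. -/
lemma pd_mollify {j : Fin d} (φ : ContDiffBump (0 : E d)) (hf : LocallyIntegrable f volume)
    (h : IsWeakPartial j f g) : pd j (mollify φ f) = mollify φ g := by
  ext x
  have hflip : mollify φ f = convolution f (φ.normed volume)
      (ContinuousLinearMap.lsmul ℝ ℝ : ℝ →L[ℝ] ℂ →L[ℝ] ℂ).flip volume := by
    unfold mollify; rw [convolution_flip]
  have h1 := φ.hasCompactSupport_normed.hasFDerivAt_convolution_right
    (ContinuousLinearMap.lsmul ℝ ℝ : ℝ →L[ℝ] ℂ →L[ℝ] ℂ).flip hf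
    (φ.contDiff_normed (n := 1) (μ := volume)) x
  rw [← hflip] at h1
  have hψ1 : ContDiff ℝ ∞ (fun t => φ.normed volume (x - t)) :=
    φ.contDiff_normed.comp (contDiff_const.sub contDiff_id)
  have hψ2 : HasCompactSupport (fun t => φ.normed volume (x - t)) :=
    φ.hasCompactSupport_normed.comp_homeomorph (Homeomorph.subLeft x)
  have key := h.2 _ hψ1 hψ2
  unfold pd
  rw [h1.fderiv, convolution_precompR_apply _ hf (φ.hasCompactSupport_normed.fderiv (𝕜 := ℝ))
    ((φ.contDiff_normed (n := 1)).continuous_fderiv (by simp)), mollify_apply]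
  have e : ∀ t, fderiv ℝ (fun t => φ.normed volume (x - t)) t (stdVec j)
      = - fderiv ℝ (φ.normed volume) (x - t) (stdVec j) := fun t => by
    have h2 := ((φ.contDiff_normed (μ := volume) (n := 1)).differentiable (by simp)
      (x - t)).hasFDerivAt.comp t ((hasFDerivAt_id t).const_sub x)
    have h3 : (fun t => φ.normed volume (x - t)) = φ.normed volume ∘ HSub.hSub x := rfl
    rw [h3, h2.fderiv]; simp
  simp only [e] at key
  have : (∫ t, φ.normed volume (x - t) • g t) = ∫ t, g t * (φ.normed volume (x - t) : ℂ) := by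
    refine integral_congr_ae (Eventually.of_forall fun t => ?_)
    simp only [Complex.real_smul, mul_comm]
  rw [this, ← neg_eq_iff_eq_neg.mpr key, ← integral_neg]
  unfold convolution
  refine integral_congr_ae (Eventually.of_forall fun t => ?_)
  simp [mul_comm]

/-- Approximation of compactly supported `H¹` functions by test functions. -/
lemma MemH1.exists_test_of_hasCompactSupport (hf : MemH1 f) (hs : HasCompactSupport f)
    {ε : ℝ} (hε : 0 < ε) :
    ∃ ψ : E d → ℂ, ContDiff ℝ ∞ ψ ∧ HasCompactSupport ψ ∧
      l2Norm (fun x => ψ x - f x) ≤ ε ∧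
      ∀ j, l2Norm (fun x => pd j ψ x - weakPartial j f x) ≤ ε := by
  obtain ⟨r, hr, H⟩ := exists_l2Norm_mollify_sub_le hf.1 hε
  choose r' hr' H' using fun j => exists_l2Norm_mollify_sub_le (hf.memLp_weakPartial j) hε
  obtain ⟨ρ, hρ0, hρ1, hρ2⟩ : ∃ ρ > 0, ρ < r ∧ ∀ j, ρ < r' j := by
    have h1 : ∀ᶠ ρ in 𝓝[>] (0 : ℝ), ρ < r := eventually_nhdsWithin_of_eventually_nhds (eventually_lt_nhds hr)
    have h2 : ∀ᶠ ρ in 𝓝[>] (0 : ℝ), ∀ j, ρ < r' j := eventually_all.2 fun j =>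
      eventually_nhdsWithin_of_eventually_nhds (eventually_lt_nhds (hr' j))
    obtain ⟨ρ, a, b, c⟩ := ((eventually_mem_nhdsWithin (α := ℝ) (a := 0) (s := Ioi 0)).and (h1.and h2)).exists
    exact ⟨ρ, a, b, c⟩
  let φ : ContDiffBump (0 : E d) := ⟨ρ / 2, ρ, by positivity, by linarith⟩
  have hfl := hf.1.locallyIntegrable (by norm_num)
  refine ⟨mollify φ f, mollify_contDiff φ hfl, mollify_hasCompactSupport φ hs, H φ hρ1, fun j => ?_⟩
  rw [pd_mollify φ hfl (hf.isWeakPartial j)]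
  exact H' j φ (hρ2 j)

end Density

end RNLS

namespace RNLS

open scoped ContDiff

/-! ### Cutoffs, density of test functions in all of `H¹`, and integration by parts. -/

section Density

variable {d : ℕ} {f g : E d → ℂ}

/-- A smooth cutoff, equal to `1` on the ball of radius `n + 1`. -/
noncomputable def cutoff (n : ℕ) (x : E d) : ℝ :=
  (⟨1, 2, by norm_num, by norm_num⟩ : ContDiffBump (0 : E d)) ((n + 1 : ℝ)⁻¹ • x)

lemma cutoff_contDiff (n : ℕ) : ContDiff ℝ ∞ (cutoff n : E d → ℝ) :=
  (ContDiffBump.contDiff _).comp (contDiff_const_smul _)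

lemma cutoff_hasCompactSupport (n : ℕ) : HasCompactSupport (cutoff n : E d → ℝ) :=
  (ContDiffBump.hasCompactSupport _).comp_homeomorph
    (Homeomorph.smulOfNeZero ((n + 1 : ℝ)⁻¹) (by positivity))

lemma cutoff_nonneg (n : ℕ) (x : E d) : 0 ≤ cutoff n x := ContDiffBump.nonneg _

lemma cutoff_le_one (n : ℕ) (x : E d) : cutoff n x ≤ 1 := ContDiffBump.le_one _

lemma cutoff_eq_one {n : ℕ} {x : E d} (h : ‖x‖ ≤ n + 1) : cutoff n x = 1 := by
  refine ContDiffBump.one_of_mem_closedBall _ ?_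
  simp only [mem_closedBall_zero_iff, norm_smul, norm_inv]
  rw [Real.norm_of_nonneg (by positivity), inv_mul_le_iff₀ (by positivity)]
  simpa using h

/-- The dilation by (n + 1)⁻¹ puts this factor in front of the gradient, so the term of the product
rule in which the cutoff is differentiated disappears as n grows. -/
lemma exists_norm_pd_cutoff_le (d : ℕ) :
    ∃ K : ℝ, 0 ≤ K ∧ ∀ (n : ℕ) (j : Fin d) (x : E d), ‖pd j (cutoff n) x‖ ≤ K * (n + 1 : ℝ)⁻¹ := by
  set χ : ContDiffBump (0 : E d) := ⟨1, 2, by norm_num, by norm_num⟩ with hχ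
  obtain ⟨K, hK⟩ := ((χ.contDiff (n := 1)).continuous_fderiv (by simp)).bounded_above_of_compact_support
    (χ.hasCompactSupport.fderiv (𝕜 := ℝ))
  refine ⟨K, (norm_nonneg _).trans (hK 0), fun n j x => ?_⟩
  have h2 : HasFDerivAt (cutoff n : E d → ℝ) ((fderiv ℝ χ ((n + 1 : ℝ)⁻¹ • x)).comp
      ((n + 1 : ℝ)⁻¹ • ContinuousLinearMap.id ℝ (E d))) x :=
    ((χ.contDiff (n := 1)).differentiable (by simp) _).hasFDerivAt.comp x
      ((n + 1 : ℝ)⁻¹ • ContinuousLinearMap.id ℝ (E d)).hasFDerivAt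
  unfold pd
  rw [h2.fderiv]
  simp only [ContinuousLinearMap.comp_apply, _root_.smul_apply,
    ContinuousLinearMap.id_apply, map_smul, norm_smul, norm_inv]
  rw [Real.norm_of_nonneg (show (0 : ℝ) ≤ n + 1 by positivity), mul_comm]
  gcongr
  refine ((fderiv ℝ χ _).le_opNorm _).trans ?_
  rw [norm_stdVec, mul_one]
  exact hK _

lemma tendsto_cutoff (x : E d) : Tendsto (fun n : ℕ => cutoff n x) atTop (𝓝 1) := by
  refine tendsto_const_nhds.congr' ?_
  filter_upwards [eventually_ge_atTop ⌈‖x‖⌉₊] with n hn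
  refine (cutoff_eq_one ?_).symm
  have := Nat.ceil_le.mp hn
  linarith

lemma norm_cutoff_le_one (n : ℕ) (x : E d) : ‖cutoff n x‖ ≤ 1 := by
  rw [Real.norm_of_nonneg (cutoff_nonneg n x)]; exact cutoff_le_one n x

lemma tendsto_l2Norm_cutoff_mul_sub (hf : MemLp f 2 volume) :
    Tendsto (fun n : ℕ => l2Norm (fun x => (cutoff n x : ℂ) * f x - f x)) atTop (𝓝 0) := by
  refine tendsto_l2Norm_zero_of_dominated (G := fun x => (2 : ℂ) * f x) (hf.const_mul 2) ?_ ?_ ?_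
  · exact Eventually.of_forall fun n => ((Complex.continuous_ofReal.comp
      (cutoff_contDiff n).continuous).aestronglyMeasurable.mul hf.1).sub hf.1
  · refine Eventually.of_forall fun n => Eventually.of_forall fun x => ?_
    calc ‖(cutoff n x : ℂ) * f x - f x‖ ≤ ‖(cutoff n x : ℂ) * f x‖ + ‖f x‖ := norm_sub_le _ _
      _ ≤ 1 * ‖f x‖ + ‖f x‖ := by
        rw [norm_mul, Complex.norm_real]; gcongr; exact norm_cutoff_le_one n x
      _ = ‖(2 : ℂ) * f x‖ := by rw [norm_mul]; norm_num; ring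
  · refine Eventually.of_forall fun x => ?_
    have h := ((Complex.continuous_ofReal.tendsto _).comp (tendsto_cutoff x)).mul_const (f x)
    have := h.sub_const (f x)
    simpa using this

/-- Test functions are dense in `H¹`. -/
theorem MemH1.exists_test (hf : MemH1 f) {ε : ℝ} (hε : 0 < ε) :
    ∃ ψ : E d → ℂ, ContDiff ℝ ∞ ψ ∧ HasCompactSupport ψ ∧
      l2Norm (fun x => ψ x - f x) ≤ ε ∧
      ∀ j, l2Norm (fun x => pd j ψ x - weakPartial j f x) ≤ ε := by
  obtain ⟨K, hK0, hK⟩ := exists_norm_pd_cutoff_le d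
  have hw : ∀ (n : ℕ) j, IsWeakPartial j (fun x => (cutoff n x : ℂ) * f x)
      (fun x => ((pd j (cutoff n) x : ℝ) : ℂ) * f x + (cutoff n x : ℂ) * weakPartial j f x) :=
    fun n j => IsWeakPartial.real_mul (K := max 1 (K * (n + 1 : ℝ)⁻¹)) (cutoff_contDiff n)
      (fun x => (norm_cutoff_le_one n x).trans (le_max_left _ _))
      (fun x => (hK n j x).trans (le_max_right _ _)) hf.1 (hf.isWeakPartial j)
  have hm : ∀ (n : ℕ) {f : E d → ℂ}, MemLp f 2 volume →
      MemLp (fun x => (cutoff n x : ℂ) * f x) 2 volume := fun n f hf =>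
    hf.of_le ((Complex.continuous_ofReal.comp
      (cutoff_contDiff n).continuous).aestronglyMeasurable.mul hf.1) (Eventually.of_forall fun x => by
        rw [norm_mul, Complex.norm_real]
        exact mul_le_of_le_one_left (norm_nonneg _) (norm_cutoff_le_one n x))
  have hpm : ∀ (n : ℕ) j, MemLp (fun x => ((pd j (cutoff n) x : ℝ) : ℂ) * f x) 2 volume :=
    fun n j => hf.1.of_le_mul (c := K * (n + 1 : ℝ)⁻¹) ((Complex.continuous_ofReal.comp
      (pd_contDiff (m := 0) j (cutoff_contDiff n) (by simp)).continuous).aestronglyMeasurable.mul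
        hf.1.1) (Eventually.of_forall fun x => by
        rw [norm_mul, Complex.norm_real]; gcongr; exact hK n j x)
  have hH : ∀ n : ℕ, MemH1 (fun x => (cutoff n x : ℂ) * f x) := fun n =>
    .of_isWeakPartial (hm n hf.1) (hw n)
  -- Product rule: one error comes from the gradient of the cutoff and carries (n + 1)⁻¹, the other
  -- is the cutoff error of the weak derivative itself.
  have hbd : ∀ (n : ℕ) j, l2Norm (fun x => weakPartial j (fun x => (cutoff n x : ℂ) * f x) x
      - weakPartial j f x) ≤ K * (n + 1 : ℝ)⁻¹ * l2Norm f
        + l2Norm (fun x => (cutoff n x : ℂ) * weakPartial j f x - weakPartial j f x) := by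
    intro n j
    have e : l2Norm (fun x => weakPartial j (fun x => (cutoff n x : ℂ) * f x) x
      - weakPartial j f x) = l2Norm (fun x => ((pd j (cutoff n) x : ℝ) : ℂ) * f x +
        ((cutoff n x : ℂ) * weakPartial j f x - weakPartial j f x)) := by
      refine l2Norm_congr ?_
      filter_upwards [(hw n j).ae_eq] with x hx
      rw [hx]; ring
    rw [e]
    refine (l2Norm_add_le (hpm n j) ((hm n (hf.memLp_weakPartial j)).sub
      (hf.memLp_weakPartial j))).trans ?_
    have : l2Norm (fun x => ((pd j (cutoff n) x : ℝ) : ℂ) * f x)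
        ≤ l2Norm (fun x => ((K * (n + 1 : ℝ)⁻¹ : ℝ) : ℂ) * f x) :=
      l2Norm_mono (hf.1.const_mul _) (Eventually.of_forall fun x => by
        rw [norm_mul, norm_mul, Complex.norm_real, Complex.norm_real]
        gcongr
        exact (hK n j x).trans (le_abs_self _))
    rw [l2Norm_const_mul, Complex.norm_real, Real.norm_of_nonneg (by positivity)] at this
    exact add_le_add this le_rfl
  have t1 := tendsto_l2Norm_cutoff_mul_sub hf.1
  have t2 : ∀ j, Tendsto (fun n : ℕ => l2Norm (fun x =>
      weakPartial j (fun x => (cutoff n x : ℂ) * f x) x - weakPartial j f x)) atTop (𝓝 0) := by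
    intro j
    refine squeeze_zero (fun _ => l2Norm_nonneg _) (fun n => hbd n j) ?_
    have a : Tendsto (fun n : ℕ => (n + 1 : ℝ)⁻¹) atTop (𝓝 0) := by
      simpa using tendsto_one_div_add_atTop_nhds_zero_nat (𝕜 := ℝ)
    simpa using ((a.const_mul K).mul_const (l2Norm f)).add
      (tendsto_l2Norm_cutoff_mul_sub (hf.memLp_weakPartial j))
  have hev : ∀ᶠ n : ℕ in atTop, l2Norm (fun x => (cutoff n x : ℂ) * f x - f x) < ε / 2 ∧
      ∀ j, l2Norm (fun x => weakPartial j (fun x => (cutoff n x : ℂ) * f x) x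
        - weakPartial j f x) < ε / 2 :=
    (t1.eventually_lt_const (by positivity)).and
      (eventually_all.2 fun j => (t2 j).eventually_lt_const (by positivity))
  obtain ⟨n, hn1, hn2⟩ := hev.exists
  have hs : HasCompactSupport (fun x => (cutoff n x : ℂ) * f x) :=
    ((cutoff_hasCompactSupport n).comp_left Complex.ofReal_zero).mul_right
  obtain ⟨ψ, h1, h2, h3, h4⟩ := (hH n).exists_test_of_hasCompactSupport hs
    (show (0 : ℝ) < ε / 2 by positivity)
  refine ⟨ψ, h1, h2, ?_, fun j => ?_⟩
  · have := l2Norm_sub_triangle (memLp_of_hasCompactSupport h1.continuous h2) (hH n).1 hf.1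
    linarith
  · have := l2Norm_sub_triangle (memLp_of_hasCompactSupport
      (pd_contDiff (m := 0) j h1 (by simp)).continuous (pd_hasCompactSupport j h2))
      ((hH n).memLp_weakPartial j) (hf.memLp_weakPartial j)
    linarith [h4 j, hn2 j]

theorem MemH1.exists_seq_test (hf : MemH1 f) :
    ∃ ψ : ℕ → E d → ℂ, (∀ n, ContDiff ℝ ∞ (ψ n)) ∧ (∀ n, HasCompactSupport (ψ n)) ∧
      Tendsto (fun n => l2Norm (fun x => ψ n x - f x)) atTop (𝓝 0) ∧
      (∀ j, Tendsto (fun n => l2Norm (fun x => pd j (ψ n) x - weakPartial j f x)) atTop (𝓝 0)) ∧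
      Tendsto (fun n => sobNorm (fun x => ψ n x - f x)) atTop (𝓝 0) := by
  choose ψ h1 h2 h3 h4 using fun n : ℕ => hf.exists_test (ε := 1 / ((n : ℝ) + 1)) (by positivity)
  have hl := tendsto_one_div_add_atTop_nhds_zero_nat (𝕜 := ℝ)
  have a := squeeze_zero (fun _ => l2Norm_nonneg _) h3 hl
  have b := fun j => squeeze_zero (fun _ => l2Norm_nonneg _) (fun n => h4 n j) hl
  refine ⟨ψ, h1, h2, a, b, ?_⟩
  have hc : Tendsto (fun n => l2Norm (fun x => ψ n x - f x)
      + ∑ j, l2Norm (fun x => pd j (ψ n) x - weakPartial j f x)) atTop (𝓝 0) := by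
    simpa using a.add (tendsto_finsetSum Finset.univ fun j _ => b j)
  refine hc.congr fun n => ?_
  unfold sobNorm
  congr 1
  refine Finset.sum_congr rfl fun j _ => l2Norm_congr ?_
  have h1' : ContDiff ℝ 1 (ψ n) := (h1 n).of_le (by exact_mod_cast le_top)
  filter_upwards [(memH1_of_hasCompactSupport h1' (h2 n)).weakPartial_sub hf j,
    weakPartial_of_hasCompactSupport h1' (h2 n) j] with x e1 e2
  rw [e1, e2]

/-- The defining identity of weak derivatives, for complex test functions. -/
lemma IsWeakPartial.integral_mul_pd {j : Fin d} (h : IsWeakPartial j f g) (hf : MemLp f 2 volume)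
    {ψ : E d → ℂ} (h1 : ContDiff ℝ ∞ ψ) (h2 : HasCompactSupport ψ) :
    ∫ x, f x * pd j ψ x = - ∫ x, g x * ψ x := by
  have hre : ContDiff ℝ ∞ (fun x => (ψ x).re) := Complex.reCLM.contDiff.comp h1
  have him : ContDiff ℝ ∞ (fun x => (ψ x).im) := Complex.imCLM.contDiff.comp h1
  have hres : HasCompactSupport (fun x => (ψ x).re) := h2.comp_left Complex.zero_re
  have hims : HasCompactSupport (fun x => (ψ x).im) := h2.comp_left Complex.zero_im
  have e1 : ∀ x, pd j ψ x = ((fderiv ℝ (fun x => (ψ x).re) x (stdVec j) : ℝ) : ℂ)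
      + Complex.I * ((fderiv ℝ (fun x => (ψ x).im) x (stdVec j) : ℝ) : ℂ) := by
    intro x
    have hd := (h1.differentiable (by simp) x).hasFDerivAt
    have a : HasFDerivAt (fun x => (ψ x).re) (Complex.reCLM.comp (fderiv ℝ ψ x)) x :=
      Complex.reCLM.hasFDerivAt.comp x hd
    have b : HasFDerivAt (fun x => (ψ x).im) (Complex.imCLM.comp (fderiv ℝ ψ x)) x :=
      Complex.imCLM.hasFDerivAt.comp x hd
    rw [a.fderiv, b.fderiv]
    simp only [ContinuousLinearMap.comp_apply, Complex.reCLM_apply, Complex.imCLM_apply]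
    rw [mul_comm, Complex.re_add_im]
    rfl
  have e2 : ∀ x, ψ x = ((ψ x).re : ℂ) + Complex.I * ((ψ x).im : ℂ) := fun x => by
    rw [mul_comm, Complex.re_add_im]
  have p1 := integrable_mul_of_memLp hf (memLp_ofReal_fderiv_test hre hres j)
  have p2 := integrable_mul_of_memLp hf (memLp_ofReal_fderiv_test him hims j)
  have p3 := integrable_mul_of_memLp h.1 (memLp_ofReal_test hre.continuous hres)
  have p4 := integrable_mul_of_memLp h.1 (memLp_ofReal_test him.continuous hims)
  calc ∫ x, f x * pd j ψ x = ∫ x, (f x * ((fderiv ℝ (fun x => (ψ x).re) x (stdVec j) : ℝ) : ℂ)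
        + Complex.I * (f x * ((fderiv ℝ (fun x => (ψ x).im) x (stdVec j) : ℝ) : ℂ))) := by
        congr 1; ext x; rw [e1]; ring
    _ = - (∫ x, (g x * ((ψ x).re : ℂ) + Complex.I * (g x * ((ψ x).im : ℂ)))) := by
        rw [integral_add p1 (p2.const_mul _), integral_add p3 (p4.const_mul _),
          integral_const_mul, integral_const_mul, h.2 _ hre hres, h.2 _ him hims]
        ring
    _ = - ∫ x, g x * ψ x := by
        congr 2; ext x; conv_rhs => rw [e2 x]
        ring

/-- Integration by parts for two functions in `H¹`. -/
theorem MemH1.integral_weakPartial_mul (hf : MemH1 f) (hg : MemH1 g) (j : Fin d) :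
    ∫ x, weakPartial j f x * g x = - ∫ x, f x * weakPartial j g x := by
  obtain ⟨ψ, h1, h2, h3, h4, -⟩ := hg.exists_seq_test
  have m1 : ∀ n, MemLp (ψ n) 2 volume := fun n => memLp_of_hasCompactSupport (h1 n).continuous (h2 n)
  have m2 : ∀ n, MemLp (pd j (ψ n)) 2 volume := fun n => memLp_of_hasCompactSupport
    (pd_contDiff (m := 0) j (h1 n) (by simp)).continuous (pd_hasCompactSupport j (h2 n))
  have hz : ∀ f : E d → ℂ, Tendsto (fun _ : ℕ => l2Norm (fun x => f x - f x)) atTop (𝓝 0) := by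
    intro f; simp [l2Norm_zero]
  have t1 := tendsto_integral_mul (l := atTop) (F := fun _ : ℕ => weakPartial j f) (G := ψ)
    (Eventually.of_forall fun _ => hf.memLp_weakPartial j) (Eventually.of_forall m1)
    (hf.memLp_weakPartial j) hg.1 (hz _) h3
  have t2 := tendsto_integral_mul (l := atTop) (F := fun _ : ℕ => f) (G := fun n => pd j (ψ n))
    (Eventually.of_forall fun _ => hf.1) (Eventually.of_forall m2)
    hf.1 (hg.memLp_weakPartial j) (hz _) (h4 j)
  refine tendsto_nhds_unique t1 (t2.neg.congr fun n => ?_)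
  rw [(hf.isWeakPartial j).integral_mul_pd hf.1 (h1 n) (h2 n), neg_neg]

end Density

end RNLS

namespace RNLS

open scoped ContDiff

/-! ### Sobolev inequalities in dimensions one and two -/

section Sobolev

variable {d : ℕ}

lemma sum_inner_stdVec_smul (v : E d) : ∑ j, v j • (stdVec j : E d) = v := by
  ext i
  simp [stdVec, Finset.sum_apply, Pi.single_apply]

lemma norm_clm_le_sum {F : Type*} [NormedAddCommGroup F] [NormedSpace ℝ F] (L : E d →L[ℝ] F) :
    ‖L‖ ≤ ∑ j, ‖L (stdVec j)‖ := by
  refine L.opNorm_le_bound (Finset.sum_nonneg fun _ _ => norm_nonneg _) fun v => ?_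
  conv_lhs => rw [← sum_inner_stdVec_smul v]
  rw [map_sum, Finset.sum_mul]
  refine (norm_sum_le _ _).trans (Finset.sum_le_sum fun j _ => ?_)
  rw [map_smul, norm_smul, mul_comm]
  gcongr
  exact PiLp.norm_apply_le v j

lemma l2Norm_sq_eq_integral_pow_four {ψ : E d → ℂ} (hc : Continuous ψ) (hs : HasCompactSupport ψ) :
    l2Norm (fun x => ψ x * ψ x) ^ 2 = ∫ x, ‖ψ x‖ ^ 4 := by
  rw [l2Norm_sq (f := fun x => ψ x * ψ x)
    (memLp_of_hasCompactSupport (hc.mul hc) (hs.mul_right))]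
  congr 1; ext x
  rw [norm_mul]; ring

/-- The `H¹` norm of a test function, in terms of classical derivatives. -/
noncomputable def testNorm (ψ : E d → ℂ) : ℝ := l2Norm ψ + ∑ j : Fin d, l2Norm (pd j ψ)

lemma testNorm_eq_sobNorm {ψ : E d → ℂ} (h1 : ContDiff ℝ 1 ψ) (h2 : HasCompactSupport ψ) :
    sobNorm ψ = testNorm ψ := by
  unfold sobNorm testNorm
  congr 1
  exact Finset.sum_congr rfl fun j _ => l2Norm_congr (weakPartial_of_hasCompactSupport h1 h2 j)

/-- The embedding of gradients in `L¹` into `L²`, applied to ψ² instead of ψ. Since |∇(ψ²)| is at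
most 2|ψ| ∑ |∂_jψ|, Cauchy–Schwarz bounds its integral by twice the square of the norm; squaring
gives the constant. -/
lemma sobolev_test_two : ∃ C : ℝ, 0 ≤ C ∧ ∀ ψ : E 2 → ℂ, ContDiff ℝ 1 ψ → HasCompactSupport ψ →
    ∫ x, ‖ψ x‖ ^ 4 ≤ C * testNorm ψ ^ 4 := by
  set C₀ : ℝ≥0 := eLpNormLESNormFDerivOneConst (volume : Measure (E 2)) 2
  refine ⟨4 * (C₀ : ℝ) ^ 2, by positivity, fun ψ h1 h2 => ?_⟩
  have hu1 : ContDiff ℝ 1 (fun x => ψ x * ψ x) := h1.mul h1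
  have hu2 : HasCompactSupport (fun x => ψ x * ψ x) := h2.mul_right
  have hconj : NNReal.HolderConjugate (Module.finrank ℝ (E 2)) 2 := by
    have : ((Module.finrank ℝ (E 2) : ℕ) : ℝ≥0) = 2 := by simp
    rw [this]; exact NNReal.HolderConjugate.two_two
  have key := eLpNorm_le_eLpNorm_fderiv_one (volume : Measure (E 2)) hu1 hu2 hconj
  have hfc : Continuous (fderiv ℝ (fun x => ψ x * ψ x)) := hu1.continuous_fderiv (by simp)
  have hfi : Integrable (fderiv ℝ (fun x => ψ x * ψ x)) volume :=
    hfc.integrable_of_hasCompactSupport (hu2.fderiv (𝕜 := ℝ))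
  have hreal : l2Norm (fun x => ψ x * ψ x) ≤ C₀ * ∫ x, ‖fderiv ℝ (fun x => ψ x * ψ x) x‖ := by
    have := ENNReal.toReal_mono (by
      rw [eLpNorm_one_eq_lintegral_enorm]
      exact ENNReal.mul_ne_top ENNReal.coe_ne_top hfi.2.ne) key
    rw [ENNReal.toReal_mul, eLpNorm_one_eq_lintegral_enorm, ← integral_norm_eq_lintegral_enorm hfi.1]
      at this
    exact this
  have mψ := memLp_of_hasCompactSupport h1.continuous h2
  have mp : ∀ j, MemLp (pd j ψ) 2 volume := fun j => memLp_of_hasCompactSupport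
    (pd_contDiff (m := 0) j h1 (by simp)).continuous (pd_hasCompactSupport j h2)
  have hpt : ∀ x, ‖fderiv ℝ (fun x => ψ x * ψ x) x‖ ≤ ∑ j, 2 * (‖ψ x‖ * ‖pd j ψ x‖) := by
    intro x
    refine (norm_clm_le_sum _).trans (Finset.sum_le_sum fun j _ => ?_)
    have := pd_mul j (h1.differentiable (by simp) x) (h1.differentiable (by simp) x)
    unfold pd at this
    rw [this]
    refine (norm_add_le _ _).trans_eq ?_
    rw [norm_mul, norm_mul]; unfold pd; ring
  have hint : ∫ x, ‖fderiv ℝ (fun x => ψ x * ψ x) x‖ ≤ 2 * testNorm ψ ^ 2 := by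
    calc ∫ x, ‖fderiv ℝ (fun x => ψ x * ψ x) x‖ ≤ ∫ x, ∑ j, 2 * (‖ψ x‖ * ‖pd j ψ x‖) :=
          integral_mono hfi.norm (integrable_finsetSum _ fun j _ =>
            (integrable_norm_mul_of_memLp mψ (mp j)).const_mul 2) hpt
      _ = ∑ j, 2 * ∫ x, ‖ψ x‖ * ‖pd j ψ x‖ := by
          rw [integral_finsetSum _ fun j _ => (integrable_norm_mul_of_memLp mψ (mp j)).const_mul 2]
          simp only [integral_const_mul]
      _ ≤ ∑ j, 2 * (l2Norm ψ * l2Norm (pd j ψ)) := by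
          gcongr with j
          exact integral_norm_mul_le mψ (mp j)
      _ = 2 * (l2Norm ψ * ∑ j, l2Norm (pd j ψ)) := by rw [Finset.mul_sum, Finset.mul_sum]
      _ ≤ 2 * testNorm ψ ^ 2 := by
          have a := l2Norm_nonneg ψ
          have b : 0 ≤ ∑ j, l2Norm (pd j ψ) := Finset.sum_nonneg fun _ _ => l2Norm_nonneg _
          unfold testNorm; nlinarith
  rw [← l2Norm_sq_eq_integral_pow_four h1.continuous h2]
  have h3 : l2Norm (fun x => ψ x * ψ x) ≤ C₀ * (2 * testNorm ψ ^ 2) :=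
    hreal.trans (by gcongr)
  calc l2Norm (fun x => ψ x * ψ x) ^ 2 ≤ (C₀ * (2 * testNorm ψ ^ 2)) ^ 2 := by
        have := l2Norm_nonneg (fun x => ψ x * ψ x)
        gcongr
    _ = _ := by ring

/-- Identifies `E 1` with the real line, so that calculus on the line can be compared with integrals
over `E 1`. -/
lemma measurePreserving_smul_stdVec :
    MeasurePreserving (fun s : ℝ => s • (stdVec 0 : E 1)) volume volume := by
  have h1 := (volume_preserving_funUnique (Fin 1) ℝ).symm
  have h2 := (PiLp.volume_preserving_toLp (Fin 1)).comp h1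
  have : (fun s : ℝ => s • (stdVec 0 : E 1))
      = WithLp.toLp 2 ∘ (MeasurableEquiv.funUnique (Fin 1) ℝ).symm := by
    ext s i
    fin_cases i
    simp [stdVec, MeasurableEquiv.funUnique]
  rw [this]
  exact h2

/-- ψ² has compact support and is therefore recovered by integrating its derivative over a
half-line; |(ψ²)'| = 2|ψ||ψ'| is integrated by Cauchy–Schwarz. -/
lemma norm_sq_le_testNorm_one {ψ : E 1 → ℂ} (h1 : ContDiff ℝ 1 ψ) (h2 : HasCompactSupport ψ)
    (x : E 1) : ‖ψ x‖ ^ 2 ≤ 2 * testNorm ψ ^ 2 := by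
  have hu1 : ContDiff ℝ 1 (fun x => ψ x * ψ x) := h1.mul h1
  have hu2 : HasCompactSupport (fun x => ψ x * ψ x) := h2.mul_right
  set ℓ : ℝ → E 1 := fun s => s • (stdVec 0 : E 1) with hℓ
  have hℓc : ContDiff ℝ 1 ℓ := contDiff_id.smul contDiff_const
  have hemb : IsClosedEmbedding ℓ := by
    refine (Isometry.isClosedEmbedding ?_)
    refine Isometry.of_dist_eq fun s t => ?_
    rw [dist_eq_norm, dist_eq_norm, ← sub_smul, norm_smul, norm_stdVec, mul_one]
  have hv1 : ContDiff ℝ 1 (fun s => ψ (ℓ s) * ψ (ℓ s)) := hu1.comp hℓc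
  have hv2 : HasCompactSupport (fun s => ψ (ℓ s) * ψ (ℓ s)) := hu2.comp_isClosedEmbedding hemb
  have hx : ℓ (x 0) = x := by
    have := sum_inner_stdVec_smul x
    simpa using this
  have hder : ∀ s, deriv (fun s => ψ (ℓ s) * ψ (ℓ s)) s = pd 0 (fun x => ψ x * ψ x) (ℓ s) := by
    intro s
    have a : HasDerivAt ℓ (stdVec 0) s := by
      simpa using (hasDerivAt_id s).smul_const (stdVec 0 : E 1)
    exact ((hu1.differentiable (by simp) (ℓ s)).hasFDerivAt.comp_hasDerivAt s a).deriv
  have key := hv2.enorm_le_lintegral_Ici_deriv hv1 (x 0)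
  have hpc : Continuous (pd (0 : Fin 1) (fun x => ψ x * ψ x)) :=
    (pd_contDiff (m := 0) 0 hu1 (by simp)).continuous
  have hpi : Integrable (pd (0 : Fin 1) (fun x => ψ x * ψ x)) volume :=
    hpc.integrable_of_hasCompactSupport (pd_hasCompactSupport 0 hu2)
  have h3 : ‖ψ x * ψ x‖ₑ ≤ ∫⁻ y, ‖pd 0 (fun x => ψ x * ψ x) y‖ₑ := by
    rw [← measurePreserving_smul_stdVec.lintegral_comp hpc.enorm.measurable]
    simp only [hx] at key
    refine key.trans ((setLIntegral_le_lintegral _ _).trans_eq ?_)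
    exact lintegral_congr fun s => by rw [hder]
  have h4 : ‖ψ x‖ ^ 2 ≤ ∫ y, ‖pd 0 (fun x => ψ x * ψ x) y‖ := by
    have := ENNReal.toReal_mono hpi.2.ne h3
    rw [← integral_norm_eq_lintegral_enorm hpi.1, toReal_enorm, norm_mul] at this
    rw [sq]; exact this
  have mψ := memLp_of_hasCompactSupport h1.continuous h2
  have mp : MemLp (pd 0 ψ) 2 volume := memLp_of_hasCompactSupport
    (pd_contDiff (m := 0) 0 h1 (by simp)).continuous (pd_hasCompactSupport 0 h2)
  have h5 : ∫ y, ‖pd 0 (fun x => ψ x * ψ x) y‖ = 2 * ∫ y, ‖ψ y‖ * ‖pd 0 ψ y‖ := by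
    rw [← integral_const_mul]
    congr 1; ext y
    rw [pd_mul 0 (h1.differentiable (by simp) y) (h1.differentiable (by simp) y), mul_comm (ψ y),
      ← two_mul, norm_mul, norm_mul]
    norm_num; ring
  rw [h5] at h4
  refine h4.trans ?_
  have := integral_norm_mul_le mψ mp
  have a := l2Norm_nonneg ψ
  have b := l2Norm_nonneg (pd 0 ψ)
  have c : testNorm ψ = l2Norm ψ + l2Norm (pd 0 ψ) := by simp [testNorm]
  rw [c]; nlinarith

/-- A subsequence that converges almost everywhere, with convergent norms, carries inequalities from
test functions to `H¹`: pointwise bounds pass to the limit directly, integral bounds by Fatou. -/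
lemma MemH1.exists_seq_test_ae {f : E d → ℂ} (hf : MemH1 f) :
    ∃ ψ : ℕ → E d → ℂ, (∀ n, ContDiff ℝ 1 (ψ n)) ∧ (∀ n, HasCompactSupport (ψ n)) ∧
      Tendsto (fun n => testNorm (ψ n)) atTop (𝓝 (sobNorm f)) ∧
      ∀ᵐ x, Tendsto (fun n => ψ n x) atTop (𝓝 (f x)) := by
  obtain ⟨ψ, h1, h2, h3, -, h5⟩ := hf.exists_seq_test
  have h1' : ∀ n, ContDiff ℝ 1 (ψ n) := fun n => (h1 n).of_le (by exact_mod_cast le_top)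
  have m1 : ∀ n, MemLp (ψ n) 2 volume := fun n => memLp_of_hasCompactSupport (h1 n).continuous (h2 n)
  have hψ : ∀ n, MemH1 (ψ n) := fun n => memH1_of_hasCompactSupport (h1' n) (h2 n)
  have hN : ∀ n, testNorm (ψ n) ≤ sobNorm f + sobNorm (fun x => ψ n x - f x) := fun n => by
    rw [← testNorm_eq_sobNorm (h1' n) (h2 n)]
    have := sobNorm_add_le hf ((hψ n).sub hf)
    simpa using this
  have hN' : ∀ n, sobNorm f - sobNorm (fun x => ψ n x - f x) ≤ testNorm (ψ n) := fun n => by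
    rw [← testNorm_eq_sobNorm (h1' n) (h2 n), sobNorm_sub_comm (hψ n) hf]
    have := sobNorm_add_le (hψ n) (hf.sub (hψ n))
    simp only [add_sub_cancel] at this
    linarith
  have hlim : Tendsto (fun n => eLpNorm (ψ n - f) 2 volume) atTop (𝓝 0) := by
    rw [← ENNReal.tendsto_toReal_iff (fun n => ((m1 n).sub hf.1).2.ne) (by simp)]
    exact h3
  obtain ⟨ns, hns, hae⟩ := (tendstoInMeasure_of_tendsto_eLpNorm (by simp) (fun n => (m1 n).1)
    hf.1.1 hlim).exists_seq_tendsto_ae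
  have hT : Tendsto (fun n => testNorm (ψ n)) atTop (𝓝 (sobNorm f)) :=
    tendsto_of_tendsto_of_tendsto_of_le_of_le (by simpa using h5.const_sub (sobNorm f))
      (by simpa using h5.const_add (sobNorm f)) hN' hN
  exact ⟨fun n => ψ (ns n), fun n => h1' _, fun n => h2 _, hT.comp hns.tendsto_atTop, hae⟩

/-- The Sobolev embedding `H¹ ⊂ L^∞` in dimension one. -/
theorem MemH1.norm_le_one {f : E 1 → ℂ} (hf : MemH1 f) : ∀ᵐ x, ‖f x‖ ≤ 2 * sobNorm f := by
  obtain ⟨ψ, h1, h2, h3, h4⟩ := hf.exists_seq_test_ae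
  filter_upwards [h4] with x hx
  have : ‖f x‖ ^ 2 ≤ 2 * sobNorm f ^ 2 :=
    le_of_tendsto_of_tendsto (hx.norm.pow 2) ((h3.pow 2).const_mul 2)
      (Eventually.of_forall fun n => norm_sq_le_testNorm_one (h1 n) (h2 n) x)
  have h0 := sobNorm_nonneg f
  exact abs_le_of_sq_le_sq' (by nlinarith) (by positivity) |>.2

/-- The Sobolev embedding `H¹ ⊂ L⁴` in dimension two. -/
theorem sobolev_two : ∃ C : ℝ, 0 ≤ C ∧ ∀ f : E 2 → ℂ, MemH1 f →
    MemLp (fun x => f x * f x) 2 volume ∧ l2Norm (fun x => f x * f x) ≤ C * sobNorm f ^ 2 := by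
  obtain ⟨C, hC, H⟩ := sobolev_test_two
  refine ⟨Real.sqrt C, Real.sqrt_nonneg _, fun f hf => ?_⟩
  obtain ⟨ψ, h1, h2, h3, h4⟩ := hf.exists_seq_test_ae
  have h6 := sobNorm_nonneg f
  have hl : ∀ n, eLpNorm (fun x => ψ n x * ψ n x) 2 volume
      ≤ ENNReal.ofReal (Real.sqrt (C * testNorm (ψ n) ^ 4)) := fun n => by
    have hm : MemLp (fun x => ψ n x * ψ n x) 2 volume :=
      memLp_of_hasCompactSupport ((h1 n).continuous.mul (h1 n).continuous) (h2 n).mul_right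
    rw [← ENNReal.ofReal_toReal hm.2.ne]
    refine ENNReal.ofReal_le_ofReal (Real.le_sqrt_of_sq_le ?_)
    rw [← l2Norm, l2Norm_sq_eq_integral_pow_four (h1 n).continuous (h2 n)]
    exact H _ (h1 n) (h2 n)
  have hle : eLpNorm (fun x => f x * f x) 2 volume
      ≤ ENNReal.ofReal (Real.sqrt C * sobNorm f ^ 2) := by
    -- Fatou's lemma: the bound survives the almost everywhere limit and shows at the same time that
    -- f² is square integrable.
    refine (Lp.eLpNorm_lim_le_liminf_eLpNorm (f := fun n x => ψ n x * ψ n x)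
      (fun n => ((h1 n).continuous.mul (h1 n).continuous).aestronglyMeasurable) _ ?_).trans ?_
    · filter_upwards [h4] with x hx using hx.mul hx
    · have c : Tendsto (fun n => ENNReal.ofReal (Real.sqrt (C * testNorm (ψ n) ^ 4))) atTop
          (𝓝 (ENNReal.ofReal (Real.sqrt (C * sobNorm f ^ 4)))) :=
        ENNReal.tendsto_ofReal (((h3.pow 4).const_mul C).sqrt)
      have e : Real.sqrt (C * sobNorm f ^ 4) = Real.sqrt C * sobNorm f ^ 2 := by
        rw [Real.sqrt_mul hC, show sobNorm f ^ 4 = (sobNorm f ^ 2) ^ 2 by ring,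
          Real.sqrt_sq (by positivity)]
      rw [← e, ← c.liminf_eq]
      exact liminf_le_liminf (Eventually.of_forall hl)
  have hm : MemLp (fun x => f x * f x) 2 volume :=
    ⟨hf.1.1.mul hf.1.1, hle.trans_lt ENNReal.ofReal_lt_top⟩
  exact ⟨hm, ENNReal.toReal_le_of_le_ofReal (by positivity) hle⟩

/-- The product of two `H¹` functions is square integrable in dimensions one and two. -/
theorem MemH1.exists_l2Norm_mul_le (hd : d = 1 ∨ d = 2) : ∃ C : ℝ, 0 ≤ C ∧ ∀ f g : E d → ℂ,
    MemH1 f → MemH1 g → MemLp (fun x => f x * g x) 2 volume ∧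
      l2Norm (fun x => f x * g x) ≤ C * (sobNorm f * sobNorm g) := by
  rcases hd with rfl | rfl
  · refine ⟨2, by norm_num, fun f g hf hg => ?_⟩
    have hb : ∀ᵐ x, ‖f x * g x‖ ≤ ‖((2 * sobNorm f : ℝ) : ℂ) * g x‖ := by
      filter_upwards [hf.norm_le_one] with x hx
      rw [norm_mul, norm_mul, Complex.norm_real]
      gcongr
      exact hx.trans (le_abs_self _)
    refine ⟨(hg.1.const_mul _).of_le (hf.1.1.mul hg.1.1) hb, ?_⟩
    refine (l2Norm_mono (hg.1.const_mul _) hb).trans ?_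
    have h0 := sobNorm_nonneg f
    rw [l2Norm_const_mul, Complex.norm_real, Real.norm_of_nonneg (by positivity), mul_assoc]
    gcongr
    exact l2Norm_le_sobNorm g
  · obtain ⟨C, hC, H⟩ := sobolev_two
    refine ⟨C, hC, fun f g hf hg => ?_⟩
    obtain ⟨mf, lf⟩ := H f hf
    obtain ⟨mg, lg⟩ := H g hg
    have e : ∀ x, ‖f x * g x‖ ^ 2 = ‖f x * f x‖ * ‖g x * g x‖ := fun x => by
      simp only [norm_mul]; ring
    have hm : MemLp (fun x => f x * g x) 2 volume := by
      refine (memLp_two_iff_integrable_sq_norm (hf.1.1.mul hg.1.1)).mpr ?_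
      show Integrable (fun x => ‖f x * g x‖ ^ 2) volume
      simpa only [e] using integrable_norm_mul_of_memLp mf mg
    refine ⟨hm, ?_⟩
    have h1 := sobNorm_nonneg f
    have h2 := sobNorm_nonneg g
    refine (pow_le_pow_iff_left₀ (l2Norm_nonneg _) (by positivity) two_ne_zero).mp ?_
    rw [l2Norm_sq hm]
    simp only [e]
    calc ∫ x, ‖f x * f x‖ * ‖g x * g x‖ ≤ l2Norm (fun x => f x * f x) * l2Norm (fun x => g x * g x) :=
          integral_norm_mul_le mf mg
      _ ≤ (C * sobNorm f ^ 2) * (C * sobNorm g ^ 2) := by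
          gcongr
          exact l2Norm_nonneg _
      _ = _ := by ring

/-- The powers `|f|^k` of an `H¹` function are integrable for `3 ≤ k ≤ 1 + 4/d`. -/
theorem MemH1.exists_integral_pow_le (hd : d = 1 ∨ d = 2) : ∃ C : ℝ, 0 ≤ C ∧ ∀ f : E d → ℂ,
    MemH1 f → ∀ k ∈ Finset.Icc 3 (1 + crit d), Integrable (fun x => ‖f x‖ ^ k) volume ∧
      ∫ x, ‖f x‖ ^ k ≤ C * h1Norm f ^ k := by
  rcases hd with rfl | rfl
  -- In dimension one |f| ≤ 2 `sobNorm f` ≤ 4 `h1Norm f`. This bounds k - 2 factors of |f|^k; the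
  -- other two are kept for the `L²` norm, and 4^(k-2) ≤ 4⁵.
  · refine ⟨4 ^ 5, by norm_num, fun f hf k hk => ?_⟩
    have hk' : 3 ≤ k ∧ k ≤ 5 := by simpa [crit] using hk
    have h0 := h1Norm_nonneg f
    have hs : 2 * sobNorm f ≤ 4 * h1Norm f := by
      have := sobNorm_le_h1Norm f
      norm_num at this; linarith
    have hi : Integrable (fun x => ‖f x‖ ^ 2) volume := by
      simpa using hf.1.integrable_norm_pow (p := 2) (by norm_num)
    have hb : ∀ᵐ x, ‖f x‖ ^ k ≤ (4 * h1Norm f) ^ (k - 2) * ‖f x‖ ^ 2 := by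
      filter_upwards [hf.norm_le_one] with x hx
      calc ‖f x‖ ^ k = ‖f x‖ ^ (k - 2) * ‖f x‖ ^ 2 := by rw [← pow_add]; congr 1; omega
        _ ≤ _ := by gcongr; exact hx.trans hs
    have hi2 : Integrable (fun x => ‖f x‖ ^ k) volume := by
      refine (hi.const_mul ((4 * h1Norm f) ^ (k - 2))).mono' (hf.1.1.norm.pow k) (hb.mono fun x hx => ?_)
      rwa [Real.norm_of_nonneg (by positivity)]
    refine ⟨hi2, (integral_mono_ae hi2 (hi.const_mul _) hb).trans ?_⟩
    rw [integral_const_mul, ← l2Norm_sq hf.1, mul_pow]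
    have h3 : (4 : ℝ) ^ (k - 2) ≤ 4 ^ 5 := pow_le_pow_right₀ (by norm_num) (by omega)
    have h4 := l2Norm_le_h1Norm f
    have h5 := l2Norm_nonneg f
    calc 4 ^ (k - 2) * h1Norm f ^ (k - 2) * l2Norm f ^ 2
        ≤ 4 ^ 5 * h1Norm f ^ (k - 2) * h1Norm f ^ 2 := by gcongr
      _ = 4 ^ 5 * h1Norm f ^ k := by rw [mul_assoc, ← pow_add]; congr 2; omega
  · obtain ⟨C, hC, H⟩ := sobolev_two
    -- In dimension two k = 3 is the only exponent, and 9 = 3² comes from `sobNorm f` ≤ 3 `h1Norm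
    -- f`.
    refine ⟨9 * C, by positivity, fun f hf k hk => ?_⟩
    have hk' : k = 3 := by
      have : 3 ≤ k ∧ k ≤ 3 := Finset.mem_Icc.mp hk
      omega
    subst hk'
    obtain ⟨mf, lf⟩ := H f hf
    have e : ∀ x, ‖f x‖ ^ 3 = ‖f x‖ * ‖f x * f x‖ := fun x => by
      rw [norm_mul]; ring
    simp only [e]
    refine ⟨integrable_norm_mul_of_memLp hf.1 mf, (integral_norm_mul_le hf.1 mf).trans ?_⟩
    have h0 := h1Norm_nonneg f
    have h1 := sobNorm_nonneg f
    have hs : sobNorm f ≤ 3 * h1Norm f := by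
      have := sobNorm_le_h1Norm f
      norm_num at this; linarith
    calc l2Norm f * l2Norm (fun x => f x * f x) ≤ h1Norm f * (C * (3 * h1Norm f) ^ 2) := by
          have := l2Norm_nonneg (fun x => f x * f x)
          gcongr
          · exact l2Norm_le_h1Norm f
          · exact lf.trans (by gcongr)
      _ = 9 * C * h1Norm f ^ 3 := by ring

lemma abs_pow_four_sub_le {a b M : ℝ} (ha : 0 ≤ a) (hb : 0 ≤ b) (haM : a ≤ M) (hbM : b ≤ M) :
    |a ^ 4 - b ^ 4| ≤ 4 * M ^ 3 * |a - b| := by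
  have : a ^ 4 - b ^ 4 = (a ^ 3 + a ^ 2 * b + a * b ^ 2 + b ^ 3) * (a - b) := by ring
  rw [this, abs_mul, abs_of_nonneg (by positivity)]
  gcongr
  have h1 : a ^ 3 ≤ M ^ 3 := by gcongr
  have h2 : a ^ 2 * b ≤ M ^ 2 * M := by gcongr
  have h3 : a * b ^ 2 ≤ M * M ^ 2 := by gcongr; exact ha.trans haM
  have h4 : b ^ 3 ≤ M ^ 3 := by gcongr
  nlinarith

/-- The map `f ↦ |f|^{4/d}` from `H¹` to `L²` is locally Lipschitz. -/
theorem MemH1.exists_l2Norm_pow_crit_sub_le (hd : d = 1 ∨ d = 2) : ∃ C : ℝ, 0 ≤ C ∧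
    ∀ f g : E d → ℂ, MemH1 f → MemH1 g → MemLp (fun x => ((‖f x‖ ^ crit d : ℝ) : ℂ)) 2 volume ∧
      l2Norm (fun x => ((‖f x‖ ^ crit d : ℝ) : ℂ) - ((‖g x‖ ^ crit d : ℝ) : ℂ))
        ≤ C * (sobNorm f + sobNorm g) ^ (crit d - 1) * sobNorm (fun x => f x - g x) := by
  have meas : ∀ {f : E d → ℂ}, MemH1 f →
      AEStronglyMeasurable (fun x => ((‖f x‖ ^ crit d : ℝ) : ℂ)) volume := fun hf =>
    Complex.continuous_ofReal.comp_aestronglyMeasurable (hf.1.1.norm.pow _)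
  rcases hd with rfl | rfl
  -- 32 = 4 · 2³: the Lipschitz constant of s⁴ on [0, M] is 4M³, with M twice the sum of the two
  -- norms.
  · refine ⟨32, by norm_num, fun f g hf hg => ⟨?_, ?_⟩⟩
    · refine (hf.1.const_mul (((2 * sobNorm f) ^ 3 : ℝ) : ℂ)).of_le (meas hf) ?_
      filter_upwards [hf.norm_le_one] with x hx
      rw [norm_mul, Complex.norm_real, Complex.norm_real, Real.norm_of_nonneg (by positivity)]
      have h0 := sobNorm_nonneg f
      rw [Real.norm_of_nonneg (by positivity)]
      show ‖f x‖ ^ 4 ≤ _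
      rw [pow_succ]; gcongr
    · have h0 := sobNorm_nonneg f
      have h1 := sobNorm_nonneg g
      set M := 2 * (sobNorm f + sobNorm g) with hM
      have hb : ∀ᵐ x, ‖((‖f x‖ ^ crit 1 : ℝ) : ℂ) - ((‖g x‖ ^ crit 1 : ℝ) : ℂ)‖
          ≤ ‖((4 * M ^ 3 : ℝ) : ℂ) * (f x - g x)‖ := by
        filter_upwards [hf.norm_le_one, hg.norm_le_one] with x hx hy
        rw [norm_mul, ← Complex.ofReal_sub, Complex.norm_real, Complex.norm_real, Real.norm_eq_abs,
          Real.norm_of_nonneg (show 0 ≤ 4 * M ^ 3 by positivity)]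
        refine (abs_pow_four_sub_le (norm_nonneg _) (norm_nonneg _) (hx.trans (by linarith))
          (hy.trans (by linarith)) : _ ≤ 4 * M ^ 3 * _).trans ?_
        gcongr
        exact abs_norm_sub_norm_le _ _
      refine (l2Norm_mono ((hf.1.sub hg.1).const_mul _) hb).trans ?_
      rw [l2Norm_const_mul, Complex.norm_real, Real.norm_of_nonneg (by positivity)]
      have := l2Norm_le_sobNorm (fun x => f x - g x)
      have e : 32 * (sobNorm f + sobNorm g) ^ (crit 1 - 1) = 4 * M ^ 3 := by
        simp only [crit, hM]; norm_num; ring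
      rw [e]
      exact mul_le_mul_of_nonneg_left this (by positivity)
  · obtain ⟨C, hC, H⟩ := MemH1.exists_l2Norm_mul_le (d := 2) (Or.inr rfl)
    have hsq : ∀ {f : E 2 → ℂ}, MemH1 f → MemLp (fun x => ((‖f x‖ ^ crit 2 : ℝ) : ℂ)) 2 volume := by
      intro f hf
      refine (H f f hf hf).1.of_le (meas hf) (Eventually.of_forall fun x => ?_)
      rw [norm_mul, Complex.norm_real, Real.norm_of_nonneg (by positivity)]
      exact (pow_two _).le
    refine ⟨C, hC, fun f g hf hg => ⟨hsq hf, ?_⟩⟩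
    obtain ⟨m1, l1⟩ := H _ _ hf (hf.sub hg)
    obtain ⟨m2, l2⟩ := H _ _ hg (hf.sub hg)
    have hb : ∀ x, ‖((‖f x‖ ^ crit 2 : ℝ) : ℂ) - ((‖g x‖ ^ crit 2 : ℝ) : ℂ)‖
        ≤ ‖((‖f x * (f x - g x)‖ : ℝ) : ℂ) + ((‖g x * (f x - g x)‖ : ℝ) : ℂ)‖ := by
      intro x
      rw [← Complex.ofReal_sub, ← Complex.ofReal_add, Complex.norm_real, Complex.norm_real,
        Real.norm_of_nonneg (show 0 ≤ ‖f x * (f x - g x)‖ + ‖g x * (f x - g x)‖ by positivity),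
        norm_mul, norm_mul, ← add_mul, Real.norm_eq_abs]
      have : ‖f x‖ ^ crit 2 - ‖g x‖ ^ crit 2 = (‖f x‖ + ‖g x‖) * (‖f x‖ - ‖g x‖) := by
        simp only [crit]; norm_num; ring
      rw [this, abs_mul, abs_of_nonneg (by positivity)]
      gcongr
      exact abs_norm_sub_norm_le _ _
    have n1 : MemLp (fun x => ((‖f x * (f x - g x)‖ : ℝ) : ℂ)) 2 volume :=
      m1.of_le (Complex.continuous_ofReal.comp_aestronglyMeasurable m1.1.norm)
        (Eventually.of_forall fun x => by rw [Complex.norm_real, norm_norm])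
    have n2 : MemLp (fun x => ((‖g x * (f x - g x)‖ : ℝ) : ℂ)) 2 volume :=
      m2.of_le (Complex.continuous_ofReal.comp_aestronglyMeasurable m2.1.norm)
        (Eventually.of_forall fun x => by rw [Complex.norm_real, norm_norm])
    refine (l2Norm_mono (n1.add n2) (Eventually.of_forall hb)).trans ?_
    refine (l2Norm_add_le n1 n2).trans ?_
    have e1 : l2Norm (fun x => ((‖f x * (f x - g x)‖ : ℝ) : ℂ)) = l2Norm (fun x => f x * (f x - g x)) :=
      l2Norm_congr_norm fun x => by rw [Complex.norm_real, norm_norm]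
    have e2 : l2Norm (fun x => ((‖g x * (f x - g x)‖ : ℝ) : ℂ)) = l2Norm (fun x => g x * (f x - g x)) :=
      l2Norm_congr_norm fun x => by rw [Complex.norm_real, norm_norm]
    rw [e1, e2]
    have e3 : crit 2 - 1 = 1 := by simp [crit]
    rw [e3, pow_one]
    linarith

end Sobolev

end RNLS

namespace RNLS

open scoped ContDiff

/-! ### Convergence in `L²` -/

section TendstoL2

variable {d : ℕ} {ι : Type*} {l : Filter ι} {F G : ι → E d → ℂ} {f g : E d → ℂ}

/-- The functions `F i` converge to `f` in `L²`. -/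
structure TendstoL2 (F : ι → E d → ℂ) (l : Filter ι) (f : E d → ℂ) : Prop where
  mem : ∀ᶠ i in l, MemLp (F i) 2 volume
  mem_lim : MemLp f 2 volume
  tendsto : Tendsto (fun i => l2Norm (fun x => F i x - f x)) l (𝓝 0)

lemma TendstoL2.const (hf : MemLp f 2 volume) : TendstoL2 (fun _ : ι => f) l f :=
  ⟨Eventually.of_forall fun _ => hf, hf, by simp [l2Norm_zero, tendsto_const_nhds]⟩

lemma TendstoL2.add (hF : TendstoL2 F l f) (hG : TendstoL2 G l g) :
    TendstoL2 (fun i x => F i x + G i x) l (fun x => f x + g x) := by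
  refine ⟨?_, hF.mem_lim.add hG.mem_lim, ?_⟩
  · filter_upwards [hF.mem, hG.mem] with i h1 h2 using h1.add h2
  · have h := hF.tendsto.add hG.tendsto
    rw [add_zero] at h
    refine squeeze_zero' (Eventually.of_forall fun _ => l2Norm_nonneg _) ?_ h
    filter_upwards [hF.mem, hG.mem] with i h1 h2
    refine le_trans (le_of_eq ?_) (l2Norm_add_le (h1.sub hF.mem_lim) (h2.sub hG.mem_lim))
    refine congrArg l2Norm (funext fun x => ?_)
    ring

lemma TendstoL2.sum {κ : Type*} (s : Finset κ) {F : κ → ι → E d → ℂ} {f : κ → E d → ℂ}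
    (h : ∀ k ∈ s, TendstoL2 (F k) l (f k)) :
    TendstoL2 (fun i x => ∑ k ∈ s, F k i x) l (fun x => ∑ k ∈ s, f k x) := by
  classical
  induction s using Finset.induction_on with
  | empty =>
    simp only [Finset.sum_empty]
    exact TendstoL2.const (MemLp.zero' (ε := ℂ))
  | insert a s ha ih =>
    simp only [Finset.sum_insert ha]
    exact (h a (Finset.mem_insert_self _ _)).add (ih fun k hk => h k (Finset.mem_insert_of_mem hk))

lemma memLp_bdd_mul {a : E d → ℂ} {K : ℝ} (ha : AEStronglyMeasurable a volume)
    (haK : ∀ x, ‖a x‖ ≤ K) (hf : MemLp f 2 volume) : MemLp (fun x => a x * f x) 2 volume :=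
  hf.of_le_mul (c := K) (ha.mul hf.1) (Eventually.of_forall fun x => by
    rw [norm_mul]; gcongr; exact haK x)

lemma l2Norm_bdd_mul_le {a : E d → ℂ} {K : ℝ} (hK : 0 ≤ K) (haK : ∀ x, ‖a x‖ ≤ K)
    (hf : MemLp f 2 volume) : l2Norm (fun x => a x * f x) ≤ K * l2Norm f := by
  have : K * l2Norm f = l2Norm (fun x => (K : ℂ) * f x) := by
    rw [l2Norm_const_mul, Complex.norm_real, Real.norm_of_nonneg hK]
  rw [this]
  refine l2Norm_mono (hf.const_mul _) (Eventually.of_forall fun x => ?_)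
  rw [norm_mul, norm_mul, Complex.norm_real, Real.norm_of_nonneg hK]
  gcongr
  exact haK x

/-- Multiplication by uniformly convergent bounded coefficients. -/
lemma TendstoL2.bdd_mul {a : ι → E d → ℂ} {a₀ : E d → ℂ} {s : ι → ℝ} {K : ℝ}
    (ha : ∀ᶠ i in l, AEStronglyMeasurable (a i) volume) (ha₀ : AEStronglyMeasurable a₀ volume)
    (hs0 : ∀ᶠ i in l, 0 ≤ s i) (hs : Tendsto s l (𝓝 0))
    (has : ∀ᶠ i in l, ∀ x, ‖a i x - a₀ x‖ ≤ s i)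
    (hK : 0 ≤ K) (haK : ∀ x, ‖a₀ x‖ ≤ K) (hF : TendstoL2 F l f) :
    TendstoL2 (fun i x => a i x * F i x) l (fun x => a₀ x * f x) := by
  have hb : ∀ᶠ i in l, ∀ x, ‖a i x‖ ≤ s i + K := by
    filter_upwards [has] with i h x
    have := norm_add_le (a i x - a₀ x) (a₀ x)
    rw [sub_add_cancel] at this
    exact this.trans (add_le_add (h x) (haK x))
  refine ⟨?_, memLp_bdd_mul ha₀ haK hF.mem_lim, ?_⟩
  · filter_upwards [ha, hb, hF.mem] with i h1 h2 h3 using memLp_bdd_mul h1 h2 h3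
  · have hlim : Tendsto (fun i => (s i + K) * l2Norm (fun x => F i x - f x) + s i * l2Norm f)
        l (𝓝 0) := by
      simpa using ((hs.add_const K).mul hF.tendsto).add (hs.mul_const (l2Norm f))
    refine squeeze_zero' (Eventually.of_forall fun _ => l2Norm_nonneg _) ?_ hlim
    filter_upwards [ha, hb, has, hs0, hF.mem] with i h1 h2 h3 h4 h5
    have e : (fun x => a i x * F i x - a₀ x * f x)
        = fun x => a i x * (F i x - f x) + (a i x - a₀ x) * f x := by ext x; ring
    rw [e]
    refine (l2Norm_add_le (memLp_bdd_mul h1 h2 (h5.sub hF.mem_lim))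
      (memLp_bdd_mul (h1.sub ha₀) h3 hF.mem_lim)).trans ?_
    exact add_le_add (l2Norm_bdd_mul_le (by positivity) h2 (h5.sub hF.mem_lim))
      (l2Norm_bdd_mul_le h4 h3 hF.mem_lim)

lemma TendstoL2.integral_mul (hF : TendstoL2 F l f) (hG : TendstoL2 G l g) :
    Tendsto (fun i => ∫ x, F i x * G i x) l (𝓝 (∫ x, f x * g x)) :=
  tendsto_integral_mul hF.mem hG.mem hF.mem_lim hG.mem_lim hF.tendsto hG.tendsto

lemma TendstoL2.l2Norm (hF : TendstoL2 F l f) :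
    Tendsto (fun i => l2Norm (F i)) l (𝓝 (RNLS.l2Norm f)) := by
  rw [tendsto_iff_norm_sub_tendsto_zero]
  refine squeeze_zero' (Eventually.of_forall fun _ => norm_nonneg _) ?_ hF.tendsto
  filter_upwards [hF.mem] with i hi
  rw [Real.norm_eq_abs, abs_sub_le_iff]
  constructor
  · have := l2Norm_add_le (hi.sub hF.mem_lim) hF.mem_lim
    simp only [Pi.sub_apply, sub_add_cancel] at this
    exact sub_le_iff_le_add.mpr this
  · have := l2Norm_add_le (hF.mem_lim.sub hi) hi
    simp only [Pi.sub_apply, sub_add_cancel] at this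
    rw [l2Norm_sub_comm]
    exact sub_le_iff_le_add.mpr this

end TendstoL2

/-! ### The noise coefficients -/

section Noise

variable {d N : ℕ}

lemma laplacian_eq_sum_pd {F : Type*} [NormedAddCommGroup F] [NormedSpace ℝ F] {f : E d → F}
    {x : E d} (hf : ContDiffAt ℝ 2 f x) :
    Laplacian.laplacian f x = ∑ j, pd j (pd j f) x := by
  rw [InnerProductSpace.laplacian_eq_iteratedFDeriv_orthonormalBasis f
    (EuclideanSpace.basisFun (Fin d) ℝ)]
  refine Finset.sum_congr rfl fun j _ => ?_
  have hd : DifferentiableAt ℝ (fderiv ℝ f) x :=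
    (hf.fderiv_right (m := 1) (by norm_num)).differentiableAt (by simp)
  rw [iteratedFDeriv_two_apply]
  have h2 : pd j f = fun y => (fderiv ℝ f y) (stdVec j) := rfl
  rw [h2]
  unfold pd
  rw [fderiv_clm_apply hd (differentiableAt_const _)]
  simp [stdVec]

/-- The `j`-th component of `∑ₖ vₖ ∇φₖ`. -/
noncomputable def noiseGrad (φ : Fin N → E d → ℝ) (v : Fin N → ℝ) (j : Fin d) (x : E d) : ℝ :=
  ∑ k, fderiv ℝ (φ k) x (stdVec j) * v k

/-- The Laplacian of `∑ₖ vₖ φₖ`. -/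
noncomputable def noiseLap (φ : Fin N → E d → ℝ) (v : Fin N → ℝ) (x : E d) : ℝ :=
  ∑ k, Laplacian.laplacian (φ k) x * v k

variable {φ : Fin N → E d → ℝ}

lemma noiseGrad_contDiff (hφ : ∀ k, IsCbInfty (φ k)) (v : Fin N → ℝ) (j : Fin d) :
    ContDiff ℝ ∞ (noiseGrad φ v j) :=
  ContDiff.sum fun k _ => (pd_contDiff (m := ∞) j (hφ k).1 (by simp)).mul contDiff_const

lemma pd_pd_contDiff (hφ : ∀ k, IsCbInfty (φ k)) (k : Fin N) (i j : Fin d) :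
    ContDiff ℝ ∞ (pd i (pd j (φ k))) :=
  pd_contDiff (m := ∞) i (pd_contDiff (m := ∞) j (hφ k).1 (by simp)) (by simp)

lemma noiseLap_eq (hφ : ∀ k, IsCbInfty (φ k)) (v : Fin N → ℝ) (x : E d) :
    noiseLap φ v x = ∑ k, (∑ j, pd j (pd j (φ k)) x) * v k :=
  Finset.sum_congr rfl fun k _ => by
    rw [laplacian_eq_sum_pd ((hφ k).1.of_le (WithTop.coe_le_coe.mpr (le_top : (2 : ℕ∞) ≤ ⊤))).contDiffAt]

lemma noiseLap_continuous (hφ : ∀ k, IsCbInfty (φ k)) (v : Fin N → ℝ) :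
    Continuous (noiseLap φ v) := by
  have : noiseLap φ v = fun x => ∑ k, (∑ j, pd j (pd j (φ k)) x) * v k := by
    ext x; exact noiseLap_eq hφ v x
  rw [this]
  exact continuous_finsetSum _ fun k _ => (continuous_finsetSum _ fun j _ =>
    (pd_pd_contDiff hφ k j j).continuous).mul continuous_const

lemma pd_noiseGrad (hφ : ∀ k, IsCbInfty (φ k)) (v : Fin N → ℝ) (i j : Fin d) (x : E d) :
    pd i (noiseGrad φ v j) x = ∑ k, pd i (pd j (φ k)) x * v k := by
  have h : ∀ k, DifferentiableAt ℝ (pd j (φ k)) x := fun k =>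
    (pd_contDiff (m := 1) j (hφ k).1 (WithTop.coe_le_coe.mpr (le_top : (1 + 1 : ℕ∞) ≤ ⊤))).differentiable (by simp) x
  have h2 : noiseGrad φ v j = fun x => ∑ k, pd j (φ k) x * v k := rfl
  have h3 : HasFDerivAt (noiseGrad φ v j) (∑ k, v k • fderiv ℝ (pd j (φ k)) x) x := by
    rw [h2]
    exact HasFDerivAt.fun_sum fun k _ => (h k).hasFDerivAt.mul_const (v k)
  unfold pd at h3 ⊢
  rw [h3.fderiv]
  simp [mul_comm]

/-- The divergence of a gradient. With Φ = ∑ₖ vₖφₖ, this relation between b = 2i∇Φ and the imaginary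
part of c makes 2i∇Φ·∇ + iΔΦ formally symmetric, which is what conservation of mass rests on. -/
lemma sum_pd_noiseGrad (hφ : ∀ k, IsCbInfty (φ k)) (v : Fin N → ℝ) (x : E d) :
    ∑ j, pd j (noiseGrad φ v j) x = noiseLap φ v x := by
  simp only [pd_noiseGrad hφ, noiseLap_eq hφ, Finset.sum_mul]
  exact Finset.sum_comm

lemma norm_pd_pd_le {F : Type*} [NormedAddCommGroup F] [NormedSpace ℝ F] {f : E d → F} {x : E d}
    (hf : ContDiffAt ℝ 2 f x) (i j : Fin d) :
    ‖pd i (pd j f) x‖ ≤ ‖iteratedFDeriv ℝ 2 f x‖ := by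
  have hd : DifferentiableAt ℝ (fderiv ℝ f) x :=
    (hf.fderiv_right (m := 1) (by norm_num)).differentiableAt (by simp)
  have e : pd i (pd j f) x = iteratedFDeriv ℝ 2 f x ![stdVec i, stdVec j] := by
    have h2 : pd j f = fun y => (fderiv ℝ f y) (stdVec j) := rfl
    rw [iteratedFDeriv_two_apply, h2]
    unfold pd
    rw [fderiv_clm_apply hd (differentiableAt_const _)]
    simp
  rw [e]
  refine ((iteratedFDeriv ℝ 2 f x).le_opNorm _).trans_eq ?_
  simp [norm_stdVec, Fin.prod_univ_two]

/-- A uniform bound for the first and second derivatives of the noise profiles. -/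
lemma exists_noise_bound (hφ : ∀ k, IsCbInfty (φ k)) :
    ∃ K : ℝ, 0 ≤ K ∧ ∀ k x, (∀ j, ‖pd j (φ k) x‖ ≤ K) ∧ ∀ i j, ‖pd i (pd j (φ k)) x‖ ≤ K := by
  choose K₁ hK₁ using fun k => (hφ k).2 1
  choose K₂ hK₂ using fun k => (hφ k).2 2
  have n1 : ∀ k, 0 ≤ K₁ k := fun k => (norm_nonneg _).trans (hK₁ k 0)
  have n2 : ∀ k, 0 ≤ K₂ k := fun k => (norm_nonneg _).trans (hK₂ k 0)
  refine ⟨∑ k, (K₁ k + K₂ k), Finset.sum_nonneg fun k _ => add_nonneg (n1 k) (n2 k),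
    fun k x => ?_⟩
  have hle : K₁ k + K₂ k ≤ ∑ k, (K₁ k + K₂ k) :=
    Finset.single_le_sum (f := fun k => K₁ k + K₂ k) (fun k _ => add_nonneg (n1 k) (n2 k))
      (Finset.mem_univ k)
  refine ⟨fun j => ?_, fun i j => ?_⟩
  · refine (norm_pd_le j _ x).trans ?_
    rw [← norm_iteratedFDeriv_one]
    linarith [hK₁ k x, n2 k]
  · refine (norm_pd_pd_le ((hφ k).1.of_le (WithTop.coe_le_coe.mpr (le_top : (2 : ℕ∞) ≤ ⊤))).contDiffAt i j).trans ?_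
    linarith [hK₂ k x, n1 k]

variable {K : ℝ}

lemma noiseGrad_sub (v w : Fin N → ℝ) (j : Fin d) (x : E d) :
    noiseGrad φ v j x - noiseGrad φ w j x = noiseGrad φ (v - w) j x := by
  unfold noiseGrad
  rw [← Finset.sum_sub_distrib]
  simp [mul_sub]

lemma noiseLap_sub (v w : Fin N → ℝ) (x : E d) :
    noiseLap φ v x - noiseLap φ w x = noiseLap φ (v - w) x := by
  unfold noiseLap
  rw [← Finset.sum_sub_distrib]
  simp [mul_sub]

lemma norm_noiseGrad_le
    (hK : ∀ k x, (∀ j, ‖pd j (φ k) x‖ ≤ K) ∧ ∀ i j, ‖pd i (pd j (φ k)) x‖ ≤ K)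
    (v : Fin N → ℝ) (j : Fin d) (x : E d) :
    ‖noiseGrad φ v j x‖ ≤ K * ∑ k, |v k| := by
  unfold noiseGrad
  rw [Finset.mul_sum]
  refine (norm_sum_le _ _).trans (Finset.sum_le_sum fun k _ => ?_)
  rw [norm_mul, Real.norm_eq_abs (v k)]
  gcongr
  exact (hK k x).1 j

lemma norm_pd_noiseGrad_le
    (hK : ∀ k x, (∀ j, ‖pd j (φ k) x‖ ≤ K) ∧ ∀ i j, ‖pd i (pd j (φ k)) x‖ ≤ K)
    (hφ : ∀ k, IsCbInfty (φ k)) (v : Fin N → ℝ) (i j : Fin d) (x : E d) :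
    ‖pd i (noiseGrad φ v j) x‖ ≤ K * ∑ k, |v k| := by
  rw [pd_noiseGrad hφ, Finset.mul_sum]
  refine (norm_sum_le _ _).trans (Finset.sum_le_sum fun k _ => ?_)
  rw [norm_mul, Real.norm_eq_abs (v k)]
  gcongr
  exact (hK k x).2 i j

lemma norm_noiseLap_le
    (hK : ∀ k x, (∀ j, ‖pd j (φ k) x‖ ≤ K) ∧ ∀ i j, ‖pd i (pd j (φ k)) x‖ ≤ K)
    (hφ : ∀ k, IsCbInfty (φ k)) (v : Fin N → ℝ) (x : E d) :
    ‖noiseLap φ v x‖ ≤ d * (K * ∑ k, |v k|) := by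
  rw [← sum_pd_noiseGrad hφ]
  refine (norm_sum_le _ _).trans ((Finset.sum_le_sum fun j _ =>
    norm_pd_noiseGrad_le hK hφ v j j x).trans_eq ?_)
  simp

end Noise

end RNLS

namespace RNLS

open scoped ContDiff

/-! ### The weak form of the equation -/

section Equation

variable {d N : ℕ} {φ : Fin N → E d → ℝ} {β : Fin N → ℝ → ℝ} {f g ψ : E d → ℂ}

/-- The lower order perturbation `b·∇f + c f`. -/
noncomputable def noiseTerm (φ : Fin N → E d → ℝ) (β : Fin N → ℝ → ℝ) (r : ℝ) (f : E d → ℂ)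
    (x : E d) : ℂ :=
  (∑ j : Fin d, bCoef φ β r x j * weakPartial j f x) + cCoef φ β r x * f x

/-- The right-hand side `i(Δf + |f|^{4/d} f + b·∇f + c f)`, paired with `ψ`. -/
noncomputable def rhsForm (φ : Fin N → E d → ℝ) (β : Fin N → ℝ → ℝ) (r : ℝ) (f ψ : E d → ℂ) : ℂ :=
  (- Complex.I * ∑ j : Fin d, ∫ x, weakPartial j f x * weakPartial j ψ x)
    + Complex.I * (∫ x, ((‖f x‖ ^ crit d : ℝ) : ℂ) * (f x * ψ x))
    + Complex.I * ∫ x, noiseTerm φ β r f x * ψ x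

lemma bCoef_eq (r : ℝ) (x : E d) (j : Fin d) :
    bCoef φ β r x j = 2 * Complex.I * (noiseGrad φ (fun k => β k r) j x : ℂ) := rfl

lemma cCoef_eq (r : ℝ) (x : E d) :
    cCoef φ β r x = - ((∑ j : Fin d, noiseGrad φ (fun k => β k r) j x ^ 2 : ℝ) : ℂ)
      + Complex.I * (noiseLap φ (fun k => β k r) x : ℂ) := rfl

lemma continuous_bCoef (hφ : ∀ k, IsCbInfty (φ k)) (r : ℝ) (j : Fin d) :
    Continuous (fun x => bCoef φ β r x j) := by
  simp only [bCoef_eq]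
  exact continuous_const.mul (Complex.continuous_ofReal.comp (noiseGrad_contDiff hφ _ j).continuous)

lemma continuous_cCoef (hφ : ∀ k, IsCbInfty (φ k)) (r : ℝ) :
    Continuous (fun x => cCoef φ β r x) := by
  simp only [cCoef_eq]
  refine (Complex.continuous_ofReal.comp (continuous_finsetSum _ fun j _ =>
    (noiseGrad_contDiff hφ _ j).continuous.pow 2)).neg.add (continuous_const.mul
    (Complex.continuous_ofReal.comp (noiseLap_continuous hφ _)))

lemma exists_norm_bCoef_le (hφ : ∀ k, IsCbInfty (φ k)) (β : Fin N → ℝ → ℝ) (r : ℝ) :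
    ∃ K : ℝ, 0 ≤ K ∧ (∀ x j, ‖bCoef φ β r x j‖ ≤ K) ∧ ∀ x, ‖cCoef φ β r x‖ ≤ K := by
  obtain ⟨K, hK0, hK⟩ := exists_noise_bound hφ
  set S := K * ∑ k, |β k r| with hS
  have hS0 : 0 ≤ S := mul_nonneg hK0 (Finset.sum_nonneg fun _ _ => abs_nonneg _)
  refine ⟨2 * S + (d * S ^ 2 + d * S), by positivity, fun x j => ?_, fun x => ?_⟩
  · rw [bCoef_eq, norm_mul, norm_mul, Complex.norm_I, Complex.norm_real]
    have := norm_noiseGrad_le hK (fun k => β k r) j x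
    norm_num at this ⊢
    nlinarith [show (0 : ℝ) ≤ d * S ^ 2 + d * S by positivity]
  · rw [cCoef_eq]
    refine (norm_add_le _ _).trans ?_
    rw [norm_neg, norm_mul, Complex.norm_I, one_mul, Complex.norm_real, Complex.norm_real]
    have h1 := norm_noiseLap_le hK hφ (fun k => β k r) x
    have h2 : ‖∑ j : Fin d, noiseGrad φ (fun k => β k r) j x ^ 2‖ ≤ d * S ^ 2 := by
      refine (norm_sum_le _ _).trans ((Finset.sum_le_sum (g := fun _ => S ^ 2) fun j _ => ?_).trans_eq
        (by simp))
      rw [norm_pow]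
      have := norm_noiseGrad_le hK (fun k => β k r) j x
      gcongr
    linarith

lemma memLp_noiseTerm (hφ : ∀ k, IsCbInfty (φ k)) (r : ℝ) (hf : MemH1 f) :
    MemLp (noiseTerm φ β r f) 2 volume := by
  obtain ⟨K, -, h1, h2⟩ := exists_norm_bCoef_le hφ β r
  refine MemLp.add (memLp_finsetSum _ fun j _ => ?_) ?_
  · exact memLp_bdd_mul (continuous_bCoef hφ r j).aestronglyMeasurable (fun x => h1 x j)
      (hf.memLp_weakPartial j)
  · exact memLp_bdd_mul (continuous_cCoef hφ r).aestronglyMeasurable h2 hf.1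

/-- Convergence in `H¹`. -/
structure TendstoH1 {ι : Type*} (F : ι → E d → ℂ) (l : Filter ι) (f : E d → ℂ) : Prop where
  mem : ∀ᶠ i in l, MemH1 (F i)
  mem_lim : MemH1 f
  tendsto : Tendsto (fun i => sobNorm (fun x => F i x - f x)) l (𝓝 0)

section Tendsto

variable {ι : Type*} {l : Filter ι} {F G : ι → E d → ℂ}

lemma TendstoH1.tendstoL2 (h : TendstoH1 F l f) : TendstoL2 F l f :=
  ⟨h.mem.mono fun _ hi => hi.1, h.mem_lim.1, squeeze_zero (fun _ => l2Norm_nonneg _)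
    (fun _ => l2Norm_le_sobNorm _) h.tendsto⟩

lemma TendstoH1.weakPartial (h : TendstoH1 F l f) (j : Fin d) :
    TendstoL2 (fun i => weakPartial j (F i)) l (weakPartial j f) := by
  refine ⟨h.mem.mono fun _ hi => hi.memLp_weakPartial j, h.mem_lim.memLp_weakPartial j, ?_⟩
  refine squeeze_zero' (Eventually.of_forall fun _ => l2Norm_nonneg _) ?_ h.tendsto
  filter_upwards [h.mem] with i hi
  rw [← l2Norm_congr (hi.weakPartial_sub h.mem_lim j)]
  exact l2Norm_weakPartial_le_sobNorm _ _

lemma TendstoH1.sobNorm (h : TendstoH1 F l f) :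
    Tendsto (fun i => sobNorm (F i)) l (𝓝 (RNLS.sobNorm f)) := by
  unfold RNLS.sobNorm
  exact h.tendstoL2.l2Norm.add (tendsto_finsetSum _ fun j _ => (h.weakPartial j).l2Norm)

lemma TendstoH1.mul (hd : d = 1 ∨ d = 2) (h : TendstoH1 F l f) (hψ : MemH1 ψ) :
    TendstoL2 (fun i x => F i x * ψ x) l (fun x => f x * ψ x) := by
  obtain ⟨C, hC, H⟩ := MemH1.exists_l2Norm_mul_le hd
  refine ⟨h.mem.mono fun i hi => (H _ _ hi hψ).1, (H _ _ h.mem_lim hψ).1, ?_⟩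
  have hlim : Tendsto (fun i => C * (RNLS.sobNorm (fun x => F i x - f x) * RNLS.sobNorm ψ)) l (𝓝 0) := by
    simpa using (h.tendsto.mul_const (RNLS.sobNorm ψ)).const_mul C
  refine squeeze_zero' (Eventually.of_forall fun _ => l2Norm_nonneg _) ?_ hlim
  filter_upwards [h.mem] with i hi
  simpa only [sub_mul] using (H _ _ (hi.sub h.mem_lim) hψ).2

lemma TendstoH1.pow_crit (hd : d = 1 ∨ d = 2) (h : TendstoH1 F l f) :
    TendstoL2 (fun i x => ((‖F i x‖ ^ crit d : ℝ) : ℂ)) l (fun x => ((‖f x‖ ^ crit d : ℝ) : ℂ)) := by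
  obtain ⟨C, hC, H⟩ := MemH1.exists_l2Norm_pow_crit_sub_le hd
  refine ⟨h.mem.mono fun i hi => (H _ _ hi hi).1, (H _ _ h.mem_lim h.mem_lim).1, ?_⟩
  have hlim : Tendsto (fun i => C * (RNLS.sobNorm (F i) + RNLS.sobNorm f) ^ (crit d - 1)
      * RNLS.sobNorm (fun x => F i x - f x)) l (𝓝 0) := by
    have := (((h.sobNorm.add_const (RNLS.sobNorm f)).pow (crit d - 1)).const_mul C).mul h.tendsto
    rw [mul_zero] at this
    exact this
  refine squeeze_zero' (Eventually.of_forall fun _ => l2Norm_nonneg _) ?_ hlim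
  filter_upwards [h.mem] with i hi using (H _ _ hi h.mem_lim).2

/-- Time enters the coefficients only through the values of the paths. Since the derivatives of φ
are bounded, convergence of these values gives uniform convergence in x; the quadratic part uses a²
- b² = (a - b)((a - b) + 2b). -/
lemma TendstoH1.noiseTerm (hφ : ∀ k, IsCbInfty (φ k)) {τ : ι → ℝ} {r : ℝ}
    (hτ : ∀ k, Tendsto (fun i => β k (τ i)) l (𝓝 (β k r))) (h : TendstoH1 F l f) :
    TendstoL2 (fun i => noiseTerm φ β (τ i) (F i)) l (noiseTerm φ β r f) := by
  obtain ⟨K, hK0, hK⟩ := exists_noise_bound hφ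
  obtain ⟨M, hM0, hM1, hM2⟩ := exists_norm_bCoef_le hφ β r
  set s : ι → ℝ := fun i => K * ∑ k, |β k (τ i) - β k r| with hs
  have hs0 : ∀ i, 0 ≤ s i := fun i => mul_nonneg hK0 (Finset.sum_nonneg fun _ _ => abs_nonneg _)
  have hst : Tendsto s l (𝓝 0) := by
    have : Tendsto (fun i => ∑ k, |β k (τ i) - β k r|) l (𝓝 (∑ _k : Fin N, 0)) :=
      tendsto_finsetSum _ fun k _ => by
        simpa using ((hτ k).sub_const (β k r)).abs
    simpa using this.const_mul K
  have hg : ∀ i j x, |noiseGrad φ (fun k => β k (τ i)) j x - noiseGrad φ (fun k => β k r) j x| ≤ s i :=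
    fun i j x => by
      rw [noiseGrad_sub]
      exact norm_noiseGrad_le hK _ j x
  have hl : ∀ i x, |noiseLap φ (fun k => β k (τ i)) x - noiseLap φ (fun k => β k r) x| ≤ d * s i :=
    fun i x => by
      rw [noiseLap_sub]
      exact norm_noiseLap_le hK hφ _ x
  set S := K * ∑ k, |β k r| with hS
  have hS0 : 0 ≤ S := mul_nonneg hK0 (Finset.sum_nonneg fun _ _ => abs_nonneg _)
  have hgS : ∀ j x, |noiseGrad φ (fun k => β k r) j x| ≤ S := fun j x => norm_noiseGrad_le hK _ j x
  refine TendstoL2.add (TendstoL2.sum _ fun j _ => ?_) ?_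
  · refine TendstoL2.bdd_mul (s := fun i => 2 * s i) (K := M)
      (Eventually.of_forall fun i => (continuous_bCoef hφ _ j).aestronglyMeasurable)
      (continuous_bCoef hφ _ j).aestronglyMeasurable
      (Eventually.of_forall fun i => by have := hs0 i; positivity) (by simpa using hst.const_mul 2)
      (Eventually.of_forall fun i x => ?_) hM0 (fun x => hM1 x j) (h.weakPartial j)
    rw [bCoef_eq, bCoef_eq, ← mul_sub, ← Complex.ofReal_sub, norm_mul, norm_mul, Complex.norm_I,
      Complex.norm_real, Real.norm_eq_abs]
    norm_num
    exact hg i j x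
  · refine TendstoL2.bdd_mul (s := fun i => d * (s i * (s i + 2 * S)) + d * s i) (K := M)
      (Eventually.of_forall fun i => (continuous_cCoef hφ _).aestronglyMeasurable)
      (continuous_cCoef hφ _).aestronglyMeasurable
      (Eventually.of_forall fun i => by have := hs0 i; positivity) ?_
      (Eventually.of_forall fun i x => ?_) hM0 hM2 h.tendstoL2
    · have := ((hst.mul (hst.add_const (2 * S))).const_mul (d : ℝ)).add (hst.const_mul (d : ℝ))
      simpa using this
    · rw [cCoef_eq, cCoef_eq]
      have e : (-((∑ j : Fin d, noiseGrad φ (fun k => β k (τ i)) j x ^ 2 : ℝ) : ℂ)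
            + Complex.I * (noiseLap φ (fun k => β k (τ i)) x : ℂ))
          - (-((∑ j : Fin d, noiseGrad φ (fun k => β k r) j x ^ 2 : ℝ) : ℂ)
            + Complex.I * (noiseLap φ (fun k => β k r) x : ℂ))
          = -((∑ j : Fin d, (noiseGrad φ (fun k => β k (τ i)) j x ^ 2
              - noiseGrad φ (fun k => β k r) j x ^ 2) : ℝ) : ℂ)
            + Complex.I * ((noiseLap φ (fun k => β k (τ i)) x
              - noiseLap φ (fun k => β k r) x : ℝ) : ℂ) := by
        rw [Finset.sum_sub_distrib]; push_cast; ring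
      rw [e]
      refine (norm_add_le _ _).trans ?_
      rw [norm_neg, norm_mul, Complex.norm_I, one_mul, Complex.norm_real, Complex.norm_real]
      refine add_le_add ?_ (hl i x)
      refine (norm_sum_le _ _).trans ((Finset.sum_le_sum (g := fun _ => s i * (s i + 2 * S))
        fun j _ => ?_).trans_eq (by simp))
      have a := hg i j x
      have b := hgS j x
      have e2 : noiseGrad φ (fun k => β k (τ i)) j x ^ 2 - noiseGrad φ (fun k => β k r) j x ^ 2
          = (noiseGrad φ (fun k => β k (τ i)) j x - noiseGrad φ (fun k => β k r) j x)
            * ((noiseGrad φ (fun k => β k (τ i)) j x - noiseGrad φ (fun k => β k r) j x)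
              + 2 * noiseGrad φ (fun k => β k r) j x) := by ring
      rw [e2, norm_mul]
      refine mul_le_mul a ((norm_add_le _ _).trans ?_) (norm_nonneg _) (hs0 i)
      rw [norm_mul, Real.norm_eq_abs, Real.norm_eq_abs, Real.norm_eq_abs]
      norm_num
      linarith

lemma TendstoH1.rhsForm (hd : d = 1 ∨ d = 2) (hφ : ∀ k, IsCbInfty (φ k)) {τ : ι → ℝ} {r : ℝ}
    (hτ : ∀ k, Tendsto (fun i => β k (τ i)) l (𝓝 (β k r))) (h : TendstoH1 F l f) (hψ : MemH1 ψ) :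
    Tendsto (fun i => rhsForm φ β (τ i) (F i) ψ) l (𝓝 (rhsForm φ β r f ψ)) := by
  refine (((tendsto_finsetSum _ fun j _ => (h.weakPartial j).integral_mul
    (TendstoL2.const (hψ.memLp_weakPartial j))).const_mul _).add
    (((h.pow_crit hd).integral_mul (h.mul hd hψ)).const_mul _)).add
    (((h.noiseTerm hφ hτ).integral_mul (TendstoL2.const hψ.1)).const_mul _)

end Tendsto

/-- The bound of `rhsForm` as a functional on `H¹`. -/
noncomputable def rhsBound (φ : Fin N → E d → ℝ) (β : Fin N → ℝ → ℝ) (C r : ℝ) (f : E d → ℂ) : ℝ :=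
  (∑ j : Fin d, l2Norm (weakPartial j f))
    + C * (l2Norm (fun x => ((‖f x‖ ^ crit d : ℝ) : ℂ)) * sobNorm f) + l2Norm (noiseTerm φ β r f)

/-- Every summand is a pairing of two `L²` functions. In the nonlinear one, |f|^{4/d} is grouped
apart from the product fψ, both being square integrable by the Sobolev embeddings. -/
lemma norm_rhsForm_le (hd : d = 1 ∨ d = 2) : ∃ C : ℝ, 0 ≤ C ∧ ∀ {N : ℕ} (φ : Fin N → E d → ℝ)
    (_ : ∀ k, IsCbInfty (φ k)) (β : Fin N → ℝ → ℝ) (r : ℝ) (f ψ : E d → ℂ), MemH1 f → MemH1 ψ →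
      ‖rhsForm φ β r f ψ‖ ≤ rhsBound φ β C r f * sobNorm ψ := by
  obtain ⟨C, hC, H⟩ := MemH1.exists_l2Norm_mul_le hd
  obtain ⟨C', hC', H'⟩ := MemH1.exists_l2Norm_pow_crit_sub_le hd
  refine ⟨C, hC, fun {N} φ hφ β r f ψ hf hψ => ?_⟩
  unfold rhsForm
  refine (norm_add₃_le).trans ?_
  simp only [norm_mul, norm_neg, Complex.norm_I, one_mul]
  have h0 := sobNorm_nonneg ψ
  have a : ‖∑ j : Fin d, ∫ x, weakPartial j f x * weakPartial j ψ x‖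
      ≤ (∑ j : Fin d, l2Norm (weakPartial j f)) * sobNorm ψ := by
    rw [Finset.sum_mul]
    refine (norm_sum_le _ _).trans (Finset.sum_le_sum fun j _ => ?_)
    refine (norm_integral_mul_le (hf.memLp_weakPartial j) (hψ.memLp_weakPartial j)).trans ?_
    gcongr
    · exact l2Norm_nonneg _
    · exact l2Norm_weakPartial_le_sobNorm _ _
  have b : ‖∫ x, ((‖f x‖ ^ crit d : ℝ) : ℂ) * (f x * ψ x)‖
      ≤ C * (l2Norm (fun x => ((‖f x‖ ^ crit d : ℝ) : ℂ)) * sobNorm f) * sobNorm ψ := by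
    refine (norm_integral_mul_le (H' f f hf hf).1 (H f ψ hf hψ).1).trans ?_
    calc _ ≤ l2Norm (fun x => ((‖f x‖ ^ crit d : ℝ) : ℂ)) * (C * (sobNorm f * sobNorm ψ)) := by
          gcongr
          · exact l2Norm_nonneg _
          · exact (H f ψ hf hψ).2
      _ = _ := by ring
  have c : ‖∫ x, noiseTerm φ β r f x * ψ x‖ ≤ l2Norm (noiseTerm φ β r f) * sobNorm ψ := by
    refine (norm_integral_mul_le (memLp_noiseTerm hφ r hf) hψ.1).trans ?_
    gcongr
    · exact l2Norm_nonneg _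
    · exact l2Norm_le_sobNorm _
  unfold rhsBound
  linarith

lemma integrable_crit_mul (hd : d = 1 ∨ d = 2) (hf : MemH1 f) (hψ : MemH1 ψ) :
    Integrable (fun x => ((‖f x‖ ^ crit d : ℝ) : ℂ) * (f x * ψ x)) volume := by
  obtain ⟨C, hC, H⟩ := MemH1.exists_l2Norm_mul_le hd
  obtain ⟨C', hC', H'⟩ := MemH1.exists_l2Norm_pow_crit_sub_le hd
  exact integrable_mul_of_memLp (H' f f hf hf).1 (H f ψ hf hψ).1

lemma rhsForm_add (hd : d = 1 ∨ d = 2) (hφ : ∀ k, IsCbInfty (φ k)) (r : ℝ) (hf : MemH1 f)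
    (hg : MemH1 g) (hψ : MemH1 ψ) :
    rhsForm φ β r f (fun x => g x + ψ x) = rhsForm φ β r f g + rhsForm φ β r f ψ := by
  have a : ∀ j, ∫ x, weakPartial j f x * weakPartial j (fun x => g x + ψ x) x
      = (∫ x, weakPartial j f x * weakPartial j g x) + ∫ x, weakPartial j f x * weakPartial j ψ x := by
    intro j
    rw [← integral_add (integrable_mul_of_memLp (hf.memLp_weakPartial j) (hg.memLp_weakPartial j))
      (integrable_mul_of_memLp (hf.memLp_weakPartial j) (hψ.memLp_weakPartial j))]
    refine integral_congr_ae ?_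
    filter_upwards [hg.weakPartial_add hψ j] with x hx
    rw [hx]; ring
  unfold rhsForm
  simp only [a, Finset.sum_add_distrib, mul_add]
  rw [integral_add (integrable_crit_mul hd hf hg) (integrable_crit_mul hd hf hψ),
    integral_add (integrable_mul_of_memLp (memLp_noiseTerm hφ r hf) hg.1)
      (integrable_mul_of_memLp (memLp_noiseTerm hφ r hf) hψ.1)]
  ring

lemma rhsForm_const_mul (r : ℝ) (c : ℂ) (hψ : MemH1 ψ) :
    rhsForm φ β r f (fun x => c * ψ x) = c * rhsForm φ β r f ψ := by
  have a : ∀ j, ∫ x, weakPartial j f x * weakPartial j (fun x => c * ψ x) x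
      = c * ∫ x, weakPartial j f x * weakPartial j ψ x := by
    intro j
    rw [← integral_const_mul]
    refine integral_congr_ae ?_
    filter_upwards [hψ.weakPartial_const_mul c j] with x hx
    rw [hx]; ring
  have b : ∫ x, ((‖f x‖ ^ crit d : ℝ) : ℂ) * (f x * (c * ψ x))
      = c * ∫ x, ((‖f x‖ ^ crit d : ℝ) : ℂ) * (f x * ψ x) := by
    rw [← integral_const_mul]; congr 1; ext x; ring
  have e : ∫ x, noiseTerm φ β r f x * (c * ψ x) = c * ∫ x, noiseTerm φ β r f x * ψ x := by
    rw [← integral_const_mul]; congr 1; ext x; ring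
  unfold rhsForm
  simp only [a, b, e, ← Finset.mul_sum]
  ring

/-- Integration by parts in the perturbation. -/
lemma integral_noiseTerm_mul (hφ : ∀ k, IsCbInfty (φ k)) (r : ℝ) (hf : MemH1 f) (hψ : MemH1 ψ) :
    ∫ x, noiseTerm φ β r f x * ψ x = ∫ x, f x *
      (-((∑ j : Fin d, noiseGrad φ (fun k => β k r) j x ^ 2 : ℝ) : ℂ) * ψ x
        - Complex.I * (noiseLap φ (fun k => β k r) x : ℂ) * ψ x
        - 2 * Complex.I * ∑ j, (noiseGrad φ (fun k => β k r) j x : ℂ) * weakPartial j ψ x) := by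
  obtain ⟨K, hK0, hK⟩ := exists_noise_bound hφ
  obtain ⟨M, hM0, hM1, hM2⟩ := exists_norm_bCoef_le hφ β r
  set v : Fin N → ℝ := fun k => β k r with hv
  set S := K * ∑ k, |v k| with hS
  have hw : ∀ j, IsWeakPartial j (fun x => (noiseGrad φ v j x : ℂ) * ψ x)
      (fun x => ((pd j (noiseGrad φ v j) x : ℝ) : ℂ) * ψ x
        + (noiseGrad φ v j x : ℂ) * weakPartial j ψ x) := fun j =>
    IsWeakPartial.real_mul (noiseGrad_contDiff hφ v j) (norm_noiseGrad_le hK v j)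
      (norm_pd_noiseGrad_le hK hφ v j j) hψ.1 (hψ.isWeakPartial j)
  have hgc : ∀ j, AEStronglyMeasurable (fun x => (noiseGrad φ v j x : ℂ)) volume := fun j =>
    (Complex.continuous_ofReal.comp (noiseGrad_contDiff hφ v j).continuous).aestronglyMeasurable
  have hgb : ∀ j x, ‖(noiseGrad φ v j x : ℂ)‖ ≤ S := fun j x => by
    rw [Complex.norm_real]; exact norm_noiseGrad_le hK v j x
  have hGψ : ∀ j, MemLp (fun x => (noiseGrad φ v j x : ℂ) * ψ x) 2 volume := fun j =>
    memLp_bdd_mul (hgc j) (hgb j) hψ.1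
  have hH : ∀ j, ∫ x, weakPartial j f x * ((noiseGrad φ v j x : ℂ) * ψ x)
      = - ∫ x, f x * (((pd j (noiseGrad φ v j) x : ℝ) : ℂ) * ψ x
        + (noiseGrad φ v j x : ℂ) * weakPartial j ψ x) := by
    intro j
    have key := MemH1.integral_weakPartial_mul (g := fun x => (noiseGrad φ v j x : ℂ) * ψ x) hf
      (MemH1.of_isWeakPartial (G := fun i x => ((pd i (noiseGrad φ v j) x : ℝ) : ℂ) * ψ x
        + (noiseGrad φ v j x : ℂ) * weakPartial i ψ x) (hGψ j) fun i =>
        IsWeakPartial.real_mul (noiseGrad_contDiff hφ v j) (norm_noiseGrad_le hK v j)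
      (norm_pd_noiseGrad_le hK hφ v i j) hψ.1 (hψ.isWeakPartial i)) j
    rw [key]
    congr 1
    refine integral_congr_ae ?_
    filter_upwards [(hw j).ae_eq] with x hx
    rw [hx]
  have hc : MemLp (fun x => cCoef φ β r x * f x) 2 volume :=
    memLp_bdd_mul (continuous_cCoef hφ r).aestronglyMeasurable hM2 hf.1
  have i1 : ∀ j, Integrable (fun x => weakPartial j f x * ((noiseGrad φ v j x : ℂ) * ψ x)) volume :=
    fun j => integrable_mul_of_memLp (hf.memLp_weakPartial j) (hGψ j)
  have i2 : ∀ j, Integrable (fun x => f x * (((pd j (noiseGrad φ v j) x : ℝ) : ℂ) * ψ x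
        + (noiseGrad φ v j x : ℂ) * weakPartial j ψ x)) volume := fun j =>
    integrable_mul_of_memLp hf.1 (hw j).1
  have i3 := integrable_mul_of_memLp hc hψ.1
  have i4 : ∀ j, Integrable (fun x => 2 * Complex.I * -(f x * (((pd j (noiseGrad φ v j) x : ℝ) : ℂ)
      * ψ x + (noiseGrad φ v j x : ℂ) * weakPartial j ψ x))) volume := fun j => (i2 j).neg.const_mul _
  have e1 : ∀ x, noiseTerm φ β r f x * ψ x
      = (∑ j, 2 * Complex.I * (weakPartial j f x * ((noiseGrad φ v j x : ℂ) * ψ x)))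
        + cCoef φ β r x * f x * ψ x := by
    intro x
    unfold noiseTerm
    rw [add_mul, Finset.sum_mul]
    congr 1
    refine Finset.sum_congr rfl fun j _ => ?_
    rw [bCoef_eq]; ring
  simp only [e1]
  rw [integral_add (integrable_finsetSum _ fun j _ => (i1 j).const_mul _) i3,
    integral_finsetSum _ fun j _ => (i1 j).const_mul _]
  simp only [integral_const_mul, hH]
  have e2 : ∑ j, 2 * Complex.I * -∫ x, f x * (((pd j (noiseGrad φ v j) x : ℝ) : ℂ) * ψ x
        + (noiseGrad φ v j x : ℂ) * weakPartial j ψ x)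
      = ∫ x, ∑ j, 2 * Complex.I * -(f x * (((pd j (noiseGrad φ v j) x : ℝ) : ℂ) * ψ x
        + (noiseGrad φ v j x : ℂ) * weakPartial j ψ x)) := by
    rw [integral_finsetSum _ fun j _ => i4 j]
    simp only [integral_const_mul, integral_neg]
  rw [e2, ← integral_add (integrable_finsetSum _ fun j _ => i4 j) i3]
  refine integral_congr_ae (Eventually.of_forall fun x => ?_)
  -- With Φ = ∑ₖ vₖφₖ, the divergence of b contributes -2iΔΦ, which turns the +iΔΦ of c into -iΔΦ.
  have e3 := sum_pd_noiseGrad hφ v x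
  simp only [cCoef_eq, ← hv, ← e3]
  rw [← Finset.mul_sum, Finset.sum_neg_distrib, ← Finset.mul_sum, Finset.sum_add_distrib,
    ← Finset.sum_mul]
  push_cast
  ring

/-- Conservation of mass, in infinitesimal form. -/
lemma re_rhsForm_conj (hφ : ∀ k, IsCbInfty (φ k)) (r : ℝ) (hf : MemH1 f) :
    (rhsForm φ β r f (fun x => star (f x))).re = 0 := by
  have real_of_conj : ∀ {z : ℂ}, star z = z → z.im = 0 := fun h => Complex.conj_eq_iff_im.mp h
  have a : ∀ j, (∫ x, weakPartial j f x * weakPartial j (fun x => star (f x)) x).im = 0 := by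
    intro j
    have : ∫ x, weakPartial j f x * weakPartial j (fun x => star (f x)) x
        = ∫ x, ((‖weakPartial j f x‖ ^ 2 : ℝ) : ℂ) := by
      refine integral_congr_ae ?_
      filter_upwards [hf.weakPartial_conj j] with x hx
      rw [hx]
      exact_mod_cast Complex.mul_conj' _
    rw [this, integral_complex_ofReal]
    exact Complex.ofReal_im _
  have b : (∫ x, ((‖f x‖ ^ crit d : ℝ) : ℂ) * (f x * star (f x))).im = 0 := by
    have : ∫ x, ((‖f x‖ ^ crit d : ℝ) : ℂ) * (f x * star (f x))
        = ∫ x, ((‖f x‖ ^ crit d * ‖f x‖ ^ 2 : ℝ) : ℂ) := by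
      congr 1; ext x
      have := Complex.mul_conj' (f x)
      rw [Complex.ofReal_mul, Complex.ofReal_pow ‖f x‖ 2, ← this]; rfl
    rw [this, integral_complex_ofReal]
    exact Complex.ofReal_im _
  -- Symmetry of the perturbation: for ψ the conjugate of f, the transposed integrand is the
  -- conjugate of the original one, so the integral equals its own conjugate.
  have c : (∫ x, noiseTerm φ β r f x * star (f x)).im = 0 := by
    apply real_of_conj
    conv_rhs => rw [integral_noiseTerm_mul hφ r hf hf.conj]
    rw [show star (∫ x, noiseTerm φ β r f x * star (f x))
      = ∫ x, star (noiseTerm φ β r f x * star (f x)) from integral_conj.symm]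
    have hae : ∀ᵐ x, ∀ j, weakPartial j (fun x => star (f x)) x = star (weakPartial j f x) :=
      ae_all_iff.2 fun j => hf.weakPartial_conj j
    refine integral_congr_ae ?_
    filter_upwards [hae] with x hx
    simp only [hx]
    unfold noiseTerm
    simp only [bCoef_eq, cCoef_eq, star_mul', star_add, star_sum, star_neg, star_star]
    have h1 : ∀ y : ℝ, star (y : ℂ) = (y : ℂ) := fun y => Complex.conj_ofReal y
    have h2 : star Complex.I = - Complex.I := Complex.conj_I
    have h3 : star (2 : ℂ) = 2 := by simp
    simp only [h1, h2, h3, mul_neg, neg_mul]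
    rw [Finset.sum_neg_distrib]
    have h4 : ∑ j, 2 * Complex.I * (noiseGrad φ (fun k => β k r) j x : ℂ) * star (weakPartial j f x)
        = 2 * Complex.I * ∑ j, (noiseGrad φ (fun k => β k r) j x : ℂ) * star (weakPartial j f x) := by
      rw [Finset.mul_sum]; exact Finset.sum_congr rfl fun j _ => by ring
    rw [h4]
    ring
  unfold rhsForm
  have hs : (∑ j : Fin d, ∫ x, weakPartial j f x * weakPartial j (fun x => star (f x)) x).im = 0 := by
    rw [Complex.im_sum]; exact Finset.sum_eq_zero fun j _ => a j
  simp only [Complex.add_re, Complex.mul_re, Complex.neg_re, Complex.neg_im, Complex.I_re,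
    Complex.I_im, hs, b, c]
  ring

end Equation

end RNLS

namespace RNLS

open scoped ContDiff

/-! ### Solutions tested against `H¹` functions -/

section Solution

variable {d N : ℕ} {φ : Fin N → E d → ℝ} {β : Fin N → ℝ → ℝ} {t₀ t₁ : ℝ} {u : ℝ → E d → ℂ}
  {ψ : E d → ℂ}

lemma IsSolutionOn.tendstoH1 (hu : IsSolutionOn φ β t₀ t₁ u) {s : ℝ} (hs : s ∈ Icc t₀ t₁) :
    TendstoH1 u (𝓝[Icc t₀ t₁] s) (u s) := by
  refine ⟨?_, hu.memH1 s hs, ?_⟩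
  · filter_upwards [self_mem_nhdsWithin] with t ht using hu.memH1 t ht
  · refine squeeze_zero (fun _ => sobNorm_nonneg _) (fun _ => sobNorm_le_h1Norm _) ?_
    simpa using (hu.cont s hs).const_mul ((d : ℝ) + 1)

lemma IsSolutionOn.continuousOn_rhsForm (hu : IsSolutionOn φ β t₀ t₁ u) (hd : d = 1 ∨ d = 2)
    (hφ : ∀ k, IsCbInfty (φ k)) (hβ : ∀ k, ContinuousOn (β k) (Icc t₀ t₁)) (hψ : MemH1 ψ) :
    ContinuousOn (fun r => rhsForm φ β r (u r) ψ) (Icc t₀ t₁) := fun s hs =>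
  (hu.tendstoH1 hs).rhsForm hd hφ (τ := fun r => r) (fun k => hβ k s hs) hψ

/-- Continuity of u in `H¹` on a compact interval bounds the functionals uniformly in time. This
controls the time integral when test functions are replaced by limits, and the quotients of the
mass. -/
lemma IsSolutionOn.exists_bound (hu : IsSolutionOn φ β t₀ t₁ u) (hd : d = 1 ∨ d = 2)
    (hφ : ∀ k, IsCbInfty (φ k)) (hβ : ∀ k, ContinuousOn (β k) (Icc t₀ t₁)) :
    ∃ M : ℝ, 0 ≤ M ∧ ∀ r ∈ Icc t₀ t₁, ∀ ψ : E d → ℂ, MemH1 ψ →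
      ‖rhsForm φ β r (u r) ψ‖ ≤ M * sobNorm ψ := by
  obtain ⟨C, hC, H⟩ := norm_rhsForm_le hd
  have hc : ContinuousOn (fun r => rhsBound φ β C r (u r)) (Icc t₀ t₁) := by
    intro s hs
    have h := hu.tendstoH1 hs
    exact ((tendsto_finsetSum _ fun j _ => (h.weakPartial j).l2Norm).add
      (((h.pow_crit hd).l2Norm.mul h.sobNorm).const_mul C)).add
      ((h.noiseTerm hφ (τ := fun r => r) (fun k => hβ k s hs)).l2Norm)
  obtain ⟨M, hM⟩ := isCompact_Icc.exists_bound_of_continuousOn hc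
  refine ⟨max M 0, le_max_right _ _, fun r hr ψ hψ => ?_⟩
  refine (H φ hφ β r (u r) ψ (hu.memH1 r hr) hψ).trans ?_
  have := sobNorm_nonneg ψ
  gcongr
  exact (le_abs_self _).trans ((hM r hr).trans (le_max_left _ _))

lemma rhsForm_ofReal_test {f : E d → ℂ} {ψ : E d → ℝ} (h1 : ContDiff ℝ ∞ ψ)
    (h2 : HasCompactSupport ψ) (r : ℝ) :
    rhsForm φ β r f (fun x => (ψ x : ℂ)) =
      (- Complex.I * ∑ j : Fin d,
              ∫ x, weakPartial j f x * ((fderiv ℝ ψ x (stdVec j) : ℝ) : ℂ))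
            + Complex.I * (∫ x, (‖f x‖ ^ crit d : ℝ) * f x * (ψ x : ℂ))
            + Complex.I * ∫ x, ((∑ j : Fin d, bCoef φ β r x j * weakPartial j f x)
                + cCoef φ β r x * f x) * (ψ x : ℂ) := by
  have h1' : ContDiff ℝ 1 (fun x => (ψ x : ℂ)) :=
    Complex.ofRealCLM.contDiff.comp (h1.of_le (by exact_mod_cast le_top))
  have h2' : HasCompactSupport (fun x => (ψ x : ℂ)) := h2.comp_left Complex.ofReal_zero
  unfold rhsForm
  congr 2
  · congr 2
    ext j
    refine integral_congr_ae ?_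
    filter_upwards [weakPartial_of_hasCompactSupport h1' h2' j] with x hx
    rw [hx, pd_ofReal j (h1.differentiable (by simp) x)]
    rfl
  · congr 2
    ext x
    push_cast
    ring

lemma memH1_re_im_of_test {ψ : E d → ℂ} (h1 : ContDiff ℝ ∞ ψ) (h2 : HasCompactSupport ψ) :
    MemH1 (fun x => ((ψ x).re : ℂ)) ∧ MemH1 (fun x => ((ψ x).im : ℂ)) := by
  have h1' : ContDiff ℝ 1 ψ := h1.of_le (by exact_mod_cast le_top)
  exact ⟨memH1_of_hasCompactSupport (Complex.ofRealCLM.contDiff.comp (Complex.reCLM.contDiff.comp h1'))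
    (h2.comp_left (g := fun z : ℂ => (z.re : ℂ)) (by simp)),
    memH1_of_hasCompactSupport (Complex.ofRealCLM.contDiff.comp (Complex.imCLM.contDiff.comp h1'))
    (h2.comp_left (g := fun z : ℂ => (z.im : ℂ)) (by simp))⟩

lemma IsSolutionOn.intervalIntegrable_rhsForm (hu : IsSolutionOn φ β t₀ t₁ u) (hd : d = 1 ∨ d = 2)
    (hφ : ∀ k, IsCbInfty (φ k)) (hβ : ∀ k, ContinuousOn (β k) (Icc t₀ t₁)) (hψ : MemH1 ψ)
    {s t : ℝ} (hs : s ∈ Icc t₀ t₁) (ht : t ∈ Icc t₀ t₁) :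
    IntervalIntegrable (fun r => rhsForm φ β r (u r) ψ) volume s t :=
  ((hu.continuousOn_rhsForm hd hφ hβ hψ).mono (uIcc_subset_Icc hs ht)).intervalIntegrable

/-- The equation is posed for real test functions; both sides are complex linear in ψ, so splitting
into real and imaginary parts suffices. -/
lemma IsSolutionOn.eqn_test (hu : IsSolutionOn φ β t₀ t₁ u) (hd : d = 1 ∨ d = 2)
    (hφ : ∀ k, IsCbInfty (φ k)) (hβ : ∀ k, ContinuousOn (β k) (Icc t₀ t₁))
    (h1 : ContDiff ℝ ∞ ψ) (h2 : HasCompactSupport ψ)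
    {s t : ℝ} (hs : s ∈ Icc t₀ t₁) (ht : t ∈ Icc t₀ t₁) :
    (∫ x, u t x * ψ x) - ∫ x, u s x * ψ x = ∫ r in s..t, rhsForm φ β r (u r) ψ := by
  have hre : ContDiff ℝ ∞ (fun x => (ψ x).re) := Complex.reCLM.contDiff.comp h1
  have him : ContDiff ℝ ∞ (fun x => (ψ x).im) := Complex.imCLM.contDiff.comp h1
  have hres : HasCompactSupport (fun x => (ψ x).re) := h2.comp_left Complex.zero_re
  have hims : HasCompactSupport (fun x => (ψ x).im) := h2.comp_left Complex.zero_im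
  obtain ⟨m1, m2⟩ := memH1_re_im_of_test h1 h2
  have e1 := hu.eqn _ hre hres s hs t ht
  have e2 := hu.eqn _ him hims s hs t ht
  simp only [← rhsForm_ofReal_test hre hres] at e1
  simp only [← rhsForm_ofReal_test him hims] at e2
  have eψ : ψ = fun x => ((ψ x).re : ℂ) + Complex.I * ((ψ x).im : ℂ) := by
    ext x; rw [mul_comm, Complex.re_add_im]
  have hsplit : ∀ τ ∈ Icc t₀ t₁, ∫ x, u τ x * ψ x
      = (∫ x, u τ x * ((ψ x).re : ℂ)) + Complex.I * ∫ x, u τ x * ((ψ x).im : ℂ) := by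
    intro τ hτ
    rw [← integral_const_mul, ← integral_add (integrable_mul_of_memLp (hu.memH1 τ hτ).1 m1.1)
      ((integrable_mul_of_memLp (hu.memH1 τ hτ).1 m2.1).const_mul _)]
    refine integral_congr_ae (Eventually.of_forall fun x => ?_)
    simp only
    conv_lhs => rw [← Complex.re_add_im (ψ x)]
    ring
  have hr : ∀ r ∈ uIcc s t, rhsForm φ β r (u r) ψ = rhsForm φ β r (u r) (fun x => ((ψ x).re : ℂ))
      + Complex.I * rhsForm φ β r (u r) (fun x => ((ψ x).im : ℂ)) := by
    intro r hr
    conv_lhs => rw [eψ]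
    rw [rhsForm_add hd hφ r (hu.memH1 r (uIcc_subset_Icc hs ht hr)) m1 (m2.const_mul _),
      rhsForm_const_mul r _ m2]
  rw [hsplit t ht, hsplit s hs, intervalIntegral.integral_congr hr,
    intervalIntegral.integral_add (hu.intervalIntegrable_rhsForm hd hφ hβ m1 hs ht)
      ((hu.intervalIntegrable_rhsForm hd hφ hβ m2 hs ht).const_mul _),
    intervalIntegral.integral_const_mul, ← e1, ← e2]
  ring

lemma rhsForm_sub (hd : d = 1 ∨ d = 2) (hφ : ∀ k, IsCbInfty (φ k)) (r : ℝ) {f g : E d → ℂ}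
    (hf : MemH1 f) (hg : MemH1 g) (hψ : MemH1 ψ) :
    rhsForm φ β r f (fun x => g x - ψ x) = rhsForm φ β r f g - rhsForm φ β r f ψ := by
  have := rhsForm_add (φ := φ) (β := β) hd hφ r hf hg (hψ.const_mul (-1))
  rw [rhsForm_const_mul r _ hψ] at this
  simpa [sub_eq_add_neg] using this

/-- The equation, tested against `H¹` functions. -/
theorem IsSolutionOn.eqn_memH1 (hu : IsSolutionOn φ β t₀ t₁ u) (hd : d = 1 ∨ d = 2)
    (hφ : ∀ k, IsCbInfty (φ k)) (hβ : ∀ k, ContinuousOn (β k) (Icc t₀ t₁)) (hψ : MemH1 ψ)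
    {s t : ℝ} (hs : s ∈ Icc t₀ t₁) (ht : t ∈ Icc t₀ t₁) :
    (∫ x, u t x * ψ x) - ∫ x, u s x * ψ x = ∫ r in s..t, rhsForm φ β r (u r) ψ := by
  obtain ⟨χ, h1, h2, h3, -, h5⟩ := hψ.exists_seq_test
  have hχ : ∀ n, MemH1 (χ n) := fun n =>
    memH1_of_hasCompactSupport ((h1 n).of_le (by exact_mod_cast le_top)) (h2 n)
  have hT : TendstoL2 χ atTop ψ := ⟨Eventually.of_forall fun n => (hχ n).1, hψ.1, h3⟩
  have hL : Tendsto (fun n => (∫ x, u t x * χ n x) - ∫ x, u s x * χ n x) atTop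
      (𝓝 ((∫ x, u t x * ψ x) - ∫ x, u s x * ψ x)) :=
    ((TendstoL2.const (hu.memH1 t ht).1).integral_mul hT).sub
      ((TendstoL2.const (hu.memH1 s hs).1).integral_mul hT)
  obtain ⟨M, hM0, hM⟩ := hu.exists_bound hd hφ hβ
  have hR : Tendsto (fun n => ∫ r in s..t, rhsForm φ β r (u r) (χ n)) atTop
      (𝓝 (∫ r in s..t, rhsForm φ β r (u r) ψ)) := by
    rw [tendsto_iff_norm_sub_tendsto_zero]
    have hlim : Tendsto (fun n => M * sobNorm (fun x => χ n x - ψ x) * |t - s|) atTop (𝓝 0) := by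
      simpa using (h5.const_mul M).mul_const |t - s|
    refine squeeze_zero (fun _ => norm_nonneg _) (fun n => ?_) hlim
    rw [← intervalIntegral.integral_sub (hu.intervalIntegrable_rhsForm hd hφ hβ (hχ n) hs ht)
      (hu.intervalIntegrable_rhsForm hd hφ hβ hψ hs ht)]
    refine intervalIntegral.norm_integral_le_of_norm_le_const fun r hr => ?_
    have hr' := uIcc_subset_Icc hs ht (uIoc_subset_uIcc hr)
    rw [← rhsForm_sub hd hφ r (hu.memH1 r hr') (hχ n) hψ]
    exact hM r hr' _ ((hχ n).sub hψ)
  refine tendsto_nhds_unique hL (hR.congr fun n => ?_)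
  rw [hu.eqn_test hd hφ hβ (h1 n) (h2 n) hs ht]

/-- Conservation of mass. -/
theorem IsSolutionOn.l2Norm_eq (hu : IsSolutionOn φ β t₀ t₁ u) (hd : d = 1 ∨ d = 2)
    (hφ : ∀ k, IsCbInfty (φ k)) (hβ : ∀ k, ContinuousOn (β k) (Icc t₀ t₁))
    {t : ℝ} (ht : t ∈ Icc t₀ t₁) : l2Norm (u t) = l2Norm (u t₁) := by
  obtain ⟨M, hM0, hM⟩ := hu.exists_bound hd hφ hβ
  -- The time derivative of u lies only in H⁻¹, so ‖u‖² is differentiated by polarization: ‖u(t)‖² -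
  -- ‖u(s)‖² = Re ⟨u(t) - u(s), u(t) + u(s)⟩, where the second factor is an admissible test
  -- function. As the form at time r has zero real part against the conjugate of u(r), only u(t) +
  -- u(s) - 2u(r) counts, and this tends to zero in `H¹`.
  have key : ∀ s ∈ Icc t₀ t₁, HasDerivWithinAt (fun t => l2Norm (u t) ^ 2) 0 (Icc t₀ t₁) s := by
    intro s hs
    rw [hasDerivWithinAt_iff_isLittleO]
    refine Asymptotics.isLittleO_iff.mpr fun c hc => ?_
    -- The corrected test function has norm at most 3η, one η from u(t) - u(s) and two from u(r) -
    -- u(s), and M · 3η ≤ c.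
    set η := c / (4 * (M + 1)) with hη
    have hη0 : 0 < η := by positivity
    have hev := (hu.tendstoH1 hs).tendsto.eventually_lt_const hη0
    rw [eventually_nhdsWithin_iff, Metric.eventually_nhds_iff] at hev
    obtain ⟨δ, hδ, hev⟩ := hev
    rw [eventually_nhdsWithin_iff, Metric.eventually_nhds_iff]
    refine ⟨δ, hδ, fun t htδ ht => ?_⟩
    have ms := hu.memH1 s hs
    have mt := hu.memH1 t ht
    have hψ : MemH1 (fun x => star (u t x + u s x)) := (mt.add ms).conj
    have e := hu.eqn_memH1 hd hφ hβ hψ hs ht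
    have e0 : ∀ f g : E d → ℂ, MemH1 f → MemH1 g →
        ((∫ x, f x * star (f x + g x)) - ∫ x, g x * star (f x + g x)).re
          = l2Norm f ^ 2 - l2Norm g ^ 2 := by
      intro f g hf hg
      rw [← integral_sub (integrable_mul_of_memLp hf.1 (hf.add hg).conj.1)
        (integrable_mul_of_memLp hg.1 (hf.add hg).conj.1), l2Norm_sq hf.1, l2Norm_sq hg.1,
        ← integral_sub (by simpa using hf.1.integrable_norm_pow (p := 2) (by norm_num))
          (by simpa using hg.1.integrable_norm_pow (p := 2) (by norm_num))]
      have hi := (integrable_mul_of_memLp hf.1 (hf.add hg).conj.1).sub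
        (integrable_mul_of_memLp hg.1 (hf.add hg).conj.1)
      have := integral_re (𝕜 := ℂ) hi
      simp only [RCLike.re_eq_complex_re, Pi.sub_apply] at this
      rw [← this]
      refine integral_congr_ae (Eventually.of_forall fun x => ?_)
      simp only [Complex.star_def, map_add, Complex.sub_re, Complex.mul_re, Complex.add_re,
        Complex.add_im, Complex.conj_re, Complex.conj_im]
      rw [← Complex.normSq_eq_norm_sq, ← Complex.normSq_eq_norm_sq, Complex.normSq_apply,
        Complex.normSq_apply]
      ring
    rw [smul_zero, sub_zero, ← e0 _ _ mt ms, e]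
    have hbd : ∀ r ∈ uIoc s t, |(rhsForm φ β r (u r) (fun x => star (u t x + u s x))).re| ≤ c := by
      intro r hr
      have hr1 := uIoc_subset_uIcc hr
      have hr' := uIcc_subset_Icc hs ht hr1
      have mr := hu.memH1 r hr'
      have d1 : (rhsForm φ β r (u r) (fun x => star (u t x + u s x))).re
          = (rhsForm φ β r (u r) (fun x => star (u t x + u s x) - 2 * star (u r x))).re := by
        rw [rhsForm_sub hd hφ r mr hψ (mr.conj.const_mul 2), rhsForm_const_mul r _ mr.conj]
        have := re_rhsForm_conj (β := β) hφ r mr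
        rw [Complex.sub_re, Complex.mul_re, this]
        norm_num
      rw [d1]
      refine (Complex.abs_re_le_norm _).trans ((hM r hr' _ (hψ.sub (mr.conj.const_mul 2))).trans ?_)
      have a1 : sobNorm (fun x => u t x - u s x) < η := hev htδ ht
      have a2 : sobNorm (fun x => u r x - u s x) < η := by
        refine hev (lt_of_le_of_lt ?_ htδ) hr'
        exact abs_sub_left_of_mem_uIcc hr1
      have a3 : sobNorm (fun x => star (u t x + u s x) - 2 * star (u r x))
          ≤ sobNorm (fun x => u t x - u s x) + 2 * sobNorm (fun x => u r x - u s x) := by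
        have e1 : (fun x => star (u t x + u s x) - 2 * star (u r x))
            = fun x => star ((u t x - u s x) + (-2) * (u r x - u s x)) := by
          ext x
          simp only [Complex.star_def, map_add, map_sub, map_mul, map_neg]
          have : (starRingEnd ℂ) 2 = 2 := map_ofNat (starRingEnd ℂ) 2
          rw [this]; ring
        rw [e1, sobNorm_conj ((mt.sub ms).add ((mr.sub ms).const_mul (-2)))]
        refine (sobNorm_add_le (mt.sub ms) ((mr.sub ms).const_mul (-2))).trans ?_
        rw [sobNorm_const_mul _ (mr.sub ms)]
        simp
      calc M * sobNorm (fun x => star (u t x + u s x) - 2 * star (u r x)) ≤ M * (3 * η) := by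
            gcongr; linarith
        _ ≤ c := by
            rw [hη, ← mul_div_assoc, ← mul_div_assoc, div_le_iff₀ (by positivity)]
            nlinarith
    have hre : (∫ r in s..t, rhsForm φ β r (u r) (fun x => star (u t x + u s x))).re
        = ∫ r in s..t, (rhsForm φ β r (u r) (fun x => star (u t x + u s x))).re :=
      (Complex.reCLM.intervalIntegral_comp_comm
        (hu.intervalIntegrable_rhsForm hd hφ hβ hψ hs ht)).symm
    rw [hre]
    exact intervalIntegral.norm_integral_le_of_norm_le_const hbd
  have hcst : l2Norm (u t) ^ 2 = l2Norm (u t₀) ^ 2 ∧ l2Norm (u t₁) ^ 2 = l2Norm (u t₀) ^ 2 := by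
    rcases eq_or_lt_of_le (ht.1.trans ht.2) with h | h
    · have h3 : t = t₀ := le_antisymm (ht.2.trans h.ge) ht.1
      rw [h3, h]; simp
    have hdiff : DifferentiableOn ℝ (fun t => l2Norm (u t) ^ 2) (Icc t₀ t₁) := fun s hs =>
      (key s hs).differentiableWithinAt
    have hz : ∀ s ∈ Ico t₀ t₁, derivWithin (fun t => l2Norm (u t) ^ 2) (Icc t₀ t₁) s = 0 :=
      fun s hs => (key s ⟨hs.1, hs.2.le⟩).derivWithin (uniqueDiffOn_Icc h s ⟨hs.1, hs.2.le⟩)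
    exact ⟨constant_of_derivWithin_zero hdiff hz t ht,
      constant_of_derivWithin_zero hdiff hz t₁ ⟨h.le, le_rfl⟩⟩
  have := hcst.1.trans hcst.2.symm
  exact (pow_left_inj₀ (l2Norm_nonneg _) (l2Norm_nonneg _) two_ne_zero).mp this

/-- The time derivative of the pairing with a fixed `H¹` function. -/
theorem IsSolutionOn.hasDerivWithinAt_pairing (hu : IsSolutionOn φ β t₀ t₁ u) (hd : d = 1 ∨ d = 2)
    (hφ : ∀ k, IsCbInfty (φ k)) (hβ : ∀ k, ContinuousOn (β k) (Icc t₀ t₁)) (hψ : MemH1 ψ)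
    {s : ℝ} (hs : s ∈ Icc t₀ t₁) :
    HasDerivWithinAt (fun t => ∫ x, u t x * ψ x) (rhsForm φ β s (u s) ψ) (Icc t₀ t₁) s := by
  have h01 : t₀ ≤ t₁ := hs.1.trans hs.2
  -- The constant extension beyond the interval is continuous on ℝ, so the two-sided fundamental
  -- theorem applies and is then restricted; the end points need no separate treatment.
  set g : ℝ → ℂ := IccExtend h01 (fun r : Icc t₀ t₁ => rhsForm φ β r (u r) ψ) with hg
  have hgc : Continuous g := by
    have := continuousOn_iff_continuous_domRestrict.mp (hu.continuousOn_rhsForm hd hφ hβ hψ)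
    exact this.Icc_extend'
  have hge : ∀ r ∈ Icc t₀ t₁, g r = rhsForm φ β r (u r) ψ := fun r hr => IccExtend_of_mem h01 _ hr
  have h1 : HasDerivAt (fun t => (∫ r in s..t, g r) + ∫ x, u s x * ψ x) (g s) s :=
    (intervalIntegral.integral_hasDerivAt_right (hgc.intervalIntegrable _ _)
      (hgc.stronglyMeasurableAtFilter _ _) hgc.continuousAt).add_const _
  rw [← hge s hs]
  refine h1.hasDerivWithinAt.congr (fun t ht => ?_) (by simp)
  rw [← sub_eq_iff_eq_add, hu.eqn_memH1 hd hφ hβ hψ hs ht]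
  exact intervalIntegral.integral_congr fun r hr => (hge r (uIcc_subset_Icc hs ht hr)).symm

end Solution

end RNLS

namespace RNLS

open scoped ContDiff

/-! ### Rapid decay for a second order differential equation -/

section ODE

/-- Second order necessary condition for a local maximum. -/
lemma second_deriv_nonpos_of_isLocalMax {D D' : ℝ → ℝ} {x c : ℝ}
    (h1 : ∀ᶠ s in 𝓝 x, HasDerivAt D (D' s) s) (h2 : HasDerivAt D' c x) (hm : IsLocalMax D x) :
    D' x = 0 ∧ c ≤ 0 := by
  have h0 : D' x = 0 := hm.hasDerivAt_eq_zero h1.self_of_nhds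
  refine ⟨h0, ?_⟩
  by_contra! hc
  have e1 : deriv D =ᶠ[𝓝 x] D' := h1.mono fun s hs => hs.deriv
  have hmin : IsLocalMin D x := isLocalMin_of_deriv_deriv_pos
    (by rw [e1.deriv_eq, h2.deriv]; exact hc) (by rw [e1.self_of_nhds, h0])
    h1.self_of_nhds.continuousAt
  have e2 : D =ᶠ[𝓝 x] fun _ => D x := by
    filter_upwards [hm, hmin] with s hs hs' using le_antisymm hs hs'
  have e3 : D' =ᶠ[𝓝 x] fun _ => 0 := by
    filter_upwards [e1, e2.eventuallyEq_nhds] with s hs hs'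
    rw [← hs, hs'.deriv_eq, deriv_const]
  rw [h2.unique ((hasDerivAt_const x (0 : ℝ)).congr_of_eventuallyEq e3)] at hc
  exact lt_irrefl _ hc

variable {h h' h'' a K : ℝ → ℝ} {S : ℝ} {n : ℕ}

/-- Maximum principle with the barrier A s^{-k}. If h exceeded it, then h - A s^{-k}, which is not
positive at S and is eventually small because h tends to zero, would have a positive interior
maximum at some m. There h' ≤ 0 and h'' ≤ A k(k+1) m^{-k-2}, so the left side of the equation is at
most A m^{-k}/4, because 16k(k+1) ≤ m. The right side is larger than A m^{-k}/2 - A m^{-k}/4, a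
contradiction. -/
lemma le_barrier_of_ode {A : ℝ} (hA : 0 < A) (k : ℕ) (hS : 1 ≤ S) (hkS : 16 * (k * (k + 1)) ≤ S)
    (hd1 : ∀ s, S ≤ s → HasDerivAt h (h' s) s) (hd2 : ∀ s, S ≤ s → HasDerivAt h' (h'' s) s)
    (hode : ∀ s, S ≤ s → 4 * s * h'' s + 2 * n * h' s = a s * h s + K s)
    (ha : ∀ s, S ≤ s → 1 / 2 ≤ a s) (hK : ∀ s, S ≤ s → |K s| ≤ A / 4 * s ^ (-(k : ℤ)))
    (h0 : h S ≤ A * S ^ (-(k : ℤ))) (hlim : Tendsto h atTop (𝓝 0)) {s : ℝ} (hs : S ≤ s) :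
    h s ≤ A * s ^ (-(k : ℤ)) := by
  by_contra! hlt
  set D : ℝ → ℝ := fun s => h s - A * s ^ (-(k : ℤ)) with hD
  have hpos : 0 < D s := by simp only [hD]; linarith
  obtain ⟨s₁, hs₁, hs₁'⟩ : ∃ s₁, s < s₁ ∧ D s₁ < D s := by
    have := (hlim.eventually_lt_const hpos).and (eventually_gt_atTop s)
    obtain ⟨s₁, h1, h2⟩ := this.exists
    refine ⟨s₁, h2, lt_of_le_of_lt ?_ h1⟩
    have : 0 ≤ A * s₁ ^ (-(k : ℤ)) := by
      have : 0 < s₁ := by linarith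
      positivity
    simp only [hD]; linarith
  have hDd : ∀ s, S ≤ s →
      HasDerivAt D (h' s - A * (((-(k : ℤ) : ℤ) : ℝ) * s ^ (-(k : ℤ) - 1))) s := fun s hs =>
    (hd1 s hs).sub ((hasDerivAt_zpow _ s (Or.inl (by linarith))).const_mul A)
  have hcont : ContinuousOn D (Icc S s₁) := fun x hx => (hDd x hx.1).continuousAt.continuousWithinAt
  obtain ⟨m, hm, hmax⟩ := isCompact_Icc.exists_isMaxOn ⟨s, hs, hs₁.le⟩ hcont
  have hms : D s ≤ D m := hmax ⟨hs, hs₁.le⟩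
  have hmS : S < m := by
    refine lt_of_le_of_ne hm.1 fun e => ?_
    rw [← e] at hms
    simp only [hD] at hms hpos; linarith
  have hms₁ : m < s₁ := by
    refine lt_of_le_of_ne hm.2 fun e => ?_
    rw [e] at hms; linarith
  have hloc : IsLocalMax D m := hmax.isLocalMax (Icc_mem_nhds hmS hms₁)
  have hm0 : 0 < m := by linarith
  obtain ⟨e1, e2⟩ := second_deriv_nonpos_of_isLocalMax
    ((eventually_ge_nhds hmS).mono fun s hs => hDd s hs)
    ((hd2 m hmS.le).sub (((hasDerivAt_zpow _ m (Or.inl hm0.ne')).const_mul _).const_mul A)) hloc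
  have ez1 : m ^ (-(k : ℤ) - 1) = m ^ (-(k : ℤ)) / m := by
    rw [zpow_sub_one₀ hm0.ne', div_eq_mul_inv]
  have ez2 : m ^ (-(k : ℤ) - 1 - 1) = m ^ (-(k : ℤ)) / m / m := by
    rw [zpow_sub_one₀ hm0.ne', ez1, ← div_eq_mul_inv]
  rw [ez1] at e1
  rw [ez2] at e2
  set W := m ^ (-(k : ℤ)) with hW
  have hW0 : 0 < W := by positivity
  push_cast at e1 e2
  have hode' := hode m hmS.le
  have hDm : A * W < h m := by
    have := hpos.trans_le hms
    simp only [hD] at this; linarith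
  have hKm := (abs_le.mp (hK m hmS.le)).1
  have ha' := ha m hmS.le
  have hh : A * W / 2 < a m * h m := by
    have : 0 < A * W := by positivity
    nlinarith
  have key : 4 * m * h'' m + 2 * n * h' m ≤ A * W / 4 := by
    have f1 : h'' m ≤ A * (W / m / m * (k * (k + 1))) := by
      have : A * (-(k : ℝ) * ((-(k : ℝ) - 1) * (W / m / m))) = A * (W / m / m * (k * (k + 1))) := by
        ring
      linarith
    have f2 : h' m ≤ 0 := by
      have : 0 ≤ A * (k * (W / m)) := by positivity
      linarith
    have f3 : 4 * m * h'' m ≤ 4 * m * (A * (W / m / m * (k * (k + 1)))) := by gcongr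
    have f4 : 4 * m * (A * (W / m / m * (k * (k + 1)))) = A * W / 4 * (16 * (k * (k + 1)) / m) := by
      field_simp; ring
    have f5 : 16 * ((k : ℝ) * (k + 1)) / m ≤ 1 := by
      rw [div_le_one hm0]; linarith
    have f6 : A * W / 4 * (16 * (k * (k + 1)) / m) ≤ A * W / 4 := by
      have : 0 < A * W / 4 := by positivity
      nlinarith
    have f7 : 2 * (n : ℝ) * h' m ≤ 0 := by
      have : 0 ≤ 2 * (n : ℝ) := by positivity
      nlinarith
    linarith
  linarith

/-- Functions on a half-line that decay faster than any power. -/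
def RapidOn (S : ℝ) (f : ℝ → ℝ) : Prop := ∀ k : ℕ, ∃ C, ∀ s, S ≤ s → s ^ k * |f s| ≤ C

lemma RapidOn.add {f g : ℝ → ℝ} (hf : RapidOn S f) (hg : RapidOn S g) (hS : 0 ≤ S) :
    RapidOn S (fun s => f s + g s) := fun k => by
  obtain ⟨C, hC⟩ := hf k
  obtain ⟨C', hC'⟩ := hg k
  refine ⟨C + C', fun s hs => ?_⟩
  have : 0 ≤ s ^ k := pow_nonneg (hS.trans hs) k
  nlinarith [hC s hs, hC' s hs, abs_add_le (f s) (g s)]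

lemma RapidOn.of_le {f g : ℝ → ℝ} (hf : RapidOn S f) (hS : 0 ≤ S) (M : ℝ) (m : ℕ)
    (hg : ∀ s, S ≤ s → |g s| ≤ M * s ^ m * |f s|) : RapidOn S g := fun k => by
  obtain ⟨C, hC⟩ := hf (m + k)
  refine ⟨|M| * C, fun s hs => ?_⟩
  have h0 : 0 ≤ s ^ k := pow_nonneg (hS.trans hs) k
  have h0' : 0 ≤ s ^ m := pow_nonneg (hS.trans hs) m
  calc s ^ k * |g s| ≤ s ^ k * (M * s ^ m * |f s|) := mul_le_mul_of_nonneg_left (hg s hs) h0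
    _ = M * (s ^ (m + k) * |f s|) := by ring
    _ ≤ |M| * (s ^ (m + k) * |f s|) := by
        refine mul_le_mul_of_nonneg_right (le_abs_self M) ?_
        rw [pow_add]; positivity
    _ ≤ |M| * C := mul_le_mul_of_nonneg_left (hC s hs) (abs_nonneg _)

/-- Solutions that vanish at infinity decay rapidly. -/
lemma rapidOn_of_ode (hS : 1 ≤ S)
    (hd1 : ∀ s, S ≤ s → HasDerivAt h (h' s) s) (hd2 : ∀ s, S ≤ s → HasDerivAt h' (h'' s) s)
    (hode : ∀ s, S ≤ s → 4 * s * h'' s + 2 * n * h' s = a s * h s + K s)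
    (ha : ∀ s, S ≤ s → 1 / 2 ≤ a s) (hK : RapidOn S K) (hlim : Tendsto h atTop (𝓝 0)) :
    RapidOn S h := by
  intro k
  -- The barrier of order k is available only beyond R; on [S, R] compactness gives the bound.
  set R : ℝ := max S (16 * (k * (k + 1))) with hR
  have hSR : S ≤ R := le_max_left _ _
  have hcont : ContinuousOn (fun s => s ^ k * |h s|) (Icc S R) := fun s hs =>
    (((continuous_pow k).continuousAt).mul
      (hd1 s hs.1).continuousAt.abs).continuousWithinAt
  obtain ⟨C₁, hC₁⟩ := isCompact_Icc.bddAbove_image hcont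
  obtain ⟨C₂, hC₂⟩ := hK k
  have b1 : ∀ s, S ≤ s → s ≤ R → s ^ k * |h s| ≤ C₁ := fun s h1 h2 => hC₁ ⟨s, ⟨h1, h2⟩, rfl⟩
  have hC₁0 : 0 ≤ C₁ := le_trans (by positivity) (b1 S le_rfl hSR)
  have hC₂0 : 0 ≤ C₂ := le_trans (by positivity) (hC₂ S le_rfl)
  -- C₁ makes the barrier dominate |h| at R, 4C₂ makes a quarter of it dominate |K|, and the one
  -- makes A positive.
  set A : ℝ := C₁ + 4 * C₂ + 1 with hA
  have hA0 : 0 < A := by positivity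
  have hz : ∀ s : ℝ, s ^ (-(k : ℤ)) = (s ^ k)⁻¹ := fun s => by rw [zpow_neg, zpow_natCast]
  have hKb : ∀ s, R ≤ s → |K s| ≤ A / 4 * s ^ (-(k : ℤ)) := fun s hs => by
    have hs0 : 0 < s := by linarith
    rw [hz, ← div_eq_mul_inv, le_div_iff₀ (by positivity), mul_comm]
    have := hC₂ s (hSR.trans hs)
    linarith
  have hRb : |h R| ≤ A * R ^ (-(k : ℤ)) := by
    have hR0 : 0 < R := by linarith
    rw [hz, ← div_eq_mul_inv, le_div_iff₀ (by positivity), mul_comm]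
    have := b1 R hSR le_rfl
    linarith
  have up : ∀ s, R ≤ s → |h s| ≤ A * s ^ (-(k : ℤ)) := fun s hs => by
    refine abs_le.mpr ⟨?_, ?_⟩
    · have := le_barrier_of_ode (h := fun s => - h s) (h' := fun s => - h' s)
        (h'' := fun s => - h'' s) (K := fun s => - K s) (a := a) (n := n) hA0 k (hS.trans hSR)
        (le_max_right _ _) (fun s hs => (hd1 s (hSR.trans hs)).neg)
        (fun s hs => (hd2 s (hSR.trans hs)).neg)
        (fun s hs => by linarith [hode s (hSR.trans hs)]) (fun s hs => ha s (hSR.trans hs))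
        (fun s hs => by rw [abs_neg]; exact hKb s hs) (by linarith [(abs_le.mp hRb).1])
        (by simpa using hlim.neg) hs
      linarith
    · exact le_barrier_of_ode hA0 k (hS.trans hSR)
        (le_max_right _ _) (fun s hs => (hd1 s (hSR.trans hs)))
        (fun s hs => (hd2 s (hSR.trans hs)))
        (fun s hs => hode s (hSR.trans hs)) (fun s hs => ha s (hSR.trans hs))
        hKb (abs_le.mp hRb).2 hlim hs
  refine ⟨A, fun s hs => ?_⟩
  rcases le_total s R with h1 | h1
  · have := b1 s hs h1
    linarith
  · have hs0 : 0 < s := by linarith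
    have := up s h1
    rw [hz, ← div_eq_mul_inv, le_div_iff₀ (by positivity)] at this
    linarith

/-- The derivative of a rapidly decaying solution decays rapidly. -/
lemma rapidOn_deriv_of_ode (hS : 1 ≤ S) (hn : n ≤ 2) {F : ℝ → ℝ}
    (hd1 : ∀ s, S ≤ s → HasDerivAt h (h' s) s) (hd2 : ∀ s, S ≤ s → HasDerivAt h' (h'' s) s)
    (hode : ∀ s, S ≤ s → 4 * s * h'' s + 2 * n * h' s = F s)
    (hF : RapidOn S F) (hh : RapidOn S h) : RapidOn S h' := by
  intro k
  obtain ⟨C₁, hC₁⟩ := hF k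
  obtain ⟨C₂, hC₂⟩ := hh k
  refine ⟨C₁ + 4 * C₂, fun s hs => ?_⟩
  have hs1 : 1 ≤ s := hS.trans hs
  have hs0 : 0 < s := by linarith
  -- s^c is the integrating factor: (s^c h')' = s^{c-1} F/4. The restriction n ≤ 2 gives c ≤ 1, so
  -- that s^{c-1} ≤ 1 for s ≥ 1.
  set c : ℝ := (n : ℝ) / 2 with hc
  have hc1 : c ≤ 1 := by
    have : (n : ℝ) ≤ 2 := by exact_mod_cast hn
    rw [hc]; linarith
  have hc0 : 0 ≤ c := by positivity
  -- At this point h' equals h(s + 1) - h(s), which already decays rapidly; a second mean value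
  -- theorem, for s^c h' on [s, x], brings the bound back to s at the cost of one value of F.
  obtain ⟨x, hx, hx'⟩ := exists_hasDerivAt_eq_slope h h' (show s < s + 1 by linarith)
    (fun t ht => (hd1 t (hs.trans ht.1)).continuousAt.continuousWithinAt)
    (fun t ht => hd1 t (hs.trans ht.1.le))
  have hx1 : h' x = h (s + 1) - h s := by rw [hx']; ring
  have hG : ∀ t, S ≤ t → HasDerivAt (fun t => t ^ c * h' t) (t ^ (c - 1) * (F t / 4)) t :=
    fun t ht => by
    have ht0 : 0 < t := by linarith
    refine ((Real.hasDerivAt_rpow_const (p := c) (Or.inl ht0.ne')).mul (hd2 t ht)).congr_deriv ?_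
    have : t ^ c = t ^ (c - 1) * t := by
      rw [← Real.rpow_add_one ht0.ne']; ring_nf
    rw [this, ← hode t ht, hc]; ring
  obtain ⟨y, hy, hy'⟩ := exists_hasDerivAt_eq_slope (fun t => t ^ c * h' t) _ hx.1
    (fun t ht => (hG t (hs.trans ht.1)).continuousAt.continuousWithinAt)
    (fun t ht => hG t (hs.trans ht.1.le))
  have hy0 : s ≤ y := hy.1.le
  have e1 : s ^ c * h' s = x ^ c * h' x - (x - s) * (y ^ (c - 1) * (F y / 4)) := by
    rw [hy']
    have : x - s ≠ 0 := by have := hx.1; intro h; linarith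
    field_simp
    ring
  have b1 : |s ^ c * h' s| ≤ x ^ c * (|h (s + 1)| + |h s|) + |F y| / 4 := by
    rw [e1, hx1]
    have t1 : |x ^ c * (h (s + 1) - h s)| ≤ x ^ c * (|h (s + 1)| + |h s|) := by
      have : 0 ≤ x ^ c := Real.rpow_nonneg (by linarith [hx.1]) _
      rw [abs_mul, abs_of_nonneg this]
      exact mul_le_mul_of_nonneg_left (abs_sub _ _) this
    have t2 : |(x - s) * (y ^ (c - 1) * (F y / 4))| ≤ |F y| / 4 := by
      have h1 : |x - s| ≤ 1 := by
        rw [abs_of_nonneg (by linarith [hx.1])]; linarith [hx.2]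
      have h2 : |y ^ (c - 1)| ≤ 1 := by
        rw [abs_of_nonneg (Real.rpow_nonneg (by linarith) _)]
        exact Real.rpow_le_one_of_one_le_of_nonpos (by linarith) (by linarith)
      rw [abs_mul, abs_mul, abs_div, abs_of_pos (by norm_num : (0 : ℝ) < 4)]
      have h3 : 0 ≤ |F y| / 4 := by positivity
      calc |x - s| * (|y ^ (c - 1)| * (|F y| / 4)) ≤ 1 * (1 * (|F y| / 4)) := by gcongr
        _ = _ := by ring
    exact (abs_sub _ _).trans (add_le_add t1 t2)
  have hxc : x ^ c ≤ 2 * s ^ c := by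
    calc x ^ c ≤ (2 * s) ^ c := Real.rpow_le_rpow (by linarith [hx.1]) (by linarith [hx.2]) hc0
      _ = 2 ^ c * s ^ c := Real.mul_rpow (by norm_num) hs0.le
      _ ≤ 2 * s ^ c := by
        gcongr
        calc (2 : ℝ) ^ c ≤ 2 ^ (1 : ℝ) := Real.rpow_le_rpow_of_exponent_le (by norm_num) hc1
          _ = 2 := by norm_num
  have hsc : 1 ≤ s ^ c := Real.one_le_rpow hs1 hc0
  have hscp : 0 < s ^ c := by linarith
  have b2 : |h' s| ≤ 2 * (|h (s + 1)| + |h s|) + |F y| / 4 := by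
    rw [abs_mul, abs_of_pos hscp] at b1
    have hp1 : 0 ≤ |h (s + 1)| + |h s| := by positivity
    have hp2 : 0 ≤ |F y| / 4 := by positivity
    have : s ^ c * |h' s| ≤ s ^ c * (2 * (|h (s + 1)| + |h s|) + |F y| / 4) := by
      nlinarith
    exact le_of_mul_le_mul_left this hscp
  have hk : 0 ≤ s ^ k := by positivity
  have c1 : s ^ k * |h (s + 1)| ≤ C₂ := by
    refine le_trans ?_ (hC₂ (s + 1) (by linarith))
    gcongr; linarith
  have c2 : s ^ k * |F y| ≤ C₁ := by
    refine le_trans ?_ (hC₁ y (hs.trans hy0))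
    gcongr
  have c3 := hC₂ s hs
  have c4 : 0 ≤ s ^ k * |F y| := by positivity
  nlinarith [mul_le_mul_of_nonneg_left b2 hk]

end ODE

end RNLS

namespace RNLS

open scoped ContDiff

variable {d : ℕ}

/-! ### Functions of rapid decay -/

/-- Functions that decay faster than any power. -/
def Decays {F : Type*} [NormedAddCommGroup F] (f : E d → F) : Prop :=
  ∀ k : ℕ, ∃ C, ∀ x, (1 + ‖x‖) ^ k * ‖f x‖ ≤ C

/-- The one-dimensional variable is the square of the norm. Where ‖x‖² ≥ S ≥ 1, one has 1 + ‖x‖ ≤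
2‖x‖², so powers of s control powers of 1 + ‖x‖; the remaining ball is compact. -/
lemma decays_of_rapidOn {f : E d → ℝ} (hf : Continuous f) {S : ℝ} (hS : 1 ≤ S) {g : ℝ → ℝ}
    (hg : RapidOn S g) (h : ∀ x, S ≤ ‖x‖ ^ 2 → |f x| ≤ |g (‖x‖ ^ 2)|) : Decays f := by
  intro k
  obtain ⟨C, hC⟩ := hg k
  obtain ⟨C', hC'⟩ := (isCompact_closedBall (0 : E d) S).exists_bound_of_continuousOn hf.continuousOn
  have hC0 : 0 ≤ C := le_trans (by positivity) (hC S le_rfl)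
  have hC0' : 0 ≤ C' := (norm_nonneg _).trans (hC' 0 (by simp; linarith))
  refine ⟨(1 + S) ^ k * C' + 2 ^ k * C, fun x => ?_⟩
  rcases lt_or_ge (‖x‖ ^ 2) S with h1 | h1
  · have hx : ‖x‖ ≤ S := by nlinarith [norm_nonneg x]
    have := hC' x (by simpa using hx)
    have : (1 + ‖x‖) ^ k * ‖f x‖ ≤ (1 + S) ^ k * C' := by gcongr
    have : 0 ≤ 2 ^ k * C := by positivity
    linarith
  · have hx : 1 ≤ ‖x‖ := by nlinarith [norm_nonneg x]
    have h2 : 1 + ‖x‖ ≤ 2 * ‖x‖ ^ 2 := by nlinarith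
    have : (1 + ‖x‖) ^ k * ‖f x‖ ≤ 2 ^ k * C := by
      calc (1 + ‖x‖) ^ k * ‖f x‖ ≤ (2 * ‖x‖ ^ 2) ^ k * |g (‖x‖ ^ 2)| := by
            gcongr; exact h x h1
        _ = 2 ^ k * ((‖x‖ ^ 2) ^ k * |g (‖x‖ ^ 2)|) := by rw [mul_pow]; ring
        _ ≤ 2 ^ k * C := by gcongr; exact hC _ h1
    have : 0 ≤ (1 + S) ^ k * C' := by positivity
    linarith

/-! ### Radial functions -/

/-- The classical partial derivatives of a `C¹` function in `H¹` are square integrable. -/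
lemma MemH1.memLp_pd {f : E d → ℂ} (hf : MemH1 f) (hc : ContDiff ℝ 1 f) (j : Fin d) :
    MemLp (pd j f) 2 volume := by
  refine (hf.memLp_weakPartial j).ae_eq ?_
  have hpc : Continuous (pd j f) := (pd_contDiff (m := 0) j hc (by simp)).continuous
  refine ae_eq_of_integral_contDiff_smul_eq
    ((hf.memLp_weakPartial j).locallyIntegrable (by norm_num)) hpc.locallyIntegrable
    fun ψ h1 h2 => ?_
  have e1 := (hf.isWeakPartial j).2 ψ h1 h2
  have hψ : ContDiff ℝ 1 (fun x => (ψ x : ℂ)) :=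
    Complex.ofRealCLM.contDiff.comp (h1.of_le (by exact_mod_cast le_top))
  have hψs : HasCompactSupport (fun x => (ψ x : ℂ)) := h2.comp_left Complex.ofReal_zero
  have hpψ : Continuous (pd j fun x => (ψ x : ℂ)) := (pd_contDiff (m := 0) j hψ (by simp)).continuous
  have e2 := integral_mul_fderiv_eq_neg_fderiv_mul_of_integrable (μ := volume)
    (f := f) (g := fun x => (ψ x : ℂ)) (v := stdVec j)
    ((hpc.mul hψ.continuous).integrable_of_hasCompactSupport hψs.mul_left)
    ((hc.continuous.mul hpψ).integrable_of_hasCompactSupport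
      (pd_hasCompactSupport j hψs).mul_left)
    ((hc.continuous.mul hψ.continuous).integrable_of_hasCompactSupport hψs.mul_left)
    (fun x _ => hc.differentiable (by simp) x) (fun x _ => hψ.differentiable (by simp) x)
  have e3 : ∀ x, fderiv ℝ (fun x => (ψ x : ℂ)) x (stdVec j) = ((fderiv ℝ ψ x (stdVec j) : ℝ) : ℂ) :=
    fun x => pd_ofReal j (h1.differentiable (by simp) x)
  simp only [e3] at e2
  rw [e2, neg_inj] at e1
  have : ∀ F : E d → ℂ, (∫ x, ψ x • F x) = ∫ x, F x * (ψ x : ℂ) := fun F =>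
    integral_congr_ae (Eventually.of_forall fun x => by
      simp only [Complex.real_smul, mul_comm])
  rw [this, this]
  exact e1.symm

section Radial

variable {f : E d → ℝ} (j₀ : Fin d)

/-- The profile of a radial function, as a function of the square of the radius. -/
noncomputable def radProfile (f : E d → ℝ) (s : ℝ) : ℝ := f (√s • stdVec j₀)

lemma radProfile_sq_norm (hr : ∀ x y : E d, ‖x‖ = ‖y‖ → f x = f y) (x : E d) :
    radProfile j₀ f (‖x‖ ^ 2) = f x :=
  hr _ _ (by simp [norm_smul, norm_stdVec])

lemma radProfile_contDiffOn (hf : ContDiff ℝ 2 f) : ContDiffOn ℝ 2 (radProfile j₀ f) (Ioi 0) :=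
  fun s hs => (hf.contDiffAt.comp s
    ((Real.contDiffAt_sqrt (ne_of_gt hs)).smul contDiffAt_const)).contDiffWithinAt

lemma hasDerivAt_radProfile (hf : ContDiff ℝ 2 f) {s : ℝ} (hs : 0 < s) :
    HasDerivAt (radProfile j₀ f) (deriv (radProfile j₀ f) s) s :=
  (((radProfile_contDiffOn j₀ hf).differentiableOn (by simp) s hs).differentiableAt
    (Ioi_mem_nhds hs)).hasDerivAt

lemma hasDerivAt_deriv_radProfile (hf : ContDiff ℝ 2 f) {s : ℝ} (hs : 0 < s) :
    HasDerivAt (deriv (radProfile j₀ f)) (deriv (deriv (radProfile j₀ f)) s) s := by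
  have : ContDiffOn ℝ 1 (deriv (radProfile j₀ f)) (Ioi 0) :=
    (radProfile_contDiffOn j₀ hf).deriv_of_isOpen isOpen_Ioi (by norm_num)
  exact ((this.differentiableOn (by simp) s hs).differentiableAt (Ioi_mem_nhds hs)).hasDerivAt

lemma inner_stdVec (x : E d) (j : Fin d) : inner ℝ x (stdVec j) = x j := by
  simp [stdVec, EuclideanSpace.inner_single_right]

lemma hasFDerivAt_sq_norm (x : E d) :
    HasFDerivAt (fun x : E d => ‖x‖ ^ 2) ((2 : ℝ) • innerSL ℝ x) x := by
  have := (hasStrictFDerivAt_norm_sq x).hasFDerivAt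
  have e : (2 : ℝ) • innerSL ℝ x = (2 : ℕ) • innerSL ℝ x := by rw [two_smul, two_smul]
  rw [e]
  exact this

lemma pd_comp_sq_norm {h : ℝ → ℝ} {c : ℝ} {x : E d} (hh : HasDerivAt h c (‖x‖ ^ 2)) (j : Fin d) :
    pd j (fun x => h (‖x‖ ^ 2)) x = 2 * c * x j := by
  have := hh.comp_hasFDerivAt x (hasFDerivAt_sq_norm x)
  unfold pd
  have e : (fun x : E d => h (‖x‖ ^ 2)) = h ∘ fun x : E d => ‖x‖ ^ 2 := rfl
  rw [e, this.fderiv]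
  simp [inner_stdVec]
  ring

lemma pd_radial (hf : ContDiff ℝ 2 f) (hr : ∀ x y : E d, ‖x‖ = ‖y‖ → f x = f y) {x : E d}
    (hx : x ≠ 0) (j : Fin d) : pd j f x = 2 * deriv (radProfile j₀ f) (‖x‖ ^ 2) * x j := by
  have e : f = fun x => radProfile j₀ f (‖x‖ ^ 2) := funext fun x => (radProfile_sq_norm j₀ hr x).symm
  conv_lhs => rw [e]
  exact pd_comp_sq_norm (hasDerivAt_radProfile j₀ hf (by positivity)) j

lemma pd_coord (i j : Fin d) (x : E d) : pd i (fun x : E d => x j) x = if i = j then 1 else 0 := by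
  have : HasFDerivAt (fun x : E d => x j) (EuclideanSpace.proj (𝕜 := ℝ) j) x :=
    (EuclideanSpace.proj (𝕜 := ℝ) j).hasFDerivAt
  unfold pd
  rw [this.fderiv]
  simp [stdVec, eq_comm]

lemma contDiff_coord {n : WithTop ℕ∞} (j : Fin d) : ContDiff ℝ n (fun x : E d => x j) :=
  (EuclideanSpace.proj (𝕜 := ℝ) j).contDiff

lemma pd_pd_radial (hf : ContDiff ℝ 2 f) (hr : ∀ x y : E d, ‖x‖ = ‖y‖ → f x = f y) {x : E d}
    (hx : x ≠ 0) (i j : Fin d) :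
    pd i (pd j f) x = 4 * deriv (deriv (radProfile j₀ f)) (‖x‖ ^ 2) * x i * x j
      + if i = j then 2 * deriv (radProfile j₀ f) (‖x‖ ^ 2) else 0 := by
  have e : pd j f =ᶠ[𝓝 x] fun x => 2 * deriv (radProfile j₀ f) (‖x‖ ^ 2) * x j := by
    filter_upwards [isOpen_ne.mem_nhds hx] with y hy using pd_radial j₀ hf hr hy j
  have hd := hasDerivAt_deriv_radProfile j₀ hf (s := ‖x‖ ^ 2) (by positivity)
  have h1 := hd.comp_hasFDerivAt x (hasFDerivAt_sq_norm x)
  have h2 : HasFDerivAt (fun x : E d => x j) (EuclideanSpace.proj (𝕜 := ℝ) j) x :=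
    (EuclideanSpace.proj (𝕜 := ℝ) j).hasFDerivAt
  have h3 := (h1.const_mul 2).mul h2
  unfold pd at e ⊢
  rw [e.fderiv_eq]
  have e4 := h3.fderiv
  simp only [Function.comp_def] at e4
  rw [show (fun x : E d => 2 * deriv (radProfile j₀ f) (‖x‖ ^ 2) * x j) =
    ((fun y : E d => 2 * deriv (radProfile j₀ f) (‖y‖ ^ 2)) * fun x : E d => x j) from rfl, e4]
  by_cases hij : i = j
  · subst hij
    have hi : inner ℝ x (EuclideanSpace.single i 1) = x i := inner_stdVec x i
    simp [stdVec, hi]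
    ring
  · simp [inner_stdVec, hij]
    have : (stdVec i : E d) j = 0 := by simp [stdVec, Ne.symm hij]
    rw [this]; ring

/-- Trace of the Hessian 4h'' x_i x_j + 2h' δ_ij of h(‖x‖²). In the variable s = ‖x‖² the Laplacian
is 4s h'' + 2d h', the operator treated by the barrier argument. -/
lemma laplacian_radial (hf : ContDiff ℝ 2 f) (hr : ∀ x y : E d, ‖x‖ = ‖y‖ → f x = f y) {x : E d}
    (hx : x ≠ 0) : Laplacian.laplacian f x =
      4 * ‖x‖ ^ 2 * deriv (deriv (radProfile j₀ f)) (‖x‖ ^ 2)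
        + 2 * d * deriv (radProfile j₀ f) (‖x‖ ^ 2) := by
  rw [laplacian_eq_sum_pd hf.contDiffAt]
  simp only [pd_pd_radial j₀ hf hr hx, if_true, Finset.sum_add_distrib, Finset.sum_const,
    Finset.card_univ, Fintype.card_fin, nsmul_eq_mul]
  rw [EuclideanSpace.norm_sq_eq, Finset.mul_sum, Finset.sum_mul]
  congr 1
  · refine Finset.sum_congr rfl fun j _ => ?_
    rw [Real.norm_eq_abs, sq_abs]; ring
  · ring

/-- Radial functions of class `C²` in `H¹` vanish at infinity. -/
lemma tendsto_radProfile (hf : ContDiff ℝ 2 f) (hr : ∀ x y : E d, ‖x‖ = ‖y‖ → f x = f y)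
    (hH : MemH1 fun x => (f x : ℂ)) : Tendsto (radProfile j₀ f) atTop (𝓝 0) := by
  have hc1 : ContDiff ℝ 1 (fun x => (f x : ℂ)) :=
    Complex.ofRealCLM.contDiff.comp (hf.of_le (by norm_num))
  have hfd : Differentiable ℝ f := hf.differentiable (by simp)
  have hpd : ∀ j, Continuous (pd j f) := fun j =>
    (pd_contDiff (m := 1) j hf (by norm_num)).continuous
  set e : E d := stdVec j₀ with he
  have i1 : Integrable (fun x => f x ^ 2) volume := by
    have := (memLp_two_iff_integrable_sq_norm hH.1.1).mp hH.1
    simpa using this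
  have i2 : ∀ j, Integrable (fun x => pd j f x ^ 2) volume := fun j => by
    have h := hH.memLp_pd hc1 j
    have := (memLp_two_iff_integrable_sq_norm h.1).mp h
    have e : ∀ x, ‖pd j (fun x => (f x : ℂ)) x‖ ^ 2 = pd j f x ^ 2 := fun x => by
      rw [pd_ofReal j (hfd x)]; simp
    simpa only [e] using this
  have i3 : Integrable (fun x => ∑ j, pd j f x ^ 2) volume := integrable_finsetSum _ fun j _ => i2 j
  have : Nontrivial (E d) := ⟨⟨e, 0, fun h => by
    have := norm_stdVec (d := d) j₀; rw [← he, h] at this; simp at this⟩⟩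
  have hne : ∀ x : E d, ‖(‖x‖ • e)‖ = ‖x‖ := fun x => by simp [he, norm_smul, norm_stdVec]
  have r1 : (fun x => f x ^ 2) = fun x => (fun r : ℝ => f (r • e) ^ 2) ‖x‖ := by
    funext x; simp only; rw [hr x _ (hne x).symm]
  have r2 : (fun x => ∑ j, pd j f x ^ 2) = fun x => (fun r : ℝ => ∑ j, pd j f (r • e) ^ 2) ‖x‖ := by
    have key : ∀ y : E d, y ≠ 0 → ∑ j, pd j f y ^ 2
        = 4 * deriv (radProfile j₀ f) (‖y‖ ^ 2) ^ 2 * ‖y‖ ^ 2 := fun y hy => by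
      rw [EuclideanSpace.norm_sq_eq y, Finset.mul_sum]
      refine Finset.sum_congr rfl fun j _ => ?_
      rw [pd_radial j₀ hf hr hy, EuclideanSpace.norm_sq_eq, Real.norm_eq_abs, sq_abs]; ring
    funext x
    by_cases hx : x = 0
    · simp [hx]
    · simp only
      rw [key x hx, key (‖x‖ • e) (by rw [← norm_ne_zero_iff, hne]; exact norm_ne_zero_iff.mpr hx),
        hne]
  rw [r1] at i1
  rw [r2] at i3
  rw [integrable_fun_norm_addHaar volume (f := fun r : ℝ => f (r • e) ^ 2)] at i1
  rw [integrable_fun_norm_addHaar volume (f := fun r : ℝ => ∑ j, pd j f (r • e) ^ 2)] at i3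
  -- Beyond radius one the weight r^{d-1} of polar coordinates is at least one and can be discarded.
  have drop : ∀ {g : ℝ → ℝ}, Continuous g → IntegrableOn
      (fun y : ℝ => y ^ (Module.finrank ℝ (E d) - 1) • g y) (Ioi 0) → IntegrableOn g (Ioi 1) := by
    intro g hg hi
    refine Integrable.mono (hi.mono_set (Ioi_subset_Ioi zero_le_one)) hg.aestronglyMeasurable ?_
    filter_upwards [ae_restrict_mem measurableSet_Ioi] with y hy
    rw [norm_smul]
    refine le_mul_of_one_le_left (norm_nonneg _) ?_
    rw [norm_pow, Real.norm_eq_abs]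
    exact one_le_pow₀ ((le_of_lt hy).trans (le_abs_self y))
  have hline : Continuous fun r : ℝ => r • e := continuous_id.smul continuous_const
  have c1 : Continuous fun r : ℝ => f (r • e) := hf.continuous.comp hline
  have c2 : ∀ j, Continuous fun r : ℝ => pd j f (r • e) := fun j => (hpd j).comp hline
  have k1 := drop (c1.pow 2) i1
  have k2 := drop (continuous_finsetSum _ fun j _ => (c2 j).pow 2) i3
  have hder : ∀ r : ℝ, HasDerivAt (fun r : ℝ => f (r • e) ^ 2)
      (2 * f (r • e) * pd j₀ f (r • e)) r := fun r => by
    have h1 : HasDerivAt (fun r : ℝ => r • e) e r := by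
      simpa using (hasDerivAt_id r).smul_const e
    have h2 := ((hfd (r • e)).hasFDerivAt.comp_hasDerivAt r h1).pow 2
    refine h2.congr_deriv ?_
    simp [pd, he]
  have hint : IntegrableOn (fun r : ℝ => 2 * f (r • e) * pd j₀ f (r • e)) (Ioi 1) := by
    refine Integrable.mono (k1.add k2)
      ((continuous_const.mul c1).mul (c2 j₀)).aestronglyMeasurable (Eventually.of_forall fun r => ?_)
    have h1 := Finset.single_le_sum (f := fun j => pd j f (r • e) ^ 2)
      (fun _ _ => sq_nonneg _) (Finset.mem_univ j₀)
    refine le_trans ?_ (le_abs_self _)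
    rw [Real.norm_eq_abs]
    simp only [Pi.add_apply, Pi.pow_apply]
    refine abs_le.mpr ⟨?_, ?_⟩
    · nlinarith [sq_nonneg (f (r • e) + pd j₀ f (r • e))]
    · nlinarith [sq_nonneg (f (r • e) - pd j₀ f (r • e))]
  -- Along a ray f² is integrable and so is its derivative 2f ∂f, being dominated by f² + |∇f|²;
  -- such a function tends to zero.
  have hlim := tendsto_zero_of_hasDerivAt_of_integrableOn_Ioi (fun x _ => hder x) hint k1
  have hlim2 : Tendsto (fun r : ℝ => f (r • e)) atTop (𝓝 0) := by
    rw [tendsto_zero_iff_norm_tendsto_zero]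
    have := (Real.continuous_sqrt.tendsto 0).comp hlim
    simpa [Function.comp_def, Real.sqrt_sq_eq_abs] using this
  exact hlim2.comp Real.tendsto_sqrt_atTop

/-- Rapid decay of radial solutions of `Δf = a f + K`, together with their derivatives. -/
lemma decays_of_radial (hd0 : 0 < d) (hd : d ≤ 2) (hf : ContDiff ℝ 2 f)
    (hr : ∀ x y : E d, ‖x‖ = ‖y‖ → f x = f y)
    (hH : MemH1 fun x => (f x : ℂ)) {a K : E d → ℝ} {S M : ℝ} (hS : 1 ≤ S)
    (heq : ∀ x, Laplacian.laplacian f x = a x * f x + K x)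
    (ha : ∀ x, S ≤ ‖x‖ ^ 2 → 1 / 2 ≤ a x) (haM : ∀ x, S ≤ ‖x‖ ^ 2 → a x ≤ M) (hK : Decays K) :
    Decays f ∧ (∀ j, Decays (pd j f)) ∧ ∀ i j, Decays (pd i (pd j f)) := by
  set j₀ : Fin d := ⟨0, hd0⟩
  set e : E d := stdVec j₀ with he
  have hne : ∀ s : ℝ, 0 ≤ s → ‖√s • e‖ ^ 2 = s := fun s hs => by
    simp [he, norm_smul, norm_stdVec, Real.sq_sqrt hs]
  have hne0 : ∀ s : ℝ, 0 < s → √s • e ≠ 0 := fun s hs h => by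
    have := hne s hs.le; rw [h] at this; simp at this; linarith
  set h := radProfile j₀ f with hh
  have hd1 : ∀ s, S ≤ s → HasDerivAt h (deriv h s) s := fun s hs =>
    hasDerivAt_radProfile j₀ hf (by linarith)
  have hd2 : ∀ s, S ≤ s → HasDerivAt (deriv h) (deriv (deriv h) s) s := fun s hs =>
    hasDerivAt_deriv_radProfile j₀ hf (by linarith)
  have hode : ∀ s, S ≤ s → 4 * s * deriv (deriv h) s + 2 * d * deriv h s
      = a (√s • e) * h s + K (√s • e) := fun s hs => by
    have h1 := laplacian_radial j₀ hf hr (hne0 s (by linarith))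
    rw [hne s (by linarith), heq] at h1
    exact h1.symm
  have hKr : RapidOn S fun s => K (√s • e) := fun k => by
    obtain ⟨C, hC⟩ := hK (2 * k)
    refine ⟨C, fun s hs => le_trans ?_ (hC (√s • e))⟩
    have hs0 : 0 ≤ s := by linarith
    rw [Real.norm_eq_abs]
    gcongr
    rw [pow_mul]
    gcongr
    nlinarith [hne s hs0, norm_nonneg (√s • e)]
  have R0 : RapidOn S h := rapidOn_of_ode hS hd1 hd2 hode
    (fun s hs => ha _ (by rw [hne s (by linarith)]; exact hs)) hKr (tendsto_radProfile j₀ hf hr hH)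
  have RF : RapidOn S fun s => a (√s • e) * h s + K (√s • e) := by
    refine RapidOn.add (R0.of_le (by linarith) M 0 fun s hs => ?_) hKr (by linarith)
    have h1 := ha (√s • e) (by rw [hne s (by linarith)]; exact hs)
    have h2 := haM (√s • e) (by rw [hne s (by linarith)]; exact hs)
    rw [abs_mul, abs_of_nonneg (by linarith), pow_zero, mul_one]
    gcongr
  have R1 : RapidOn S (deriv h) := rapidOn_deriv_of_ode hS hd hd1 hd2 hode RF R0
  -- The second derivative is read off from the equation; division by 4s is harmless because s ≥ 1.
  have R2 : RapidOn S (deriv (deriv h)) := by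
    refine RapidOn.of_le (f := fun s => (a (√s • e) * h s + K (√s • e)) + (-(2 * d)) * deriv h s)
      (RF.add (R1.of_le (by linarith) (2 * d) 0 fun s hs => ?_) (by linarith)) (by linarith)
      1 0 fun s hs => ?_
    · rw [abs_mul, abs_neg, abs_of_nonneg (by positivity)]; simp
    · have hs1 : 1 ≤ s := hS.trans hs
      rw [show (a (√s • e) * h s + K (√s • e)) + (-(2 * d)) * deriv h s = 4 * s * deriv (deriv h) s by
        rw [← hode s hs]; ring, abs_mul, abs_of_nonneg (by positivity : 0 ≤ 4 * s)]
      nlinarith [abs_nonneg (deriv (deriv h) s)]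
  have hx0 : ∀ x : E d, S ≤ ‖x‖ ^ 2 → x ≠ 0 := fun x hx h => by
    rw [h] at hx; simp at hx; linarith
  have hxj : ∀ (x : E d) j, |x j| ≤ ‖x‖ := fun x j => PiLp.norm_apply_le x j
  have hcp : ∀ j, ContDiff ℝ 1 (pd j f) := fun j => pd_contDiff j hf (by norm_num)
  have h12 : ∀ x : E d, S ≤ ‖x‖ ^ 2 → ‖x‖ ≤ ‖x‖ ^ 2 := fun x hx => by
    nlinarith [norm_nonneg x]
  refine ⟨?_, fun j => ?_, fun i j => ?_⟩
  · exact decays_of_rapidOn hf.continuous hS R0 fun x _ => by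
      rw [hh, radProfile_sq_norm j₀ hr]
  · refine decays_of_rapidOn (hcp j).continuous hS (g := fun s => 2 * s * deriv h s)
      (R1.of_le (by linarith) 2 1 fun s hs => ?_) fun x hx => ?_
    · rw [abs_mul, abs_of_nonneg (by linarith), pow_one]
    · rw [pd_radial j₀ hf hr (hx0 x hx), abs_mul, abs_mul, abs_mul (2 * _), abs_mul 2,
        abs_of_nonneg (by norm_num : (0 : ℝ) ≤ 2), abs_of_nonneg (sq_nonneg ‖x‖)]
      have := (hxj x j).trans (h12 x hx)
      nlinarith [abs_nonneg (deriv h (‖x‖ ^ 2)), mul_le_mul_of_nonneg_left this (abs_nonneg (deriv h (‖x‖ ^ 2)))]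
  · refine decays_of_rapidOn (pd_contDiff (m := 0) i (hcp j) (by simp)).continuous hS
      (g := fun s => 4 * s * |deriv (deriv h) s| + 2 * |deriv h s|)
      (RapidOn.add (R2.of_le (by linarith) 4 1 fun s hs => ?_)
        (R1.of_le (by linarith) 2 0 fun s hs => ?_) (by linarith)) fun x hx => ?_
    · rw [abs_mul, abs_of_nonneg (by linarith), abs_abs, pow_one]
    · rw [abs_mul, abs_of_nonneg (by norm_num), abs_abs]; simp
    · rw [pd_pd_radial j₀ hf hr (hx0 x hx)]
      refine le_trans ?_ (le_abs_self _)
      refine (abs_add_le _ _).trans (add_le_add ?_ ?_)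
      · rw [abs_mul, abs_mul, abs_mul, abs_of_nonneg (by norm_num : (0 : ℝ) ≤ 4)]
        have : |x i| * |x j| ≤ ‖x‖ ^ 2 := by
          rw [sq]; exact mul_le_mul (hxj x i) (hxj x j) (abs_nonneg _) (norm_nonneg _)
        nlinarith [mul_le_mul_of_nonneg_left this (abs_nonneg (deriv (deriv h) (‖x‖ ^ 2)))]
      · split_ifs
        · rw [abs_mul, abs_of_nonneg (by norm_num : (0 : ℝ) ≤ 2)]
        · simp

end Radial

end RNLS

namespace RNLS

open scoped ContDiff

variable {d : ℕ}

/-! ### Stability and integrability of rapid decay. -/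

section DecayRules

variable {f g : E d → ℝ}

lemma Decays.exists_bound (hf : Decays f) : ∃ C, 0 ≤ C ∧ ∀ x, |f x| ≤ C := by
  obtain ⟨C, hC⟩ := hf 0
  exact ⟨C, (norm_nonneg (f 0)).trans (by simpa using hC 0), fun x => by simpa using hC x⟩

lemma Decays.mul_of_le (hf : Decays f) {a : E d → ℝ} (M : ℝ) (m : ℕ)
    (ha : ∀ x, |a x| ≤ M * (1 + ‖x‖) ^ m) : Decays fun x => a x * f x := fun k => by
  obtain ⟨C, hC⟩ := hf (m + k)
  have hM : 0 ≤ M := by simpa using (abs_nonneg _).trans (ha 0)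
  refine ⟨M * C, fun x => ?_⟩
  calc (1 + ‖x‖) ^ k * ‖a x * f x‖ = |a x| * ((1 + ‖x‖) ^ k * ‖f x‖) := by
        rw [norm_mul, Real.norm_eq_abs (a x)]; ring
    _ ≤ M * (1 + ‖x‖) ^ m * ((1 + ‖x‖) ^ k * ‖f x‖) := by gcongr; exact ha x
    _ = M * ((1 + ‖x‖) ^ (m + k) * ‖f x‖) := by rw [pow_add]; ring
    _ ≤ M * C := by gcongr; exact hC x

lemma Decays.add (hf : Decays f) (hg : Decays g) : Decays fun x => f x + g x := fun k => by
  obtain ⟨C, hC⟩ := hf k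
  obtain ⟨C', hC'⟩ := hg k
  refine ⟨C + C', fun x => ?_⟩
  calc (1 + ‖x‖) ^ k * ‖f x + g x‖ ≤ (1 + ‖x‖) ^ k * (‖f x‖ + ‖g x‖) := by
        gcongr; exact norm_add_le _ _
    _ ≤ C + C' := by rw [mul_add]; exact add_le_add (hC x) (hC' x)

lemma Decays.const_mul (hf : Decays f) (c : ℝ) : Decays fun x => c * f x :=
  hf.mul_of_le |c| 0 (by simp)

lemma decays_zero : Decays fun _ : E d => (0 : ℝ) := fun k => ⟨0, fun x => by simp⟩

lemma Decays.sum {ι : Type*} (s : Finset ι) {F : ι → E d → ℝ} (h : ∀ i ∈ s, Decays (F i)) :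
    Decays fun x => ∑ i ∈ s, F i x := by
  classical
  induction s using Finset.induction_on with
  | empty => simpa using decays_zero
  | insert i s hi ih =>
    simp only [Finset.sum_insert hi]
    exact (h i (Finset.mem_insert_self i s)).add
      (ih fun j hj => h j (Finset.mem_insert_of_mem hj))

lemma Decays.coord_mul (hf : Decays f) (j : Fin d) : Decays fun x => x j * f x :=
  hf.mul_of_le 1 1 fun x => by
    have : |x j| ≤ ‖x‖ := PiLp.norm_apply_le x j
    linarith

lemma Decays.sq_norm_mul (hf : Decays f) : Decays fun x => ‖x‖ ^ 2 * f x :=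
  hf.mul_of_le 1 2 fun x => by
    rw [abs_of_nonneg (by positivity)]
    nlinarith [norm_nonneg x]

lemma Decays.mul (hf : Decays f) (hg : Decays g) : Decays fun x => f x * g x := by
  obtain ⟨C, -, hC⟩ := hf.exists_bound
  exact hg.mul_of_le C 0 (by simpa using hC)

lemma Decays.integrable (hf : Decays f) (hc : Continuous f) : Integrable f volume := by
  obtain ⟨C, hC⟩ := hf (d + 1)
  have h1 : Integrable (fun x : E d => (1 + ‖x‖) ^ (-((d + 1 : ℕ) : ℝ))) volume :=
    integrable_one_add_norm (by simp)
  refine Integrable.mono' (h1.const_mul C) hc.aestronglyMeasurable (Eventually.of_forall fun x => ?_)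
  have hp : 0 < 1 + ‖x‖ := by positivity
  rw [Real.rpow_neg hp.le, Real.rpow_natCast, ← div_eq_mul_inv, le_div_iff₀ (by positivity), mul_comm]
  exact hC x

lemma Decays.memLp (hf : Decays f) (hc : Continuous f) : MemLp (fun x => (f x : ℂ)) 2 volume := by
  have hc' : Continuous fun x => (f x : ℂ) := Complex.continuous_ofReal.comp hc
  rw [memLp_two_iff_integrable_sq_norm hc'.aestronglyMeasurable]
  have := (hf.mul hf).integrable (hc.mul hc)
  refine this.congr (Eventually.of_forall fun x => ?_)
  simp [sq]

end DecayRules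

/-! ### Calculus of partial derivatives -/

section Calculus

variable {f g : E d → ℝ} {x : E d} (j : Fin d)

lemma pd_add' (hf : DifferentiableAt ℝ f x) (hg : DifferentiableAt ℝ g x) :
    pd j (fun x => f x + g x) x = pd j f x + pd j g x := by
  unfold pd; rw [fderiv_fun_add hf hg]; rfl

lemma pd_const_mul' (c : ℝ) (hf : DifferentiableAt ℝ f x) :
    pd j (fun x => c * f x) x = c * pd j f x := by
  unfold pd; rw [fderiv_const_mul hf]; rfl

lemma pd_mul' (hf : DifferentiableAt ℝ f x) (hg : DifferentiableAt ℝ g x) :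
    pd j (fun x => f x * g x) x = pd j f x * g x + f x * pd j g x := by
  unfold pd; rw [fderiv_fun_mul hf hg]
  simp; ring

lemma pd_pow' (n : ℕ) (hf : DifferentiableAt ℝ f x) :
    pd j (fun x => f x ^ n) x = n * f x ^ (n - 1) * pd j f x := by
  unfold pd; rw [fderiv_fun_pow n hf]
  simp

lemma pd_sum' {ι : Type*} (s : Finset ι) {F : ι → E d → ℝ}
    (hF : ∀ i ∈ s, DifferentiableAt ℝ (F i) x) :
    pd j (fun x => ∑ i ∈ s, F i x) x = ∑ i ∈ s, pd j (F i) x := by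
  unfold pd; rw [fderiv_fun_sum hF]; simp

lemma pd_coord_mul (i : Fin d) (hf : DifferentiableAt ℝ f x) :
    pd i (fun x => x j * f x) x = (if i = j then f x else 0) + x j * pd i f x := by
  rw [pd_mul' i ((contDiff_coord (n := 1) j).differentiable (by simp) x) hf, pd_coord]
  split_ifs <;> simp

lemma pd_comm (i : Fin d) (hf : ContDiff ℝ 2 f) : pd i (pd j f) x = pd j (pd i f) x := by
  have hs := (hf.contDiffAt (x := x)).isSymmSndFDerivAt (by simp)
  have hd : DifferentiableAt ℝ (fderiv ℝ f) x :=
    (hf.fderiv_right (m := 1) (by norm_num)).differentiable (by simp) x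
  have e : ∀ i j, pd i (pd j f) x = fderiv ℝ (fderiv ℝ f) x (stdVec i) (stdVec j) := fun i j => by
    unfold pd
    rw [fderiv_clm_apply hd (by fun_prop)]
    simp
  rw [e, e]
  exact hs (stdVec i) (stdVec j)

end Calculus

/-! ### Admissible profiles -/

/-- Functions of class `C²` such that the function, its gradient and its Laplacian decay rapidly. -/
structure IsProfile (g : E d → ℝ) : Prop where
  contDiff : ContDiff ℝ 2 g
  decays : Decays g
  decays_pd : ∀ j, Decays (pd j g)
  decays_laplacian : Decays (Laplacian.laplacian g)

namespace IsProfile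

variable {f g : E d → ℝ}

lemma differentiable (hg : IsProfile g) : Differentiable ℝ g := hg.contDiff.differentiable (by simp)

lemma contDiff_pd (hg : IsProfile g) (j : Fin d) : ContDiff ℝ 1 (pd j g) :=
  pd_contDiff j hg.contDiff (by norm_num)

lemma continuous_pd (hg : IsProfile g) (j : Fin d) : Continuous (pd j g) := (hg.contDiff_pd j).continuous

lemma differentiable_pd (hg : IsProfile g) (j : Fin d) : Differentiable ℝ (pd j g) :=
  (hg.contDiff_pd j).differentiable (by simp)

lemma laplacian_eq (hg : IsProfile g) (x : E d) :
    Laplacian.laplacian g x = ∑ j, pd j (pd j g) x := laplacian_eq_sum_pd hg.contDiff.contDiffAt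

lemma continuous_pd_pd (hg : IsProfile g) (i j : Fin d) : Continuous (pd i (pd j g)) :=
  (pd_contDiff (m := 0) i (hg.contDiff_pd j) (by simp)).continuous

lemma continuous_laplacian (hg : IsProfile g) : Continuous (Laplacian.laplacian g) := by
  rw [show Laplacian.laplacian g = fun x => ∑ j, pd j (pd j g) x from funext hg.laplacian_eq]
  exact continuous_finsetSum _ fun j _ => hg.continuous_pd_pd j j

lemma laplacian_add (hf : IsProfile f) (hg : IsProfile g) (x : E d) :
    Laplacian.laplacian (fun x => f x + g x) x
      = Laplacian.laplacian f x + Laplacian.laplacian g x := by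
  rw [laplacian_eq_sum_pd (hf.contDiff.add hg.contDiff).contDiffAt, hf.laplacian_eq, hg.laplacian_eq,
    ← Finset.sum_add_distrib]
  refine Finset.sum_congr rfl fun j _ => ?_
  rw [show pd j (fun x => f x + g x) = fun x => pd j f x + pd j g x from
    funext fun x => pd_add' j (hf.differentiable x) (hg.differentiable x)]
  exact pd_add' j (hf.differentiable_pd j x) (hg.differentiable_pd j x)

lemma laplacian_const_mul (hg : IsProfile g) (c : ℝ) (x : E d) :
    Laplacian.laplacian (fun x => c * g x) x = c * Laplacian.laplacian g x := by
  rw [laplacian_eq_sum_pd (contDiff_const.mul hg.contDiff).contDiffAt, hg.laplacian_eq, Finset.mul_sum]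
  refine Finset.sum_congr rfl fun j _ => ?_
  rw [show pd j (fun x => c * g x) = fun x => c * pd j g x from
    funext fun x => pd_const_mul' j c (hg.differentiable x)]
  exact pd_const_mul' j c (hg.differentiable_pd j x)

lemma laplacian_coord_mul (hg : IsProfile g) (j : Fin d) (x : E d) :
    Laplacian.laplacian (fun x => x j * g x) x = x j * Laplacian.laplacian g x + 2 * pd j g x := by
  rw [laplacian_eq_sum_pd ((contDiff_coord j).mul hg.contDiff).contDiffAt, hg.laplacian_eq,
    Finset.mul_sum]
  have : ∀ i, pd i (pd i fun x => x j * g x) x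
      = x j * pd i (pd i g) x + if i = j then 2 * pd j g x else 0 := fun i => by
    rw [show pd i (fun x => x j * g x) = fun x => (if i = j then 1 else 0) * g x + x j * pd i g x from
      funext fun x => by rw [pd_coord_mul j i (hg.differentiable x)]; split_ifs <;> simp]
    rw [pd_add' (g := fun x => x j * pd i g x) i ((hg.differentiable x).const_mul _)
      (((contDiff_coord (n := 1) j).differentiable (by simp) x).mul (hg.differentiable_pd i x)),
      pd_const_mul' i _ (hg.differentiable x), pd_coord_mul j i (hg.differentiable_pd i x)]
    split_ifs with h
    · subst h; ring
    · ring
  simp [this, Finset.sum_add_distrib]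

lemma add (hf : IsProfile f) (hg : IsProfile g) : IsProfile fun x => f x + g x where
  contDiff := hf.contDiff.add hg.contDiff
  decays := hf.decays.add hg.decays
  decays_pd j := by
    rw [show pd j (fun x => f x + g x) = fun x => pd j f x + pd j g x from
      funext fun x => pd_add' j (hf.differentiable x) (hg.differentiable x)]
    exact (hf.decays_pd j).add (hg.decays_pd j)
  decays_laplacian := by
    rw [show Laplacian.laplacian (fun x => f x + g x) = _ from funext (hf.laplacian_add hg)]
    exact hf.decays_laplacian.add hg.decays_laplacian

lemma const_mul (hg : IsProfile g) (c : ℝ) : IsProfile fun x => c * g x where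
  contDiff := contDiff_const.mul hg.contDiff
  decays := hg.decays.const_mul c
  decays_pd j := by
    rw [show pd j (fun x => c * g x) = fun x => c * pd j g x from
      funext fun x => pd_const_mul' j c (hg.differentiable x)]
    exact (hg.decays_pd j).const_mul c
  decays_laplacian := by
    rw [show Laplacian.laplacian (fun x => c * g x) = _ from funext (hg.laplacian_const_mul c)]
    exact hg.decays_laplacian.const_mul c

lemma coord_mul (hg : IsProfile g) (j : Fin d) : IsProfile fun x => x j * g x where
  contDiff := (contDiff_coord j).mul hg.contDiff
  decays := hg.decays.coord_mul j
  decays_pd i := by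
    rw [show pd i (fun x => x j * g x) = fun x => (if i = j then 1 else 0) * g x + x j * pd i g x from
      funext fun x => by rw [pd_coord_mul j i (hg.differentiable x)]; split_ifs <;> simp]
    exact (hg.decays.const_mul _).add ((hg.decays_pd i).coord_mul j)
  decays_laplacian := by
    rw [show Laplacian.laplacian (fun x => x j * g x) = _ from funext (hg.laplacian_coord_mul j)]
    exact (hg.decays_laplacian.coord_mul j).add ((hg.decays_pd j).const_mul 2)

lemma laplacian_zero (x : E d) : Laplacian.laplacian (fun _ : E d => (0 : ℝ)) x = 0 := by
  have h0 : ∀ j, pd j (fun _ : E d => (0 : ℝ)) = fun _ => 0 := fun j => funext fun x => by simp [pd]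
  rw [laplacian_eq_sum_pd contDiffAt_const]
  simp [h0]

lemma zero : IsProfile fun _ : E d => (0 : ℝ) where
  contDiff := contDiff_const
  decays := decays_zero
  decays_pd j := by
    rw [show pd j (fun _ : E d => (0 : ℝ)) = fun _ => 0 from funext fun x => by simp [pd]]
    exact decays_zero
  decays_laplacian := by
    rw [show Laplacian.laplacian (fun _ : E d => (0 : ℝ)) = fun _ => 0 from funext laplacian_zero]
    exact decays_zero

lemma sum {ι : Type*} (s : Finset ι) {F : ι → E d → ℝ} (h : ∀ i ∈ s, IsProfile (F i)) :
    IsProfile fun x => ∑ i ∈ s, F i x := by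
  classical
  induction s using Finset.induction_on with
  | empty => simpa using zero
  | insert i s hi ih =>
    simp only [Finset.sum_insert hi]
    exact (h i (Finset.mem_insert_self i s)).add
      (ih fun j hj => h j (Finset.mem_insert_of_mem hj))

lemma laplacian_sum {ι : Type*} (s : Finset ι) {F : ι → E d → ℝ} (h : ∀ i ∈ s, IsProfile (F i))
    (x : E d) : Laplacian.laplacian (fun x => ∑ i ∈ s, F i x) x
      = ∑ i ∈ s, Laplacian.laplacian (F i) x := by
  classical
  induction s using Finset.induction_on with
  | empty =>
    simp
  | insert i s hi ih =>
    have h' : ∀ j ∈ s, IsProfile (F j) := fun j hj => h j (Finset.mem_insert_of_mem hj)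
    simp only [Finset.sum_insert hi]
    rw [laplacian_add (h i (Finset.mem_insert_self i s)) (IsProfile.sum s h'), ih h']

end IsProfile

lemma sq_norm_eq_sum (x : E d) : ‖x‖ ^ 2 = ∑ j, x j * x j := by
  rw [EuclideanSpace.norm_sq_eq]
  exact Finset.sum_congr rfl fun j _ => by rw [Real.norm_eq_abs, sq_abs, sq]

lemma sq_norm_mul_eq (f : E d → ℝ) :
    (fun x : E d => ‖x‖ ^ 2 * f x) = fun x => ∑ j, x j * (x j * f x) := funext fun x => by
  rw [sq_norm_eq_sum, Finset.sum_mul]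
  exact Finset.sum_congr rfl fun j _ => by ring

/-- The generator `Λ = d/2 + y·∇` of the `L²` scaling. -/
noncomputable def scaleGen (g : E d → ℝ) (x : E d) : ℝ := (d : ℝ) / 2 * g x + ∑ j, x j * pd j g x

lemma IsProfile.sq_norm_mul {g : E d → ℝ} (hg : IsProfile g) : IsProfile fun x => ‖x‖ ^ 2 * g x := by
  rw [sq_norm_mul_eq]
  exact IsProfile.sum _ fun j _ => (hg.coord_mul j).coord_mul j

lemma isProfile_scaleGen {g : E d → ℝ} (hg : IsProfile g) (h : ∀ j, IsProfile (pd j g)) :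
    IsProfile (scaleGen g) :=
  (hg.const_mul _).add (IsProfile.sum _ fun j _ => (h j).coord_mul j)

/-! ### The ground state -/

section GroundState

variable {Q ρ : E d → ℝ}

lemma crit_ge_two (hd : d = 1 ∨ d = 2) : 2 ≤ crit d := by
  rcases hd with rfl | rfl <;> norm_num [crit]

lemma one_add_div_eq (hd : d = 1 ∨ d = 2) : (1 : ℝ) + 4 / (d : ℝ) = 1 + crit d := by
  rcases hd with rfl | rfl <;> norm_num [crit]

lemma IsGroundState.contDiff_two (hQ : IsGroundState Q) : ContDiff ℝ 2 Q :=
  hQ.smooth.of_le (WithTop.coe_le_coe.mpr (le_top : (2 : ℕ∞) ≤ ⊤))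

lemma IsGroundState.exists_small (hQ : IsGroundState Q) (hd : d = 1 ∨ d = 2) {η : ℝ} (hη : 0 < η) :
    ∃ S : ℝ, 1 ≤ S ∧ ∀ x, S ≤ ‖x‖ ^ 2 → Q x ≤ η := by
  have hd0 : 0 < d := by omega
  have := tendsto_radProfile ⟨0, hd0⟩ hQ.contDiff_two hQ.radial hQ.memH1
  obtain ⟨S, hS⟩ := eventually_atTop.mp (this.eventually_lt_const hη)
  refine ⟨max S 1, le_max_right _ _, fun x hx => ?_⟩
  have := hS (‖x‖ ^ 2) ((le_max_left _ _).trans hx)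
  rw [radProfile_sq_norm ⟨0, hd0⟩ hQ.radial] at this
  exact this.le

lemma IsGroundState.laplacian_eq (hQ : IsGroundState Q) (x : E d) :
    Laplacian.laplacian Q x = Q x - Q x ^ (1 + crit d) := by linarith [hQ.eqn x]

/-- The equation is ΔQ = (1 - Q^{4/d}) Q. Far out Q ≤ 1/2, and since 4/d ≥ 1 this gives Q^{4/d} ≤ Q
≤ 1/2, so the potential lies between 1/2 and 1 there. -/
lemma IsGroundState.decays_all (hQ : IsGroundState Q) (hd : d = 1 ∨ d = 2) :
    Decays Q ∧ (∀ j, Decays (pd j Q)) ∧ ∀ i j, Decays (pd i (pd j Q)) := by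
  obtain ⟨S, hS, hQS⟩ := hQ.exists_small hd (η := 1 / 2) (by norm_num)
  refine decays_of_radial (by omega) (by omega) hQ.contDiff_two hQ.radial hQ.memH1
    (a := fun x => 1 - Q x ^ crit d) (K := fun _ => 0) (M := 1) hS (fun x => ?_) (fun x hx => ?_)
    (fun x hx => ?_) decays_zero
  · rw [hQ.laplacian_eq, pow_add]; ring
  · have h1 := hQS x hx
    have : Q x ^ crit d ≤ Q x := pow_le_of_le_one (hQ.pos x).le (by linarith)
      (by have := crit_ge_two hd; omega)
    linarith
  · have := pow_pos (hQ.pos x) (crit d)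
    linarith

lemma IsGroundState.decays_pow_mul (hQ : IsGroundState Q) (hd : d = 1 ∨ d = 2) (n : ℕ)
    {f : E d → ℝ} (hf : Decays f) : Decays fun x => Q x ^ n * f x := by
  obtain ⟨C, hC0, hC⟩ := (hQ.decays_all hd).1.exists_bound
  refine hf.mul_of_le (C ^ n) 0 fun x => ?_
  rw [abs_pow, pow_zero, mul_one]
  exact pow_le_pow_left₀ (abs_nonneg _) (hC x) n

lemma IsGroundState.isProfile (hQ : IsGroundState Q) (hd : d = 1 ∨ d = 2) : IsProfile Q where
  contDiff := hQ.contDiff_two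
  decays := (hQ.decays_all hd).1
  decays_pd := (hQ.decays_all hd).2.1
  decays_laplacian := by
    rw [show Laplacian.laplacian Q = fun x => Q x + (-1) * (Q x ^ crit d * Q x) from
      funext fun x => by rw [hQ.laplacian_eq, pow_add]; ring]
    exact (hQ.decays_all hd).1.add
      ((hQ.decays_pow_mul hd _ (hQ.decays_all hd).1).const_mul _)

/-- The ground state equation is differentiated; exchanging ∂_j with Δ uses third derivatives,
available because Q is smooth. -/
lemma IsGroundState.laplacian_pd (hQ : IsGroundState Q) (j : Fin d) (x : E d) :
    Laplacian.laplacian (pd j Q) x = pd j Q x - (1 + crit d) * Q x ^ crit d * pd j Q x := by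
  have hj : ∀ j, ContDiff ℝ ∞ (pd j Q) := fun j => pd_contDiff j hQ.smooth (by simp)
  have hij : ∀ i j, ContDiff ℝ ∞ (pd i (pd j Q)) := fun i j => pd_contDiff i (hj j) (by simp)
  have h2 : (2 : WithTop ℕ∞) ≤ ((⊤ : ℕ∞) : WithTop ℕ∞) := WithTop.coe_le_coe.mpr (le_top : (2 : ℕ∞) ≤ ⊤)
  have e1 : pd j (Laplacian.laplacian Q) x = Laplacian.laplacian (pd j Q) x := by
    rw [laplacian_eq_sum_pd ((hj j).of_le h2).contDiffAt,
      show Laplacian.laplacian Q = fun x => ∑ i, pd i (pd i Q) x from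
        funext fun x => laplacian_eq_sum_pd hQ.contDiff_two.contDiffAt,
      pd_sum' j _ fun i _ => (hij i i).differentiable (by simp) x]
    refine Finset.sum_congr rfl fun i _ => ?_
    rw [pd_comm i j ((hj i).of_le h2)]
    rw [show pd j (pd i Q) = pd i (pd j Q) from funext fun x => pd_comm i j hQ.contDiff_two]
  have hQd : Differentiable ℝ Q := hQ.smooth.differentiable (by simp)
  rw [← e1, show Laplacian.laplacian Q = fun x => Q x + (-1) * Q x ^ (1 + crit d) from
    funext fun x => by rw [hQ.laplacian_eq]; ring,
    pd_add' (g := fun x => -1 * Q x ^ (1 + crit d)) j (hQd x) (((hQd x).pow _).const_mul _),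
    pd_const_mul' (f := fun x => Q x ^ (1 + crit d)) j _ ((hQd x).pow _), pd_pow' j _ (hQd x)]
  simp only [Nat.add_sub_cancel_left]
  push_cast
  ring

lemma IsGroundState.isProfile_pd (hQ : IsGroundState Q) (hd : d = 1 ∨ d = 2) (j : Fin d) :
    IsProfile (pd j Q) where
  contDiff := (pd_contDiff (m := ∞) j hQ.smooth (by simp)).of_le
    (WithTop.coe_le_coe.mpr (le_top : (2 : ℕ∞) ≤ ⊤))
  decays := (hQ.decays_all hd).2.1 j
  decays_pd i := (hQ.decays_all hd).2.2 i j
  decays_laplacian := by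
    rw [show Laplacian.laplacian (pd j Q)
      = fun x => pd j Q x + (-(1 + crit d)) * (Q x ^ crit d * pd j Q x) from
      funext fun x => by rw [hQ.laplacian_pd]; ring]
    exact ((hQ.decays_all hd).2.1 j).add
      ((hQ.decays_pow_mul hd _ ((hQ.decays_all hd).2.1 j)).const_mul _)

lemma IsRho.laplacian_eq (hρ : IsRho Q ρ) (hd : d = 1 ∨ d = 2) (x : E d) :
    Laplacian.laplacian ρ x = (1 - (1 + crit d) * Q x ^ crit d) * ρ x + ‖x‖ ^ 2 * Q x := by
  have := hρ.eqn x
  rw [one_add_div_eq hd] at this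
  linarith

/-- The decay argument for Q with the rapidly decaying source |x|²Q. The threshold 1/10 for Q is
dictated by 1 + 4/d ≤ 5: it keeps (1 + 4/d) Q^{4/d} ≤ 1/2, so the potential stays above 1/2. -/
lemma IsRho.isProfile (hρ : IsRho Q ρ) (hQ : IsGroundState Q) (hd : d = 1 ∨ d = 2) :
    IsProfile ρ := by
  obtain ⟨S, hS, hQS⟩ := hQ.exists_small hd (η := 1 / 10) (by norm_num)
  have hc5 : (crit d : ℝ) ≤ 4 := by
    rcases hd with rfl | rfl <;> norm_num [crit]
  have hx2 := (hQ.isProfile hd).decays.sq_norm_mul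
  obtain ⟨h1, h2, -⟩ := decays_of_radial (by omega) (by omega) hρ.smooth hρ.radial hρ.memH1
    (a := fun x => 1 - (1 + crit d) * Q x ^ crit d) (K := fun x => ‖x‖ ^ 2 * Q x) (M := 1) hS
    (hρ.laplacian_eq hd) (fun x hx => by
      have h1 := hQS x hx
      have h0 := (hQ.pos x).le
      have : Q x ^ crit d ≤ Q x := pow_le_of_le_one h0 (by linarith)
        (by have := crit_ge_two hd; omega)
      have h3 : 0 ≤ Q x ^ crit d := pow_nonneg h0 _
      nlinarith) (fun x hx => by
      have := pow_pos (hQ.pos x) (crit d)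
      have : 0 ≤ (1 + (crit d : ℝ)) * Q x ^ crit d := by positivity
      linarith) hx2
  refine ⟨hρ.smooth, h1, h2, ?_⟩
  rw [show Laplacian.laplacian ρ
    = fun x => (ρ x + (-(1 + crit d)) * (Q x ^ crit d * ρ x)) + ‖x‖ ^ 2 * Q x from
    funext fun x => by rw [hρ.laplacian_eq hd]; ring]
  exact (h1.add ((hQ.decays_pow_mul hd _ h1).const_mul _)).add hx2

end GroundState

end RNLS

namespace RNLS

open scoped ContDiff

variable {d : ℕ}

/-! ### Pairing with rapidly decaying weights -/

/-- Continuous functions of rapid decay. -/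
structure IsWeight (g : E d → ℝ) : Prop where
  continuous : Continuous g
  decays : Decays g

namespace IsWeight

variable {f g : E d → ℝ}

lemma memLp (hg : IsWeight g) : MemLp (fun x => (g x : ℂ)) 2 volume := hg.decays.memLp hg.continuous

lemma integrable (hg : IsWeight g) : Integrable g volume := hg.decays.integrable hg.continuous

lemma add (hf : IsWeight f) (hg : IsWeight g) : IsWeight fun x => f x + g x :=
  ⟨hf.1.add hg.1, hf.2.add hg.2⟩

lemma const_mul (hg : IsWeight g) (c : ℝ) : IsWeight fun x => c * g x :=
  ⟨continuous_const.mul hg.1, hg.2.const_mul c⟩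

lemma mul (hf : IsWeight f) (hg : IsWeight g) : IsWeight fun x => f x * g x :=
  ⟨hf.1.mul hg.1, hf.2.mul hg.2⟩

lemma coord_mul (hg : IsWeight g) (j : Fin d) : IsWeight fun x => x j * g x :=
  ⟨(contDiff_coord (n := 0) j).continuous.mul hg.1, hg.2.coord_mul j⟩

lemma sq_norm_mul (hg : IsWeight g) : IsWeight fun x => ‖x‖ ^ 2 * g x :=
  ⟨(continuous_norm.pow 2).mul hg.1, hg.2.sq_norm_mul⟩

lemma sum {ι : Type*} (s : Finset ι) {F : ι → E d → ℝ} (h : ∀ i ∈ s, IsWeight (F i)) :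
    IsWeight fun x => ∑ i ∈ s, F i x :=
  ⟨continuous_finsetSum _ fun i hi => (h i hi).1, Decays.sum s fun i hi => (h i hi).2⟩

end IsWeight

lemma IsProfile.isWeight {g : E d → ℝ} (hg : IsProfile g) : IsWeight g :=
  ⟨hg.contDiff.continuous, hg.decays⟩

lemma IsProfile.isWeight_pd {g : E d → ℝ} (hg : IsProfile g) (j : Fin d) : IsWeight (pd j g) :=
  ⟨hg.continuous_pd j, hg.decays_pd j⟩

lemma IsProfile.isWeight_laplacian {g : E d → ℝ} (hg : IsProfile g) :
    IsWeight (Laplacian.laplacian g) := ⟨hg.continuous_laplacian, hg.decays_laplacian⟩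

lemma IsProfile.isWeight_scaleGen {g : E d → ℝ} (hg : IsProfile g) : IsWeight (scaleGen g) :=
  (hg.isWeight.const_mul _).add (IsWeight.sum _ fun j _ => (hg.isWeight_pd j).coord_mul j)

/-- The pairing of a real weight with a complex function. -/
noncomputable def pair (g : E d → ℝ) (f : E d → ℂ) : ℂ := ∫ x, (g x : ℂ) * f x

section Pair

variable {g g' : E d → ℝ} {f f' : E d → ℂ}

lemma pair_integrable (hg : IsWeight g) (hf : MemLp f 2 volume) :
    Integrable (fun x => (g x : ℂ) * f x) volume := integrable_mul_of_memLp hg.memLp hf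

lemma norm_pair_le (hg : IsWeight g) (hf : MemLp f 2 volume) :
    ‖pair g f‖ ≤ l2Norm (fun x => (g x : ℂ)) * l2Norm f := norm_integral_mul_le hg.memLp hf

lemma pair_add_left (hg : IsWeight g) (hg' : IsWeight g') (hf : MemLp f 2 volume) :
    pair (fun x => g x + g' x) f = pair g f + pair g' f := by
  unfold pair
  rw [← integral_add (pair_integrable hg hf) (pair_integrable hg' hf)]
  exact integral_congr_ae (Eventually.of_forall fun x => by push_cast; ring)

lemma pair_add_right (hg : IsWeight g) (hf : MemLp f 2 volume) (hf' : MemLp f' 2 volume) :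
    pair g (fun x => f x + f' x) = pair g f + pair g f' := by
  unfold pair
  rw [← integral_add (pair_integrable hg hf) (pair_integrable hg hf')]
  exact integral_congr_ae (Eventually.of_forall fun x => by ring)

lemma pair_const_mul_left (c : ℝ) (g : E d → ℝ) (f : E d → ℂ) :
    pair (fun x => c * g x) f = c * pair g f := by
  unfold pair
  rw [← integral_const_mul]
  exact integral_congr_ae (Eventually.of_forall fun x => by push_cast; ring)

lemma pair_sum_left {ι : Type*} (s : Finset ι) {G : ι → E d → ℝ} (hG : ∀ i ∈ s, IsWeight (G i))
    (hf : MemLp f 2 volume) : pair (fun x => ∑ i ∈ s, G i x) f = ∑ i ∈ s, pair (G i) f := by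
  unfold pair
  rw [← integral_finsetSum _ fun i hi => pair_integrable (hG i hi) hf]
  exact integral_congr_ae (Eventually.of_forall fun x => by push_cast; rw [Finset.sum_mul])

lemma pair_ofReal (g h : E d → ℝ) : pair g (fun x => (h x : ℂ)) = ((∫ x, g x * h x : ℝ) : ℂ) := by
  unfold pair
  rw [← integral_complex_ofReal]
  exact integral_congr_ae (Eventually.of_forall fun x => by push_cast; ring)

end Pair

/-! ### Integration by parts -/

section Parts

/-- Green's formula for `u ∈ H¹` and a function of class `C²`. -/
lemma MemH1.sum_integral_weakPartial_mul_pd {u ψ : E d → ℂ} (hu : MemH1 u) (hψ : ContDiff ℝ 2 ψ)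
    (h1 : ∀ j, MemLp (pd j ψ) 2 volume) (h2 : MemLp (fun x => ∑ j, pd j (pd j ψ) x) 2 volume) :
    ∑ j, ∫ x, weakPartial j u x * pd j ψ x = - ∫ x, u x * ∑ j, pd j (pd j ψ) x := by
  -- Approximating u rather than ψ keeps the requirements on ψ low: only its gradient and its
  -- Laplacian as a whole have to be square integrable, not each second derivative.
  obtain ⟨χ, c1, c2, c3, c4, -⟩ := hu.exists_seq_test
  have m1 : ∀ n, MemLp (χ n) 2 volume := fun n => memLp_of_hasCompactSupport (c1 n).continuous (c2 n)
  have m2 : ∀ n j, MemLp (pd j (χ n)) 2 volume := fun n j => memLp_of_hasCompactSupport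
    (pd_contDiff (m := 0) j (c1 n) (by simp)).continuous (pd_hasCompactSupport j (c2 n))
  have T1 : TendstoL2 χ atTop u := ⟨Eventually.of_forall m1, hu.1, c3⟩
  have T2 : ∀ j, TendstoL2 (fun n => pd j (χ n)) atTop (weakPartial j u) := fun j =>
    ⟨Eventually.of_forall fun n => m2 n j, hu.memLp_weakPartial j, c4 j⟩
  have l1 := (T1.integral_mul (TendstoL2.const h2)).neg
  have l2 := tendsto_finsetSum Finset.univ fun j _ =>
    (T2 j).integral_mul (TendstoL2.const (h1 j))
  refine tendsto_nhds_unique l2 (l1.congr fun n => ?_)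
  have hc : ∀ j, ContDiff ℝ 1 (pd j ψ) := fun j => pd_contDiff j hψ (by norm_num)
  have hcc : ∀ j, Continuous (pd j (pd j ψ)) := fun j =>
    (pd_contDiff (m := 0) j (hc j) (by simp)).continuous
  have hcs : ∀ j, Integrable (fun x => χ n x * pd j (pd j ψ) x) volume := fun j =>
    ((c1 n).continuous.mul (hcc j)).integrable_of_hasCompactSupport (c2 n).mul_right
  have e : ∀ x, χ n x * ∑ j, pd j (pd j ψ) x = ∑ j, χ n x * pd j (pd j ψ) x := fun x =>
    Finset.mul_sum _ _ _
  simp only [e]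
  rw [integral_finsetSum _ fun j _ => hcs j, ← Finset.sum_neg_distrib]
  refine Finset.sum_congr rfl fun j _ => ?_
  have hp : Continuous (pd j (χ n)) := (pd_contDiff (m := 0) j (c1 n) (by simp)).continuous
  have := integral_mul_fderiv_eq_neg_fderiv_mul_of_integrable (μ := volume)
    (f := χ n) (g := pd j ψ) (v := stdVec j)
    ((hp.mul (hc j).continuous).integrable_of_hasCompactSupport (pd_hasCompactSupport j (c2 n)).mul_right)
    (hcs j)
    (((c1 n).continuous.mul (hc j).continuous).integrable_of_hasCompactSupport (c2 n).mul_right)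
    (fun x _ => (c1 n).differentiable (by simp) x) (fun x _ => (hc j).differentiable (by simp) x)
  rw [neg_eq_iff_eq_neg]
  exact this

variable {f g : E d → ℝ}

lemma integral_pd_mul (j : Fin d) (hf : ContDiff ℝ 1 f) (hg : ContDiff ℝ 1 g) (df : Decays f)
    (dg : Decays g) (dpf : Decays (pd j f)) (dpg : Decays (pd j g)) :
    ∫ x, pd j f x * g x = - ∫ x, f x * pd j g x := by
  have cf : Continuous (pd j f) := (pd_contDiff (m := 0) j hf (by simp)).continuous
  have cg : Continuous (pd j g) := (pd_contDiff (m := 0) j hg (by simp)).continuous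
  have := integral_mul_fderiv_eq_neg_fderiv_mul_of_integrable (μ := volume)
    (f := f) (g := g) (v := stdVec j) ((dpf.mul dg).integrable (cf.mul hg.continuous))
    ((df.mul dpg).integrable (hf.continuous.mul cg))
    ((df.mul dg).integrable (hf.continuous.mul hg.continuous))
    (fun x _ => hf.differentiable (by simp) x) (fun x _ => hg.differentiable (by simp) x)
  unfold pd
  rw [this, neg_neg]

lemma IsProfile.integral_pd_mul (hf : IsProfile f) (hg : IsProfile g) (j : Fin d) :
    ∫ x, pd j f x * g x = - ∫ x, f x * pd j g x :=
  RNLS.integral_pd_mul j (hf.contDiff.of_le (by norm_num)) (hg.contDiff.of_le (by norm_num))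
    hf.decays hg.decays (hf.decays_pd j) (hg.decays_pd j)

lemma IsProfile.memH1 (hg : IsProfile g) : MemH1 fun x => (g x : ℂ) := by
  refine memH1_of_contDiff (Complex.ofRealCLM.contDiff.comp (hg.contDiff.of_le (by norm_num)))
    hg.isWeight.memLp fun j => ?_
  rw [show pd j (fun x => (g x : ℂ)) = fun x => ((pd j g x : ℝ) : ℂ) from
    funext fun x => pd_ofReal j (hg.differentiable x)]
  exact (hg.isWeight_pd j).memLp

lemma IsProfile.integral_grad_mul_grad (hf : IsProfile f) (hg : IsProfile g) :
    ∑ j, ∫ x, pd j f x * pd j g x = - ∫ x, f x * Laplacian.laplacian g x := by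
  have e1 : ∀ j, pd j (fun x => (f x : ℂ)) = fun x => ((pd j f x : ℝ) : ℂ) := fun j =>
    funext fun x => pd_ofReal j (hf.differentiable x)
  have e2 : ∀ j, pd j (fun x => (g x : ℂ)) = fun x => ((pd j g x : ℝ) : ℂ) := fun j =>
    funext fun x => pd_ofReal j (hg.differentiable x)
  have e3 : ∀ x, ∑ j, pd j (pd j (fun x => (g x : ℂ))) x = ((Laplacian.laplacian g x : ℝ) : ℂ) := by
    intro x
    rw [hg.laplacian_eq]
    push_cast
    refine Finset.sum_congr rfl fun j _ => ?_
    rw [e2]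
    exact pd_ofReal j (hg.differentiable_pd j x)
  have hc1 : ContDiff ℝ 1 (fun x => (f x : ℂ)) :=
    Complex.ofRealCLM.contDiff.comp (hf.contDiff.of_le (by norm_num))
  have key := hf.memH1.sum_integral_weakPartial_mul_pd (ψ := fun x => (g x : ℂ))
    (Complex.ofRealCLM.contDiff.comp hg.contDiff)
    (fun j => by rw [e2]; exact (hg.isWeight_pd j).memLp)
    (by simp only [e3]; exact hg.isWeight_laplacian.memLp)
  simp only [e3] at key
  simp only [e2] at key
  have e4 : ∀ j, (∫ x, weakPartial j (fun x => (f x : ℂ)) x * ((pd j g x : ℝ) : ℂ))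
      = ((∫ x, pd j f x * pd j g x : ℝ) : ℂ) := fun j => by
    rw [← integral_complex_ofReal]
    have hae := (isWeakPartial_of_contDiff (j := j) hc1 hf.isWeight.memLp
      (by rw [e1]; exact (hf.isWeight_pd j).memLp)).ae_eq
    refine integral_congr_ae (hae.mono fun x hx => ?_)
    simp only [hx, e1]
    push_cast; ring
  simp only [e4] at key
  have e5 : (∫ x, (f x : ℂ) * ((Laplacian.laplacian g x : ℝ) : ℂ))
      = ((∫ x, f x * Laplacian.laplacian g x : ℝ) : ℂ) := by
    rw [← integral_complex_ofReal]
    exact integral_congr_ae (Eventually.of_forall fun x => by push_cast; ring)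
  rw [e5] at key
  exact_mod_cast key

lemma IsProfile.integral_laplacian_mul (hf : IsProfile f) (hg : IsProfile g) :
    ∫ x, Laplacian.laplacian f x * g x = ∫ x, f x * Laplacian.laplacian g x := by
  have h1 := hf.integral_grad_mul_grad hg
  have h2 := hg.integral_grad_mul_grad hf
  have h3 : ∑ j, ∫ x, pd j f x * pd j g x = ∑ j, ∫ x, pd j g x * pd j f x :=
    Finset.sum_congr rfl fun j _ => integral_congr_ae (Eventually.of_forall fun x => mul_comm _ _)
  have h4 : (∫ x, Laplacian.laplacian f x * g x) = ∫ x, g x * Laplacian.laplacian f x :=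
    integral_congr_ae (Eventually.of_forall fun x => mul_comm _ _)
  rw [h4]
  linarith

/-- The generator of the scaling is skew-adjoint. -/
lemma IsProfile.integral_scaleGen_mul (hf : IsProfile f) (hg : IsProfile g) :
    ∫ x, scaleGen f x * g x = - ∫ x, f x * scaleGen g x := by
  have i1 := (hf.isWeight.mul hg.isWeight).integrable
  have i2 : ∀ j, Integrable (fun x => pd j f x * (x j * g x)) volume := fun j =>
    ((hf.isWeight_pd j).mul (hg.isWeight.coord_mul j)).integrable
  have i3 : ∀ j, Integrable (fun x => f x * (x j * pd j g x)) volume := fun j =>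
    (hf.isWeight.mul ((hg.isWeight_pd j).coord_mul j)).integrable
  have e1 : ∀ j, ∫ x, pd j f x * (x j * g x) = - (∫ x, f x * g x) - ∫ x, f x * (x j * pd j g x) := by
    intro j
    rw [hf.integral_pd_mul (hg.coord_mul j) j, ← neg_add', neg_inj, ← integral_add i1 (i3 j)]
    refine integral_congr_ae (Eventually.of_forall fun x => ?_)
    simp only [pd_coord_mul j j (hg.differentiable x), if_true]
    ring
  have h1 : (∫ x, scaleGen f x * g x)
      = (d : ℝ) / 2 * (∫ x, f x * g x) + ∑ j, ∫ x, pd j f x * (x j * g x) := by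
    rw [← integral_const_mul, ← integral_finsetSum _ fun j _ => i2 j, ← integral_add (i1.const_mul _)
      (integrable_finsetSum _ fun j _ => i2 j)]
    refine integral_congr_ae (Eventually.of_forall fun x => ?_)
    simp only [scaleGen, add_mul, Finset.sum_mul]
    congr 1
    · ring
    · exact Finset.sum_congr rfl fun j _ => by ring
  have h2 : (∫ x, f x * scaleGen g x)
      = (d : ℝ) / 2 * (∫ x, f x * g x) + ∑ j, ∫ x, f x * (x j * pd j g x) := by
    rw [← integral_const_mul, ← integral_finsetSum _ fun j _ => i3 j, ← integral_add (i1.const_mul _)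
      (integrable_finsetSum _ fun j _ => i3 j)]
    refine integral_congr_ae (Eventually.of_forall fun x => ?_)
    simp only [scaleGen, mul_add, Finset.mul_sum]
    congr 1
    ring
  rw [h1, h2]
  simp only [e1, Finset.sum_sub_distrib, Finset.sum_const, Finset.card_univ, Fintype.card_fin,
    nsmul_eq_mul]
  ring

end Parts

/-! ### Parity -/

lemma integral_eq_zero_of_odd {F : E d → ℝ} (h : ∀ x, F (-x) = - F x) : ∫ x, F x = 0 := by
  have h1 := integral_neg_eq_self F (volume : Measure (E d))
  simp only [h, integral_neg] at h1
  linarith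

lemma pd_neg_of_even {f : E d → ℝ} (hf : ∀ x, f (-x) = f x) (j : Fin d) (x : E d) :
    pd j f (-x) = - pd j f x := by
  have e : f ∘ (ContinuousLinearEquiv.neg ℝ : E d ≃L[ℝ] E d) = f := funext hf
  have := (ContinuousLinearEquiv.neg ℝ : E d ≃L[ℝ] E d).comp_right_fderiv (f := f) (x := x)
  rw [e] at this
  unfold pd
  rw [this]
  simp

lemma scaleGen_neg_of_even {f : E d → ℝ} (hf : ∀ x, f (-x) = f x) (x : E d) :
    scaleGen f (-x) = scaleGen f x := by
  unfold scaleGen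
  rw [hf]
  congr 1
  exact Finset.sum_congr rfl fun j _ => by rw [pd_neg_of_even hf]; simp

/-! ### The linearized operators -/

/-- `L₋ = -Δ + 1 - Q^{4/d}`. -/
noncomputable def linMinus (Q g : E d → ℝ) (x : E d) : ℝ :=
  - Laplacian.laplacian g x + g x - Q x ^ crit d * g x

/-- `L₊ = -Δ + 1 - (1 + 4/d) Q^{4/d}`. -/
noncomputable def linPlus (Q g : E d → ℝ) (x : E d) : ℝ :=
  - Laplacian.laplacian g x + g x - (1 + crit d) * (Q x ^ crit d * g x)

section Identities

variable {Q ρ g : E d → ℝ}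

lemma IsGroundState.linMinus_self (hQ : IsGroundState Q) (x : E d) : linMinus Q Q x = 0 := by
  unfold linMinus; rw [hQ.laplacian_eq]; ring

/-- Since L₋Q = 0, only the commutator of -Δ with x_j survives, and it equals -2∂_j. -/
lemma IsGroundState.linMinus_coord_mul (hQ : IsGroundState Q) (hd : d = 1 ∨ d = 2) (j : Fin d)
    (x : E d) : linMinus Q (fun x => x j * Q x) x = - 2 * pd j Q x := by
  unfold linMinus
  rw [(hQ.isProfile hd).laplacian_coord_mul, hQ.laplacian_eq]; ring

/-- Since L₋Q = 0, only the commutator of -Δ with |x|² survives, and it equals -2d - 4x·∇ = -4Λ. -/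
lemma IsGroundState.linMinus_sq_norm_mul (hQ : IsGroundState Q) (hd : d = 1 ∨ d = 2)
    (x : E d) : linMinus Q (fun x => ‖x‖ ^ 2 * Q x) x = - 4 * scaleGen Q x := by
  have hp := hQ.isProfile hd
  unfold linMinus
  have e : Laplacian.laplacian (fun x => ‖x‖ ^ 2 * Q x) x
      = ‖x‖ ^ 2 * Laplacian.laplacian Q x + (2 * d * Q x + 4 * ∑ j, x j * pd j Q x) := by
    rw [sq_norm_mul_eq, IsProfile.laplacian_sum _ fun j _ => (hp.coord_mul j).coord_mul j]
    have : ∀ j, Laplacian.laplacian (fun x => x j * (x j * Q x)) x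
        = x j * x j * Laplacian.laplacian Q x + (2 * Q x + 4 * (x j * pd j Q x)) := fun j => by
      rw [(hp.coord_mul j).laplacian_coord_mul, hp.laplacian_coord_mul,
        pd_coord_mul j j (hp.differentiable x), if_pos rfl]
      ring
    simp only [this, Finset.sum_add_distrib, ← Finset.sum_mul, ← Finset.mul_sum, ← sq_norm_eq_sum,
      Finset.sum_const, Finset.card_univ, Fintype.card_fin, nsmul_eq_mul]
    ring
  rw [e, hQ.laplacian_eq, scaleGen]
  ring

/-- Translation invariance: this is the derivative of the ground state equation along ∂_j. -/
lemma IsGroundState.linPlus_pd (hQ : IsGroundState Q) (j : Fin d) (x : E d) :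
    linPlus Q (pd j Q) x = 0 := by
  unfold linPlus; rw [hQ.laplacian_pd]; ring

lemma IsGroundState.isProfile_scaleGen (hQ : IsGroundState Q) (hd : d = 1 ∨ d = 2) :
    IsProfile (scaleGen Q) := RNLS.isProfile_scaleGen (hQ.isProfile hd) (hQ.isProfile_pd hd)

/-- Scaling: the functions μ^{d/2} Q(μx) solve the equation with mass term μ² in place of one, and Λ
is the derivative in μ at μ = 1. Mass criticality enters as (4/d) · d = 4. -/
lemma IsGroundState.linPlus_scaleGen (hQ : IsGroundState Q) (hd : d = 1 ∨ d = 2) (x : E d) :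
    linPlus Q (scaleGen Q) x = - 2 * Q x := by
  have hp := hQ.isProfile hd
  have hpd := hQ.isProfile_pd hd
  have e : Laplacian.laplacian (scaleGen Q) x
      = ((d : ℝ) / 2 + 2) * Laplacian.laplacian Q x
        + (1 - (1 + crit d) * Q x ^ crit d) * ∑ j, x j * pd j Q x := by
    unfold scaleGen
    rw [IsProfile.laplacian_add (hp.const_mul _) (IsProfile.sum _ fun j _ => (hpd j).coord_mul j),
      hp.laplacian_const_mul, IsProfile.laplacian_sum _ fun j _ => (hpd j).coord_mul j]
    simp only [fun j => (hpd j).laplacian_coord_mul j x, hQ.laplacian_pd, Finset.sum_add_distrib,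
      ← Finset.mul_sum, ← hp.laplacian_eq]
    rw [Finset.mul_sum]
    have : ∑ j, x j * (pd j Q x - (1 + crit d) * Q x ^ crit d * pd j Q x)
        = ∑ j, (1 - (1 + crit d) * Q x ^ crit d) * (x j * pd j Q x) :=
      Finset.sum_congr rfl fun j _ => by ring
    rw [this]; ring
  have hcd : (crit d : ℝ) * d = 4 := by
    rcases hd with rfl | rfl <;> norm_num [crit]
  unfold linPlus
  rw [e, hQ.laplacian_eq, scaleGen, pow_add]
  linear_combination (-(1 / 2) * Q x ^ crit d * Q x) * hcd

lemma IsRho.linPlus_self (hρ : IsRho Q ρ) (hd : d = 1 ∨ d = 2) (x : E d) :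
    linPlus Q ρ x = - (‖x‖ ^ 2 * Q x) := by
  unfold linPlus; rw [hρ.laplacian_eq hd]; ring

lemma IsGroundState.neg (hQ : IsGroundState Q) (x : E d) : Q (-x) = Q x := hQ.radial _ _ (norm_neg x)

lemma IsRho.neg (hρ : IsRho Q ρ) (x : E d) : ρ (-x) = ρ x := hρ.radial _ _ (norm_neg x)

lemma IsGroundState.isWeight_pow_mul (hQ : IsGroundState Q) (hd : d = 1 ∨ d = 2) (n : ℕ)
    (hg : IsWeight g) : IsWeight fun x => Q x ^ n * g x :=
  ⟨(hQ.smooth.continuous.pow n).mul hg.1, hQ.decays_pow_mul hd n hg.2⟩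

lemma IsProfile.isWeight_linPlus (hg : IsProfile g) (hQ : IsGroundState Q) (hd : d = 1 ∨ d = 2) :
    IsWeight (linPlus Q g) := by
  have := ((hg.isWeight_laplacian.const_mul (-1)).add hg.isWeight).add
    ((hQ.isWeight_pow_mul hd (crit d) hg.isWeight).const_mul (-(1 + crit d)))
  convert this using 2 with x
  unfold linPlus; ring

/-- Self-adjointness together with L₋Q = 0. It removes the terms of order zero in η from the
evolution of every pairing. -/
lemma IsProfile.integral_linMinus_mul (hg : IsProfile g) (hQ : IsGroundState Q)
    (hd : d = 1 ∨ d = 2) : ∫ x, linMinus Q g x * Q x = 0 := by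
  have hp := hQ.isProfile hd
  have i1 := (hg.isWeight_laplacian.mul hp.isWeight).integrable
  have i2 := (hg.isWeight.mul hp.isWeight_laplacian).integrable
  have e : ∀ x, linMinus Q g x * Q x
      = g x * Laplacian.laplacian Q x - Laplacian.laplacian g x * Q x := fun x => by
    unfold linMinus; rw [hQ.laplacian_eq, pow_add]; ring
  simp only [e]
  rw [integral_sub i2 i1, hg.integral_laplacian_mul hp, sub_self]

lemma IsProfile.integral_linPlus_mul {f : E d → ℝ} (hf : IsProfile f) (hg : IsProfile g)
    (hQ : IsGroundState Q) (hd : d = 1 ∨ d = 2) :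
    ∫ x, linPlus Q f x * g x = ∫ x, f x * linPlus Q g x := by
  have i1 := (hf.isWeight_laplacian.mul hg.isWeight).integrable
  have i2 := (hf.isWeight.mul hg.isWeight_laplacian).integrable
  have i3 := ((hf.isWeight_linPlus hQ hd).mul hg.isWeight).integrable
  have e : ∀ x, f x * linPlus Q g x
      = linPlus Q f x * g x + (Laplacian.laplacian f x * g x - f x * Laplacian.laplacian g x) :=
    fun x => by unfold linPlus; ring
  simp only [e]
  have i4 : Integrable (fun x => Laplacian.laplacian f x * g x - f x * Laplacian.laplacian g x)
    volume := i1.sub i2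
  rw [integral_add i3 i4, integral_sub i1 i2, hf.integral_laplacian_mul hg]; ring

/-! ### Integrals of the profiles -/

lemma IsGroundState.integral_sq_pos (hQ : IsGroundState Q) (hd : d = 1 ∨ d = 2) :
    0 < ∫ x, Q x * Q x := by
  have hw := (hQ.isProfile hd).isWeight
  rw [integral_pos_iff_support_of_nonneg (fun x => mul_self_nonneg _) (hw.mul hw).integrable]
  have : Function.support (fun x => Q x * Q x) = univ := by
    ext x; simp [(hQ.pos x).ne']
  rw [this]
  exact isOpen_univ.measure_pos _ univ_nonempty

lemma IsGroundState.integral_sq_norm_pos (hQ : IsGroundState Q) (hd : d = 1 ∨ d = 2) :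
    0 < ∫ x, ‖x‖ ^ 2 * Q x * Q x := by
  have hw := (hQ.isProfile hd).isWeight
  rw [integral_pos_iff_support_of_nonneg (fun x => by
      have := hQ.pos x; positivity) (hw.sq_norm_mul.mul hw).integrable]
  have : Function.support (fun x => ‖x‖ ^ 2 * Q x * Q x) = {0}ᶜ := by
    ext x; simp [(hQ.pos x).ne']
  rw [this]
  refine isOpen_compl_singleton.measure_pos _ ⟨stdVec ⟨0, by omega⟩, fun h => ?_⟩
  have := norm_stdVec (d := d) ⟨0, by omega⟩
  rw [h] at this; simp at this

/-- Q ∂_jQ is half the derivative of Q², and one integration by parts moves ∂_j to x_i. -/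
lemma IsGroundState.integral_coord_mul_pd (hQ : IsGroundState Q) (hd : d = 1 ∨ d = 2) (i j : Fin d) :
    ∫ x, x i * Q x * pd j Q x = if i = j then - (∫ x, Q x * Q x) / 2 else 0 := by
  have hp := hQ.isProfile hd
  have h1 := (hp.coord_mul i).integral_pd_mul hp j
  have h2 : (∫ x, pd j (fun x => x i * Q x) x * Q x)
      = (if j = i then ∫ x, Q x * Q x else 0) + ∫ x, x i * Q x * pd j Q x := by
    have i1 := (hp.isWeight.mul hp.isWeight).integrable
    have i2 := ((hp.isWeight.coord_mul i).mul (hp.isWeight_pd j)).integrable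
    have : (if j = i then ∫ x, Q x * Q x else 0) = ∫ x, (if j = i then (1 : ℝ) else 0) * (Q x * Q x) := by
      rw [integral_const_mul]; split_ifs <;> simp
    rw [this, ← integral_add (i1.const_mul _) i2]
    refine integral_congr_ae (Eventually.of_forall fun x => ?_)
    simp only [pd_coord_mul i j (hp.differentiable x)]
    split_ifs <;> ring
  rw [h2] at h1
  by_cases hij : i = j
  · subst hij
    simp only [if_true] at h1 ⊢
    linarith
  · rw [if_neg (Ne.symm hij)] at h1
    rw [if_neg hij]
    linarith

lemma IsGroundState.integral_mul_scaleGen (hQ : IsGroundState Q) (hd : d = 1 ∨ d = 2) :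
    ∫ x, Q x * scaleGen Q x = 0 := by
  have hp := hQ.isProfile hd
  have h1 := hp.integral_scaleGen_mul hp
  have h2 : (∫ x, scaleGen Q x * Q x) = ∫ x, Q x * scaleGen Q x :=
    integral_congr_ae (Eventually.of_forall fun x => mul_comm _ _)
  linarith

lemma IsProfile.scaleGen_sq_norm_mul (hg : IsProfile g) (x : E d) :
    scaleGen (fun x => ‖x‖ ^ 2 * g x) x = ‖x‖ ^ 2 * scaleGen g x + 2 * (‖x‖ ^ 2 * g x) := by
  have : ∀ j, pd j (fun x => ‖x‖ ^ 2 * g x) x = 2 * x j * g x + ‖x‖ ^ 2 * pd j g x := fun j => by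
    rw [pd_mul' (f := fun x : E d => ‖x‖ ^ 2) j (hasFDerivAt_sq_norm x).differentiableAt
      (hg.differentiable x)]
    congr 2
    have h := pd_comp_sq_norm (h := fun s => s) (x := x) (hasDerivAt_id _) j
    simpa using h
  unfold scaleGen
  simp only [this, mul_add, Finset.sum_add_distrib]
  have e1 : ∑ j, x j * (2 * x j * g x) = 2 * (‖x‖ ^ 2 * g x) := by
    rw [sq_norm_eq_sum, Finset.sum_mul, Finset.mul_sum]
    exact Finset.sum_congr rfl fun j _ => by ring
  have e2 : ∑ j, x j * (‖x‖ ^ 2 * pd j g x) = ‖x‖ ^ 2 * ∑ j, x j * pd j g x := by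
    rw [Finset.mul_sum]; exact Finset.sum_congr rfl fun j _ => by ring
  rw [e1, e2]; ring

/-- Λ is skew-adjoint and its commutator with |x|² is 2|x|². -/
lemma IsGroundState.integral_sq_norm_mul_scaleGen (hQ : IsGroundState Q) (hd : d = 1 ∨ d = 2) :
    ∫ x, ‖x‖ ^ 2 * Q x * scaleGen Q x = - ∫ x, ‖x‖ ^ 2 * Q x * Q x := by
  have hp := hQ.isProfile hd
  have h1 := hp.sq_norm_mul.integral_scaleGen_mul hp
  have i1 := (hp.isWeight_scaleGen.sq_norm_mul.mul hp.isWeight).integrable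
  have i2 := (hp.isWeight.sq_norm_mul.mul hp.isWeight).integrable
  have h2 : (∫ x, scaleGen (fun x => ‖x‖ ^ 2 * Q x) x * Q x)
      = (∫ x, ‖x‖ ^ 2 * Q x * scaleGen Q x) + 2 * ∫ x, ‖x‖ ^ 2 * Q x * Q x := by
    rw [← integral_const_mul, show (∫ x, ‖x‖ ^ 2 * Q x * scaleGen Q x)
      = ∫ x, ‖x‖ ^ 2 * scaleGen Q x * Q x from
        integral_congr_ae (Eventually.of_forall fun x => by ring), ← integral_add i1 (i2.const_mul 2)]
    refine integral_congr_ae (Eventually.of_forall fun x => ?_)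
    simp only [hp.scaleGen_sq_norm_mul]; ring
  linarith

/-- -2⟨ρ, Q⟩ = ⟨ρ, L₊ΛQ⟩ = ⟨L₊ρ, ΛQ⟩ = -⟨|x|²Q, ΛQ⟩ = ‖xQ‖². That this is not zero is what makes the
equation for θ solvable from the condition on ρ. -/
lemma IsRho.integral_mul (hρ : IsRho Q ρ) (hQ : IsGroundState Q) (hd : d = 1 ∨ d = 2) :
    ∫ x, ρ x * Q x = - (∫ x, ‖x‖ ^ 2 * Q x * Q x) / 2 := by
  have h1 := (hρ.isProfile hQ hd).integral_linPlus_mul (hQ.isProfile_scaleGen hd) hQ hd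
  have e1 : (∫ x, linPlus Q ρ x * scaleGen Q x) = - ∫ x, ‖x‖ ^ 2 * Q x * scaleGen Q x := by
    rw [← integral_neg]
    exact integral_congr_ae (Eventually.of_forall fun x => by
      simp only [hρ.linPlus_self hd]; ring)
  have e2 : (∫ x, ρ x * linPlus Q (scaleGen Q) x) = -2 * ∫ x, ρ x * Q x := by
    rw [← integral_const_mul]
    exact integral_congr_ae (Eventually.of_forall fun x => by
      simp only [hQ.linPlus_scaleGen hd]; ring)
  rw [e1, e2, hQ.integral_sq_norm_mul_scaleGen hd] at h1
  linarith

end Identities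

end RNLS

namespace RNLS

open scoped ContDiff

variable {d : ℕ}

/-! ### Affine changes of variables -/

section Affine

variable {f g : E d → ℂ} {r : ℝ} {a : E d}

lemma map_affine (hr : 0 < r) (a : E d) :
    Measure.map (fun y : E d => r • y + a) volume
      = ENNReal.ofReal |(r ^ Module.finrank ℝ (E d))⁻¹| • (volume : Measure (E d)) := by
  have h1 := Measure.map_addHaar_smul (volume : Measure (E d)) hr.ne'
  have h2 : (fun y : E d => r • y + a) = (fun y => y + a) ∘ (fun y => r • y) := rfl
  rw [h2, ← Measure.map_map (measurable_add_const a) (measurable_const_smul r), h1,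
    Measure.map_smul, map_add_right_eq_self]

lemma measurable_affine (r : ℝ) (a : E d) : Measurable fun y : E d => r • y + a :=
  (measurable_const_smul r).add_const a

lemma memLp_comp_affine (hf : MemLp f 2 volume) (hr : 0 < r) (a : E d) :
    MemLp (fun y => f (r • y + a)) 2 volume := by
  have h : MemLp f 2 (Measure.map (fun y : E d => r • y + a) volume) := by
    rw [map_affine hr a]
    exact hf.smul_measure (by simp)
  exact h.comp_of_map (measurable_affine r a).aemeasurable

lemma integral_comp_affine {F : Type*} [NormedAddCommGroup F] [NormedSpace ℝ F] (h : E d → F)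
    (hr : 0 < r) (a : E d) : ∫ y, h (r • y + a) = (r ^ d)⁻¹ • ∫ x, h x := by
  have h1 := Measure.integral_comp_smul (volume : Measure (E d)) (fun x => h (x + a)) r
  rw [h1, integral_add_right_eq_self h a, abs_of_pos (by positivity)]
  simp

lemma l2Norm_comp_affine (hf : MemLp f 2 volume) (hr : 0 < r) (a : E d) :
    l2Norm (fun y => f (r • y + a)) = r ^ (-(d : ℝ) / 2) * l2Norm f := by
  have h1 := l2Norm_sq (memLp_comp_affine hf hr a)
  have h0 : 0 ≤ r ^ (-(d : ℝ) / 2) := by positivity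
  rw [integral_comp_affine (fun x => ‖f x‖ ^ 2) hr a, ← l2Norm_sq hf] at h1
  have h2 : (r ^ (-(d : ℝ) / 2)) ^ 2 = (r ^ d)⁻¹ := by
    rw [← Real.rpow_natCast, ← Real.rpow_mul hr.le, ← Real.rpow_natCast, ← Real.rpow_neg hr.le]
    congr 1; push_cast; ring
  rw [smul_eq_mul, ← h2, ← mul_pow] at h1
  exact (pow_left_inj₀ (l2Norm_nonneg _) (mul_nonneg h0 (l2Norm_nonneg _)) two_ne_zero).mp h1

lemma hasFDerivAt_affine_inv (r : ℝ) (a x : E d) :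
    HasFDerivAt (fun x : E d => r • (x - a)) (r • ContinuousLinearMap.id ℝ (E d)) x :=
  ((hasFDerivAt_id x).sub_const a).const_smul r

lemma pd_comp_affine {F : Type*} [NormedAddCommGroup F] [NormedSpace ℝ F] {h : E d → F} {x : E d}
    (hh : DifferentiableAt ℝ h (r • (x - a))) (j : Fin d) :
    pd j (fun x => h (r • (x - a))) x = r • pd j h (r • (x - a)) := by
  have := (hh.hasFDerivAt.comp x (hasFDerivAt_affine_inv r a x)).fderiv
  unfold pd
  rw [show (fun x => h (r • (x - a))) = h ∘ fun x => r • (x - a) from rfl, this]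
  simp

lemma affine_inv_affine (hr : 0 < r) (a y : E d) : r⁻¹ • (r • y + a - a) = y := by
  rw [add_sub_cancel_right, smul_smul, inv_mul_cancel₀ hr.ne', one_smul]

lemma affine_affine_inv (hr : 0 < r) (a x : E d) : r • (r⁻¹ • (x - a)) + a = x := by
  rw [smul_smul, mul_inv_cancel₀ hr.ne', one_smul, sub_add_cancel]

lemma IsWeakPartial.comp_affine {j : Fin d} (h : IsWeakPartial j f g) (hr : 0 < r) (a : E d) :
    IsWeakPartial j (fun y => f (r • y + a)) (fun y => (r : ℂ) * g (r • y + a)) := by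
  refine ⟨(memLp_comp_affine h.1 hr a).const_mul _, fun ψ h1 h2 => ?_⟩
  set χ : E d → ℝ := fun x => ψ (r⁻¹ • (x - a)) with hχ
  have c1 : ContDiff ℝ ∞ χ := h1.comp ((contDiff_id.sub contDiff_const).const_smul r⁻¹)
  let e : E d ≃ₜ E d := (Homeomorph.addRight (-a)).trans (Homeomorph.smulOfNeZero r⁻¹ (inv_ne_zero hr.ne'))
  have c2 : HasCompactSupport χ := by
    have : χ = ψ ∘ e := by
      funext x; simp [hχ, e, sub_eq_add_neg]
    rw [this]
    exact h2.comp_homeomorph e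
  have key := h.2 χ c1 c2
  have e1 : ∀ y, fderiv ℝ χ (r • y + a) (stdVec j) = r⁻¹ * fderiv ℝ ψ y (stdVec j) := fun y => by
    have := pd_comp_affine (r := r⁻¹) (a := a) (x := r • y + a) (h := ψ)
      (h1.differentiable (by simp) _) j
    rw [affine_inv_affine hr] at this
    exact this
  have e2 : ∀ y, χ (r • y + a) = ψ y := fun y => by rw [hχ]; simp only [affine_inv_affine hr]
  have i1 := integral_comp_affine (fun x => f x * ((fderiv ℝ χ x (stdVec j) : ℝ) : ℂ)) hr a
  have i2 := integral_comp_affine (fun x => g x * (χ x : ℂ)) hr a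
  rw [key, smul_neg, ← i2] at i1
  simp only [e1, e2] at i1
  have i3 : (∫ y, f (r • y + a) * ((r⁻¹ * fderiv ℝ ψ y (stdVec j) : ℝ) : ℂ))
      = (r : ℂ)⁻¹ * ∫ y, f (r • y + a) * ((fderiv ℝ ψ y (stdVec j) : ℝ) : ℂ) := by
    rw [← integral_const_mul]
    exact integral_congr_ae (Eventually.of_forall fun y => by push_cast; ring)
  have i4 : (∫ y, (r : ℂ) * g (r • y + a) * (ψ y : ℂ)) = (r : ℂ) * ∫ y, g (r • y + a) * (ψ y : ℂ) := by
    rw [← integral_const_mul]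
    exact integral_congr_ae (Eventually.of_forall fun y => by ring)
  rw [i3] at i1
  have hr' : (r : ℂ) ≠ 0 := by exact_mod_cast hr.ne'
  rw [i4, ← mul_neg, ← i1, ← mul_assoc, mul_inv_cancel₀ hr', one_mul]

lemma MemH1.comp_affine (hf : MemH1 f) (hr : 0 < r) (a : E d) :
    MemH1 fun y => f (r • y + a) :=
  .of_isWeakPartial (memLp_comp_affine hf.1 hr a)
    fun j => (hf.isWeakPartial j).comp_affine hr a

end Affine

/-! ### Modulated profiles at a fixed time -/

namespace ModPath

variable (p : ModPath d) (t : ℝ)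

/-- The rescaled space variable. -/
noncomputable def point (x : E d) : E d := (p.lam t)⁻¹ • (x - p.al t)

/-- The total phase. -/
noncomputable def angle (y : E d) : ℝ := p.phase t y + p.th t

/-- Multiplication by the conjugate of the modulation phase. -/
noncomputable def twist (G : E d → ℂ) (y : E d) : ℂ :=
  G y * Complex.exp (((-p.angle t y : ℝ) : ℂ) * Complex.I)

/-- The conjugate of a modulated profile. -/
noncomputable def wave (G : E d → ℂ) (x : E d) : ℂ :=
  ((p.lam t ^ (-(d : ℝ) / 2) : ℝ) : ℂ) * p.twist t G (p.point t x)

/-- The function in rescaled variables. -/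
noncomputable def resc (f : E d → ℂ) (y : E d) : ℂ :=
  ((p.lam t ^ ((d : ℝ) / 2) : ℝ) : ℂ) * p.twist t (fun y => f (p.lam t • y + p.al t)) y

/-- The gradient of the phase. -/
noncomputable def slope (j : Fin d) (y : E d) : ℝ := p.be t j - p.ga t / 2 * y j

/-- The covariant derivative associated with the modulation phase. -/
noncomputable def covd (j : Fin d) (G : E d → ℂ) (y : E d) : ℂ :=
  pd j G y - Complex.I * (p.slope t j y : ℂ) * G y

variable {p t}

lemma norm_twist (G : E d → ℂ) (y : E d) : ‖p.twist t G y‖ = ‖G y‖ := by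
  rw [twist, norm_mul, Complex.norm_exp_ofReal_mul_I, mul_one]

lemma continuous_angle : Continuous (p.angle t) := by
  unfold angle phase; fun_prop

lemma continuous_phase_exp :
    Continuous fun y => Complex.exp (((-p.angle t y : ℝ) : ℂ) * Complex.I) := by
  have : Continuous (p.angle t) := continuous_angle
  fun_prop

lemma memLp_twist {G : E d → ℂ} (hG : MemLp G 2 volume) : MemLp (p.twist t G) 2 volume :=
  hG.of_le (hG.1.mul continuous_phase_exp.aestronglyMeasurable)
    (Eventually.of_forall fun y => (norm_twist G y).le)

lemma memLp_wave (hl : 0 < p.lam t) {G : E d → ℂ} (hG : MemLp G 2 volume) :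
    MemLp (p.wave t G) 2 volume := by
  have h := memLp_comp_affine (memLp_twist (p := p) (t := t) hG) (inv_pos.mpr hl)
    (-((p.lam t)⁻¹ • p.al t))
  refine (h.const_mul ((p.lam t ^ (-(d : ℝ) / 2) : ℝ) : ℂ)).ae_eq (Eventually.of_forall fun x => ?_)
  simp only [wave, point, sub_eq_add_neg, smul_add, smul_neg]

lemma l2Norm_wave (hl : 0 < p.lam t) {G : E d → ℂ} (hG : MemLp G 2 volume) :
    l2Norm (p.wave t G) = l2Norm G := by
  have h := l2Norm_comp_affine (memLp_twist (p := p) (t := t) hG) (inv_pos.mpr hl)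
    (-((p.lam t)⁻¹ • p.al t))
  have e : p.wave t G = fun x => ((p.lam t ^ (-(d : ℝ) / 2) : ℝ) : ℂ)
      * p.twist t G ((p.lam t)⁻¹ • x + -((p.lam t)⁻¹ • p.al t)) := by
    funext x; simp only [wave, point, sub_eq_add_neg, smul_add, smul_neg]
  have h0 : 0 < p.lam t ^ (-(d : ℝ) / 2) := by positivity
  rw [e, l2Norm_const_mul, h, l2Norm_congr_norm (norm_twist (p := p) (t := t) G), Complex.norm_real,
    Real.norm_eq_abs, abs_of_pos h0, Real.inv_rpow hl.le, ← mul_assoc, mul_inv_cancel₀ h0.ne', one_mul]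

lemma memLp_resc (hl : 0 < p.lam t) {f : E d → ℂ} (hf : MemLp f 2 volume) :
    MemLp (p.resc t f) 2 volume :=
  (memLp_twist (memLp_comp_affine hf hl (p.al t))).const_mul _

lemma l2Norm_resc (hl : 0 < p.lam t) {f : E d → ℂ} (hf : MemLp f 2 volume) :
    l2Norm (p.resc t f) = l2Norm f := by
  have h0 : 0 < p.lam t ^ (-(d : ℝ) / 2) := by positivity
  have h1 : p.lam t ^ ((d : ℝ) / 2) * p.lam t ^ (-(d : ℝ) / 2) = 1 := by
    rw [← Real.rpow_add hl]; ring_nf; simp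
  unfold resc
  rw [l2Norm_const_mul, l2Norm_congr_norm (norm_twist (p := p) (t := t) _),
    l2Norm_comp_affine hf hl, Complex.norm_real, Real.norm_eq_abs, abs_of_pos (by positivity),
    ← mul_assoc, h1, one_mul]

lemma rpow_half_mul (hl : 0 < p.lam t) :
    p.lam t ^ (-(d : ℝ) / 2) * p.lam t ^ d = p.lam t ^ ((d : ℝ) / 2) := by
  rw [← Real.rpow_natCast, ← Real.rpow_add hl]; congr 1; ring

/-- The basic change of variables. -/
lemma integral_mul_wave (hl : 0 < p.lam t) (f G : E d → ℂ) :
    ∫ x, f x * p.wave t G x = ∫ y, p.resc t f y * G y := by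
  have h := integral_comp_affine (fun x => f x * p.wave t G x) hl (p.al t)
  have hd : (p.lam t ^ d) ≠ 0 := by positivity
  rw [eq_comm, inv_smul_eq_iff₀ hd] at h
  rw [h, ← integral_smul]
  refine integral_congr_ae (Eventually.of_forall fun y => ?_)
  simp only [wave, resc, twist, point, affine_inv_affine hl, Complex.real_smul,
    ← rpow_half_mul hl]
  push_cast
  ring

lemma star_bubble (g : E d → ℝ) (x : E d) :
    star (p.bubble g t x) = p.wave t (fun y => (g y : ℂ)) x := by
  have e : ∀ s : ℝ, (starRingEnd ℂ) (Complex.exp ((s : ℂ) * Complex.I))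
      = Complex.exp (((-s : ℝ) : ℂ) * Complex.I) := fun s => by
    rw [← Complex.exp_conj]; simp
  simp only [bubble, deform, wave, twist, point, angle, Complex.star_def, map_mul, e,
    Complex.conj_ofReal]
  rw [neg_add, Complex.ofReal_add, add_mul, Complex.exp_add]
  ring

lemma resc_sub (f g : E d → ℂ) (y : E d) :
    p.resc t (fun x => f x - g x) y = p.resc t f y - p.resc t g y := by
  simp only [resc, twist]; ring

lemma rpow_half_cancel (hl : 0 < p.lam t) :
    ((p.lam t ^ ((d : ℝ) / 2) : ℝ) : ℂ) * ((p.lam t ^ (-(d : ℝ) / 2) : ℝ) : ℂ) = 1 := by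
  rw [← Complex.ofReal_mul, ← Real.rpow_add hl]; ring_nf; simp

lemma resc_bubble (hl : 0 < p.lam t) (g : E d → ℝ) (y : E d) :
    p.resc t (p.bubble g t) y = (g y : ℂ) := by
  simp only [resc, twist, bubble, deform, affine_inv_affine hl, angle]
  have e : Complex.exp ((p.phase t y : ℂ) * Complex.I) * Complex.exp ((p.th t : ℂ) * Complex.I)
      * Complex.exp (((-(p.phase t y + p.th t) : ℝ) : ℂ) * Complex.I) = 1 := by
    rw [← Complex.exp_add, ← Complex.exp_add]
    rw [Complex.exp_eq_one_iff]
    exact ⟨0, by push_cast; ring⟩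
  calc _ = (((p.lam t ^ ((d : ℝ) / 2) : ℝ) : ℂ) * ((p.lam t ^ (-(d : ℝ) / 2) : ℝ) : ℂ)) * (g y : ℂ)
        * (Complex.exp ((p.phase t y : ℂ) * Complex.I) * Complex.exp ((p.th t : ℂ) * Complex.I)
      * Complex.exp (((-(p.phase t y + p.th t) : ℝ) : ℂ) * Complex.I)) := by ring
    _ = _ := by rw [e, rpow_half_cancel hl]; ring

/-- ε retains the phase exp(iβ·y - iγ|y|²/4), which `resc` removes. The two remainders differ by a
unimodular factor, so their `L²` norms agree, although their gradients do not. -/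
lemma eps_eq (Q : E d → ℝ) (u : ℝ → E d → ℂ) (y : E d) :
    p.eps Q u t y = Complex.exp ((p.phase t y : ℂ) * Complex.I) * (p.resc t (u t) y - (Q y : ℂ)) := by
  have e : Complex.exp ((p.phase t y : ℂ) * Complex.I)
      * Complex.exp (((-(p.phase t y + p.th t) : ℝ) : ℂ) * Complex.I)
      = Complex.exp (-(p.th t : ℂ) * Complex.I) := by
    rw [← Complex.exp_add]; congr 1; push_cast; ring
  simp only [eps, resc, twist, deform, angle]
  rw [← e]; ring

lemma norm_eps (Q : E d → ℝ) (u : ℝ → E d → ℂ) (y : E d) :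
    ‖p.eps Q u t y‖ = ‖p.resc t (u t) y - (Q y : ℂ)‖ := by
  rw [eps_eq, norm_mul, Complex.norm_exp_ofReal_mul_I, one_mul]

/-! ### Spatial derivatives -/

lemma contDiff_angle {n : WithTop ℕ∞} : ContDiff ℝ n (p.angle t) := by
  unfold angle phase
  exact ((contDiff_const.inner ℝ contDiff_id).sub (contDiff_const.mul (contDiff_norm_sq ℝ))).add
    contDiff_const

lemma pd_angle (j : Fin d) (y : E d) : pd j (p.angle t) y = p.slope t j y := by
  have h1 : HasFDerivAt (fun y : E d => inner ℝ (p.be t) y) (innerSL ℝ (p.be t)) y :=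
    (innerSL ℝ (p.be t)).hasFDerivAt
  have h2 : HasFDerivAt (p.angle t)
      (innerSL ℝ (p.be t) - (p.ga t / 4) • (2 : ℝ) • innerSL ℝ y) y :=
    ((h1.sub ((hasFDerivAt_sq_norm y).const_mul (p.ga t / 4))).add_const (p.th t))
  unfold pd
  rw [h2.fderiv]
  simp [inner_stdVec, slope]
  ring

/-- Conjugation by the phase replaces ∂_j by the covariant derivative, with connection the gradient
β_j - γy_j/2 of the phase. -/
lemma pd_twist {G : E d → ℂ} {y : E d} (hG : DifferentiableAt ℝ G y) (j : Fin d) :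
    pd j (p.twist t G) y = p.twist t (p.covd t j G) y := by
  have hA : HasFDerivAt (p.angle t) (fderiv ℝ (p.angle t) y) y :=
    ((contDiff_angle (n := 1)).differentiable (by simp) y).hasFDerivAt
  have h1 : HasFDerivAt (fun y => ((-p.angle t y : ℝ) : ℂ) * Complex.I)
      ((Complex.ofRealCLM.comp (-fderiv ℝ (p.angle t) y)).smulRight Complex.I) y := by
    have := (Complex.ofRealCLM.hasFDerivAt.comp y hA.neg).mul_const Complex.I
    refine this.congr_fderiv ?_
    ext v
    simp [mul_comm]
  have h2 := h1.cexp
  have e : pd j (fun y => Complex.exp (((-p.angle t y : ℝ) : ℂ) * Complex.I)) y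
      = Complex.exp (((-p.angle t y : ℝ) : ℂ) * Complex.I) * (-(p.slope t j y : ℂ) * Complex.I) := by
    have h3 : fderiv ℝ (p.angle t) y (stdVec j) = p.slope t j y := pd_angle j y
    unfold pd
    rw [h2.fderiv]
    simp [h3]
  rw [show p.twist t G = fun y => G y * Complex.exp (((-p.angle t y : ℝ) : ℂ) * Complex.I) from rfl,
    pd_mul j hG h2.differentiableAt, e]
  simp only [twist, covd]
  ring

lemma contDiff_phase_exp {n : WithTop ℕ∞} :
    ContDiff ℝ n fun y => Complex.exp (((-p.angle t y : ℝ) : ℂ) * Complex.I) :=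
  ((Complex.ofRealCLM.contDiff.comp contDiff_angle.neg).mul contDiff_const).cexp

lemma contDiff_twist {G : E d → ℂ} {n : WithTop ℕ∞} (hG : ContDiff ℝ n G) :
    ContDiff ℝ n (p.twist t G) := hG.mul contDiff_phase_exp

lemma contDiff_wave {G : E d → ℂ} {n : WithTop ℕ∞} (hG : ContDiff ℝ n G) :
    ContDiff ℝ n (p.wave t G) :=
  contDiff_const.mul ((contDiff_twist hG).comp ((contDiff_id.sub contDiff_const).const_smul _))

lemma pd_wave {G : E d → ℂ} {x : E d} (hG : Differentiable ℝ G) (j : Fin d) :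
    pd j (p.wave t G) x = ((p.lam t)⁻¹ : ℝ) * p.wave t (p.covd t j G) x := by
  have hT : Differentiable ℝ (p.twist t G) := hG.mul (contDiff_phase_exp.differentiable (n := 1) (by simp))
  have h1 : DifferentiableAt ℝ (fun x => p.twist t G (p.point t x)) x :=
    (hT _).comp x (hasFDerivAt_affine_inv _ _ x).differentiableAt
  rw [show p.wave t G = fun x => ((p.lam t ^ (-(d : ℝ) / 2) : ℝ) : ℂ)
    * p.twist t G (p.point t x) from rfl, pd_mul j (differentiableAt_const _) h1]
  have h2 : pd j (fun x => p.twist t G (p.point t x)) x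
      = (p.lam t)⁻¹ • pd j (p.twist t G) (p.point t x) := pd_comp_affine (hT _) j
  rw [h2, pd_twist (hG _)]
  simp [pd, wave]
  ring

/-- The twisted Laplacian of a real profile. -/
lemma sum_covd_covd {g : E d → ℝ} (hg : IsProfile g) (y : E d) :
    ∑ j, p.covd t j (p.covd t j fun y => (g y : ℂ)) y
      = ((Laplacian.laplacian g y - (∑ j, p.slope t j y ^ 2) * g y : ℝ) : ℂ)
        + Complex.I * ((-2 * (∑ j, p.slope t j y * pd j g y) + d * p.ga t / 2 * g y : ℝ) : ℂ) := by
  have e1 : ∀ j, p.covd t j (fun y => (g y : ℂ))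
      = fun y => ((pd j g y : ℝ) : ℂ) - Complex.I * ((p.slope t j y * g y : ℝ) : ℂ) := fun j => by
    funext y
    simp only [covd, pd_ofReal j (hg.differentiable y)]
    push_cast; ring
  have hs : ∀ j y, DifferentiableAt ℝ (p.slope t j) y := fun j y => by
    unfold slope
    exact (differentiableAt_const _).sub
      (((contDiff_coord (n := 1) j).differentiable (by simp) y).const_mul _)
  have e2 : ∀ j, pd j (p.slope t j) y = - (p.ga t / 2) := fun j => by
    have h : p.slope t j = fun y => p.be t j + (-(p.ga t / 2)) * y j := by
      funext y; simp only [slope]; ring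
    rw [h, pd_add' j (differentiableAt_const _)
      (((contDiff_coord (n := 1) j).differentiable (by simp) y).const_mul _),
      pd_const_mul' j _ ((contDiff_coord (n := 1) j).differentiable (by simp) y), pd_coord]
    simp [pd]
  have e3 : ∀ j, pd j (fun y => ((pd j g y : ℝ) : ℂ) - Complex.I * ((p.slope t j y * g y : ℝ) : ℂ)) y
      = ((pd j (pd j g) y : ℝ) : ℂ)
        - Complex.I * ((-(p.ga t / 2) * g y + p.slope t j y * pd j g y : ℝ) : ℂ) := fun j => by
    have d1 : DifferentiableAt ℝ (fun y => ((pd j g y : ℝ) : ℂ)) y :=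
      Complex.ofRealCLM.differentiableAt.comp y (hg.differentiable_pd j y)
    have d2 : DifferentiableAt ℝ (fun y => p.slope t j y * g y) y :=
      (hs j y).mul (hg.differentiable y)
    have d3 : DifferentiableAt ℝ (fun y => ((p.slope t j y * g y : ℝ) : ℂ)) y :=
      Complex.ofRealCLM.differentiableAt.comp y d2
    rw [show pd j (fun y => ((pd j g y : ℝ) : ℂ) - Complex.I * ((p.slope t j y * g y : ℝ) : ℂ)) y
      = pd j (fun y => ((pd j g y : ℝ) : ℂ)) y
        - Complex.I * pd j (fun y => ((p.slope t j y * g y : ℝ) : ℂ)) y by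
      exact congrArg (fun L : E d →L[ℝ] ℂ => L (stdVec j))
        (d1.hasFDerivAt.sub (d3.hasFDerivAt.const_mul Complex.I)).fderiv]
    rw [pd_ofReal j (hg.differentiable_pd j y), pd_ofReal j d2, pd_mul' j (hs j y) (hg.differentiable y),
      e2]
  have e4 : ∀ j, p.covd t j (p.covd t j fun y => (g y : ℂ)) y
      = ((pd j (pd j g) y - p.slope t j y ^ 2 * g y : ℝ) : ℂ)
        + Complex.I * ((-2 * (p.slope t j y * pd j g y) + p.ga t / 2 * g y : ℝ) : ℂ) := fun j => by
    rw [e1, covd, e3]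
    push_cast
    linear_combination ((p.slope t j y : ℂ) ^ 2 * (g y : ℂ)) * Complex.I_sq
  simp only [e4, Finset.sum_add_distrib, ← Finset.mul_sum, ← Complex.ofReal_sum, hg.laplacian_eq,
    Finset.sum_sub_distrib, ← Finset.sum_mul, Finset.sum_const, Finset.card_univ, Fintype.card_fin,
    nsmul_eq_mul]
  push_cast
  ring

end ModPath

end RNLS

namespace RNLS

open scoped ContDiff

variable {d : ℕ}

namespace ModPath

variable {p : ModPath d} {I : Set ℝ} {t : ℝ} {g : E d → ℝ}

/-! ### Time derivatives of modulated profiles -/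

/-- The velocity of the modulus part of `λ² ∂ₜψ` in rescaled variables. -/
noncomputable def driftRe (p : ModPath d) (I : Set ℝ) (t : ℝ) (g : E d → ℝ) (y : E d) : ℝ :=
  - (p.lam t * derivWithin p.lam I t) * scaleGen g y
    - ∑ j, p.lam t * derivWithin p.al I t j * pd j g y

/-- The velocity of the phase part of `λ² ∂ₜψ` in rescaled variables. -/
noncomputable def driftIm (p : ModPath d) (I : Set ℝ) (t : ℝ) (y : E d) : ℝ :=
  (∑ j, p.lam t ^ 2 * derivWithin p.be I t j * y j)
    - p.lam t ^ 2 * derivWithin p.ga I t / 4 * ‖y‖ ^ 2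
    - (∑ j, p.slope t j y * (p.lam t * derivWithin p.lam I t * y j
        + p.lam t * derivWithin p.al I t j))
    + p.lam t ^ 2 * derivWithin p.th I t

/-- The time derivative of a modulated profile. -/
noncomputable def waveDeriv (p : ModPath d) (I : Set ℝ) (t : ℝ) (g : E d → ℝ) (x : E d) : ℂ :=
  ((p.lam t ^ 2)⁻¹ : ℝ) * p.wave t (fun y => ((p.driftRe I t g y : ℝ) : ℂ)
    - Complex.I * ((p.driftIm I t y * g y : ℝ) : ℂ)) x

lemma fderiv_apply_eq_sum (f : E d → ℝ) (y v : E d) : fderiv ℝ f y v = ∑ j, v j * pd j f y := by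
  conv_lhs => rw [← sum_inner_stdVec_smul v]
  simp [pd]

lemma hasDerivWithinAt_point (hp : p.DiffWithinAt I t) (hl : 0 < p.lam t) (x : E d) :
    HasDerivWithinAt (fun s => p.point s x)
      (-((p.lam t)⁻¹ * derivWithin p.lam I t) • p.point t x - (p.lam t)⁻¹ • derivWithin p.al I t)
      I t := by
  have h1 := hp.lam.hasDerivWithinAt.inv hl.ne'
  have h2 := hp.al.hasDerivWithinAt.const_sub x
  refine (h1.smul h2).congr_deriv ?_
  simp only [point, smul_smul]
  rw [add_comm, smul_neg, ← sub_eq_add_neg, sub_eq_sub_iff_add_eq_add]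
  simp only [Pi.inv_apply]
  congr 2
  field_simp

lemma hasDerivWithinAt_angle_point (hp : p.DiffWithinAt I t) (hl : 0 < p.lam t) (x : E d) :
    HasDerivWithinAt (fun s => p.angle s (p.point s x))
      ((p.lam t ^ 2)⁻¹ * p.driftIm I t (p.point t x)) I t := by
  have hy := hasDerivWithinAt_point hp hl x
  have h1 := hp.be.hasDerivWithinAt.inner ℝ hy
  have h2 := (hp.ga.hasDerivWithinAt.div_const 4).mul hy.norm_sq
  have h3 := (h1.sub h2).add hp.th.hasDerivWithinAt
  refine h3.congr_deriv ?_
  simp only [driftIm, slope]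
  set y := p.point t x
  have e1 : ∀ v w : E d, inner ℝ v w = ∑ j, v j * w j := fun v w => by
    simp [PiLp.inner_apply, mul_comm]
  have e2 : ∑ j, (p.be t j - p.ga t / 2 * y j) * (p.lam t * derivWithin p.lam I t * y j
        + p.lam t * derivWithin p.al I t j)
      = p.lam t * derivWithin p.lam I t * inner ℝ (p.be t) y
        + p.lam t * inner ℝ (p.be t) (derivWithin p.al I t)
        - p.ga t / 2 * (p.lam t * derivWithin p.lam I t) * inner ℝ y y
        - p.ga t / 2 * p.lam t * inner ℝ y (derivWithin p.al I t) := by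
    simp only [e1, Finset.mul_sum, ← Finset.sum_add_distrib, ← Finset.sum_sub_distrib]
    exact Finset.sum_congr rfl fun j _ => by ring
  have e3 : ∑ j, p.lam t ^ 2 * derivWithin p.be I t j * y j
      = p.lam t ^ 2 * inner ℝ (derivWithin p.be I t) y := by
    simp only [e1, Finset.mul_sum]
    exact Finset.sum_congr rfl fun j _ => by ring
  rw [e2, e3, inner_sub_right, inner_sub_right]
  simp only [inner_smul_right, real_inner_self_eq_norm_sq]
  field_simp
  ring

/-- The product rule for amplitude, profile and phase. Amplitude and profile combine into the
generator Λ of scaling and a translation (`driftRe`), the phase gives `driftIm`; the factor λ⁻² is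
split off because the laws of the parameters are stated for λ² times the derivatives. -/
lemma hasDerivWithinAt_wave (hp : p.DiffWithinAt I t) (hl : 0 < p.lam t) (hg : Differentiable ℝ g)
    (x : E d) : HasDerivWithinAt (fun s => p.wave s (fun y => (g y : ℂ)) x)
      (p.waveDeriv I t g x) I t := by
  have hA := hp.lam.hasDerivWithinAt.rpow_const (p := -(d : ℝ) / 2) (Or.inl hl.ne')
  have hy := hasDerivWithinAt_point hp hl x
  have hgy := (hg (p.point t x)).hasFDerivAt.comp_hasDerivWithinAt t hy
  have hΘ := (hasDerivWithinAt_angle_point hp hl x).neg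
  have hE := (hΘ.ofReal_comp.mul_const Complex.I).cexp
  have h := hA.ofReal_comp.mul (hgy.ofReal_comp.mul hE)
  refine h.congr_deriv ?_
  rw [fderiv_apply_eq_sum]
  have hA' : p.lam t ^ (-(d : ℝ) / 2 - 1) = p.lam t ^ (-(d : ℝ) / 2) * (p.lam t)⁻¹ := by
    rw [Real.rpow_sub_one hl.ne', div_eq_mul_inv]
  have e1 : ∑ j, (-((p.lam t)⁻¹ * derivWithin p.lam I t) • p.point t x
      - (p.lam t)⁻¹ • derivWithin p.al I t) j * pd j g (p.point t x)
      = -((p.lam t)⁻¹ * derivWithin p.lam I t) * (∑ j, p.point t x j * pd j g (p.point t x))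
        - (p.lam t ^ 2)⁻¹ * ∑ j, p.lam t * derivWithin p.al I t j * pd j g (p.point t x) := by
    rw [Finset.mul_sum, Finset.mul_sum, ← Finset.sum_sub_distrib]
    refine Finset.sum_congr rfl fun j _ => ?_
    simp only [PiLp.sub_apply, PiLp.smul_apply, smul_eq_mul]
    field_simp
  rw [e1, hA']
  simp only [waveDeriv, wave, twist, driftRe, scaleGen, Function.comp_apply, Pi.mul_apply, Pi.neg_apply]
  have hl' : (p.lam t : ℂ) ≠ 0 := by exact_mod_cast hl.ne'
  push_cast
  field_simp
  ring


/-! ### Domination of the difference quotients -/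

lemma exists_lipschitz {F : Type*} [NormedAddCommGroup F] [NormedSpace ℝ F] {f : ℝ → F}
    (hf : DifferentiableWithinAt ℝ f I t) :
    ∃ L, 0 ≤ L ∧ ∀ᶠ s in 𝓝[I] t, ‖f s - f t‖ ≤ L * |s - t| := by
  obtain ⟨L, hL, h⟩ := hf.hasFDerivWithinAt.isBigO_sub.exists_nonneg
  exact ⟨L, hL, h.bound⟩

lemma norm_cexp_sub_le (a b : ℝ) :
    ‖Complex.exp ((a : ℂ) * Complex.I) - Complex.exp ((b : ℂ) * Complex.I)‖ ≤ |a - b| := by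
  have e : Complex.exp ((a : ℂ) * Complex.I) - Complex.exp ((b : ℂ) * Complex.I)
      = Complex.exp ((b : ℂ) * Complex.I) * (Complex.exp (Complex.I * ((a - b : ℝ) : ℂ)) - 1) := by
    rw [mul_sub, ← Complex.exp_add, mul_one]; congr 2; push_cast; ring
  rw [e, norm_mul, Complex.norm_exp_ofReal_mul_I, one_mul]
  exact Real.norm_exp_I_mul_ofReal_sub_one_le

/-- Only increments from the fixed time t are compared, as differentiability is assumed at that time
alone. The change of variables is affine in y, whence the weight 1 + |y|. -/
lemma exists_norm_point_sub_le (hp : p.DiffWithinAt I t) (hl : 0 < p.lam t) :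
    ∃ M, 0 ≤ M ∧ ∀ᶠ s in 𝓝[I] t, ∀ x,
      ‖p.point s x - p.point t x‖ ≤ M * |s - t| * (1 + ‖p.point t x‖) := by
  obtain ⟨L₁, h₁, H₁⟩ := exists_lipschitz (hp.lam.inv hl.ne')
  obtain ⟨L₂, h₂, H₂⟩ := exists_lipschitz hp.al
  have hc : ∀ᶠ s in 𝓝[I] t, L₂ * |s - t| ≤ 1 := by
    have : Tendsto (fun s => L₂ * |s - t|) (𝓝[I] t) (𝓝 (L₂ * |t - t|)) :=
      (Continuous.tendsto (by fun_prop) t).mono_left nhdsWithin_le_nhds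
    exact (this.eventually_lt_const (by simp)).mono fun s hs => hs.le
  refine ⟨L₁ * (p.lam t + 1) + (p.lam t)⁻¹ * L₂, by positivity, ?_⟩
  filter_upwards [H₁, H₂, hc] with s H₁ H₂ hc x
  set y := p.point t x with hy
  have hx : x - p.al t = p.lam t • y := by
    rw [hy, point, smul_smul, mul_inv_cancel₀ hl.ne', one_smul]
  have e : p.point s x - y
      = ((p.lam s)⁻¹ - (p.lam t)⁻¹) • (p.lam t • y - (p.al s - p.al t))
        - (p.lam t)⁻¹ • (p.al s - p.al t) := by
    rw [← hx, hy]; simp only [point]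
    module
  have hN : 0 ≤ ‖y‖ := norm_nonneg y
  have b1 : ‖p.lam t • y - (p.al s - p.al t)‖ ≤ (p.lam t + 1) * (1 + ‖y‖) := by
    refine (norm_sub_le _ _).trans ?_
    rw [norm_smul, Real.norm_eq_abs, abs_of_pos hl]
    nlinarith
  rw [e]
  refine (norm_sub_le _ _).trans ?_
  rw [norm_smul, norm_smul, norm_inv, Real.norm_eq_abs (p.lam t), abs_of_pos hl]
  have a1 : ‖(p.lam s)⁻¹ - (p.lam t)⁻¹‖ * ‖p.lam t • y - (p.al s - p.al t)‖
      ≤ L₁ * |s - t| * ((p.lam t + 1) * (1 + ‖y‖)) := by gcongr; exact H₁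
  have a2 : (p.lam t)⁻¹ * ‖p.al s - p.al t‖ ≤ (p.lam t)⁻¹ * (L₂ * |s - t|) := by gcongr
  have a3 : 0 ≤ (p.lam t)⁻¹ * (L₂ * |s - t|) * ‖y‖ := by positivity
  nlinarith

/-- The phase is quadratic in y, so its increment is O(|s - t|) with the square of the weight 1 +
|y|. -/
lemma exists_abs_angle_sub_le (hp : p.DiffWithinAt I t) (hl : 0 < p.lam t) :
    ∃ M, 0 ≤ M ∧ ∀ᶠ s in 𝓝[I] t, ∀ x,
      |p.angle s (p.point s x) - p.angle t (p.point t x)| ≤ M * |s - t| * (1 + ‖p.point t x‖) ^ 2 := by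
  obtain ⟨L₁, h₁, H₁⟩ := exists_lipschitz hp.be
  obtain ⟨L₂, h₂, H₂⟩ := exists_lipschitz hp.ga
  obtain ⟨L₃, h₃, H₃⟩ := exists_lipschitz hp.th
  obtain ⟨M, hM, HM⟩ := exists_norm_point_sub_le hp hl
  have hc : ∀ᶠ s in 𝓝[I] t, M * |s - t| ≤ 1 := by
    have : Tendsto (fun s => M * |s - t|) (𝓝[I] t) (𝓝 (M * |t - t|)) :=
      (Continuous.tendsto (by fun_prop) t).mono_left nhdsWithin_le_nhds
    exact (this.eventually_lt_const (by simp)).mono fun s hs => hs.le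
  refine ⟨2 * L₁ + ‖p.be t‖ * M + L₂ + |p.ga t| * M + L₃, by positivity, ?_⟩
  filter_upwards [H₁, H₂, H₃, HM, hc] with s H₁ H₂ H₃ HM hc x
  have HM := HM x
  set y := p.point t x
  set y' := p.point s x
  set h := |s - t|
  have hh : 0 ≤ h := abs_nonneg _
  set N := 1 + ‖y‖ with hN
  have hy0 := norm_nonneg y
  have hN1 : 1 ≤ N := by linarith
  have hNN : N ≤ N ^ 2 := by nlinarith
  have hy' : ‖y'‖ ≤ 2 * N := by
    have := norm_le_norm_add_norm_sub' y' y
    nlinarith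
  have e : p.angle s y' - p.angle t y = inner ℝ (p.be s - p.be t) y' + inner ℝ (p.be t) (y' - y)
      - (p.ga s - p.ga t) / 4 * ‖y'‖ ^ 2 - p.ga t / 4 * ((‖y'‖ + ‖y‖) * (‖y'‖ - ‖y‖))
      + (p.th s - p.th t) := by
    simp only [angle, phase, inner_sub_left, inner_sub_right]; ring
  have b1 : |inner ℝ (p.be s - p.be t) y'| ≤ L₁ * h * (2 * N) :=
    (abs_real_inner_le_norm _ _).trans (by gcongr)
  have b2 : |inner ℝ (p.be t) (y' - y)| ≤ ‖p.be t‖ * (M * h * N) :=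
    (abs_real_inner_le_norm _ _).trans (by gcongr)
  have b3 : |(p.ga s - p.ga t) / 4 * ‖y'‖ ^ 2| ≤ L₂ * h * N ^ 2 := by
    rw [abs_mul, abs_div, abs_of_pos (by norm_num : (0 : ℝ) < 4), abs_of_nonneg (sq_nonneg ‖y'‖)]
    calc |p.ga s - p.ga t| / 4 * ‖y'‖ ^ 2 ≤ L₂ * h / 4 * (2 * N) ^ 2 := by gcongr; exact H₂
      _ = L₂ * h * N ^ 2 := by ring
  have b4 : |p.ga t / 4 * ((‖y'‖ + ‖y‖) * (‖y'‖ - ‖y‖))| ≤ |p.ga t| * (M * h * N ^ 2) := by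
    rw [abs_mul, abs_div, abs_mul, abs_of_pos (by norm_num : (0 : ℝ) < 4),
      abs_of_nonneg (add_nonneg (norm_nonneg y') hy0)]
    have : |‖y'‖ - ‖y‖| ≤ M * h * N := (abs_norm_sub_norm_le _ _).trans HM
    calc |p.ga t| / 4 * ((‖y'‖ + ‖y‖) * |‖y'‖ - ‖y‖|)
        ≤ |p.ga t| / 4 * ((2 * N + 2 * N) * (M * h * N)) := by gcongr; linarith
      _ = |p.ga t| * (M * h * N ^ 2) := by ring
  have b5 : |p.th s - p.th t| ≤ L₃ * h := H₃
  rw [e]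
  have t1 := abs_add_le (inner ℝ (p.be s - p.be t) y' + inner ℝ (p.be t) (y' - y)
      - (p.ga s - p.ga t) / 4 * ‖y'‖ ^ 2 - p.ga t / 4 * ((‖y'‖ + ‖y‖) * (‖y'‖ - ‖y‖)))
      (p.th s - p.th t)
  have t2 := abs_sub (inner ℝ (p.be s - p.be t) y' + inner ℝ (p.be t) (y' - y)
      - (p.ga s - p.ga t) / 4 * ‖y'‖ ^ 2) (p.ga t / 4 * ((‖y'‖ + ‖y‖) * (‖y'‖ - ‖y‖)))
  have t3 := abs_sub (inner ℝ (p.be s - p.be t) y' + inner ℝ (p.be t) (y' - y))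
      ((p.ga s - p.ga t) / 4 * ‖y'‖ ^ 2)
  have t4 := abs_add_le (inner ℝ (p.be s - p.be t) y') (inner ℝ (p.be t) (y' - y))
  have c1 : L₁ * h * (2 * N) ≤ 2 * L₁ * h * N ^ 2 := by
    have := mul_le_mul_of_nonneg_left hNN (by positivity : 0 ≤ L₁ * h)
    linarith
  have c2 : ‖p.be t‖ * (M * h * N) ≤ ‖p.be t‖ * M * h * N ^ 2 := by
    have := mul_le_mul_of_nonneg_left hNN (by positivity : 0 ≤ ‖p.be t‖ * (M * h))
    linarith
  have c3 : L₃ * h ≤ L₃ * h * N ^ 2 :=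
    le_mul_of_one_le_right (by positivity) (hN1.trans hNN)
  have c4 : (2 * L₁ + ‖p.be t‖ * M + L₂ + |p.ga t| * M + L₃) * h * N ^ 2
      = 2 * L₁ * h * N ^ 2 + ‖p.be t‖ * M * h * N ^ 2 + L₂ * h * N ^ 2 + |p.ga t| * (M * h * N ^ 2)
        + L₃ * h * N ^ 2 := by ring
  rw [c4]
  linarith

/-- A square integrable majorant. -/
lemma memLp_majorant (c : ℝ) :
    MemLp (fun y : E d => ((c * ((1 + ‖y‖) ^ (d + 1))⁻¹ : ℝ) : ℂ)) 2 volume := by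
  have hc : Continuous fun y : E d => ((c * ((1 + ‖y‖) ^ (d + 1))⁻¹ : ℝ) : ℂ) := by
    refine Complex.continuous_ofReal.comp (continuous_const.mul (Continuous.inv₀ (by fun_prop) ?_))
    intro y; positivity
  rw [memLp_two_iff_integrable_sq_norm hc.aestronglyMeasurable]
  have h1 : Integrable (fun x : E d => (1 + ‖x‖) ^ (-((2 * (d + 1) : ℕ) : ℝ))) volume :=
    integrable_one_add_norm (by simp; linarith)
  refine (h1.const_mul (c ^ 2)).congr (Eventually.of_forall fun x => ?_)
  have hp : 0 < 1 + ‖x‖ := by positivity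
  simp only [Complex.norm_real, Real.norm_eq_abs, sq_abs]
  rw [Real.rpow_neg hp.le, Real.rpow_natCast, mul_pow, inv_pow, ← pow_mul, mul_comm (d + 1)]

/-- Amplitude, profile and phase change by O(|s - t|) with weights 1, 1 + |y| and (1 + |y|)². The
decay of g and ∇g absorbs the weights and leaves (1 + |y|)^{-(d+1)}, a square integrable majorant
independent of s. -/
lemma exists_norm_wave_sub_le (hp : p.DiffWithinAt I t) (hl : 0 < p.lam t) (hg : IsProfile g) :
    ∃ H : E d → ℂ, MemLp H 2 volume ∧ ∀ᶠ s in 𝓝[I] t, ∀ x,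
      ‖p.wave s (fun y => (g y : ℂ)) x - p.wave t (fun y => (g y : ℂ)) x‖
        ≤ |s - t| * ‖p.wave t H x‖ := by
  obtain ⟨L, h₁, H₁⟩ := exists_lipschitz
    (hp.lam.rpow_const (p := -(d : ℝ) / 2) (Or.inl hl.ne'))
  obtain ⟨M, hM, HM⟩ := exists_norm_point_sub_le hp hl
  obtain ⟨M', hM', HM'⟩ := exists_abs_angle_sub_le hp hl
  obtain ⟨C₀, hC₀⟩ := hg.decays (d + 1 + 2)
  choose C₁ hC₁ using fun j => hg.decays_pd j (d + 1 + 1)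
  have hC₀0 : 0 ≤ C₀ := le_trans (by positivity) (hC₀ 0)
  have hC₁0 : ∀ j, 0 ≤ C₁ j := fun j => le_trans (by positivity) (hC₁ j 0)
  set C₂ := ∑ j, C₁ j with hC₂
  have hC₂0 : 0 ≤ C₂ := Finset.sum_nonneg fun j _ => hC₁0 j
  -- This keeps the moved point within N/2 of y, where N = 1 + |y|, so 1 + |w| ≥ N/2 along the whole
  -- segment and the decay of g and ∇g can be evaluated at y up to powers of two.
  have hc : ∀ᶠ s in 𝓝[I] t, M * |s - t| ≤ 1 / 2 := by
    have : Tendsto (fun s => M * |s - t|) (𝓝[I] t) (𝓝 (M * |t - t|)) :=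
      (Continuous.tendsto (by fun_prop) t).mono_left nhdsWithin_le_nhds
    exact (this.eventually_lt_const (by simp)).mono fun s hs => hs.le
  set A := p.lam t ^ (-(d : ℝ) / 2) with hA
  have hA0 : 0 < A := by positivity
  set k := d + 1 with hk
  set D := L * (2 ^ (k + 2) * C₀) + A * (2 ^ (k + 1) * C₂ * M) + A * (C₀ * M') with hD
  refine ⟨_, memLp_majorant (D / A), ?_⟩
  filter_upwards [H₁, HM, HM', hc] with s H₁ HM HM' hc x
  have HM := HM x
  have HM' := HM' x
  have eR : ‖p.wave t (fun y => ((D / A * ((1 + ‖y‖) ^ (d + 1))⁻¹ : ℝ) : ℂ)) x‖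
      = D * ((1 + ‖p.point t x‖) ^ k)⁻¹ := by
    rw [wave, norm_mul, norm_twist, Complex.norm_real, Complex.norm_real, Real.norm_eq_abs,
      Real.norm_eq_abs, ← hA, abs_of_pos hA0, abs_of_nonneg (by positivity)]
    field_simp
    rw [hk]
  rw [eR]
  simp only [wave, twist, ← hA]
  set A' := p.lam s ^ (-(d : ℝ) / 2)
  set y := p.point t x
  set y' := p.point s x
  set h := |s - t|
  have hh : 0 ≤ h := abs_nonneg _
  set N := 1 + ‖y‖ with hN
  have hy0 := norm_nonneg y
  have hN1 : 1 ≤ N := by linarith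
  have hyy : ‖y' - y‖ ≤ N / 2 := by
    refine HM.trans ?_
    nlinarith
  have hball : ∀ w : E d, ‖w - y‖ ≤ N / 2 → N / 2 ≤ 1 + ‖w‖ := fun w hw => by
    have := norm_le_norm_add_norm_sub y w
    rw [norm_sub_rev] at hw
    have h3 := norm_sub_norm_le y w
    linarith
  have g0 : N ^ (k + 2) * |g y| ≤ C₀ := by simpa [hN] using hC₀ y
  have g1 : N ^ (k + 2) * |g y'| ≤ 2 ^ (k + 2) * C₀ := by
    have h1 := hC₀ y'
    have h2 : (N / 2) ^ (k + 2) * |g y'| ≤ C₀ := le_trans (by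
      rw [Real.norm_eq_abs]; gcongr; exact hball y' hyy) h1
    calc N ^ (k + 2) * |g y'| = 2 ^ (k + 2) * ((N / 2) ^ (k + 2) * |g y'|) := by
          rw [div_pow]; field_simp
      _ ≤ 2 ^ (k + 2) * C₀ := by gcongr
  have g2 : N ^ (k + 1) * |g y' - g y| ≤ 2 ^ (k + 1) * C₂ * (M * h * N) := by
    have hb : ∀ w ∈ Metric.closedBall y (N / 2), ‖fderiv ℝ g w‖ ≤ 2 ^ (k + 1) * C₂ / N ^ (k + 1) := by
      intro w hw
      rw [mem_closedBall_iff_norm] at hw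
      refine (norm_clm_le_sum _).trans ?_
      rw [le_div_iff₀ (by positivity), hC₂, Finset.mul_sum, Finset.sum_mul]
      refine Finset.sum_le_sum fun j _ => ?_
      have h1 := hC₁ j w
      have h2 : (N / 2) ^ (k + 1) * ‖pd j g w‖ ≤ C₁ j := le_trans (by
        gcongr; exact hball w hw) h1
      calc ‖fderiv ℝ g w (stdVec j)‖ * N ^ (k + 1)
          = 2 ^ (k + 1) * ((N / 2) ^ (k + 1) * ‖pd j g w‖) := by
            rw [div_pow, pd]; field_simp
        _ ≤ 2 ^ (k + 1) * C₁ j := by gcongr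
    have h1 := (convex_closedBall y (N / 2)).norm_image_sub_le_of_norm_fderiv_le (𝕜 := ℝ)
      (fun w _ => hg.differentiable w) hb (Metric.mem_closedBall_self (by linarith))
      (mem_closedBall_iff_norm.mpr hyy)
    rw [Real.norm_eq_abs] at h1
    calc N ^ (k + 1) * |g y' - g y| ≤ N ^ (k + 1) * (2 ^ (k + 1) * C₂ / N ^ (k + 1) * (M * h * N)) := by
          gcongr; exact h1.trans (by gcongr)
      _ = 2 ^ (k + 1) * C₂ * (M * h * N) := by field_simp
  have hE : ‖Complex.exp (((-p.angle s y' : ℝ) : ℂ) * Complex.I)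
      - Complex.exp (((-p.angle t y : ℝ) : ℂ) * Complex.I)‖ ≤ M' * h * N ^ 2 := by
    refine (norm_cexp_sub_le _ _).trans ?_
    rw [neg_sub_neg, abs_sub_comm]
    exact HM'
  have hA' : |A' - A| ≤ L * h := H₁
  set e' := Complex.exp (((-p.angle s y' : ℝ) : ℂ) * Complex.I) with he'
  set e := Complex.exp (((-p.angle t y : ℝ) : ℂ) * Complex.I)
  have hne' : ‖e'‖ = 1 := Complex.norm_exp_ofReal_mul_I _
  have split : (A' : ℂ) * ((g y' : ℂ) * e') - (A : ℂ) * ((g y : ℂ) * e)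
      = ((A' - A : ℝ) : ℂ) * ((g y' : ℝ) : ℂ) * e' + (A : ℂ) * ((g y' - g y : ℝ) : ℂ) * e'
        + (A : ℂ) * (g y : ℂ) * (e' - e) := by push_cast; ring
  have hsum : ‖(A' : ℂ) * ((g y' : ℂ) * e') - (A : ℂ) * ((g y : ℂ) * e)‖
      ≤ |A' - A| * |g y'| + A * |g y' - g y| + A * |g y| * (M' * h * N ^ 2) := by
    rw [split]
    refine (norm_add_le _ _).trans (add_le_add ((norm_add_le _ _).trans (add_le_add ?_ ?_)) ?_)
    · rw [norm_mul, norm_mul, hne', Complex.norm_real, Complex.norm_real, mul_one]; rfl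
    · rw [norm_mul, norm_mul, hne', Complex.norm_real, Complex.norm_real, mul_one, Real.norm_eq_abs,
        abs_of_pos hA0]; rfl
    · rw [norm_mul, norm_mul, Complex.norm_real, Complex.norm_real, Real.norm_eq_abs,
        abs_of_pos hA0, Real.norm_eq_abs]
      gcongr
  refine hsum.trans ?_
  rw [← div_eq_mul_inv, ← mul_div_assoc, le_div_iff₀ (by positivity)]
  have hNk : 0 < N ^ k := by positivity
  have k1 : N ^ k * |g y'| ≤ 2 ^ (k + 2) * C₀ := le_trans (by
    gcongr
    omega) g1
  have k2 : N ^ k * |g y' - g y| ≤ 2 ^ (k + 1) * C₂ * (M * h) := by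
    have : N * (N ^ k * |g y' - g y|) ≤ N * (2 ^ (k + 1) * C₂ * (M * h)) := by
      calc _ = N ^ (k + 1) * |g y' - g y| := by ring
        _ ≤ _ := g2
        _ = _ := by ring
    exact le_of_mul_le_mul_left this (by linarith)
  have k3 : N ^ k * (|g y| * N ^ 2) ≤ C₀ := by
    calc _ = N ^ (k + 2) * |g y| := by ring
      _ ≤ _ := g0
  have r1 : |A' - A| * |g y'| * N ^ k ≤ L * h * (2 ^ (k + 2) * C₀) := by
    calc |A' - A| * |g y'| * N ^ k = |A' - A| * (N ^ k * |g y'|) := by ring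
      _ ≤ L * h * (2 ^ (k + 2) * C₀) := by gcongr
  have r2 : A * |g y' - g y| * N ^ k ≤ A * (2 ^ (k + 1) * C₂ * (M * h)) := by
    calc A * |g y' - g y| * N ^ k = A * (N ^ k * |g y' - g y|) := by ring
      _ ≤ _ := by gcongr
  have r3 : A * |g y| * (M' * h * N ^ 2) * N ^ k ≤ A * (M' * h) * C₀ := by
    calc A * |g y| * (M' * h * N ^ 2) * N ^ k = A * (M' * h) * (N ^ k * (|g y| * N ^ 2)) := by ring
      _ ≤ _ := by gcongr
  have r4 : h * D = L * h * (2 ^ (k + 2) * C₀) + A * (2 ^ (k + 1) * C₂ * (M * h))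
      + A * (M' * h) * C₀ := by rw [hD]; ring
  rw [add_mul, add_mul, r4]
  linarith

end ModPath

end RNLS

/-! ### Defects of the modulation laws, balance of phases, and evolution of the pairings. -/

namespace RNLS

open scoped ContDiff

variable {d : ℕ}

/-- A quadratic polynomial without mixed terms. -/
noncomputable def quadPoly (c₀ : ℝ) (c : Fin d → ℝ) (c₂ : ℝ) (y : E d) : ℝ :=
  c₀ + ∑ j, c j * y j + c₂ * ‖y‖ ^ 2

lemma quadPoly_mul (c₀ : ℝ) (c : Fin d → ℝ) (c₂ : ℝ) (g : E d → ℝ) :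
    (fun y => quadPoly c₀ c c₂ y * g y)
      = fun y => (c₀ * g y + ∑ j, c j * (y j * g y)) + c₂ * (‖y‖ ^ 2 * g y) := by
  funext y
  simp only [quadPoly, add_mul, Finset.sum_mul]
  congr 1
  · congr 1
    exact Finset.sum_congr rfl fun j _ => by ring
  · ring

lemma IsWeight.quadPoly_mul {g : E d → ℝ} (hg : IsWeight g) (c₀ : ℝ) (c : Fin d → ℝ) (c₂ : ℝ) :
    IsWeight fun y => quadPoly c₀ c c₂ y * g y := by
  rw [RNLS.quadPoly_mul]
  exact ((hg.const_mul _).add (IsWeight.sum _ fun j _ => (hg.coord_mul j).const_mul _)).add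
    (hg.sq_norm_mul.const_mul _)

lemma pair_quadPoly_mul {g : E d → ℝ} (hg : IsWeight g) (c₀ : ℝ) (c : Fin d → ℝ) (c₂ : ℝ)
    {f : E d → ℂ} (hf : MemLp f 2 volume) :
    pair (fun y => quadPoly c₀ c c₂ y * g y) f
      = c₀ * pair g f + ∑ j, (c j : ℂ) * pair (fun y => y j * g y) f
        + c₂ * pair (fun y => ‖y‖ ^ 2 * g y) f := by
  rw [RNLS.quadPoly_mul, pair_add_left ((hg.const_mul _).add
    (IsWeight.sum _ fun j _ => (hg.coord_mul j).const_mul _)) (hg.sq_norm_mul.const_mul _) hf,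
    pair_add_left (hg.const_mul _) (IsWeight.sum _ fun j _ => (hg.coord_mul j).const_mul _) hf,
    pair_const_mul_left, pair_const_mul_left, pair_sum_left _ (fun j _ => (hg.coord_mul j).const_mul _) hf]
  simp only [pair_const_mul_left]

namespace ModPath

variable {p : ModPath d} {I : Set ℝ} {t : ℝ} {g : E d → ℝ}

section Equations

variable (p I t)

/-- The defect in the equation for `λ`. -/
noncomputable def defLam : ℝ := p.lam t * derivWithin p.lam I t + p.ga t

/-- The defect in the equation for `γ`. -/
noncomputable def defGa : ℝ := p.lam t ^ 2 * derivWithin p.ga I t + p.ga t ^ 2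

/-- The defect in the equation for `α`. -/
noncomputable def defAl : E d := p.lam t • derivWithin p.al I t - (2 : ℝ) • p.be t

/-- The defect in the equation for `β`. -/
noncomputable def defBe : E d := p.lam t ^ 2 • derivWithin p.be I t + p.ga t • p.be t

/-- The defect in the equation for `θ`. -/
noncomputable def defTh : ℝ := p.lam t ^ 2 * derivWithin p.th I t - 1 - ‖p.be t‖ ^ 2

/-- The potential created by the defects. -/
noncomputable def potential (y : E d) : ℝ :=
  quadPoly (p.defTh I t - inner ℝ (p.be t) (p.defAl I t))
    (fun j => p.defBe I t j - p.defLam I t * p.be t j + p.ga t / 2 * p.defAl I t j)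
    (p.defLam I t * p.ga t / 2 - p.defGa I t / 4) y

end Equations

lemma modEq_eq : p.modEq I t = |p.defLam I t| + |p.defGa I t| + ‖p.defAl I t‖ + ‖p.defBe I t‖
    + |p.defTh I t| := rfl

lemma driftIm_eq (y : E d) : p.driftIm I t y
    = quadPoly (p.lam t ^ 2 * derivWithin p.th I t - ∑ j, p.be t j * (p.lam t * derivWithin p.al I t j))
      (fun j => p.lam t ^ 2 * derivWithin p.be I t j - p.be t j * (p.lam t * derivWithin p.lam I t)
        + p.ga t / 2 * (p.lam t * derivWithin p.al I t j))
      (p.ga t / 2 * (p.lam t * derivWithin p.lam I t) - p.lam t ^ 2 * derivWithin p.ga I t / 4) y := by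
  have e : ∑ j, p.slope t j y * (p.lam t * derivWithin p.lam I t * y j
        + p.lam t * derivWithin p.al I t j)
      = ∑ j, (p.be t j * (p.lam t * derivWithin p.lam I t)
          - p.ga t / 2 * (p.lam t * derivWithin p.al I t j)) * y j
        + ∑ j, p.be t j * (p.lam t * derivWithin p.al I t j)
        - p.ga t / 2 * (p.lam t * derivWithin p.lam I t) * ‖y‖ ^ 2 := by
    rw [sq_norm_eq_sum, Finset.mul_sum, ← Finset.sum_add_distrib, ← Finset.sum_sub_distrib]
    exact Finset.sum_congr rfl fun j _ => by simp only [slope]; ring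
  simp only [driftIm, quadPoly, e]
  have e2 : ∑ j, (p.lam t ^ 2 * derivWithin p.be I t j - p.be t j * (p.lam t * derivWithin p.lam I t)
        + p.ga t / 2 * (p.lam t * derivWithin p.al I t j)) * y j
      = ∑ j, p.lam t ^ 2 * derivWithin p.be I t j * y j
        - ∑ j, (p.be t j * (p.lam t * derivWithin p.lam I t)
          - p.ga t / 2 * (p.lam t * derivWithin p.al I t j)) * y j := by
    rw [← Finset.sum_sub_distrib]
    exact Finset.sum_congr rfl fun j _ => by ring
  rw [e2]; ring

lemma sum_slope_sq (y : E d) : ∑ j, p.slope t j y ^ 2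
    = quadPoly (‖p.be t‖ ^ 2) (fun j => -(p.ga t * p.be t j)) (p.ga t ^ 2 / 4) y := by
  simp only [quadPoly]
  rw [sq_norm_eq_sum, sq_norm_eq_sum, Finset.mul_sum, ← Finset.sum_add_distrib, ← Finset.sum_add_distrib]
  exact Finset.sum_congr rfl fun j _ => by simp only [slope]; ring

/-- The balance of phases. -/
lemma driftIm_add_slope (y : E d) :
    p.driftIm I t y + ∑ j, p.slope t j y ^ 2 = 1 + p.potential I t y := by
  -- Both sides are combinations of 1, y_j and |y|², and coefficients are compared. Without defects
  -- the phase velocity and the kinetic term |∇phase|² add up to one, the frequency of the ground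
  -- state.
  rw [driftIm_eq, sum_slope_sq]
  have e1 : inner ℝ (p.be t) (p.defAl I t)
      = ∑ j, p.be t j * (p.lam t * derivWithin p.al I t j) - 2 * ‖p.be t‖ ^ 2 := by
    rw [sq_norm_eq_sum, Finset.mul_sum, ← Finset.sum_sub_distrib]
    simp only [PiLp.inner_apply, defAl, PiLp.sub_apply, PiLp.smul_apply, smul_eq_mul]
    exact Finset.sum_congr rfl fun j _ => by simp; ring
  have e2 : ∑ j, (p.defBe I t j - p.defLam I t * p.be t j + p.ga t / 2 * p.defAl I t j) * y j
      = ∑ j, (p.lam t ^ 2 * derivWithin p.be I t j - p.be t j * (p.lam t * derivWithin p.lam I t)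
        + p.ga t / 2 * (p.lam t * derivWithin p.al I t j)) * y j
        + ∑ j, -(p.ga t * p.be t j) * y j := by
    rw [← Finset.sum_add_distrib]
    refine Finset.sum_congr rfl fun j _ => ?_
    simp only [defBe, defAl, defLam, PiLp.sub_apply, PiLp.add_apply, PiLp.smul_apply, smul_eq_mul]
    ring
  simp only [potential, quadPoly]
  rw [e1, e2]
  simp only [defTh, defLam, defGa]
  ring

/-- The first-order terms of the twisted Laplacian are the transport with λλ' = -γ and λα' = 2β.
They cancel the drift of the profile up to the defects of λ and α. -/
lemma driftRe_add_slope (y : E d) :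
    p.driftRe I t g y + (2 * (∑ j, p.slope t j y * pd j g y) - d * p.ga t / 2 * g y)
      = -(p.defLam I t * scaleGen g y + ∑ j, p.defAl I t j * pd j g y) := by
  have e1 : ∑ j, p.slope t j y * pd j g y
      = ∑ j, p.be t j * pd j g y - p.ga t / 2 * ∑ j, y j * pd j g y := by
    rw [Finset.mul_sum, ← Finset.sum_sub_distrib]
    exact Finset.sum_congr rfl fun j _ => by simp only [slope]; ring
  have e2 : ∑ j, p.defAl I t j * pd j g y
      = ∑ j, p.lam t * derivWithin p.al I t j * pd j g y - 2 * ∑ j, p.be t j * pd j g y := by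
    rw [Finset.mul_sum, ← Finset.sum_sub_distrib]
    refine Finset.sum_congr rfl fun j _ => ?_
    simp only [defAl, PiLp.sub_apply, PiLp.smul_apply, smul_eq_mul]; ring
  rw [e1, e2]
  simp only [driftRe, scaleGen, defLam]
  ring

lemma isWeight_driftRe (hg : IsProfile g) : IsWeight (p.driftRe I t g) := by
  have := (hg.isWeight_scaleGen.const_mul (-(p.lam t * derivWithin p.lam I t))).add
    ((IsWeight.sum Finset.univ fun j _ => (hg.isWeight_pd j).const_mul
      (p.lam t * derivWithin p.al I t j)).const_mul (-1))
  convert this using 2 with y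
  simp only [driftRe]; ring

lemma isWeight_driftIm_mul (hg : IsProfile g) : IsWeight fun y => p.driftIm I t y * g y := by
  simp only [driftIm_eq]
  exact hg.isWeight.quadPoly_mul _ _ _

lemma memLp_drift (hg : IsProfile g) : MemLp (fun y => ((p.driftRe I t g y : ℝ) : ℂ)
    - Complex.I * ((p.driftIm I t y * g y : ℝ) : ℂ)) 2 volume :=
  (isWeight_driftRe hg).memLp.sub ((isWeight_driftIm_mul hg).memLp.const_mul _)

lemma memLp_waveDeriv (hl : 0 < p.lam t) (hg : IsProfile g) :
    MemLp (p.waveDeriv I t g) 2 volume := (memLp_wave hl (memLp_drift hg)).const_mul _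

lemma memLp_wave_profile (hl : 0 < p.lam t) (hg : IsProfile g) :
    MemLp (p.wave t fun y => (g y : ℂ)) 2 volume := memLp_wave hl hg.isWeight.memLp

/-- Pointwise differentiability and a square integrable majorant give convergence of the difference
quotients in `L²`. Since u is continuous into `L²`, this suffices to pass to the limit in its
pairing with the quotients. -/
lemma tendstoL2_wave_quotient (hl : ∀ s ∈ I, 0 < p.lam s) (ht : t ∈ I) (hp : p.DiffWithinAt I t)
    (hg : IsProfile g) :
    TendstoL2 (fun s x => (((s - t)⁻¹ : ℝ) : ℂ)
      * (p.wave s (fun y => (g y : ℂ)) x - p.wave t (fun y => (g y : ℂ)) x))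
      (𝓝[I \ {t}] t) (p.waveDeriv I t g) := by
  have hlt := hl t ht
  obtain ⟨H, hH, hb⟩ := exists_norm_wave_sub_le hp hlt hg
  have hmem : ∀ᶠ s in 𝓝[I \ {t}] t, MemLp (fun x => (((s - t)⁻¹ : ℝ) : ℂ)
      * (p.wave s (fun y => (g y : ℂ)) x - p.wave t (fun y => (g y : ℂ)) x)) 2 volume := by
    filter_upwards [self_mem_nhdsWithin] with s hs
    exact ((memLp_wave_profile (hl s hs.1) hg).sub (memLp_wave_profile hlt hg)).const_mul _
  have hD := memLp_waveDeriv (I := I) hlt hg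
  refine ⟨hmem, hD, ?_⟩
  have hG : MemLp (fun x => ((‖p.wave t H x‖ + ‖p.waveDeriv I t g x‖ : ℝ) : ℂ)) 2 volume :=
    MemLp.ofReal ((memLp_wave hlt hH).norm.add hD.norm)
  refine tendsto_l2Norm_zero_of_dominated hG (hmem.mono fun s hs => (hs.sub hD).1) ?_ ?_
  · filter_upwards [hb.filter_mono (nhdsWithin_mono t sdiff_subset), self_mem_nhdsWithin] with s hs hs'
    refine Eventually.of_forall fun x => ?_
    have hst : s - t ≠ 0 := sub_ne_zero.mpr hs'.2
    rw [Complex.norm_real, Real.norm_eq_abs, abs_of_nonneg (by positivity)]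
    refine (norm_sub_le _ _).trans (add_le_add ?_ le_rfl)
    rw [norm_mul, Complex.norm_real, norm_inv, Real.norm_eq_abs, inv_mul_le_iff₀ (abs_pos.mpr hst)]
    exact hs x
  · refine Eventually.of_forall fun x => ?_
    have h := hasDerivWithinAt_iff_tendsto_slope.mp
      (hasDerivWithinAt_wave hp hlt hg.differentiable x)
    have h2 := h.sub_const (p.waveDeriv I t g x)
    rw [sub_self] at h2
    refine h2.congr fun s => ?_
    rw [slope_def_module, Complex.real_smul]

/-! ### The time derivative of the pairings -/

section Solution

variable {N : ℕ} {φ : Fin N → E d → ℝ} {β : Fin N → ℝ → ℝ} {t₀ t₁ : ℝ} {u : ℝ → E d → ℂ}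

lemma contDiff_ofReal_profile (hg : IsProfile g) : ContDiff ℝ 2 fun y => (g y : ℂ) :=
  Complex.ofRealCLM.contDiff.comp hg.contDiff

lemma covd_ofReal (hg : IsProfile g) (j : Fin d) : p.covd t j (fun y => (g y : ℂ))
    = fun y => ((pd j g y : ℝ) : ℂ) - Complex.I * ((p.slope t j y * g y : ℝ) : ℂ) := by
  funext y
  simp only [covd, pd_ofReal j (hg.differentiable y)]
  push_cast; ring

lemma isWeight_slope_mul {f : E d → ℝ} (hf : IsWeight f) (j : Fin d) :
    IsWeight fun y => p.slope t j y * f y := by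
  have := (hf.const_mul (p.be t j)).add ((hf.coord_mul j).const_mul (-(p.ga t / 2)))
  convert this using 2 with y
  simp only [slope]; ring

lemma memLp_covd (hg : IsProfile g) (j : Fin d) :
    MemLp (p.covd t j (fun y => (g y : ℂ))) 2 volume := by
  rw [covd_ofReal hg]
  exact (hg.isWeight_pd j).memLp.sub ((isWeight_slope_mul hg.isWeight j).memLp.const_mul _)

lemma contDiff_covd (hg : IsProfile g) (j : Fin d) :
    ContDiff ℝ 1 (p.covd t j (fun y => (g y : ℂ))) := by
  rw [covd_ofReal hg]
  have h1 : ContDiff ℝ 1 (p.slope t j) := contDiff_const.sub (contDiff_const.mul (contDiff_coord j))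
  exact (Complex.ofRealCLM.contDiff.comp (hg.contDiff_pd j)).sub
    (contDiff_const.mul (Complex.ofRealCLM.contDiff.comp (h1.mul (hg.contDiff.of_le (by norm_num)))))

lemma pd_wave_profile (hg : IsProfile g) (j : Fin d) : pd j (p.wave t fun y => (g y : ℂ))
    = fun x => (((p.lam t)⁻¹ : ℝ) : ℂ) * p.wave t (p.covd t j fun y => (g y : ℂ)) x :=
  funext fun _ => pd_wave ((contDiff_ofReal_profile hg).differentiable (by simp)) j

lemma memLp_pd_wave (hl : 0 < p.lam t) (hg : IsProfile g) (j : Fin d) :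
    MemLp (pd j (p.wave t fun y => (g y : ℂ))) 2 volume := by
  rw [pd_wave_profile hg]
  exact (memLp_wave hl (memLp_covd hg j)).const_mul _

lemma memH1_wave (hl : 0 < p.lam t) (hg : IsProfile g) : MemH1 (p.wave t fun y => (g y : ℂ)) :=
  memH1_of_contDiff (contDiff_wave ((contDiff_ofReal_profile hg).of_le (by norm_num)))
    (memLp_wave_profile hl hg) (memLp_pd_wave hl hg)

lemma weakPartial_wave (hl : 0 < p.lam t) (hg : IsProfile g) (j : Fin d) :
    weakPartial j (p.wave t fun y => (g y : ℂ)) =ᵐ[volume] pd j (p.wave t fun y => (g y : ℂ)) :=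
  (isWeakPartial_of_contDiff (contDiff_wave ((contDiff_ofReal_profile hg).of_le (by norm_num)))
    (memLp_wave_profile hl hg) (memLp_pd_wave hl hg j)).ae_eq

lemma sum_pd_pd_wave (hg : IsProfile g) (x : E d) :
    ∑ j, pd j (pd j (p.wave t fun y => (g y : ℂ))) x
      = (((p.lam t ^ 2)⁻¹ : ℝ) : ℂ) * p.wave t (fun y => ((Laplacian.laplacian g y
          - (∑ j, p.slope t j y ^ 2) * g y : ℝ) : ℂ)
        + Complex.I * ((-2 * (∑ j, p.slope t j y * pd j g y) + d * p.ga t / 2 * g y : ℝ) : ℂ)) x := by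
  have e : ∀ j, pd j (pd j (p.wave t fun y => (g y : ℂ))) x = (((p.lam t ^ 2)⁻¹ : ℝ) : ℂ)
      * p.wave t (p.covd t j (p.covd t j fun y => (g y : ℂ))) x := fun j => by
    rw [pd_wave_profile hg, pd_mul j (differentiableAt_const _)
      ((contDiff_wave (contDiff_covd hg j)).differentiable (by simp) x),
      pd_wave ((contDiff_covd hg j).differentiable (by simp))]
    simp [pd]; ring
  simp only [e, wave, twist, ← sum_covd_covd hg, ← Finset.mul_sum, ← Finset.sum_mul]

lemma memLp_twisted_laplacian (hg : IsProfile g) : MemLp (fun y => ((Laplacian.laplacian g y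
          - (∑ j, p.slope t j y ^ 2) * g y : ℝ) : ℂ)
        + Complex.I * ((-2 * (∑ j, p.slope t j y * pd j g y) + d * p.ga t / 2 * g y : ℝ) : ℂ))
      2 volume := by
  have w1 : IsWeight fun y => Laplacian.laplacian g y - (∑ j, p.slope t j y ^ 2) * g y := by
    have := hg.isWeight_laplacian.add ((hg.isWeight.quadPoly_mul (‖p.be t‖ ^ 2)
      (fun j => -(p.ga t * p.be t j)) (p.ga t ^ 2 / 4)).const_mul (-1))
    convert this using 2 with y
    rw [sum_slope_sq]; ring
  have w2 : IsWeight fun y => -2 * (∑ j, p.slope t j y * pd j g y) + d * p.ga t / 2 * g y :=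
    ((IsWeight.sum _ fun j _ => isWeight_slope_mul (hg.isWeight_pd j) j).const_mul _).add
      (hg.isWeight.const_mul _)
  exact w1.memLp.add (w2.memLp.const_mul _)

/-- Green's formula puts both derivatives of the Laplacian on the modulated profile, where they are
explicit. -/
lemma rhsForm_wave (hl : 0 < p.lam t) (hg : IsProfile g) {f : E d → ℂ} (hf : MemH1 f) :
    rhsForm φ β t f (p.wave t fun y => (g y : ℂ))
      = Complex.I * (∫ x, f x * ∑ j, pd j (pd j (p.wave t fun y => (g y : ℂ))) x)
        + Complex.I * (∫ x, ((‖f x‖ ^ crit d : ℝ) : ℂ) * (f x * p.wave t (fun y => (g y : ℂ)) x))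
        + Complex.I * ∫ x, noiseTerm φ β t f x * p.wave t (fun y => (g y : ℂ)) x := by
  have h := hf.sum_integral_weakPartial_mul_pd (contDiff_wave (p := p) (t := t)
    (contDiff_ofReal_profile hg)) (memLp_pd_wave hl hg) (by
      rw [show (fun x => ∑ j, pd j (pd j (p.wave t fun y => (g y : ℂ))) x) = _ from
        funext (sum_pd_pd_wave hg)]
      exact (memLp_wave hl (memLp_twisted_laplacian hg)).const_mul _)
  have e : ∑ j, ∫ x, weakPartial j f x * weakPartial j (p.wave t fun y => (g y : ℂ)) x
      = ∑ j, ∫ x, weakPartial j f x * pd j (p.wave t fun y => (g y : ℂ)) x :=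
    Finset.sum_congr rfl fun j _ => integral_congr_ae
      ((weakPartial_wave hl hg j).mono fun x hx => by simp only [hx])
  rw [rhsForm, e, h]
  ring

/-- Mass criticality: |u|^{4/d} scales exactly like λ⁻², so no power of λ is left in front of the
rescaled nonlinearity. -/
lemma resc_crit (hd : d = 1 ∨ d = 2) (hl : 0 < p.lam t) (f : E d → ℂ) (y : E d) :
    (p.lam t ^ 2 : ℝ) * p.resc t (fun x => ((‖f x‖ ^ crit d : ℝ) : ℂ) * f x) y
      = ((‖p.resc t f y‖ ^ crit d : ℝ) : ℂ) * p.resc t f y := by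
  have hc : (p.lam t ^ ((d : ℝ) / 2)) ^ crit d = p.lam t ^ 2 := by
    rw [← Real.rpow_natCast, ← Real.rpow_mul hl.le, ← Real.rpow_natCast (p.lam t) 2]
    congr 1
    rcases hd with rfl | rfl <;> norm_num [crit]
  have e : ‖p.resc t f y‖ ^ crit d = p.lam t ^ 2 * ‖f (p.lam t • y + p.al t)‖ ^ crit d := by
    rw [resc, norm_mul, norm_twist, Complex.norm_real, Real.norm_eq_abs,
      abs_of_pos (by positivity), mul_pow, hc]
  rw [e]
  simp only [resc, twist]
  push_cast
  ring

/-- The evolution of the pairing of the rescaled solution with a profile. -/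
theorem hasDerivWithinAt_pair_resc (hu : IsSolutionOn φ β t₀ t₁ u) (hd : d = 1 ∨ d = 2)
    (hφ : ∀ k, IsCbInfty (φ k)) (hβ : ∀ k, ContinuousOn (β k) (Icc t₀ t₁))
    (hl : ∀ s ∈ Icc t₀ t₁, 0 < p.lam s) (ht : t ∈ Icc t₀ t₁)
    (hp : p.DiffWithinAt (Icc t₀ t₁) t) (hg : IsProfile g) :
    ∃ D : ℂ, HasDerivWithinAt (fun s => pair g (p.resc s (u s))) D (Icc t₀ t₁) t ∧
      ((p.lam t ^ 2 : ℝ) : ℂ) * D =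
        Complex.I * pair (fun y => Laplacian.laplacian g y - g y) (p.resc t (u t))
        + Complex.I * (∫ y, ((‖p.resc t (u t) y‖ ^ crit d : ℝ) : ℂ) * p.resc t (u t) y * (g y : ℂ))
        - p.defLam (Icc t₀ t₁) t * pair (scaleGen g) (p.resc t (u t))
        - ∑ j, (p.defAl (Icc t₀ t₁) t j : ℂ) * pair (pd j g) (p.resc t (u t))
        - Complex.I * pair (fun y => p.potential (Icc t₀ t₁) t y * g y) (p.resc t (u t))
        + Complex.I * ((p.lam t ^ 2 : ℝ) : ℂ)
          * ∫ x, noiseTerm φ β t (u t) x * p.wave t (fun y => (g y : ℂ)) x := by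
  set I := Icc t₀ t₁ with hI
  have hlt := hl t ht
  set z := p.resc t (u t) with hz
  have hut := hu.memH1 t ht
  have hzm : MemLp z 2 volume := memLp_resc hlt hut.1
  have hK : ∀ s ∈ I, pair g (p.resc s (u s)) = ∫ x, u s x * p.wave s (fun y => (g y : ℂ)) x :=
    fun s hs => by
      rw [integral_mul_wave (hl s hs)]
      exact integral_congr_ae (Eventually.of_forall fun y => mul_comm _ _)
  set ψ := p.wave t (fun y => (g y : ℂ)) with hψ
  have hψH := memH1_wave hlt hg (p := p)
  have d1 := hu.hasDerivWithinAt_pairing hd hφ hβ hψH ht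
  have d1' := hasDerivWithinAt_iff_tendsto_slope.mp d1
  have hq := tendstoL2_wave_quotient hl ht hp hg
  have hu2 : TendstoL2 u (𝓝[I \ {t}] t) (u t) := by
    have := (hu.tendstoH1 ht).tendstoL2
    exact ⟨this.mem.filter_mono (nhdsWithin_mono t sdiff_subset), this.mem_lim,
      this.tendsto.mono_left (nhdsWithin_mono t sdiff_subset)⟩
  have d2 := hu2.integral_mul hq
  -- Product rule in the asymmetric form u(s)w_s - u(t)w_t = (u(s) - u(t))w_t + u(s)(w_s - w_t): the
  -- equation is tested with the fixed w_t, and the second term needs only continuity of u in `L²`.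
  refine ⟨rhsForm φ β t (u t) ψ + ∫ x, u t x * p.waveDeriv I t g x, ?_, ?_⟩
  · refine hasDerivWithinAt_iff_tendsto_slope.mpr ((d1'.add d2).congr' ?_)
    filter_upwards [self_mem_nhdsWithin] with s hs
    have m1 := (hu.memH1 s hs.1).1
    have m2 := memLp_wave_profile (p := p) (hl s hs.1) hg
    have m3 := memLp_wave_profile (p := p) hlt hg
    rw [slope_def_module, slope_def_module, hK s hs.1, hK t ht, Complex.real_smul, Complex.real_smul,
      ← hψ]
    have e : (∫ x, u s x * ((((s - t)⁻¹ : ℝ) : ℂ) * (p.wave s (fun y => (g y : ℂ)) x - ψ x)))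
        = (((s - t)⁻¹ : ℝ) : ℂ) * ((∫ x, u s x * p.wave s (fun y => (g y : ℂ)) x)
          - ∫ x, u s x * ψ x) := by
      rw [← integral_sub (integrable_mul_of_memLp m1 m2) (integrable_mul_of_memLp m1 m3),
        ← integral_const_mul]
      exact integral_congr_ae (Eventually.of_forall fun x => by ring)
    rw [e]; ring
  · have hL : ((p.lam t ^ 2 : ℝ) : ℂ) * (((p.lam t ^ 2)⁻¹ : ℝ) : ℂ) = 1 := by
      rw [← Complex.ofReal_mul, mul_inv_cancel₀ (by positivity)]; simp
    have i1 : ((p.lam t ^ 2 : ℝ) : ℂ) * (∫ x, u t x * ∑ j, pd j (pd j ψ) x)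
        = ∫ y, z y * (((Laplacian.laplacian g y
        - (∑ j, p.slope t j y ^ 2) * g y : ℝ) : ℂ)
      + Complex.I * ((-2 * (∑ j, p.slope t j y * pd j g y) + d * p.ga t / 2 * g y : ℝ) : ℂ)) := by
      rw [← integral_mul_wave hlt, ← integral_const_mul]
      refine integral_congr_ae (Eventually.of_forall fun x => ?_)
      simp only [hψ, sum_pd_pd_wave hg]
      linear_combination (u t x * p.wave t (fun y => ((Laplacian.laplacian g y
        - (∑ j, p.slope t j y ^ 2) * g y : ℝ) : ℂ)
      + Complex.I * ((-2 * (∑ j, p.slope t j y * pd j g y) + d * p.ga t / 2 * g y : ℝ) : ℂ)) x) * hL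
    have i2 : ((p.lam t ^ 2 : ℝ) : ℂ) * (∫ x, u t x * p.waveDeriv I t g x)
        = ∫ y, z y * (((p.driftRe I t g y : ℝ) : ℂ)
          - Complex.I * ((p.driftIm I t y * g y : ℝ) : ℂ)) := by
      rw [← integral_mul_wave hlt, ← integral_const_mul]
      refine integral_congr_ae (Eventually.of_forall fun x => ?_)
      simp only [waveDeriv]
      linear_combination (u t x * p.wave t (fun y => ((p.driftRe I t g y : ℝ) : ℂ)
          - Complex.I * ((p.driftIm I t y * g y : ℝ) : ℂ)) x) * hL
    have i3 : ((p.lam t ^ 2 : ℝ) : ℂ) * (∫ x, ((‖u t x‖ ^ crit d : ℝ) : ℂ) * (u t x * ψ x))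
        = ∫ y, ((‖z y‖ ^ crit d : ℝ) : ℂ) * z y * (g y : ℂ) := by
      have := integral_mul_wave hlt (fun x => ((‖u t x‖ ^ crit d : ℝ) : ℂ) * u t x)
        (fun y => (g y : ℂ))
      simp only [mul_assoc] at this
      rw [hψ, this, ← integral_const_mul]
      refine integral_congr_ae (Eventually.of_forall fun y => ?_)
      simp only
      rw [← mul_assoc]
      have := resc_crit hd hlt (u t) y
      simp only [← hz] at this
      rw [this]
    have wP : IsWeight fun y => p.potential I t y * g y := hg.isWeight.quadPoly_mul _ _ _
    have wL : IsWeight fun y => Laplacian.laplacian g y - g y := by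
      have := hg.isWeight_laplacian.add (hg.isWeight.const_mul (-1))
      convert this using 2; ring
    have j1 := pair_integrable wL hzm
    have j2 := pair_integrable hg.isWeight_scaleGen hzm
    have j3 := fun j => pair_integrable (hg.isWeight_pd j) hzm
    have j4 := pair_integrable wP hzm
    -- The twisted Laplacian and the drift are added under the integral. The balance of phases turns
    -- the zero-order part into -1 minus the potential of the defects, the balance of transport
    -- turns the first-order part into the defects of λ and α.
    have i4 : Complex.I * (∫ y, z y * (((Laplacian.laplacian g y
        - (∑ j, p.slope t j y ^ 2) * g y : ℝ) : ℂ)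
      + Complex.I * ((-2 * (∑ j, p.slope t j y * pd j g y) + d * p.ga t / 2 * g y : ℝ) : ℂ)))
        + ∫ y, z y * (((p.driftRe I t g y : ℝ) : ℂ)
          - Complex.I * ((p.driftIm I t y * g y : ℝ) : ℂ))
        = Complex.I * pair (fun y => Laplacian.laplacian g y - g y) z
          - p.defLam I t * pair (scaleGen g) z
          - ∑ j, (p.defAl I t j : ℂ) * pair (pd j g) z
          - Complex.I * pair (fun y => p.potential I t y * g y) z := by
      have k1 : Integrable (fun y => Complex.I * (((Laplacian.laplacian g y - g y : ℝ) : ℂ) * z y)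
          - (p.defLam I t : ℂ) * ((scaleGen g y : ℂ) * z y)) volume :=
        (j1.const_mul _).sub (j2.const_mul _)
      have k2 : Integrable (fun y => ∑ j, (p.defAl I t j : ℂ) * (((pd j g y : ℝ) : ℂ) * z y)) volume :=
        integrable_finsetSum _ fun j _ => (j3 j).const_mul _
      have k3 : Integrable (fun y => Complex.I * (((Laplacian.laplacian g y - g y : ℝ) : ℂ) * z y)
          - (p.defLam I t : ℂ) * ((scaleGen g y : ℂ) * z y)
          - ∑ j, (p.defAl I t j : ℂ) * (((pd j g y : ℝ) : ℂ) * z y)) volume := k1.sub k2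
      unfold pair
      simp only [← integral_const_mul]
      rw [← integral_add ((integrable_mul_of_memLp hzm (memLp_twisted_laplacian hg)).const_mul _)
        (integrable_mul_of_memLp hzm (memLp_drift hg)),
        ← integral_finsetSum _ fun j _ => (j3 j).const_mul _,
        ← integral_sub (j1.const_mul _) (j2.const_mul _), ← integral_sub k1 k2, ← integral_sub k3 (j4.const_mul _)]
      refine integral_congr_ae (Eventually.of_forall fun y => ?_)
      have a1 := congrArg (fun r : ℝ => (r : ℂ)) (driftIm_add_slope (p := p) (I := I) (t := t) y)
      have a2 := congrArg (fun r : ℝ => (r : ℂ))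
        (driftRe_add_slope (p := p) (I := I) (t := t) (g := g) y)
      have a3 : ∑ j, (p.defAl I t j : ℂ) * (((pd j g y : ℝ) : ℂ) * z y)
          = (∑ j, (p.defAl I t j : ℂ) * ((pd j g y : ℝ) : ℂ)) * z y := by
        rw [Finset.sum_mul]; exact Finset.sum_congr rfl fun j _ => by ring
      simp only [a3]
      push_cast at a1 a2 ⊢
      linear_combination (-Complex.I * z y * (g y : ℂ)) * a1 + z y * a2
        + (z y * (-2 * (∑ j, (p.slope t j y : ℂ) * ((pd j g y : ℝ) : ℂ))
          + d * p.ga t / 2 * g y)) * Complex.I_sq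
    rw [rhsForm_wave hlt hg hut, mul_add, mul_add, mul_add, mul_left_comm, i1, mul_left_comm, i3,
      i2]
    linear_combination i4

end Solution

end ModPath

end RNLS

namespace RNLS

open scoped ContDiff

variable {d : ℕ}

/-! ### The nonlinear remainder -/

section Remainder

/-- The superlinear part of `h ↦ |q + h|^{4/d} (q + h)`. -/
noncomputable def nlRem (d : ℕ) (q : ℝ) (h : ℂ) : ℂ :=
  ((‖(q : ℂ) + h‖ ^ crit d : ℝ) : ℂ) * ((q : ℂ) + h) - ((q ^ (1 + crit d) : ℝ) : ℂ)
    - (((1 + crit d) * (q ^ crit d * h.re) : ℝ) : ℂ) - Complex.I * ((q ^ crit d * h.im : ℝ) : ℂ)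

lemma norm_sq_add_eq (q : ℝ) (h : ℂ) : ‖(q : ℂ) + h‖ ^ 2 = q ^ 2 + (2 * q * h.re + ‖h‖ ^ 2) := by
  rw [← Complex.normSq_eq_norm_sq, ← Complex.normSq_eq_norm_sq, Complex.normSq_apply,
    Complex.normSq_apply]
  simp only [Complex.add_re, Complex.ofReal_re, Complex.add_im, Complex.ofReal_im]
  ring

lemma nlRem_two (q : ℝ) (h : ℂ) : nlRem 2 q h
    = ((q * ‖h‖ ^ 2 : ℝ) : ℂ) + ((2 * q * h.re + ‖h‖ ^ 2 : ℝ) : ℂ) * h := by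
  have e := norm_sq_add_eq q h
  have hh := Complex.re_add_im h
  simp only [nlRem, crit, Nat.reduceDiv, e]
  push_cast
  linear_combination (-(q : ℂ) ^ 2) * hh

lemma nlRem_one (q : ℝ) (h : ℂ) : nlRem 1 q h
    = ((2 * q ^ 3 * ‖h‖ ^ 2 : ℝ) : ℂ) + ((2 * q ^ 2 * (2 * q * h.re + ‖h‖ ^ 2) : ℝ) : ℂ) * h
      + (((2 * q * h.re + ‖h‖ ^ 2) ^ 2 : ℝ) : ℂ) * ((q : ℂ) + h) := by
  have e : ‖(q : ℂ) + h‖ ^ 4 = (q ^ 2 + (2 * q * h.re + ‖h‖ ^ 2)) ^ 2 := by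
    rw [← norm_sq_add_eq]; ring
  have hh := Complex.re_add_im h
  simp only [nlRem, crit, Nat.reduceDiv, e]
  push_cast
  linear_combination (-(q : ℂ) ^ 4) * hh

/-- As 4/d is an even integer, the nonlinearity is a real polynomial in the components of h. What
remains after removing orders zero and one has degrees 2 to 1 + 4/d in h, with coefficients bounded
for 0 ≤ q ≤ K. -/
lemma exists_norm_nlRem_le (hd : d = 1 ∨ d = 2) {K : ℝ} (hK : 0 ≤ K) : ∃ C : ℝ, 0 ≤ C ∧
    ∀ q : ℝ, 0 ≤ q → q ≤ K → ∀ h : ℂ,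
      ‖nlRem d q h‖ ≤ C * (‖h‖ ^ 2 + ∑ k ∈ Finset.Icc 3 (1 + crit d), ‖h‖ ^ k) := by
  have hs : ∀ q : ℝ, 0 ≤ q → q ≤ K → ∀ h : ℂ,
      ‖((2 * q * h.re + ‖h‖ ^ 2 : ℝ) : ℂ)‖ ≤ 2 * K * ‖h‖ + ‖h‖ ^ 2 := fun q hq hqK h => by
    rw [Complex.norm_real, Real.norm_eq_abs]
    refine (abs_add_le _ _).trans ?_
    rw [abs_mul, abs_of_nonneg (by positivity : 0 ≤ 2 * q), abs_of_nonneg (sq_nonneg ‖h‖)]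
    gcongr
    exact Complex.abs_re_le_norm h
  rcases hd with rfl | rfl
  -- The numbers 10, 10, 5, 1 are the coefficients of degree two to five in |h| of (K + |h|)⁵. In
  -- dimension two the same expansion of (K + |h|)³ gives 3K + 1.
  · refine ⟨10 * K ^ 3 + 10 * K ^ 2 + 5 * K + 1, by positivity, fun q hq hqK h => ?_⟩
    have e : ∑ k ∈ Finset.Icc 3 (1 + crit 1), ‖h‖ ^ k = ‖h‖ ^ 3 + (‖h‖ ^ 4 + ‖h‖ ^ 5) := by
      rw [show Finset.Icc 3 (1 + crit 1) = {3, 4, 5} from rfl]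
      simp [Finset.sum_insert]
    rw [e, nlRem_one]
    have s := hs q hq hqK h
    have a1 : ‖((2 * q ^ 3 * ‖h‖ ^ 2 : ℝ) : ℂ)‖ ≤ 2 * K ^ 3 * ‖h‖ ^ 2 := by
      rw [Complex.norm_real, Real.norm_eq_abs, abs_of_nonneg (by positivity)]
      gcongr
    have a2 : ‖((2 * q ^ 2 * (2 * q * h.re + ‖h‖ ^ 2) : ℝ) : ℂ) * h‖
        ≤ 2 * K ^ 2 * (2 * K * ‖h‖ + ‖h‖ ^ 2) * ‖h‖ := by
      rw [Complex.ofReal_mul, norm_mul, norm_mul]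
      gcongr
      rw [Complex.norm_real, Real.norm_eq_abs, abs_of_nonneg (by positivity)]
      gcongr
    have a3 : ‖(((2 * q * h.re + ‖h‖ ^ 2) ^ 2 : ℝ) : ℂ) * ((q : ℂ) + h)‖
        ≤ (2 * K * ‖h‖ + ‖h‖ ^ 2) ^ 2 * (K + ‖h‖) := by
      rw [Complex.ofReal_pow, norm_mul, norm_pow]
      gcongr
      refine (norm_add_le _ _).trans ?_
      rw [Complex.norm_real, Real.norm_eq_abs, abs_of_nonneg hq]
      gcongr
    refine (norm_add₃_le).trans ((add_le_add (add_le_add a1 a2) a3).trans ?_)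
    have n := norm_nonneg h
    have b2 : 0 ≤ (10 * K ^ 2 + 5 * K + 1) * ‖h‖ ^ 2 := by positivity
    have b3 : 0 ≤ (10 * K ^ 3 + 5 * K + 1) * ‖h‖ ^ 3 := by positivity
    have b4 : 0 ≤ (10 * K ^ 3 + 10 * K ^ 2 + 1) * ‖h‖ ^ 4 := by positivity
    have b5 : 0 ≤ (10 * K ^ 3 + 10 * K ^ 2 + 5 * K) * ‖h‖ ^ 5 := by positivity
    linarith
  · refine ⟨3 * K + 1, by positivity, fun q hq hqK h => ?_⟩
    have e : ∑ k ∈ Finset.Icc 3 (1 + crit 2), ‖h‖ ^ k = ‖h‖ ^ 3 := by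
      rw [show Finset.Icc 3 (1 + crit 2) = {3} from rfl]
      simp
    rw [e, nlRem_two]
    have a1 : ‖((q * ‖h‖ ^ 2 : ℝ) : ℂ)‖ ≤ K * ‖h‖ ^ 2 := by
      rw [Complex.norm_real, Real.norm_eq_abs, abs_of_nonneg (by positivity)]
      gcongr
    have a2 : ‖((2 * q * h.re + ‖h‖ ^ 2 : ℝ) : ℂ) * h‖ ≤ (2 * K * ‖h‖ + ‖h‖ ^ 2) * ‖h‖ := by
      rw [norm_mul]
      gcongr
      exact hs q hq hqK h
    refine (norm_add_le _ _).trans ((add_le_add a1 a2).trans ?_)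
    have b2 : 0 ≤ ‖h‖ ^ 2 := by positivity
    have b3 : 0 ≤ 3 * K * ‖h‖ ^ 3 := by positivity
    linarith

lemma continuous_nlRem : Continuous fun p : ℝ × ℂ => nlRem d p.1 p.2 := by
  unfold nlRem; fun_prop

variable {Q g : E d → ℝ}

/-- The remainder depends on η only through bounds in |η|. It is therefore estimated by norms of any
`H¹` function of the same modulus; ε is used, because its `H¹` norm is the one in the conclusion. -/
lemma IsGroundState.exists_integral_nlRem_le (hQ : IsGroundState Q) (hd : d = 1 ∨ d = 2)
    (hg : IsWeight g) : ∃ C : ℝ, 0 ≤ C ∧ ∀ f η : E d → ℂ, MemH1 f → MemLp η 2 volume →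
      (∀ y, ‖η y‖ = ‖f y‖) → Integrable (fun y => nlRem d (Q y) (η y) * (g y : ℂ)) volume ∧
      ‖∫ y, nlRem d (Q y) (η y) * (g y : ℂ)‖
        ≤ C * (l2Norm f ^ 2 + ∑ k ∈ Finset.Icc 3 (1 + crit d), h1Norm f ^ k) := by
  have hp := hQ.isProfile hd
  obtain ⟨K, hK0, hK⟩ := hp.decays.exists_bound
  obtain ⟨G, hG0, hG⟩ := hg.decays.exists_bound
  obtain ⟨C₁, hC₁, hrem⟩ := exists_norm_nlRem_le hd hK0
  obtain ⟨C₂, hC₂, hint⟩ := MemH1.exists_integral_pow_le (d := d) hd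
  refine ⟨C₁ * G * (1 + C₂), by positivity, fun f η hf hη hfη => ?_⟩
  have hi2 : Integrable (fun y => ‖f y‖ ^ 2) volume := hf.1.norm.integrable_sq
  have hisum : Integrable (fun y => ∑ k ∈ Finset.Icc 3 (1 + crit d), ‖f y‖ ^ k) volume :=
    integrable_finsetSum _ fun k hk => (hint f hf k hk).1
  have hB : Integrable (fun y => C₁ * G * (‖f y‖ ^ 2
      + ∑ k ∈ Finset.Icc 3 (1 + crit d), ‖f y‖ ^ k)) volume := (hi2.add hisum).const_mul _
  have hb : ∀ y, ‖nlRem d (Q y) (η y) * (g y : ℂ)‖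
      ≤ C₁ * G * (‖f y‖ ^ 2 + ∑ k ∈ Finset.Icc 3 (1 + crit d), ‖f y‖ ^ k) := fun y => by
    rw [norm_mul, Complex.norm_real, Real.norm_eq_abs, mul_right_comm]
    have := hrem (Q y) (hQ.pos y).le ((le_abs_self _).trans (hK y)) (η y)
    rw [hfη] at this
    exact mul_le_mul this (hG y) (abs_nonneg _) ((norm_nonneg _).trans this)
  have hm : AEStronglyMeasurable (fun y => nlRem d (Q y) (η y) * (g y : ℂ)) volume :=
    (continuous_nlRem.comp_aestronglyMeasurable
      (hp.contDiff.continuous.aestronglyMeasurable.prodMk hη.1)).mul hg.memLp.1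
  refine ⟨hB.mono' hm (Eventually.of_forall hb), (norm_integral_le_of_norm_le hB
    (Eventually.of_forall hb)).trans ?_⟩
  rw [integral_const_mul, integral_add hi2 hisum, integral_finsetSum _ fun k hk => (hint f hf k hk).1,
    ← l2Norm_sq hf.1, mul_assoc (C₁ * G)]
  refine mul_le_mul_of_nonneg_left ?_ (by positivity)
  have h1 : ∑ k ∈ Finset.Icc 3 (1 + crit d), ∫ y, ‖f y‖ ^ k
      ≤ C₂ * ∑ k ∈ Finset.Icc 3 (1 + crit d), h1Norm f ^ k := by
    rw [Finset.mul_sum]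
    exact Finset.sum_le_sum fun k hk => (hint f hf k hk).2
  have h2 : 0 ≤ C₂ * l2Norm f ^ 2 := by positivity
  have h3 : 0 ≤ ∑ k ∈ Finset.Icc 3 (1 + crit d), h1Norm f ^ k :=
    Finset.sum_nonneg fun k _ => pow_nonneg (h1Norm_nonneg f) k
  linarith

lemma integral_ofReal_mul_re {f : E d → ℂ} (hg : IsWeight g) (hf : MemLp f 2 volume) :
    (∫ y, ((g y * (f y).re : ℝ) : ℂ)) = ((pair g f).re : ℂ) := by
  rw [integral_complex_ofReal]
  congr 1
  have := Complex.reCLM.integral_comp_comm (pair_integrable hg hf)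
  simpa [pair] using this

lemma integral_ofReal_mul_im {f : E d → ℂ} (hg : IsWeight g) (hf : MemLp f 2 volume) :
    (∫ y, ((g y * (f y).im : ℝ) : ℂ)) = ((pair g f).im : ℂ) := by
  rw [integral_complex_ofReal]
  congr 1
  have := Complex.imCLM.integral_comp_comm (pair_integrable hg hf)
  simpa [pair] using this

lemma integrable_ofReal_mul_re {f : E d → ℂ} (hg : IsWeight g) (hf : MemLp f 2 volume) :
    Integrable (fun y => ((g y * (f y).re : ℝ) : ℂ)) volume := by
  have := (pair_integrable hg hf).re.ofReal (𝕜 := ℂ)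
  simpa using this

lemma integrable_ofReal_mul_im {f : E d → ℂ} (hg : IsWeight g) (hf : MemLp f 2 volume) :
    Integrable (fun y => ((g y * (f y).im : ℝ) : ℂ)) volume := by
  have := (pair_integrable hg hf).im.ofReal (𝕜 := ℂ)
  simpa using this

/-- Expansion of the nonlinear term around the ground state. -/
lemma IsGroundState.integral_nonlinearity (hQ : IsGroundState Q) (hd : d = 1 ∨ d = 2)
    (hg : IsWeight g) {η : E d → ℂ} (hη : MemLp η 2 volume)
    (hr : Integrable (fun y => nlRem d (Q y) (η y) * (g y : ℂ)) volume) :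
    ∫ y, ((‖(Q y : ℂ) + η y‖ ^ crit d : ℝ) : ℂ) * ((Q y : ℂ) + η y) * (g y : ℂ)
      = ((∫ y, Q y ^ (1 + crit d) * g y : ℝ) : ℂ)
        + ((1 + crit d : ℝ) : ℂ) * ((pair (fun y => Q y ^ crit d * g y) η).re : ℂ)
        + Complex.I * ((pair (fun y => Q y ^ crit d * g y) η).im : ℂ)
        + ∫ y, nlRem d (Q y) (η y) * (g y : ℂ) := by
  have w := hQ.isWeight_pow_mul hd (crit d) hg
  have w1 := hQ.isWeight_pow_mul hd (1 + crit d) hg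
  have i0 : Integrable (fun y => ((Q y ^ (1 + crit d) * g y : ℝ) : ℂ)) volume :=
    w1.integrable.ofReal
  have i1 := (integrable_ofReal_mul_re w hη).const_mul ((1 + crit d : ℝ) : ℂ)
  have i2 := (integrable_ofReal_mul_im w hη).const_mul Complex.I
  rw [← integral_ofReal_mul_re w hη, ← integral_ofReal_mul_im w hη, ← integral_complex_ofReal,
    ← integral_const_mul, ← integral_const_mul, ← integral_add i0 i1,
    ← integral_add (by exact i0.add i1) i2, ← integral_add (by exact (i0.add i1).add i2) hr]
  refine integral_congr_ae (Eventually.of_forall fun y => ?_)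
  simp only [nlRem]
  push_cast
  ring

end Remainder

/-! ### The noise near its zero -/

section NoiseNearOrigin

variable {N : ℕ} {φ : Fin N → E d → ℝ}

lemma norm_le_pow_of_norm_fderiv_le {F : Type*} [NormedAddCommGroup F] [NormedSpace ℝ F]
    {f : E d → F} (hf : Differentiable ℝ f) (h0 : f 0 = 0) {K : ℝ} {n : ℕ}
    (h : ∀ x, ‖fderiv ℝ f x‖ ≤ K * ‖x‖ ^ n) (x : E d) : ‖f x‖ ≤ K * ‖x‖ ^ (n + 1) := by
  rcases eq_or_ne x 0 with rfl | hx
  · simp [h0]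
  have hK : 0 ≤ K := by
    have := (norm_nonneg _).trans (h x)
    exact nonneg_of_mul_nonneg_left this (by positivity)
  have := (convex_closedBall (0 : E d) ‖x‖).norm_image_sub_le_of_norm_fderiv_le (𝕜 := ℝ)
    (fun y _ => hf y) (C := K * ‖x‖ ^ n) (fun y hy => (h y).trans (by
      gcongr; simpa using hy)) (x := 0) (y := x) (by simp) (by simp)
  simpa [h0, pow_succ, mul_assoc] using this

/-- Taylor's estimate by repeated mean value inequalities: the sixth derivative is bounded, and each
lower one, which vanishes at the origin, gains a power of ‖x‖. The cases j = 5 and j = 4 are the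
gradient and the second derivatives. -/
lemma exists_norm_iteratedFDeriv_le {f : E d → ℝ} (hf : IsCbInfty f) (h0 : FlatAtOrigin f) :
    ∃ K : ℝ, 0 ≤ K ∧ ∀ j, j ≤ 6 → ∀ x, ‖iteratedFDeriv ℝ (6 - j) f x‖ ≤ K * ‖x‖ ^ j := by
  obtain ⟨K, hK⟩ := hf.2 6
  refine ⟨K, (norm_nonneg _).trans (hK 0), fun j => ?_⟩
  induction j with
  | zero => intro _ x; simpa using hK x
  | succ n ih =>
    intro hn x
    refine norm_le_pow_of_norm_fderiv_le (hf.1.differentiable_iteratedFDeriv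
      (WithTop.coe_lt_coe.mpr (ENat.natCast_lt_top _))) (h0 _ (by omega)) (fun y => ?_) x
    rw [norm_fderiv_iteratedFDeriv, show 6 - (n + 1) + 1 = 6 - n by omega]
    exact ih (by omega) y

lemma exists_noise_flat_bound (hφ : ∀ k, IsCbInfty (φ k)) (h0 : ∀ k, FlatAtOrigin (φ k)) :
    ∃ K : ℝ, 0 ≤ K ∧ ∀ (v : Fin N → ℝ) (A : ℝ), (∀ k, |v k| ≤ A) → ∀ x,
      (∀ j, |noiseGrad φ v j x| ≤ K * A * ‖x‖ ^ 5) ∧ |noiseLap φ v x| ≤ K * A * ‖x‖ ^ 4 := by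
  choose K hK0 hK using fun k => exists_norm_iteratedFDeriv_le (hφ k) (h0 k)
  have hS : 0 ≤ ∑ k, K k := Finset.sum_nonneg fun k _ => hK0 k
  have h1 : ∀ (v : Fin N → ℝ) (A : ℝ), (∀ k, |v k| ≤ A) → ∀ x j,
      |noiseGrad φ v j x| ≤ (∑ k, K k) * A * ‖x‖ ^ 5 := fun v A hv x j => by
    unfold noiseGrad
    rw [Finset.sum_mul, Finset.sum_mul]
    refine (Finset.abs_sum_le_sum_abs _ _).trans (Finset.sum_le_sum fun k _ => ?_)
    rw [abs_mul, mul_right_comm]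
    refine mul_le_mul ?_ (hv k) (abs_nonneg _) (by have := hK0 k; positivity)
    have : ‖iteratedFDeriv ℝ 1 (φ k) x‖ ≤ K k * ‖x‖ ^ 5 := hK k 5 (by norm_num) x
    rw [norm_iteratedFDeriv_one] at this
    exact (norm_pd_le j _ x).trans this
  have h2 : ∀ (v : Fin N → ℝ) (A : ℝ), (∀ k, |v k| ≤ A) → ∀ x,
      |noiseLap φ v x| ≤ d * (∑ k, K k) * A * ‖x‖ ^ 4 := fun v A hv x => by
    rw [← sum_pd_noiseGrad hφ, mul_assoc (d : ℝ), mul_assoc (d : ℝ)]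
    refine (Finset.abs_sum_le_sum_abs _ _).trans ?_
    have : ∀ j ∈ (Finset.univ : Finset (Fin d)), |pd j (noiseGrad φ v j) x|
        ≤ (∑ k, K k) * A * ‖x‖ ^ 4 := fun j _ => by
      rw [pd_noiseGrad hφ, Finset.sum_mul, Finset.sum_mul]
      refine (Finset.abs_sum_le_sum_abs _ _).trans (Finset.sum_le_sum fun k _ => ?_)
      rw [abs_mul, mul_right_comm]
      refine mul_le_mul ?_ (hv k) (abs_nonneg _) (by have := hK0 k; positivity)
      exact (norm_pd_pd_le ((hφ k).1.of_le
        (WithTop.coe_le_coe.mpr (le_top : (2 : ℕ∞) ≤ ⊤))).contDiffAt j j).trans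
        (hK k 4 (by norm_num) x)
    refine (Finset.sum_le_sum this).trans_eq ?_
    simp
  refine ⟨(d + 1) * ∑ k, K k, by positivity, fun v A hv x => ⟨fun j => ?_, ?_⟩⟩
  all_goals
    rcases isEmpty_or_nonempty (Fin N) with hN | ⟨⟨k⟩⟩
    · simp [noiseGrad, noiseLap]
    have hA : 0 ≤ A := (abs_nonneg _).trans (hv k)
  · refine (h1 v A hv x j).trans ?_
    gcongr
    have : 0 ≤ (d : ℝ) * ∑ k, K k := by positivity
    linarith
  · refine (h2 v A hv x).trans ?_
    gcongr
    linarith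

end NoiseNearOrigin

end RNLS

/-! ### Sixth-order smallness of the noise on concentrated profiles. -/

namespace RNLS

open scoped ContDiff

variable {d : ℕ} {g Q : E d → ℝ}

lemma Decays.abs (hg : Decays g) : Decays fun x => |g x| := fun k => by simpa using hg k

lemma IsWeight.abs (hg : IsWeight g) : IsWeight fun x => |g x| := ⟨hg.1.abs, hg.2.abs⟩

lemma IsWeight.one_add_norm_pow_mul (hg : IsWeight g) (m : ℕ) :
    IsWeight fun x => (1 + ‖x‖) ^ m * g x :=
  ⟨((continuous_const.add continuous_norm).pow m).mul hg.1, hg.2.mul_of_le 1 m fun x => by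
    rw [one_mul, abs_of_nonneg (by positivity)]⟩

namespace ModPath

variable {p : ModPath d} {t : ℝ}

lemma norm_wave (hl : 0 < p.lam t) (G : E d → ℂ) (x : E d) :
    ‖p.wave t G x‖ = p.lam t ^ (-(d : ℝ) / 2) * ‖G (p.point t x)‖ := by
  rw [wave, norm_mul, norm_twist, Complex.norm_real, Real.norm_eq_abs, abs_of_pos (by positivity)]

lemma size_nonneg : 0 ≤ p.size t := by unfold size; positivity

lemma lam_le_size : p.lam t ≤ p.size t := by
  unfold size
  have := le_abs_self (p.lam t)
  have := norm_nonneg (p.al t)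
  have := norm_nonneg (p.be t)
  have := abs_nonneg (p.ga t)
  linarith

lemma norm_be_le_size : ‖p.be t‖ ≤ p.size t := by
  unfold size
  have := abs_nonneg (p.lam t)
  have := norm_nonneg (p.al t)
  have := abs_nonneg (p.ga t)
  linarith

lemma abs_ga_le_size : |p.ga t| ≤ p.size t := by
  unfold size
  have := abs_nonneg (p.lam t)
  have := norm_nonneg (p.al t)
  have := norm_nonneg (p.be t)
  linarith

/-- Since x = λy + α, each power of the distance to the zero of the noise becomes a power of P, at
the price of a weight in y. -/
lemma norm_le_size_mul (hl : 0 < p.lam t) (x : E d) :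
    ‖x‖ ≤ p.size t * (1 + ‖p.point t x‖) := by
  conv_lhs => rw [← affine_affine_inv hl (p.al t) x]
  refine (norm_add_le _ _).trans ?_
  rw [norm_smul, Real.norm_eq_abs]
  change |p.lam t| * ‖p.point t x‖ + _ ≤ _
  have h1 : ‖p.al t‖ ≤ p.size t := by
    unfold size
    have := abs_nonneg (p.lam t)
    have := norm_nonneg (p.be t)
    have := abs_nonneg (p.ga t)
    linarith
  have h2 : |p.lam t| * ‖p.point t x‖ ≤ p.size t * ‖p.point t x‖ := by
    gcongr
    rw [abs_of_pos hl]; exact lam_le_size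
  linarith

lemma abs_slope_le (hs : p.size t ≤ 1) (j : Fin d) (y : E d) : |p.slope t j y| ≤ 1 + ‖y‖ := by
  unfold slope
  refine (abs_sub _ _).trans (add_le_add ?_ ?_)
  · exact (PiLp.norm_apply_le (p.be t) j).trans (norm_be_le_size.trans hs)
  · rw [abs_mul, abs_div, abs_two]
    have h1 := abs_ga_le_size.trans hs
    have h2 : |y j| ≤ ‖y‖ := PiLp.norm_apply_le y j
    calc |p.ga t| / 2 * |y j| ≤ 1 * ‖y‖ := by gcongr; linarith [abs_nonneg (p.ga t)]
      _ = ‖y‖ := one_mul _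

lemma norm_covd_le (hs : p.size t ≤ 1) (hg : IsProfile g) (j : Fin d) (y : E d) :
    ‖p.covd t j (fun y => (g y : ℂ)) y‖ ≤ |pd j g y| + (1 + ‖y‖) * |g y| := by
  rw [covd_ofReal hg]
  refine (norm_sub_le _ _).trans ?_
  rw [norm_mul, Complex.norm_I, one_mul, Complex.norm_real, Complex.norm_real, Real.norm_eq_abs,
    Real.norm_eq_abs, abs_mul]
  gcongr
  exact abs_slope_le hs j y

variable {N : ℕ} {φ : Fin N → E d → ℝ}

/-- The noise acts on a concentrated profile only to sixth order. -/
theorem exists_norm_noise_pairing_le (hφ : ∀ k, IsCbInfty (φ k)) (h0 : ∀ k, FlatAtOrigin (φ k))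
    (hg : IsProfile g) (A : ℝ) : ∃ C : ℝ, 0 ≤ C ∧ ∀ (p : ModPath d) (t : ℝ) (β : Fin N → ℝ → ℝ)
      (r : ℝ) (f : E d → ℂ), MemH1 f → 0 < p.lam t → p.size t ≤ 1 → (∀ k, |β k r| ≤ A) →
      ‖((p.lam t ^ 2 : ℝ) : ℂ) * ∫ x, noiseTerm φ β r f x * p.wave t (fun y => (g y : ℂ)) x‖
        ≤ C * p.size t ^ 6 * l2Norm f := by
  obtain ⟨K, hK0, hK⟩ := exists_noise_flat_bound hφ h0
  -- The exponent 11 exceeds all weights that occur: 10 from the squared gradient, 4 from the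
  -- Laplacian, and 6 from the gradient combined with the slope of the phase.
  set H : E d → ℝ := fun y => (1 + ‖y‖) ^ 11 * (|g y| + ∑ j, |pd j g y|) with hHdef
  have hH : IsWeight H := (hg.isWeight.abs.add
    (IsWeight.sum _ fun j _ => (hg.isWeight_pd j).abs)).one_add_norm_pow_mul 11
  set L : ℝ := K * |A| with hL
  have hL0 : 0 ≤ L := by positivity
  set C₀ : ℝ := d * L ^ 2 + L + 2 * L * (d + 1) with hC₀
  have hC₀0 : 0 ≤ C₀ := by positivity
  refine ⟨C₀ * l2Norm (fun y => (H y : ℂ)), mul_nonneg hC₀0 (l2Norm_nonneg _),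
    fun p t β r f hf hl hs hA => ?_⟩
  have hP := size_nonneg (p := p) (t := t)
  have hW := memLp_wave hl hH.memLp (p := p)
  have hbd := fun x => hK (fun k => β k r) |A| (fun k => (hA k).trans (le_abs_self A)) x
  -- Integrating by parts first leaves no derivative on f, so the bound involves its `L²` norm
  -- alone.
  rw [integral_noiseTerm_mul hφ r hf (memH1_wave hl hg), ← integral_const_mul]
  have hae : ∀ᵐ x, ∀ j, weakPartial j (p.wave t fun y => (g y : ℂ)) x
      = (((p.lam t)⁻¹ : ℝ) : ℂ) * p.wave t (p.covd t j fun y => (g y : ℂ)) x := by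
    refine ae_all_iff.mpr fun j => ?_
    have := weakPartial_wave hl hg j (p := p)
    rwa [pd_wave_profile hg] at this
  refine (norm_integral_le_of_norm_le ((integrable_norm_mul_of_memLp hf.1 hW).const_mul
    (C₀ * p.size t ^ 6)) (hae.mono fun x hx => ?_)).trans ?_
  · simp only [hx]
    set y := p.point t x with hy
    set s := 1 + ‖y‖ with hsdef
    have hs1 : 1 ≤ s := by rw [hsdef]; linarith [norm_nonneg y]
    have hxs : ‖x‖ ≤ p.size t * s := norm_le_size_mul hl x
    set c := p.lam t ^ (-(d : ℝ) / 2) with hc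
    have hc0 : 0 ≤ c := by positivity
    set m := |g y| + ∑ j, |pd j g y| with hm
    have hm1 : |g y| ≤ m := by
      have : 0 ≤ ∑ j, |pd j g y| := Finset.sum_nonneg fun j _ => abs_nonneg _
      linarith
    have hm0 : 0 ≤ m := (abs_nonneg _).trans hm1
    have hlP : p.lam t ≤ p.size t := lam_le_size
    have hP10 : p.size t ^ 10 ≤ p.size t ^ 6 := pow_le_pow_of_le_one hP hs (by norm_num)
    have hl1 : p.lam t ≤ 1 := hlP.trans hs
    have a1 : ∀ j, |noiseGrad φ (fun k => β k r) j x| ≤ L * (p.size t * s) ^ 5 := fun j =>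
      ((hbd x).1 j).trans (by gcongr)
    have a2 : |noiseLap φ (fun k => β k r) x| ≤ L * (p.size t * s) ^ 4 := (hbd x).2.trans (by gcongr)
    have hg' : ‖p.wave t (fun y => (g y : ℂ)) x‖ ≤ c * m := by
      rw [norm_wave hl, Complex.norm_real, Real.norm_eq_abs]
      gcongr
    have b1 : ‖((p.lam t ^ 2 : ℝ) : ℂ)
        * (((∑ j : Fin d, noiseGrad φ (fun k => β k r) j x ^ 2 : ℝ) : ℂ)
          * p.wave t (fun y => (g y : ℂ)) x)‖ ≤ d * L ^ 2 * p.size t ^ 6 * (c * (s ^ 11 * m)) := by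
      rw [norm_mul, norm_mul, Complex.norm_real, Complex.norm_real, Real.norm_eq_abs, Real.norm_eq_abs,
        abs_of_nonneg (by positivity), abs_of_nonneg (Finset.sum_nonneg fun j _ => sq_nonneg _)]
      have e1 : ∑ j : Fin d, noiseGrad φ (fun k => β k r) j x ^ 2
          ≤ d * (L * (p.size t * s) ^ 5) ^ 2 := by
        refine (Finset.sum_le_sum fun j _ => sq_le_sq.mpr ((a1 j).trans (le_abs_self _))).trans_eq ?_
        simp
      calc p.lam t ^ 2 * ((∑ j : Fin d, noiseGrad φ (fun k => β k r) j x ^ 2)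
            * ‖p.wave t (fun y => (g y : ℂ)) x‖)
          ≤ 1 * (d * (L * (p.size t * s) ^ 5) ^ 2 * (c * m)) := by
            gcongr
            exact pow_le_one₀ hl.le hl1
        _ = d * L ^ 2 * p.size t ^ 10 * (c * (s ^ 10 * m)) := by ring
        _ ≤ _ := by gcongr; norm_num
    have b2 : ‖((p.lam t ^ 2 : ℝ) : ℂ) * ((noiseLap φ (fun k => β k r) x : ℂ)
          * p.wave t (fun y => (g y : ℂ)) x)‖ ≤ L * p.size t ^ 6 * (c * (s ^ 11 * m)) := by
      rw [norm_mul, norm_mul, Complex.norm_real, Complex.norm_real, Real.norm_eq_abs, Real.norm_eq_abs,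
        abs_of_nonneg (by positivity)]
      calc p.lam t ^ 2 * (|noiseLap φ (fun k => β k r) x| * ‖p.wave t (fun y => (g y : ℂ)) x‖)
          ≤ p.size t ^ 2 * (L * (p.size t * s) ^ 4 * (c * m)) := by gcongr
        _ = L * p.size t ^ 6 * (c * (s ^ 4 * m)) := by ring
        _ ≤ _ := by gcongr; norm_num
    have b3 : ‖((p.lam t ^ 2 : ℝ) : ℂ) * ∑ j, (noiseGrad φ (fun k => β k r) j x : ℂ)
          * ((((p.lam t)⁻¹ : ℝ) : ℂ) * p.wave t (p.covd t j fun y => (g y : ℂ)) x)‖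
        ≤ L * (d + 1) * p.size t ^ 6 * (c * (s ^ 11 * m)) := by
      -- Differentiating the concentrated profile costs λ⁻¹. One factor λ remains, and with |x|⁵ it
      -- makes six powers of P; in the term with the Laplacian λ² and |x|⁴ do the same.
      have e : ((p.lam t ^ 2 : ℝ) : ℂ) * ∑ j, (noiseGrad φ (fun k => β k r) j x : ℂ)
          * ((((p.lam t)⁻¹ : ℝ) : ℂ) * p.wave t (p.covd t j fun y => (g y : ℂ)) x)
          = (p.lam t : ℂ) * ∑ j, (noiseGrad φ (fun k => β k r) j x : ℂ)
            * p.wave t (p.covd t j fun y => (g y : ℂ)) x := by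
        have hl' : (p.lam t : ℂ) ≠ 0 := by exact_mod_cast hl.ne'
        rw [Finset.mul_sum, Finset.mul_sum]
        refine Finset.sum_congr rfl fun j _ => ?_
        push_cast
        field_simp
      rw [e, norm_mul, Complex.norm_real, Real.norm_eq_abs, abs_of_pos hl]
      have e2 : ‖∑ j, (noiseGrad φ (fun k => β k r) j x : ℂ)
            * p.wave t (p.covd t j fun y => (g y : ℂ)) x‖
          ≤ ∑ j, L * (p.size t * s) ^ 5 * (c * (|pd j g y| + s * |g y|)) := by
        refine (norm_sum_le _ _).trans (Finset.sum_le_sum fun j _ => ?_)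
        rw [norm_mul, norm_wave hl, Complex.norm_real, Real.norm_eq_abs]
        have := norm_covd_le hs hg j y
        have := a1 j
        gcongr
      have e3 : ∑ j, (|pd j g y| + s * |g y|) ≤ (d + 1) * (s * m) := by
        rw [Finset.sum_add_distrib]
        simp only [Finset.sum_const, Finset.card_univ, Fintype.card_fin, nsmul_eq_mul]
        have f1 : ∑ j, |pd j g y| ≤ s * m := by
          have : ∑ j, |pd j g y| ≤ m := by linarith [abs_nonneg (g y)]
          exact this.trans (le_mul_of_one_le_left hm0 hs1)
        have f2 : (d : ℝ) * (s * |g y|) ≤ d * (s * m) := by gcongr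
        linarith
      have hs0 : 0 ≤ s := by linarith
      calc p.lam t * ‖∑ j, (noiseGrad φ (fun k => β k r) j x : ℂ)
            * p.wave t (p.covd t j fun y => (g y : ℂ)) x‖
          ≤ p.size t * (L * (p.size t * s) ^ 5 * (c * ((d + 1) * (s * m)))) := by
            refine mul_le_mul hlP (e2.trans ?_) (norm_nonneg _) hP
            rw [← Finset.mul_sum, ← Finset.mul_sum]
            gcongr
        _ = L * (d + 1) * p.size t ^ 6 * (c * (s ^ 6 * m)) := by ring
        _ ≤ _ := by gcongr; norm_num
    have hWx : ‖p.wave t (fun y => (H y : ℂ)) x‖ = c * (s ^ 11 * m) := by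
      rw [norm_wave hl, Complex.norm_real, Real.norm_eq_abs, abs_of_nonneg (by positivity)]
    rw [hWx]
    set w := p.wave t (fun y => (g y : ℂ)) x with hw
    set a := ((∑ j : Fin d, noiseGrad φ (fun k => β k r) j x ^ 2 : ℝ) : ℂ)
    set b := (noiseLap φ (fun k => β k r) x : ℂ)
    set S := ∑ j, (noiseGrad φ (fun k => β k r) j x : ℂ)
          * ((((p.lam t)⁻¹ : ℝ) : ℂ) * p.wave t (p.covd t j fun y => (g y : ℂ)) x)
    set l2 := ((p.lam t ^ 2 : ℝ) : ℂ)
    have e : l2 * (f x * (-a * w - Complex.I * b * w - 2 * Complex.I * S))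
        = f x * (-(l2 * (a * w)) - Complex.I * (l2 * (b * w)) - 2 * Complex.I * (l2 * S)) := by ring
    rw [e, norm_mul]
    have n1 : ‖-(l2 * (a * w)) - Complex.I * (l2 * (b * w)) - 2 * Complex.I * (l2 * S)‖
        ≤ ‖l2 * (a * w)‖ + ‖l2 * (b * w)‖ + 2 * ‖l2 * S‖ := by
      refine (norm_sub_le _ _).trans (add_le_add ((norm_sub_le _ _).trans ?_) ?_)
      · rw [norm_neg, norm_mul Complex.I, Complex.norm_I, one_mul]
      · rw [norm_mul (2 * Complex.I), norm_mul, Complex.norm_I, mul_one]; simp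
    have n2 : ‖l2 * (a * w)‖ + ‖l2 * (b * w)‖ + 2 * ‖l2 * S‖
        ≤ C₀ * p.size t ^ 6 * (c * (s ^ 11 * m)) := by
      rw [hC₀]; linarith
    calc _ ≤ ‖f x‖ * (C₀ * p.size t ^ 6 * (c * (s ^ 11 * m))) := by gcongr; exact n1.trans n2
      _ = _ := by ring
  · rw [integral_const_mul]
    have := integral_norm_mul_le hf.1 hW
    rw [l2Norm_wave hl hH.memLp] at this
    calc _ ≤ C₀ * p.size t ^ 6 * (l2Norm f * l2Norm fun y => (H y : ℂ)) := by gcongr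
      _ = _ := by ring

end ModPath

end RNLS

/-! ### Linearization of the evolution of the pairings at the ground state, and orthogonality. -/

namespace RNLS

open scoped ContDiff

variable {d : ℕ} {g Q : E d → ℝ}

namespace ModPath

variable {p : ModPath d} {I : Set ℝ} {t : ℝ} {u : ℝ → E d → ℂ}

/-- The remainder in rescaled variables with the modulation phase removed. -/
noncomputable def eta (p : ModPath d) (Q : E d → ℝ) (u : ℝ → E d → ℂ) (t : ℝ) (y : E d) : ℂ :=
  p.resc t (u t) y - (Q y : ℂ)

/-- The right-hand side of the estimate, without the parameter `P² ‖ε‖`. -/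
noncomputable def good (p : ModPath d) (Q : E d → ℝ) (u : ℝ → E d → ℂ) (t : ℝ) : ℝ :=
  l2Norm (p.eps Q u t) ^ 2 + ∑ k ∈ Finset.Icc 3 (1 + crit d), h1Norm (p.eps Q u t) ^ k
    + p.size t ^ 6

/-- The admissible errors in the linearized equations. -/
noncomputable def rest (p : ModPath d) (Q : E d → ℝ) (u : ℝ → E d → ℂ) (I : Set ℝ) (t : ℝ) : ℝ :=
  p.good Q u t + (p.size t + l2Norm (p.eps Q u t)) * p.modEq I t

lemma l2Norm_eta : l2Norm (p.eta Q u t) = l2Norm (p.eps Q u t) :=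
  l2Norm_congr_norm fun y => (norm_eps Q u y).symm

lemma memLp_eta (hl : 0 < p.lam t) (hu : MemLp (u t) 2 volume) (hQ : IsWeight Q) :
    MemLp (p.eta Q u t) 2 volume := (memLp_resc hl hu).sub hQ.memLp

lemma memH1_eps (hl : 0 < p.lam t) (hu : MemH1 (u t)) (hQ : IsProfile Q) :
    MemH1 (p.eps Q u t) := by
  have h1 : MemH1 (p.twist t fun y => (Q y : ℂ)) := by
    refine memH1_of_contDiff (contDiff_twist ((contDiff_ofReal_profile hQ).of_le (by norm_num)))
      (memLp_twist hQ.isWeight.memLp) fun j => ?_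
    rw [show pd j (p.twist t fun y => (Q y : ℂ)) = p.twist t (p.covd t j fun y => (Q y : ℂ)) from
      funext fun y => pd_twist ((contDiff_ofReal_profile hQ).differentiable (by simp) y) j]
    exact memLp_twist (memLp_covd hQ j)
  have h2 := ((hu.comp_affine hl (p.al t)).const_mul (((p.lam t ^ ((d : ℝ) / 2) : ℝ) : ℂ)
    * Complex.exp (-(p.th t : ℂ) * Complex.I))).sub
    (h1.conj.const_mul (Complex.exp (-(p.th t : ℂ) * Complex.I)))
  refine h2.congr_ae (Eventually.of_forall fun y => ?_)
  have e : ∀ s : ℝ, (starRingEnd ℂ) (Complex.exp ((s : ℂ) * Complex.I))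
      = Complex.exp (((-s : ℝ) : ℂ) * Complex.I) := fun s => by
    rw [← Complex.exp_conj]; simp
  have e2 : Complex.exp (-(p.th t : ℂ) * Complex.I)
      * Complex.exp (((p.phase t y + p.th t : ℝ) : ℂ) * Complex.I)
      = Complex.exp ((p.phase t y : ℂ) * Complex.I) := by
    rw [← Complex.exp_add]; congr 1; push_cast; ring
  simp only [eps, deform, twist, angle, Complex.star_def, map_mul, e, Complex.conj_ofReal, neg_neg]
  rw [← e2]
  ring

lemma good_nonneg : 0 ≤ p.good Q u t := by
  unfold good
  have : 0 ≤ ∑ k ∈ Finset.Icc 3 (1 + crit d), h1Norm (p.eps Q u t) ^ k :=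
    Finset.sum_nonneg fun k _ => pow_nonneg (h1Norm_nonneg _) k
  have := size_nonneg (p := p) (t := t)
  positivity

lemma modEq_nonneg : 0 ≤ p.modEq I t := by unfold modEq; positivity

lemma abs_defLam_le : |p.defLam I t| ≤ p.modEq I t := by
  rw [modEq_eq]
  have := abs_nonneg (p.defGa I t)
  have := norm_nonneg (p.defAl I t)
  have := norm_nonneg (p.defBe I t)
  have := abs_nonneg (p.defTh I t)
  linarith

lemma norm_defAl_add_le : |p.defLam I t| + ‖p.defAl I t‖ ≤ p.modEq I t := by
  rw [modEq_eq]
  have := abs_nonneg (p.defGa I t)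
  have := norm_nonneg (p.defBe I t)
  have := abs_nonneg (p.defTh I t)
  linarith

lemma abs_defAl_le (j : Fin d) : |p.defAl I t j| ≤ p.modEq I t :=
  (PiLp.norm_apply_le (p.defAl I t) j).trans
    ((le_add_of_nonneg_left (abs_nonneg _)).trans norm_defAl_add_le)

lemma abs_defBe_le (j : Fin d) : |p.defBe I t j| ≤ p.modEq I t := by
  refine (PiLp.norm_apply_le (p.defBe I t) j).trans ?_
  rw [modEq_eq]
  have := abs_nonneg (p.defGa I t)
  have := abs_nonneg (p.defLam I t)
  have := norm_nonneg (p.defAl I t)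
  have := abs_nonneg (p.defTh I t)
  linarith

lemma abs_defGa_le : |p.defGa I t| ≤ p.modEq I t := by
  rw [modEq_eq]
  have := abs_nonneg (p.defLam I t)
  have := norm_nonneg (p.defAl I t)
  have := norm_nonneg (p.defBe I t)
  have := abs_nonneg (p.defTh I t)
  linarith

lemma abs_defTh_le : |p.defTh I t| ≤ p.modEq I t := by
  rw [modEq_eq]
  have := abs_nonneg (p.defLam I t)
  have := norm_nonneg (p.defAl I t)
  have := norm_nonneg (p.defBe I t)
  have := abs_nonneg (p.defGa I t)
  linarith

lemma abs_inner_defAl_le : |inner ℝ (p.be t) (p.defAl I t)| ≤ p.size t * p.modEq I t :=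
  (abs_real_inner_le_norm _ _).trans (mul_le_mul norm_be_le_size
    ((le_add_of_nonneg_left (abs_nonneg _)).trans norm_defAl_add_le) (norm_nonneg _) size_nonneg)

/-- The potential contains products of a defect with a parameter besides the defects themselves;
such products are of size P · Mod and are absorbed at the end. -/
lemma abs_linear_correction_le (j : Fin d) :
    |p.ga t / 2 * p.defAl I t j - p.defLam I t * p.be t j| ≤ p.size t * p.modEq I t := by
  refine (abs_sub _ _).trans ?_
  rw [abs_mul, abs_mul, abs_div, abs_two]
  have h1 : |p.ga t| / 2 * |p.defAl I t j| ≤ p.size t * ‖p.defAl I t‖ :=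
    mul_le_mul (by have := abs_ga_le_size (p := p) (t := t); have := abs_nonneg (p.ga t); linarith)
      (PiLp.norm_apply_le (p.defAl I t) j) (abs_nonneg _) size_nonneg
  have h2 : |p.defLam I t| * |p.be t j| ≤ |p.defLam I t| * p.size t :=
    mul_le_mul_of_nonneg_left ((PiLp.norm_apply_le (p.be t) j).trans norm_be_le_size) (abs_nonneg _)
  have h3 := mul_le_mul_of_nonneg_left (norm_defAl_add_le (p := p) (I := I) (t := t))
    (size_nonneg (p := p) (t := t))
  linarith

lemma abs_quadratic_correction_le :
    |p.defLam I t * p.ga t / 2| ≤ p.size t * p.modEq I t := by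
  rw [abs_div, abs_mul, abs_two]
  have h := mul_le_mul (abs_defLam_le (p := p) (I := I) (t := t)) (abs_ga_le_size (p := p) (t := t))
    (abs_nonneg _) modEq_nonneg
  have : 0 ≤ |p.defLam I t| * |p.ga t| := by positivity
  linarith

section Linearized

variable {N : ℕ} {φ : Fin N → E d → ℝ}

/-- The main terms in the evolution of the real part of the pairing with `g`. -/
noncomputable def mainRe (p : ModPath d) (Q : E d → ℝ) (u : ℝ → E d → ℂ) (I : Set ℝ) (t : ℝ)
    (g : E d → ℝ) : ℝ :=
  (pair (linMinus Q g) (p.eta Q u t)).im + p.defLam I t * (∫ y, g y * scaleGen Q y)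
    + ∑ j, p.defAl I t j * ∫ y, g y * pd j Q y

/-- The main terms in the evolution of the imaginary part of the pairing with `g`. -/
noncomputable def mainIm (p : ModPath d) (Q : E d → ℝ) (u : ℝ → E d → ℂ) (I : Set ℝ) (t : ℝ)
    (g : E d → ℝ) : ℝ :=
  - (pair (linPlus Q g) (p.eta Q u t)).re - p.defTh I t * (∫ y, g y * Q y)
    - (∑ j, p.defBe I t j * ∫ y, y j * g y * Q y) + p.defGa I t / 4 * ∫ y, ‖y‖ ^ 2 * g y * Q y

/-- The weights entering the error terms. -/
noncomputable def errConst (Q g : E d → ℝ) : ℝ :=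
  l2Norm (fun y => (scaleGen g y : ℂ)) + ∑ j, l2Norm (fun y => ((pd j g y : ℝ) : ℂ))
    + (|∫ y, g y * Q y| + ∑ j, |∫ y, y j * g y * Q y| + |∫ y, ‖y‖ ^ 2 * g y * Q y|)
    + 2 * (l2Norm (fun y => (g y : ℂ)) + ∑ j, l2Norm (fun y => ((y j * g y : ℝ) : ℂ))
      + l2Norm (fun y => ((‖y‖ ^ 2 * g y : ℝ) : ℂ)))

lemma sum_l2Norm_nonneg {ι : Type*} (s : Finset ι) (f : ι → E d → ℂ) :
    0 ≤ ∑ j ∈ s, l2Norm (f j) := Finset.sum_nonneg fun _ _ => l2Norm_nonneg _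

lemma abs_moments_nonneg (a c : ℝ) (b : Fin d → ℝ) : 0 ≤ |a| + ∑ j, |b j| + |c| :=
  add_nonneg (add_nonneg (abs_nonneg _) (Finset.sum_nonneg fun _ _ => abs_nonneg _)) (abs_nonneg _)

lemma errConst_nonneg (Q g : E d → ℝ) : 0 ≤ errConst Q g :=
  add_nonneg (add_nonneg (add_nonneg (l2Norm_nonneg _) (sum_l2Norm_nonneg _ _))
    (abs_moments_nonneg _ _ _)) (mul_nonneg two_pos.le
      (add_nonneg (add_nonneg (l2Norm_nonneg _) (sum_l2Norm_nonneg _ _)) (l2Norm_nonneg _)))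

lemma norm_transport_le (hg : IsProfile g) {η : E d → ℂ} (hη : MemLp η 2 volume) :
    ‖(p.defLam I t : ℂ) * pair (scaleGen g) η + ∑ j, (p.defAl I t j : ℂ) * pair (pd j g) η‖
      ≤ (l2Norm (fun y => (scaleGen g y : ℂ)) + ∑ j, l2Norm (fun y => ((pd j g y : ℝ) : ℂ)))
        * (l2Norm η * p.modEq I t) := by
  rw [add_mul, Finset.sum_mul]
  refine (norm_add_le _ _).trans (add_le_add ?_ ((norm_sum_le _ _).trans
    (Finset.sum_le_sum fun j _ => ?_)))
  · rw [norm_mul, Complex.norm_real, Real.norm_eq_abs]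
    have := mul_le_mul (abs_defLam_le (p := p) (I := I) (t := t))
      (norm_pair_le hg.isWeight_scaleGen hη) (norm_nonneg _) modEq_nonneg
    linarith
  · rw [norm_mul, Complex.norm_real, Real.norm_eq_abs]
    have := mul_le_mul (abs_defAl_le (p := p) (I := I) (t := t) j)
      (norm_pair_le (hg.isWeight_pd j) hη) (norm_nonneg _) modEq_nonneg
    linarith

/-- Every coefficient of the potential is a defect plus products bounded by P · Mod, hence at most 2
Mod when P ≤ 1. Paired with η it contributes ‖ε‖ · Mod. -/
lemma norm_pair_potential_le (hg : IsWeight g) (hs : p.size t ≤ 1) {η : E d → ℂ}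
    (hη : MemLp η 2 volume) :
    ‖pair (fun y => p.potential I t y * g y) η‖
      ≤ 2 * (l2Norm (fun y => (g y : ℂ)) + ∑ j, l2Norm (fun y => ((y j * g y : ℝ) : ℂ))
      + l2Norm (fun y => ((‖y‖ ^ 2 * g y : ℝ) : ℂ))) * (l2Norm η * p.modEq I t) := by
  have hM := modEq_nonneg (p := p) (I := I) (t := t)
  have hPM : p.size t * p.modEq I t ≤ p.modEq I t := mul_le_of_le_one_left hM hs
  have c0 : |p.defTh I t - inner ℝ (p.be t) (p.defAl I t)| ≤ 2 * p.modEq I t := by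
    refine (abs_sub _ _).trans ?_
    linarith [abs_defTh_le (p := p) (I := I) (t := t), abs_inner_defAl_le (p := p) (I := I) (t := t)]
  have c1 : ∀ j, |p.defBe I t j - p.defLam I t * p.be t j + p.ga t / 2 * p.defAl I t j|
      ≤ 2 * p.modEq I t := fun j => by
    have e : p.defBe I t j - p.defLam I t * p.be t j + p.ga t / 2 * p.defAl I t j
      = p.defBe I t j + (p.ga t / 2 * p.defAl I t j - p.defLam I t * p.be t j) := by ring
    rw [e]
    refine (abs_add_le _ _).trans ?_
    linarith [abs_defBe_le (p := p) (I := I) (t := t) j,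
      abs_linear_correction_le (p := p) (I := I) (t := t) j]
  have c2 : |p.defLam I t * p.ga t / 2 - p.defGa I t / 4| ≤ 2 * p.modEq I t := by
    refine (abs_sub _ _).trans ?_
    rw [abs_div (p.defGa I t), abs_of_pos (by norm_num : (0 : ℝ) < 4)]
    linarith [abs_defGa_le (p := p) (I := I) (t := t), abs_nonneg (p.defGa I t),
      abs_quadratic_correction_le (p := p) (I := I) (t := t)]
  have key : ∀ (c : ℝ) {w : E d → ℝ}, IsWeight w → |c| ≤ 2 * p.modEq I t →
      ‖(c : ℂ) * pair w η‖ ≤ 2 * l2Norm (fun y => (w y : ℂ)) * (l2Norm η * p.modEq I t) :=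
    fun c w hw hc => by
      rw [norm_mul, Complex.norm_real, Real.norm_eq_abs]
      have := mul_le_mul hc (norm_pair_le hw hη) (norm_nonneg _) (by linarith)
      linarith
  have e := pair_quadPoly_mul hg (p.defTh I t - inner ℝ (p.be t) (p.defAl I t))
    (fun j => p.defBe I t j - p.defLam I t * p.be t j + p.ga t / 2 * p.defAl I t j)
    (p.defLam I t * p.ga t / 2 - p.defGa I t / 4) hη
  unfold potential
  rw [e, mul_add, mul_add, add_mul, add_mul, Finset.mul_sum, Finset.sum_mul]
  exact norm_add₃_le.trans (add_le_add (add_le_add (key _ hg c0) ((norm_sum_le _ _).trans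
    (Finset.sum_le_sum fun j _ => key _ (hg.coord_mul j) (c1 j)))) (key _ hg.sq_norm_mul c2))

/-- The evolution of the pairings, linearized at the ground state. -/
theorem exists_linearized (hQ : IsGroundState Q) (hd : d = 1 ∨ d = 2) (hφ : ∀ k, IsCbInfty (φ k))
    (h0 : ∀ k, FlatAtOrigin (φ k)) (hg : IsProfile g) (A : ℝ) : ∃ C : ℝ, 0 ≤ C ∧
      ∀ (p : ModPath d) (β : Fin N → ℝ → ℝ) (t₀ t₁ t : ℝ) (u : ℝ → E d → ℂ),
        IsSolutionOn φ β t₀ t₁ u → (∀ k, ContinuousOn (β k) (Icc t₀ t₁)) →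
        (∀ k, ∀ s ∈ Icc t₀ t₁, |β k s| ≤ A) → (∀ s ∈ Icc t₀ t₁, 0 < p.lam s) → t ∈ Icc t₀ t₁ →
        p.DiffWithinAt (Icc t₀ t₁) t → p.size t ≤ 1 →
        l2Norm (u t) = l2Norm (fun y => (Q y : ℂ)) →
        ∃ D : ℂ, HasDerivWithinAt (fun s => pair g (p.resc s (u s))) D (Icc t₀ t₁) t ∧
          ‖((p.lam t ^ 2 : ℝ) : ℂ) * D - ((p.mainRe Q u (Icc t₀ t₁) t g : ℂ)
            + Complex.I * (p.mainIm Q u (Icc t₀ t₁) t g : ℂ))‖ ≤ C * p.rest Q u (Icc t₀ t₁) t := by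
  have hp := hQ.isProfile hd
  obtain ⟨C₁, hC₁, hnl⟩ := hQ.exists_integral_nlRem_le hd hg.isWeight
  obtain ⟨C₂, hC₂, hns⟩ := exists_norm_noise_pairing_le hφ h0 hg A
  have hc0 := errConst_nonneg Q g
  refine ⟨C₁ + errConst Q g + C₂ * l2Norm (fun y => (Q y : ℂ)), add_nonneg (add_nonneg hC₁ hc0)
    (mul_nonneg hC₂ (l2Norm_nonneg _)), fun p β t₀ t₁ t u hu hβ hA hl ht hpd hs hm => ?_⟩
  obtain ⟨D, hD, hDe⟩ := hasDerivWithinAt_pair_resc hu hd hφ hβ hl ht hpd hg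
  refine ⟨D, hD, ?_⟩
  set I := Icc t₀ t₁
  have hlt := hl t ht
  have hut := hu.memH1 t ht
  have hη := memLp_eta hlt hut.1 hp.isWeight
  have hηε := l2Norm_eta (p := p) (Q := Q) (u := u) (t := t)
  obtain ⟨hi, hnl'⟩ := hnl _ _ (memH1_eps hlt hut hp) hη fun y => (norm_eps Q u y).symm
  have hnoise := hns p t β t (u t) hut hlt hs fun k => hA k t ht
  set η := p.eta Q u t with hηdef
  have hz : p.resc t (u t) = fun y => (Q y : ℂ) + η y := by
    funext y; simp only [hηdef, eta]; ring
  rw [hz] at hDe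
  have hnonlin := hQ.integral_nonlinearity hd hg.isWeight hη hi
  have wL : IsWeight fun y => Laplacian.laplacian g y - g y := by
    have := hg.isWeight_laplacian.add (hg.isWeight.const_mul (-1))
    convert this using 2; ring
  have wq := hQ.isWeight_pow_mul hd (crit d) hg.isWeight
  have wP : IsWeight fun y => p.potential I t y * g y := hg.isWeight.quadPoly_mul _ _ _
  have hQm := hp.isWeight.memLp
  rw [hnonlin, pair_add_right wL hQm hη, pair_add_right hg.isWeight_scaleGen hQm hη,
    pair_add_right wP hQm hη, Finset.sum_congr rfl fun j _ => by
      rw [pair_add_right (hg.isWeight_pd j) hQm hη]] at hDe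
  -- The order zero in η cancels because Q solves the stationary equation, that is L₋Q = 0.
  have s1 : ((∫ y, Q y ^ (1 + crit d) * g y : ℝ) : ℂ)
      + pair (fun y => Laplacian.laplacian g y - g y) (fun y => (Q y : ℂ)) = 0 := by
    rw [pair_ofReal, ← Complex.ofReal_add, ← integral_add
      (hQ.isWeight_pow_mul hd _ hg.isWeight).integrable (wL.mul hp.isWeight).integrable]
    have := hg.integral_linMinus_mul hQ hd
    rw [← neg_eq_zero, ← integral_neg] at this
    rw [Complex.ofReal_eq_zero, ← this]
    refine integral_congr_ae (Eventually.of_forall fun y => ?_)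
    simp only [linMinus]; ring
  have s2 : pair (scaleGen g) (fun y => (Q y : ℂ)) = ((-∫ y, g y * scaleGen Q y : ℝ) : ℂ) := by
    rw [pair_ofReal, hg.integral_scaleGen_mul hp]
  have s3 : ∀ j, pair (pd j g) (fun y => (Q y : ℂ)) = ((-∫ y, g y * pd j Q y : ℝ) : ℂ) := fun j => by
    rw [pair_ofReal, hg.integral_pd_mul hp]
  -- The first summand is linear in the defects and belongs to the main terms; the second collects
  -- defects multiplied by parameters and belongs to the errors.
  have s4 : pair (fun y => p.potential I t y * g y) (fun y => (Q y : ℂ))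
      = ((p.defTh I t * (∫ y, g y * Q y) + (∑ j, p.defBe I t j * ∫ y, y j * g y * Q y)
          - p.defGa I t / 4 * ∫ y, ‖y‖ ^ 2 * g y * Q y : ℝ) : ℂ)
        + ((-(inner ℝ (p.be t) (p.defAl I t) * ∫ y, g y * Q y)
          + (∑ j, (p.ga t / 2 * p.defAl I t j - p.defLam I t * p.be t j) * ∫ y, y j * g y * Q y)
          + p.defLam I t * p.ga t / 2 * ∫ y, ‖y‖ ^ 2 * g y * Q y : ℝ) : ℂ) := by
    have e := pair_quadPoly_mul hg.isWeight (p.defTh I t - inner ℝ (p.be t) (p.defAl I t))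
      (fun j => p.defBe I t j - p.defLam I t * p.be t j + p.ga t / 2 * p.defAl I t j)
      (p.defLam I t * p.ga t / 2 - p.defGa I t / 4) hQm
    unfold potential
    rw [e]
    simp only [pair_ofReal]
    have e2 : ∑ j, (p.defBe I t j - p.defLam I t * p.be t j + p.ga t / 2 * p.defAl I t j)
          * ∫ y, y j * g y * Q y
        = (∑ j, p.defBe I t j * ∫ y, y j * g y * Q y)
          + ∑ j, (p.ga t / 2 * p.defAl I t j - p.defLam I t * p.be t j) * ∫ y, y j * g y * Q y := by
      rw [← Finset.sum_add_distrib]; exact Finset.sum_congr rfl fun j _ => by ring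
    have e3 := congrArg (fun r : ℝ => (r : ℂ)) e2
    simp only at e3
    push_cast at e3 ⊢
    rw [e3]; ring
  have s5 : pair (linMinus Q g) η = -(pair (fun y => Laplacian.laplacian g y - g y) η)
      - pair (fun y => Q y ^ crit d * g y) η := by
    have e : linMinus Q g = fun y => (-1) * (Laplacian.laplacian g y - g y)
      + (-1) * (Q y ^ crit d * g y) := by funext y; simp only [linMinus]; ring
    rw [e, pair_add_left (wL.const_mul _) (wq.const_mul _) hη, pair_const_mul_left,
      pair_const_mul_left]
    push_cast; ring
  have s6 : pair (linPlus Q g) η = -(pair (fun y => Laplacian.laplacian g y - g y) η)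
      - ((1 + crit d : ℝ) : ℂ) * pair (fun y => Q y ^ crit d * g y) η := by
    have e : linPlus Q g = fun y => (-1) * (Laplacian.laplacian g y - g y)
      + (-(1 + crit d)) * (Q y ^ crit d * g y) := by funext y; simp only [linPlus]; ring
    rw [e, pair_add_left (wL.const_mul _) (wq.const_mul _) hη, pair_const_mul_left,
      pair_const_mul_left]
    push_cast; ring
  set a := pair (fun y => Laplacian.laplacian g y - g y) η with ha
  set b := pair (fun y => Q y ^ crit d * g y) η with hb
  have s5' : (pair (linMinus Q g) η).im = -a.im - b.im := by rw [s5]; simp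
  have s6' : (pair (linPlus Q g) η).re = -a.re - (1 + crit d) * b.re := by
    rw [s6, Complex.sub_re, Complex.re_ofReal_mul, Complex.neg_re]
  -- The exact error: nonlinear remainder, transport of η by the defects, defects times parameters
  -- tested on Q, the potential tested on η, and the noise.
  have hE : ((p.lam t ^ 2 : ℝ) : ℂ) * D - ((p.mainRe Q u I t g : ℂ)
            + Complex.I * (p.mainIm Q u I t g : ℂ))
      = Complex.I * (∫ y, nlRem d (Q y) (η y) * (g y : ℂ))
        - ((p.defLam I t : ℂ) * pair (scaleGen g) η + ∑ j, (p.defAl I t j : ℂ) * pair (pd j g) η)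
        - Complex.I * ((-(inner ℝ (p.be t) (p.defAl I t) * ∫ y, g y * Q y)
          + (∑ j, (p.ga t / 2 * p.defAl I t j - p.defLam I t * p.be t j) * ∫ y, y j * g y * Q y)
          + p.defLam I t * p.ga t / 2 * ∫ y, ‖y‖ ^ 2 * g y * Q y : ℝ) : ℂ)
        - Complex.I * pair (fun y => p.potential I t y * g y) η
        + Complex.I * (((p.lam t ^ 2 : ℝ) : ℂ)
          * ∫ x, noiseTerm φ β t (u t) x * p.wave t (fun y => (g y : ℂ)) x) := by
    have e3 : ∑ j, (p.defAl I t j : ℂ) * (pair (pd j g) (fun y => (Q y : ℂ)) + pair (pd j g) η)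
        = -((∑ j, p.defAl I t j * ∫ y, g y * pd j Q y : ℝ) : ℂ)
          + ∑ j, (p.defAl I t j : ℂ) * pair (pd j g) η := by
      push_cast
      rw [← Finset.sum_neg_distrib, ← Finset.sum_add_distrib]
      refine Finset.sum_congr rfl fun j _ => ?_
      rw [s3]; push_cast; ring
    rw [hDe, e3, s2, s4, mainRe, mainIm, s5', s6']
    have ea : a = (a.re : ℂ) + (a.im : ℂ) * Complex.I := (Complex.re_add_im a).symm
    push_cast at s1 ⊢
    linear_combination Complex.I * s1 + Complex.I * ea + ((a.im : ℂ) + (b.im : ℂ)) * Complex.I_sq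
  rw [hE]
  have hM := modEq_nonneg (p := p) (I := I) (t := t)
  have hP := size_nonneg (p := p) (t := t)
  have hε := l2Norm_nonneg (p.eps Q u t)
  have hG : l2Norm (p.eps Q u t) ^ 2 + ∑ k ∈ Finset.Icc 3 (1 + crit d), h1Norm (p.eps Q u t) ^ k
      ≤ p.rest Q u I t := by
    unfold rest good
    have : 0 ≤ p.size t ^ 6 := by positivity
    have : 0 ≤ (p.size t + l2Norm (p.eps Q u t)) * p.modEq I t := by positivity
    linarith
  have hG6 : p.size t ^ 6 ≤ p.rest Q u I t := by
    unfold rest good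
    have : 0 ≤ ∑ k ∈ Finset.Icc 3 (1 + crit d), h1Norm (p.eps Q u t) ^ k :=
      Finset.sum_nonneg fun k _ => pow_nonneg (h1Norm_nonneg _) k
    have : 0 ≤ l2Norm (p.eps Q u t) ^ 2 := by positivity
    have : 0 ≤ (p.size t + l2Norm (p.eps Q u t)) * p.modEq I t := by positivity
    linarith
  have hGm : p.size t * p.modEq I t + l2Norm (p.eps Q u t) * p.modEq I t ≤ p.rest Q u I t := by
    unfold rest
    have := good_nonneg (p := p) (Q := Q) (u := u) (t := t)
    linarith
  have hPM : 0 ≤ p.size t * p.modEq I t := by positivity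
  have hεM : 0 ≤ l2Norm (p.eps Q u t) * p.modEq I t := by positivity
  have T1 : ‖Complex.I * (∫ y, nlRem d (Q y) (η y) * (g y : ℂ))‖ ≤ C₁ * p.rest Q u I t := by
    rw [norm_mul, Complex.norm_I, one_mul]
    exact hnl'.trans (mul_le_mul_of_nonneg_left hG hC₁)
  have T2 := norm_transport_le (p := p) (I := I) (t := t) hg hη
  rw [hηε] at T2
  have T3 : ‖Complex.I * ((-(inner ℝ (p.be t) (p.defAl I t) * ∫ y, g y * Q y)
          + (∑ j, (p.ga t / 2 * p.defAl I t j - p.defLam I t * p.be t j) * ∫ y, y j * g y * Q y)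
          + p.defLam I t * p.ga t / 2 * ∫ y, ‖y‖ ^ 2 * g y * Q y : ℝ) : ℂ)‖
      ≤ (|∫ y, g y * Q y| + ∑ j, |∫ y, y j * g y * Q y| + |∫ y, ‖y‖ ^ 2 * g y * Q y|)
        * (p.size t * p.modEq I t) := by
    rw [norm_mul, Complex.norm_I, one_mul, Complex.norm_real, Real.norm_eq_abs, add_mul, add_mul,
      Finset.sum_mul]
    refine (abs_add_three _ _ _).trans (add_le_add (add_le_add ?_
      ((Finset.abs_sum_le_sum_abs _ _).trans (Finset.sum_le_sum fun j _ => ?_))) ?_)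
    · rw [abs_neg, abs_mul, mul_comm]
      exact mul_le_mul_of_nonneg_left abs_inner_defAl_le (abs_nonneg _)
    · rw [abs_mul, mul_comm]
      exact mul_le_mul_of_nonneg_left (abs_linear_correction_le j) (abs_nonneg _)
    · rw [abs_mul, mul_comm]
      exact mul_le_mul_of_nonneg_left abs_quadratic_correction_le (abs_nonneg _)
  have nI : ‖Complex.I * pair (fun y => p.potential I t y * g y) η‖
      = ‖pair (fun y => p.potential I t y * g y) η‖ := by rw [norm_mul, Complex.norm_I, one_mul]
  have T4 := norm_pair_potential_le (p := p) (I := I) (t := t) hg.isWeight hs hη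
  rw [hηε, ← nI] at T4
  -- Conservation of mass replaces the norm of u by that of Q, so the constant does not depend on
  -- the solution.
  have T5 : ‖Complex.I * (((p.lam t ^ 2 : ℝ) : ℂ)
          * ∫ x, noiseTerm φ β t (u t) x * p.wave t (fun y => (g y : ℂ)) x)‖
      ≤ C₂ * l2Norm (fun y => (Q y : ℂ)) * p.rest Q u I t := by
    rw [norm_mul, Complex.norm_I, one_mul]
    refine hnoise.trans ?_
    rw [hm, mul_right_comm]
    exact mul_le_mul_of_nonneg_left hG6 (mul_nonneg hC₂ (l2Norm_nonneg _))
  have r1 : l2Norm (p.eps Q u t) * p.modEq I t ≤ p.rest Q u I t := by linarith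
  have r2 : p.size t * p.modEq I t ≤ p.rest Q u I t := by linarith
  have m2 := T2.trans (mul_le_mul_of_nonneg_left r1
    (add_nonneg (l2Norm_nonneg _) (sum_l2Norm_nonneg _ _)))
  have m3 := T3.trans (mul_le_mul_of_nonneg_left r2 (abs_moments_nonneg _ _ _))
  have m4 := T4.trans (mul_le_mul_of_nonneg_left r1 (mul_nonneg two_pos.le
      (add_nonneg (add_nonneg (l2Norm_nonneg _) (sum_l2Norm_nonneg _ _)) (l2Norm_nonneg _))))
  refine (norm_add_le _ _).trans ((add_le_add ((norm_sub_le _ _).trans (add_le_add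
    ((norm_sub_le _ _).trans (add_le_add ((norm_sub_le _ _).trans (add_le_add T1 m2)) m3)) m4))
      T5).trans_eq ?_)
  unfold errConst
  ring

end Linearized

end ModPath

end RNLS

namespace RNLS

open scoped ContDiff

variable {d : ℕ} {g Q ρ : E d → ℝ}

namespace ModPath

variable {p : ModPath d} {I : Set ℝ} {t : ℝ} {u : ℝ → E d → ℂ}

/-! ### The orthogonality conditions in rescaled variables -/

section Orthogonality

lemma bubble_eq (g : E d → ℝ) : p.bubble g t = fun x => star (p.wave t (fun y => (g y : ℂ)) x) := by
  funext x; rw [← star_bubble, star_star]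

lemma integral_star_wave_mul_star_bigR (hl : 0 < p.lam t) (G : E d → ℂ) :
    ∫ x, star (p.wave t G x) * star (p.bigR Q u t x) = star (∫ y, p.eta Q u t y * G y) := by
  have e : ∀ y, p.resc t (p.bigR Q u t) y = p.eta Q u t y := fun y => by
    rw [show p.bigR Q u t = fun x => u t x - p.bubble Q t x from rfl, resc_sub, resc_bubble hl, eta]
  simp only [← e]
  rw [← integral_mul_wave hl]
  refine Eq.trans (integral_congr_ae (Eventually.of_forall fun x => ?_)) integral_conj
  simp only [Complex.star_def, map_mul]
  ring

lemma integral_bubble_mul_star_bigR (hl : 0 < p.lam t) (g : E d → ℝ) :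
    ∫ x, p.bubble g t x * star (p.bigR Q u t x) = star (pair g (p.eta Q u t)) := by
  rw [bubble_eq, integral_star_wave_mul_star_bigR hl]
  congr 1
  exact integral_congr_ae (Eventually.of_forall fun y => mul_comm _ _)

lemma coord_mul_bubble (hl : 0 < p.lam t) (j : Fin d) (x : E d) :
    ((x j - p.al t j : ℝ) : ℂ) * p.bubble Q t x
      = (p.lam t : ℂ) * p.bubble (fun y => y j * Q y) t x := by
  have h : x j - p.al t j = p.lam t * ((p.lam t)⁻¹ • (x - p.al t)) j := by
    simp only [PiLp.smul_apply, PiLp.sub_apply, smul_eq_mul]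
    rw [mul_inv_cancel_left₀ hl.ne']
  rw [h]
  simp only [bubble, deform]
  push_cast
  ring

lemma sq_norm_mul_bubble (hl : 0 < p.lam t) (x : E d) :
    ((‖x - p.al t‖ ^ 2 : ℝ) : ℂ) * p.bubble Q t x
      = ((p.lam t ^ 2 : ℝ) : ℂ) * p.bubble (fun y => ‖y‖ ^ 2 * Q y) t x := by
  have h : ‖x - p.al t‖ ^ 2 = p.lam t ^ 2 * ‖(p.lam t)⁻¹ • (x - p.al t)‖ ^ 2 := by
    rw [norm_smul, mul_pow, norm_inv, Real.norm_eq_abs, abs_of_pos hl, inv_pow,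
      mul_inv_cancel_left₀ (by positivity)]
  rw [h]
  simp only [bubble, deform]
  push_cast
  ring

lemma pd_bubble (hQ : IsProfile Q) (j : Fin d) (x : E d) : pd j (p.bubble Q t) x
    = (((p.lam t)⁻¹ : ℝ) : ℂ) * star (p.wave t (p.covd t j fun y => (Q y : ℂ)) x) := by
  rw [bubble_eq, pd_star j ((contDiff_wave (contDiff_ofReal_profile hQ)).differentiable (by simp) x),
    pd_wave_profile hQ]
  simp only [Complex.star_def, map_mul, Complex.conj_ofReal]

lemma scaled_bubble (hQ : IsProfile Q) (x : E d) :
    (d : ℂ) / 2 * p.bubble Q t x + fderiv ℝ (p.bubble Q t) x (x - p.al t)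
      = star (p.wave t (fun y => ((scaleGen Q y : ℝ) : ℂ)
        - Complex.I * ((∑ j, y j * p.slope t j y * Q y : ℝ) : ℂ)) x) := by
  have e1 : fderiv ℝ (p.bubble Q t) x (x - p.al t)
      = ∑ j, ((p.point t x j : ℝ) : ℂ) * star (p.wave t (p.covd t j fun y => (Q y : ℂ)) x) := by
    conv_lhs => rw [← sum_inner_stdVec_smul (x - p.al t)]
    rw [map_sum]
    refine Finset.sum_congr rfl fun j _ => ?_
    rw [map_smul]
    change (x - p.al t) j • pd j (p.bubble Q t) x = _
    rw [pd_bubble hQ, Complex.real_smul, ← mul_assoc, ← Complex.ofReal_mul]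
    congr 2
    simp only [point, PiLp.smul_apply, PiLp.sub_apply, smul_eq_mul]
    ring
  rw [e1, bubble_eq]
  have e2 : ∀ (r : ℝ) (G : E d → ℂ), (r : ℂ) * star (p.wave t G x)
      = star ((r : ℂ) * p.wave t G x) := fun r G => by
    simp only [Complex.star_def, map_mul, Complex.conj_ofReal]
  have e3 : (d : ℂ) / 2 = ((d / 2 : ℝ) : ℂ) := by push_cast; rfl
  rw [e3]
  simp only [e2]
  rw [← star_sum, ← star_add]
  congr 1
  simp only [wave, twist, covd_ofReal hQ, scaleGen]
  rw [show ∀ a b c : ℂ, a * (b * c) = b * (a * c) from fun a b c => mul_left_comm a b c]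
  push_cast
  rw [Finset.sum_congr rfl (fun j _ => show _ = (((p.lam t ^ (-(d : ℝ) / 2) : ℝ) : ℂ)
      * Complex.exp (-(p.angle t (p.point t x) : ℂ) * Complex.I))
      * ((p.point t x j : ℂ) * ((pd j Q (p.point t x) : ℝ) : ℂ)
        - Complex.I * ((p.point t x j : ℂ) * (p.slope t j (p.point t x) : ℂ)
          * (Q (p.point t x) : ℂ))) by ring), ← Finset.mul_sum, Finset.sum_sub_distrib,
    ← Finset.mul_sum]
  ring

lemma Orthogonal.re_pair_coord_mul (hl : 0 < p.lam t) (h : p.Orthogonal Q ρ u t) (j : Fin d) :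
    (pair (fun y => y j * Q y) (p.eta Q u t)).re = 0 := by
  have := h.x_w j
  simp only [coord_mul_bubble hl, mul_assoc] at this
  rw [integral_const_mul, integral_bubble_mul_star_bigR hl, Complex.re_ofReal_mul] at this
  simpa [hl.ne'] using this

lemma Orthogonal.re_pair_sq_norm_mul (hl : 0 < p.lam t) (h : p.Orthogonal Q ρ u t) :
    (pair (fun y => ‖y‖ ^ 2 * Q y) (p.eta Q u t)).re = 0 := by
  have := h.sq_w
  simp only [sq_norm_mul_bubble hl, mul_assoc] at this
  rw [integral_const_mul, integral_bubble_mul_star_bigR hl, Complex.re_ofReal_mul] at this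
  simpa [hl.ne'] using this

lemma Orthogonal.im_pair_rho (hl : 0 < p.lam t) (h : p.Orthogonal Q ρ u t) :
    (pair ρ (p.eta Q u t)).im = 0 := by
  have := h.rho
  rw [integral_bubble_mul_star_bigR hl] at this
  simpa using this

/-- ∇w also differentiates the phase, which adds (β_j - γy_j/2)Q to ∂_jQ. The γ part vanishes by the
condition on y_jQ; the β part remains and is quadratic in ε by conservation of mass. -/
lemma Orthogonal.im_pair_pd (hQ : IsProfile Q) (hl : 0 < p.lam t)
    (hu : MemLp (u t) 2 volume) (h : p.Orthogonal Q ρ u t) (j : Fin d) :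
    (pair (pd j Q) (p.eta Q u t)).im = p.be t j * (pair Q (p.eta Q u t)).re := by
  have hη := memLp_eta hl hu hQ.isWeight
  have h1 := h.grad_w j
  have e : ∀ x, fderiv ℝ (p.bubble Q t) x (stdVec j) * star (p.bigR Q u t x)
      = (((p.lam t)⁻¹ : ℝ) : ℂ) * (star (p.wave t (p.covd t j fun y => (Q y : ℂ)) x)
        * star (p.bigR Q u t x)) := fun x => by
    change pd j (p.bubble Q t) x * _ = _
    rw [pd_bubble hQ]; ring
  simp only [e] at h1
  rw [integral_const_mul, integral_star_wave_mul_star_bigR hl, Complex.im_ofReal_mul] at h1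
  have e2 : ∫ y, p.eta Q u t y * p.covd t j (fun y => (Q y : ℂ)) y
      = pair (pd j Q) (p.eta Q u t) - Complex.I * ((p.be t j : ℂ) * pair Q (p.eta Q u t)
        + ((-(p.ga t / 2) : ℝ) : ℂ) * pair (fun y => y j * Q y) (p.eta Q u t)) := by
    rw [← pair_const_mul_left, ← pair_const_mul_left, ← pair_add_left (hQ.isWeight.const_mul _)
      ((hQ.isWeight.coord_mul j).const_mul _) hη]
    unfold pair
    rw [← integral_const_mul, ← integral_sub (pair_integrable (hQ.isWeight_pd j) hη)
      ((pair_integrable ((hQ.isWeight.const_mul _).add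
        ((hQ.isWeight.coord_mul j).const_mul _)) hη).const_mul _)]
    refine integral_congr_ae (Eventually.of_forall fun y => ?_)
    simp only [covd_ofReal hQ, slope]
    push_cast; ring
  have h2 : (∫ y, p.eta Q u t y * p.covd t j (fun y => (Q y : ℂ)) y).im = 0 := by
    simpa [hl.ne'] using h1
  rw [e2, Complex.sub_im, Complex.I_mul_im, Complex.add_re, Complex.re_ofReal_mul,
    Complex.re_ofReal_mul, h.re_pair_coord_mul hl] at h2
  linarith

/-- The derivative of the phase along y contributes multiples of y_jQ and |y|²Q, all annihilated by
the two real conditions; the relation for ΛQ is therefore exact. -/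
lemma Orthogonal.im_pair_scaleGen (hQ : IsProfile Q) (hl : 0 < p.lam t)
    (hu : MemLp (u t) 2 volume) (h : p.Orthogonal Q ρ u t) : (pair (scaleGen Q) (p.eta Q u t)).im = 0 := by
  have hη := memLp_eta hl hu hQ.isWeight
  have h1 := h.lambda_w
  simp only [scaled_bubble hQ] at h1
  rw [integral_star_wave_mul_star_bigR hl] at h1
  have w1 : IsWeight fun y => ∑ j, p.be t j * (y j * Q y) :=
    IsWeight.sum _ fun j _ => (hQ.isWeight.coord_mul j).const_mul _
  have e2 : ∫ y, p.eta Q u t y * (((scaleGen Q y : ℝ) : ℂ)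
        - Complex.I * ((∑ j, y j * p.slope t j y * Q y : ℝ) : ℂ))
      = pair (scaleGen Q) (p.eta Q u t)
        - Complex.I * ((∑ j, (p.be t j : ℂ) * pair (fun y => y j * Q y) (p.eta Q u t))
        + ((-(p.ga t / 2) : ℝ) : ℂ) * pair (fun y => ‖y‖ ^ 2 * Q y) (p.eta Q u t)) := by
    simp only [← pair_const_mul_left]
    rw [← pair_sum_left _ (fun j _ => (hQ.isWeight.coord_mul j).const_mul _) hη,
      ← pair_add_left w1 (hQ.isWeight.sq_norm_mul.const_mul _) hη]
    unfold pair
    rw [← integral_const_mul, ← integral_sub (pair_integrable hQ.isWeight_scaleGen hη)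
      ((pair_integrable (w1.add (hQ.isWeight.sq_norm_mul.const_mul _)) hη).const_mul _)]
    refine integral_congr_ae (Eventually.of_forall fun y => ?_)
    have e3 : ∑ j, y j * p.slope t j y * Q y
        = ∑ j, p.be t j * (y j * Q y) + -(p.ga t / 2) * (‖y‖ ^ 2 * Q y) := by
      rw [sq_norm_eq_sum, Finset.sum_mul, Finset.mul_sum, ← Finset.sum_add_distrib]
      exact Finset.sum_congr rfl fun j _ => by simp only [slope]; ring
    simp only [e3]
    ring
  have h2 := h1
  rw [e2, Complex.star_def, Complex.conj_im, neg_eq_zero, Complex.sub_im, Complex.I_mul_im,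
    Complex.add_re, Complex.re_ofReal_mul, h.re_pair_sq_norm_mul hl, Complex.re_sum,
    Finset.sum_eq_zero fun j _ => by rw [Complex.re_ofReal_mul, h.re_pair_coord_mul hl, mul_zero]] at h2
  linarith

end Orthogonality

/-- Conservation of mass, in terms of the remainder. -/
lemma two_mul_re_pair_eta (hQ : IsWeight Q) (hl : 0 < p.lam t) (hu : MemLp (u t) 2 volume)
    (hm : l2Norm (u t) = l2Norm (fun y => (Q y : ℂ))) :
    2 * (pair Q (p.eta Q u t)).re = - l2Norm (p.eps Q u t) ^ 2 := by
  have hη := memLp_eta (p := p) hl hu hQ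
  have hz := memLp_resc (p := p) hl hu
  have h1 := l2Norm_sq hz
  rw [l2Norm_resc hl hu, hm, l2Norm_sq hQ.memLp] at h1
  have i1 : Integrable (fun y => ‖(Q y : ℂ)‖ ^ 2) volume := hQ.memLp.norm.integrable_sq
  have i2 : Integrable (fun y => ‖p.eta Q u t y‖ ^ 2) volume := hη.norm.integrable_sq
  have i3 : Integrable (fun y => 2 * ((Q y : ℂ) * p.eta Q u t y).re) volume :=
    (pair_integrable hQ hη).re.const_mul 2
  have e : ∀ y, ‖p.resc t (u t) y‖ ^ 2
      = ‖(Q y : ℂ)‖ ^ 2 + 2 * ((Q y : ℂ) * p.eta Q u t y).re + ‖p.eta Q u t y‖ ^ 2 := fun y => by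
    have : p.resc t (u t) y = (Q y : ℂ) + p.eta Q u t y := by simp only [eta]; ring
    rw [this, norm_sq_add_eq, Complex.re_ofReal_mul, Complex.norm_real, Real.norm_eq_abs, sq_abs]
    ring
  simp only [e] at h1
  rw [integral_add (by exact i1.add i3) i2, integral_add i1 i3, ← l2Norm_sq hη, l2Norm_eta,
    integral_const_mul] at h1
  have e2 := Complex.reCLM.integral_comp_comm (pair_integrable hQ hη)
  simp only [Complex.reCLM_apply] at e2
  rw [e2] at h1
  simp only [pair]
  linarith

end ModPath

end RNLS

/-! ### The five modulation equations. -/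

namespace RNLS

open scoped ContDiff

variable {d : ℕ} {g Q ρ : E d → ℝ}

lemma norm_le_sum_abs (v : E d) : ‖v‖ ≤ ∑ j, |v j| := by
  conv_lhs => rw [← sum_inner_stdVec_smul v]
  refine (norm_sum_le _ _).trans_eq (Finset.sum_congr rfl fun j _ => ?_)
  rw [norm_smul, norm_stdVec, mul_one, Real.norm_eq_abs]

lemma pair_of_eq_zero {f : E d → ℂ} (h : ∀ y, g y = 0) : pair g f = 0 := by
  simp [pair, h]

lemma integral_coord_mul_even (hQ : ∀ x, Q (-x) = Q x) (hρ : ∀ x, ρ (-x) = ρ x) (j : Fin d) :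
    ∫ y, y j * ρ y * Q y = 0 :=
  integral_eq_zero_of_odd fun y => by rw [hQ, hρ, PiLp.neg_apply]; ring

lemma integral_even_mul_pd (hQ : ∀ x, Q (-x) = Q x) (hg : ∀ x, g (-x) = g x) (j : Fin d) :
    ∫ y, g y * pd j Q y = 0 :=
  integral_eq_zero_of_odd fun y => by rw [hg, pd_neg_of_even hQ]; ring

namespace ModPath

variable {N : ℕ} {φ : Fin N → E d → ℝ} {A : ℝ} {p : ModPath d} {β : Fin N → ℝ → ℝ}
  {t₀ t₁ t : ℝ} {u : ℝ → E d → ℂ}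

/-- The standing assumptions on a solution with a geometrical decomposition near the ground
state. -/
structure Admissible (φ : Fin N → E d → ℝ) (A : ℝ) (Q ρ : E d → ℝ) (p : ModPath d)
    (β : Fin N → ℝ → ℝ) (t₀ t₁ t : ℝ) (u : ℝ → E d → ℂ) : Prop where
  lt : t₀ < t₁
  sol : IsSolutionOn φ β t₀ t₁ u
  cont : ∀ k, ContinuousOn (β k) (Icc t₀ t₁)
  bdd : ∀ k, ∀ s ∈ Icc t₀ t₁, |β k s| ≤ A
  lam_pos : ∀ s ∈ Icc t₀ t₁, 0 < p.lam s
  orth : ∀ s ∈ Icc t₀ t₁, p.Orthogonal Q ρ u s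
  mass : ∀ s ∈ Icc t₀ t₁, l2Norm (u s) = l2Norm (fun y => (Q y : ℂ))
  mem : t ∈ Icc t₀ t₁
  diff : p.DiffWithinAt (Icc t₀ t₁) t
  size_le : p.size t ≤ 1
  eps_le : l2Norm (p.eps Q u t) ≤ 1

lemma pair_resc (hg : IsWeight g) (hQ : IsWeight Q) (hl : 0 < p.lam t)
    (hu : MemLp (u t) 2 volume) :
    pair g (p.resc t (u t)) = ((∫ y, g y * Q y : ℝ) : ℂ) + pair g (p.eta Q u t) := by
  rw [← pair_ofReal, ← pair_add_right hg hQ.memLp (memLp_eta hl hu hQ)]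
  congr 1
  funext y; simp only [eta]; ring

lemma rest_lower : l2Norm (p.eps Q u t) ^ 2
    + l2Norm (p.eps Q u t) * p.modEq (Icc t₀ t₁) t ≤ p.rest Q u (Icc t₀ t₁) t := by
  unfold rest good
  have h1 : 0 ≤ ∑ k ∈ Finset.Icc 3 (1 + crit d), h1Norm (p.eps Q u t) ^ k :=
    Finset.sum_nonneg fun k _ => pow_nonneg (h1Norm_nonneg _) k
  have h2 := size_nonneg (p := p) (t := t)
  have h3 : 0 ≤ p.size t ^ 6 := pow_nonneg h2 6
  have h4 := mul_nonneg h2 (modEq_nonneg (p := p) (I := Icc t₀ t₁) (t := t))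
  linarith

lemma sq_le_rest : l2Norm (p.eps Q u t) ^ 2 ≤ p.rest Q u (Icc t₀ t₁) t := by
  have h := mul_nonneg (l2Norm_nonneg (p.eps Q u t))
    (modEq_nonneg (p := p) (I := Icc t₀ t₁) (t := t))
  have := rest_lower (p := p) (Q := Q) (u := u) (t := t) (t₀ := t₀) (t₁ := t₁)
  linarith

lemma exists_abs_sub_main_le (hQ : IsGroundState Q) (hd : d = 1 ∨ d = 2) (hφ : ∀ k, IsCbInfty (φ k))
    (h0 : ∀ k, FlatAtOrigin (φ k)) (hg : IsProfile g) (A : ℝ) (ρ : E d → ℝ) : ∃ C : ℝ, 0 ≤ C ∧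
    ∀ (p : ModPath d) (β : Fin N → ℝ → ℝ) (t₀ t₁ t : ℝ) (u : ℝ → E d → ℂ),
      Admissible φ A Q ρ p β t₀ t₁ t u →
      ∃ D : ℂ, HasDerivWithinAt (fun s => pair g (p.resc s (u s))) D (Icc t₀ t₁) t ∧
        |p.lam t ^ 2 * D.re - p.mainRe Q u (Icc t₀ t₁) t g| ≤ C * p.rest Q u (Icc t₀ t₁) t ∧
        |p.lam t ^ 2 * D.im - p.mainIm Q u (Icc t₀ t₁) t g| ≤ C * p.rest Q u (Icc t₀ t₁) t := by
  obtain ⟨C, hC, h⟩ := exists_linearized hQ hd hφ h0 hg A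
  refine ⟨C, hC, fun p β t₀ t₁ t u a => ?_⟩
  obtain ⟨D, hD, hb⟩ := h p β t₀ t₁ t u a.sol a.cont a.bdd a.lam_pos a.mem a.diff a.size_le
    (a.mass t a.mem)
  refine ⟨D, hD, ?_, ?_⟩
  · refine le_trans (le_of_eq ?_) ((Complex.abs_re_le_norm _).trans hb)
    rw [Complex.sub_re, Complex.re_ofReal_mul, Complex.add_re, Complex.I_mul_re, Complex.ofReal_re,
      Complex.ofReal_im, neg_zero, add_zero]
  · refine le_trans (le_of_eq ?_) ((Complex.abs_im_le_norm _).trans hb)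
    rw [Complex.sub_im, Complex.im_ofReal_mul, Complex.add_im, Complex.I_mul_im, Complex.ofReal_re,
      Complex.ofReal_im, zero_add]

/-- If Re ⟨g, η⟩ vanishes throughout the interval, then Re ⟨g, z⟩ is the constant ∫ gQ. Derivatives
within a nondegenerate closed interval are unique, end points included, so the derivative is zero
and the main term equals minus the error. -/
lemma exists_abs_mainRe_le (hQ : IsGroundState Q) (hd : d = 1 ∨ d = 2) (hφ : ∀ k, IsCbInfty (φ k))
    (h0 : ∀ k, FlatAtOrigin (φ k)) (hg : IsProfile g) (A : ℝ) (hre : ∀ (p : ModPath d) (t : ℝ)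
      (u : ℝ → E d → ℂ), 0 < p.lam t → MemLp (u t) 2 volume → p.Orthogonal Q ρ u t →
      (pair g (p.eta Q u t)).re = 0) : ∃ C : ℝ, 0 ≤ C ∧
    ∀ (p : ModPath d) (β : Fin N → ℝ → ℝ) (t₀ t₁ t : ℝ) (u : ℝ → E d → ℂ),
      Admissible φ A Q ρ p β t₀ t₁ t u →
      |p.mainRe Q u (Icc t₀ t₁) t g| ≤ C * p.rest Q u (Icc t₀ t₁) t := by
  obtain ⟨C, hC, h⟩ := exists_abs_sub_main_le hQ hd hφ h0 hg A ρ
  refine ⟨C, hC, fun p β t₀ t₁ t u a => ?_⟩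
  obtain ⟨D, hD, hb, -⟩ := h p β t₀ t₁ t u a
  have h1 := Complex.reCLM.hasFDerivAt.comp_hasDerivWithinAt t hD
  have h2 : HasDerivWithinAt (fun _ : ℝ => ∫ y, g y * Q y) 0 (Icc t₀ t₁) t :=
    hasDerivWithinAt_const _ _ _
  have e : ∀ s ∈ Icc t₀ t₁, (∫ y, g y * Q y) = (pair g (p.resc s (u s))).re := fun s hs => by
    rw [pair_resc hg.isWeight (hQ.isProfile hd).isWeight (a.lam_pos s hs) (a.sol.memH1 s hs).1,
      Complex.add_re, Complex.ofReal_re, hre p s u (a.lam_pos s hs) (a.sol.memH1 s hs).1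
      (a.orth s hs), add_zero]
  have h3 := (uniqueDiffOn_Icc a.lt t a.mem).eq_deriv _ (h1.congr e (e t a.mem)) h2
  simp only [Complex.reCLM_apply] at h3
  rwa [h3, mul_zero, zero_sub, abs_neg] at hb

/-- As g and Q are real, Im ⟨g, z⟩ = Im ⟨g, η⟩. If this vanishes on the whole interval its
derivative is zero, and the main term is again an error. -/
lemma exists_abs_mainIm_le (hQ : IsGroundState Q) (hd : d = 1 ∨ d = 2) (hφ : ∀ k, IsCbInfty (φ k))
    (h0 : ∀ k, FlatAtOrigin (φ k)) (hg : IsProfile g) (A : ℝ) (him : ∀ (p : ModPath d) (t : ℝ)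
      (u : ℝ → E d → ℂ), 0 < p.lam t → MemLp (u t) 2 volume → p.Orthogonal Q ρ u t →
      (pair g (p.eta Q u t)).im = 0) : ∃ C : ℝ, 0 ≤ C ∧
    ∀ (p : ModPath d) (β : Fin N → ℝ → ℝ) (t₀ t₁ t : ℝ) (u : ℝ → E d → ℂ),
      Admissible φ A Q ρ p β t₀ t₁ t u →
      |p.mainIm Q u (Icc t₀ t₁) t g| ≤ C * p.rest Q u (Icc t₀ t₁) t := by
  obtain ⟨C, hC, h⟩ := exists_abs_sub_main_le hQ hd hφ h0 hg A ρ
  refine ⟨C, hC, fun p β t₀ t₁ t u a => ?_⟩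
  obtain ⟨D, hD, -, hb⟩ := h p β t₀ t₁ t u a
  have h1 := Complex.imCLM.hasFDerivAt.comp_hasDerivWithinAt t hD
  have h2 : HasDerivWithinAt (fun _ : ℝ => (0 : ℝ)) 0 (Icc t₀ t₁) t :=
    hasDerivWithinAt_const _ _ _
  have e : ∀ s ∈ Icc t₀ t₁, 0 = (pair g (p.resc s (u s))).im := fun s hs => by
    rw [pair_resc hg.isWeight (hQ.isProfile hd).isWeight (a.lam_pos s hs) (a.sol.memH1 s hs).1,
      Complex.add_im, Complex.ofReal_im, him p s u (a.lam_pos s hs) (a.sol.memH1 s hs).1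
      (a.orth s hs), add_zero]
  have h3 := (uniqueDiffOn_Icc a.lt t a.mem).eq_deriv _ (h1.congr e (e t a.mem)) h2
  simp only [Complex.imCLM_apply] at h3
  rwa [h3, mul_zero, zero_sub, abs_neg] at hb

/-- The equation for `α`. -/
lemma exists_abs_defAl_le (hQ : IsGroundState Q) (hd : d = 1 ∨ d = 2) (hφ : ∀ k, IsCbInfty (φ k))
    (h0 : ∀ k, FlatAtOrigin (φ k)) (A : ℝ) (ρ : E d → ℝ) (j : Fin d) : ∃ C : ℝ, 0 ≤ C ∧
    ∀ (p : ModPath d) (β : Fin N → ℝ → ℝ) (t₀ t₁ t : ℝ) (u : ℝ → E d → ℂ),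
      Admissible φ A Q ρ p β t₀ t₁ t u →
      |p.defAl (Icc t₀ t₁) t j| ≤ C * p.rest Q u (Icc t₀ t₁) t := by
  have hp := hQ.isProfile hd
  obtain ⟨C, hC, h⟩ := exists_abs_mainRe_le (ρ := ρ) hQ hd hφ h0 (hp.coord_mul j) A
    fun p t u hl _ ho => ho.re_pair_coord_mul hl j
  have hb := hQ.integral_sq_pos hd
  set b := ∫ y, Q y * Q y with hbdef
  refine ⟨2 / b * (C + 1), by positivity, fun p β t₀ t₁ t u a => ?_⟩
  have h1 := h p β t₀ t₁ t u a
  have hl := a.lam_pos t a.mem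
  have hu := (a.sol.memH1 t a.mem).1
  have e1 : linMinus Q (fun x => x j * Q x) = fun x => (-2) * pd j Q x :=
    funext (hQ.linMinus_coord_mul hd j)
  have e2 : (∫ y, y j * Q y * scaleGen Q y) = 0 := integral_eq_zero_of_odd fun y => by
    rw [hQ.neg, scaleGen_neg_of_even hQ.neg, PiLp.neg_apply]; ring
  -- Im ⟨-2∂_jQ, η⟩ = -2β_j Re ⟨Q, η⟩ = β_j‖ε‖², a quadratic term; parity removes the defect of λ,
  -- and the moments of Q ∂_iQ leave only the j-th defect of α.
  have e3 : p.mainRe Q u (Icc t₀ t₁) t (fun x => x j * Q x)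
      = p.be t j * l2Norm (p.eps Q u t) ^ 2 - p.defAl (Icc t₀ t₁) t j * (b / 2) := by
    have m := two_mul_re_pair_eta (p := p) hp.isWeight hl hu (a.mass t a.mem)
    simp only [mainRe, e1, e2, hQ.integral_coord_mul_pd hd]
    rw [pair_const_mul_left, Complex.im_ofReal_mul,
      (a.orth t a.mem).im_pair_pd hp hl hu]
    simp only [mul_ite, mul_zero, Finset.sum_ite_eq, Finset.mem_univ, if_true, add_zero]
    linear_combination (-p.be t j) * m
  rw [e3] at h1
  have h2 : |p.be t j| ≤ 1 :=
    (PiLp.norm_apply_le (p.be t) j).trans (norm_be_le_size.trans a.size_le)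
  have h3 : |p.be t j * l2Norm (p.eps Q u t) ^ 2| ≤ p.rest Q u (Icc t₀ t₁) t := by
    rw [abs_mul, abs_of_nonneg (sq_nonneg (l2Norm (p.eps Q u t)))]
    exact (mul_le_of_le_one_left (sq_nonneg _) h2).trans sq_le_rest
  have h4 : |p.defAl (Icc t₀ t₁) t j| * (b / 2) ≤ (C + 1) * p.rest Q u (Icc t₀ t₁) t := by
    rw [← abs_of_pos (half_pos hb), ← abs_mul]
    have := abs_sub_abs_le_abs_sub (p.defAl (Icc t₀ t₁) t j * (b / 2))
      (p.be t j * l2Norm (p.eps Q u t) ^ 2)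
    rw [abs_sub_comm] at h1
    linarith
  rw [← le_div_iff₀ (half_pos hb)] at h4
  refine h4.trans_eq ?_
  field_simp

/-- The equation for `λ`. -/
lemma exists_abs_defLam_le (hQ : IsGroundState Q) (hd : d = 1 ∨ d = 2) (hφ : ∀ k, IsCbInfty (φ k))
    (h0 : ∀ k, FlatAtOrigin (φ k)) (A : ℝ) (ρ : E d → ℝ) : ∃ C : ℝ, 0 ≤ C ∧
    ∀ (p : ModPath d) (β : Fin N → ℝ → ℝ) (t₀ t₁ t : ℝ) (u : ℝ → E d → ℂ),
      Admissible φ A Q ρ p β t₀ t₁ t u →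
      |p.defLam (Icc t₀ t₁) t| ≤ C * p.rest Q u (Icc t₀ t₁) t := by
  have hp := hQ.isProfile hd
  obtain ⟨C, hC, h⟩ := exists_abs_mainRe_le (ρ := ρ) hQ hd hφ h0 hp.sq_norm_mul A
    fun p t u hl _ ho => ho.re_pair_sq_norm_mul hl
  have hb := hQ.integral_sq_norm_pos hd
  set b := ∫ y, ‖y‖ ^ 2 * Q y * Q y with hbdef
  refine ⟨C / b, by positivity, fun p β t₀ t₁ t u a => ?_⟩
  have h1 := h p β t₀ t₁ t u a
  have hl := a.lam_pos t a.mem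
  have hu := (a.sol.memH1 t a.mem).1
  have e1 : linMinus Q (fun x => ‖x‖ ^ 2 * Q x) = fun x => (-4) * scaleGen Q x :=
    funext (hQ.linMinus_sq_norm_mul hd)
  have e2 : ∀ j, (∫ y, ‖y‖ ^ 2 * Q y * pd j Q y) = 0 := fun j =>
    integral_even_mul_pd (g := fun y => ‖y‖ ^ 2 * Q y) hQ.neg
      (fun y => by rw [hQ.neg, norm_neg]) j
  -- The term in η is Im ⟨-4ΛQ, η⟩, which is zero by orthogonality, and the defect of α drops out by
  -- parity.
  have e3 : p.mainRe Q u (Icc t₀ t₁) t (fun x => ‖x‖ ^ 2 * Q x)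
      = - (p.defLam (Icc t₀ t₁) t * b) := by
    simp only [mainRe, e1, e2, hQ.integral_sq_norm_mul_scaleGen hd]
    rw [pair_const_mul_left, Complex.im_ofReal_mul, (a.orth t a.mem).im_pair_scaleGen hp hl hu]
    simp [hbdef]
  rw [e3, abs_neg, abs_mul, abs_of_pos hb, ← le_div_iff₀ hb] at h1
  refine h1.trans_eq ?_
  ring

/-- The equation for `γ`. -/
lemma exists_abs_defGa_le (hQ : IsGroundState Q) (hd : d = 1 ∨ d = 2) (hφ : ∀ k, IsCbInfty (φ k))
    (h0 : ∀ k, FlatAtOrigin (φ k)) (A : ℝ) (ρ : E d → ℝ) : ∃ C : ℝ, 0 ≤ C ∧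
    ∀ (p : ModPath d) (β : Fin N → ℝ → ℝ) (t₀ t₁ t : ℝ) (u : ℝ → E d → ℂ),
      Admissible φ A Q ρ p β t₀ t₁ t u →
      |p.defGa (Icc t₀ t₁) t| ≤ C * p.rest Q u (Icc t₀ t₁) t := by
  have hp := hQ.isProfile hd
  obtain ⟨C, hC, h⟩ := exists_abs_mainIm_le (ρ := ρ) hQ hd hφ h0 (hQ.isProfile_scaleGen hd) A
    fun p t u hl hu ho => ho.im_pair_scaleGen hp hl hu
  have hb := hQ.integral_sq_norm_pos hd
  have hsg := hQ.integral_sq_norm_mul_scaleGen hd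
  set b := ∫ y, ‖y‖ ^ 2 * Q y * Q y with hbdef
  refine ⟨4 / b * (C + 1), by positivity, fun p β t₀ t₁ t u a => ?_⟩
  have h1 := h p β t₀ t₁ t u a
  have e1 : linPlus Q (scaleGen Q) = fun x => (-2) * Q x := funext (hQ.linPlus_scaleGen hd)
  have e2 : (∫ y, scaleGen Q y * Q y) = 0 := by
    rw [← hQ.integral_mul_scaleGen hd]
    exact integral_congr_ae (Eventually.of_forall fun y => mul_comm _ _)
  have e3 : (∫ y, ‖y‖ ^ 2 * scaleGen Q y * Q y) = - b := by
    rw [← hsg]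
    exact integral_congr_ae (Eventually.of_forall fun y => mul_right_comm _ _ _)
  have e4 : ∀ j, (∫ y, y j * scaleGen Q y * Q y) = 0 :=
    integral_coord_mul_even hQ.neg (scaleGen_neg_of_even hQ.neg)
  -- The term in η is 2 Re ⟨Q, η⟩ = -‖ε‖² by conservation of mass. The defect of θ drops out because
  -- ⟨ΛQ, Q⟩ = 0, that of β by parity.
  have e5 : p.mainIm Q u (Icc t₀ t₁) t (scaleGen Q)
      = - l2Norm (p.eps Q u t) ^ 2 - p.defGa (Icc t₀ t₁) t * (b / 4) := by
    have m := two_mul_re_pair_eta (p := p) hp.isWeight (a.lam_pos t a.mem)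
      (a.sol.memH1 t a.mem).1 (a.mass t a.mem)
    simp only [mainIm, e1, e2, e3, e4]
    rw [pair_const_mul_left, Complex.re_ofReal_mul]
    simp only [mul_zero, Finset.sum_const_zero, sub_zero]
    linear_combination m
  rw [e5] at h1
  have h3 := sq_le_rest (p := p) (Q := Q) (u := u) (t := t) (t₀ := t₀) (t₁ := t₁)
  have hb4 : 0 < b / 4 := by positivity
  have h4 : |p.defGa (Icc t₀ t₁) t| * (b / 4) ≤ (C + 1) * p.rest Q u (Icc t₀ t₁) t := by
    rw [← abs_of_pos hb4, ← abs_mul]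
    rw [abs_le] at h1 ⊢
    have := sq_nonneg (l2Norm (p.eps Q u t))
    constructor <;> linarith [h1.1, h1.2]
  rw [← le_div_iff₀ hb4] at h4
  refine h4.trans_eq ?_
  field_simp

/-- The equation for `β`. -/
lemma exists_abs_defBe_le (hQ : IsGroundState Q) (hd : d = 1 ∨ d = 2) (hφ : ∀ k, IsCbInfty (φ k))
    (h0 : ∀ k, FlatAtOrigin (φ k)) (A : ℝ) (ρ : E d → ℝ) (j : Fin d) : ∃ C : ℝ, 0 ≤ C ∧
    ∀ (p : ModPath d) (β : Fin N → ℝ → ℝ) (t₀ t₁ t : ℝ) (u : ℝ → E d → ℂ),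
      Admissible φ A Q ρ p β t₀ t₁ t u →
      |p.defBe (Icc t₀ t₁) t j| ≤ C * p.rest Q u (Icc t₀ t₁) t := by
  have hp := hQ.isProfile hd
  have hpj := hQ.isProfile_pd hd j
  obtain ⟨C₁, hC₁, hj⟩ := exists_abs_sub_main_le hQ hd hφ h0 hpj A ρ
  obtain ⟨C₂, hC₂, hq⟩ := exists_abs_sub_main_le hQ hd hφ h0 hp A ρ
  have hb := hQ.integral_sq_pos hd
  have hcp := fun i => hQ.integral_coord_mul_pd hd i j
  set b := ∫ y, Q y * Q y with hbdef
  refine ⟨2 / b * (C₁ + C₂ + 1), by positivity, fun p β t₀ t₁ t u a => ?_⟩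
  obtain ⟨D, hD, -, hDb⟩ := hj p β t₀ t₁ t u a
  obtain ⟨D', hD', hDb', -⟩ := hq p β t₀ t₁ t u a
  set I := Icc t₀ t₁
  have hlt := a.lam_pos t a.mem
  have hut := (a.sol.memH1 t a.mem).1
  -- Here the orthogonality relation does not make the pairing constant: Im ⟨∂_jQ, z⟩ = β_j (Re ⟨Q,
  -- z⟩ - ‖Q‖²). The right side is differentiated as a product, with g = Q used for its second
  -- factor.
  have hK : ∀ s ∈ I, (pair (pd j Q) (p.resc s (u s))).im
      = p.be s j * ((pair Q (p.resc s (u s))).re - b) := fun s hs => by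
    have hl := a.lam_pos s hs
    have hu := (a.sol.memH1 s hs).1
    rw [pair_resc hpj.isWeight hp.isWeight hl hu, pair_resc hp.isWeight hp.isWeight hl hu,
      Complex.add_im, Complex.ofReal_im, (a.orth s hs).im_pair_pd hp hl hu, Complex.add_re,
      Complex.ofReal_re]
    ring
  have d1 := Complex.imCLM.hasFDerivAt.comp_hasDerivWithinAt t hD
  have d2 := Complex.reCLM.hasFDerivAt.comp_hasDerivWithinAt t hD'
  have d3 : HasDerivWithinAt (fun s => p.be s j) (derivWithin p.be I t j) I t :=
    (EuclideanSpace.proj j : E d →L[ℝ] ℝ).hasFDerivAt.comp_hasDerivWithinAt t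
      a.diff.be.hasDerivWithinAt
  have d4 := (d3.mul (d2.sub_const b)).congr hK (hK t a.mem)
  have d5 := (uniqueDiffOn_Icc a.lt t a.mem).eq_deriv _ d1 d4
  simp only [Function.comp_apply, Complex.reCLM_apply, Complex.imCLM_apply] at d5
  have m := two_mul_re_pair_eta (p := p) hp.isWeight hlt hut (a.mass t a.mem)
  have e0 : (pair Q (p.resc t (u t))).re - b = - l2Norm (p.eps Q u t) ^ 2 / 2 := by
    rw [pair_resc hp.isWeight hp.isWeight hlt hut, Complex.add_re, Complex.ofReal_re]
    linarith
  rw [e0] at d5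
  -- λ²β_j' is the defect of β_j minus γβ_j. It is multiplied by Re ⟨Q, η⟩ = -‖ε‖²/2, so it cannot
  -- spoil the equation.
  have e1 : p.lam t ^ 2 * D.im = - (p.defBe I t j - p.ga t * p.be t j)
      * (l2Norm (p.eps Q u t) ^ 2 / 2) + p.be t j * (p.lam t ^ 2 * D'.re) := by
    have : p.defBe I t j - p.ga t * p.be t j = p.lam t ^ 2 * derivWithin p.be I t j := by
      simp only [defBe, PiLp.add_apply, PiLp.smul_apply, smul_eq_mul]; ring
    rw [this, d5]; ring
  have e2 : p.mainRe Q u I t Q = 0 := by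
    have : ∀ i, (∫ y, Q y * pd i Q y) = 0 := integral_even_mul_pd hQ.neg hQ.neg
    simp only [mainRe, this, hQ.integral_mul_scaleGen hd]
    rw [pair_of_eq_zero hQ.linMinus_self]
    simp
  have e3 : p.mainIm Q u I t (pd j Q) = p.defBe I t j * (b / 2) := by
    have f1 : (∫ y, pd j Q y * Q y) = 0 := by
      rw [← integral_even_mul_pd hQ.neg hQ.neg j]
      exact integral_congr_ae (Eventually.of_forall fun y => mul_comm _ _)
    have f2 : (∫ y, ‖y‖ ^ 2 * pd j Q y * Q y) = 0 := by
      rw [← integral_even_mul_pd (g := fun y => ‖y‖ ^ 2 * Q y) hQ.neg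
        (fun y => by rw [hQ.neg, norm_neg]) j]
      exact integral_congr_ae (Eventually.of_forall fun y => mul_right_comm _ _ _)
    have f3 : ∀ i, (∫ y, y i * pd j Q y * Q y) = if i = j then - b / 2 else 0 := fun i => by
      rw [← hcp]
      exact integral_congr_ae (Eventually.of_forall fun y => mul_right_comm _ _ _)
    simp only [mainIm, f1, f2, f3]
    rw [pair_of_eq_zero (hQ.linPlus_pd j)]
    simp only [mul_ite, mul_zero, Finset.sum_ite_eq', Finset.mem_univ, if_true, Complex.zero_re]
    ring
  rw [e1, e3] at hDb
  rw [e2, sub_zero] at hDb'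
  have hR := rest_lower (p := p) (Q := Q) (u := u) (t := t) (t₀ := t₀) (t₁ := t₁)
  have hε := l2Norm_nonneg (p.eps Q u t)
  have hM := modEq_nonneg (p := p) (I := I) (t := t)
  have hbe : |p.be t j| ≤ 1 :=
    (PiLp.norm_apply_le (p.be t) j).trans (norm_be_le_size.trans a.size_le)
  have hga : |p.ga t| ≤ 1 := abs_ga_le_size.trans a.size_le
  -- The product of ‖ε‖² with a defect is bounded by ‖ε‖ · Mod because ‖ε‖ ≤ 1; the part γβ_j is
  -- bounded and leaves ‖ε‖².
  have g1 : |(p.defBe I t j - p.ga t * p.be t j) * (l2Norm (p.eps Q u t) ^ 2 / 2)|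
      ≤ p.rest Q u I t := by
    rw [abs_mul, abs_of_nonneg (show 0 ≤ l2Norm (p.eps Q u t) ^ 2 / 2 by positivity)]
    have : |p.defBe I t j - p.ga t * p.be t j| ≤ p.modEq I t + 1 := by
      refine (abs_sub _ _).trans (add_le_add (abs_defBe_le j) ?_)
      rw [abs_mul]
      exact mul_le_one₀ hga (abs_nonneg _) hbe
    have h1 : l2Norm (p.eps Q u t) ^ 2 * p.modEq I t ≤ l2Norm (p.eps Q u t) * p.modEq I t := by
      rw [sq, mul_assoc]
      exact mul_le_of_le_one_left (mul_nonneg hε hM) a.eps_le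
    have h2 := mul_le_mul_of_nonneg_right this
      (show 0 ≤ l2Norm (p.eps Q u t) ^ 2 / 2 by positivity)
    have h3 := mul_nonneg hε hM
    have h4 := sq_nonneg (l2Norm (p.eps Q u t))
    linarith
  have g2 : |p.be t j * (p.lam t ^ 2 * D'.re)| ≤ C₂ * p.rest Q u I t := by
    rw [abs_mul]
    exact (mul_le_of_le_one_left (abs_nonneg _) hbe).trans hDb'
  have hb2 := half_pos hb
  have g3 : |p.defBe I t j| * (b / 2) ≤ (C₁ + C₂ + 1) * p.rest Q u I t := by
    rw [← abs_of_pos hb2, ← abs_mul]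
    rw [abs_le] at hDb g1 g2 ⊢
    constructor <;> linarith [hDb.1, hDb.2, g1.1, g1.2, g2.1, g2.2]
  rw [← le_div_iff₀ hb2] at g3
  refine g3.trans_eq ?_
  field_simp

/-- The equation for `θ`. -/
lemma exists_abs_defTh_le (hQ : IsGroundState Q) (hd : d = 1 ∨ d = 2) (hφ : ∀ k, IsCbInfty (φ k))
    (h0 : ∀ k, FlatAtOrigin (φ k)) (A : ℝ) (hρ : IsRho Q ρ) : ∃ C : ℝ, 0 ≤ C ∧
    ∀ (p : ModPath d) (β : Fin N → ℝ → ℝ) (t₀ t₁ t : ℝ) (u : ℝ → E d → ℂ),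
      Admissible φ A Q ρ p β t₀ t₁ t u →
      |p.defTh (Icc t₀ t₁) t| ≤ C * p.rest Q u (Icc t₀ t₁) t := by
  obtain ⟨C₁, hC₁, h⟩ := exists_abs_mainIm_le (ρ := ρ) hQ hd hφ h0 (hρ.isProfile hQ hd) A
    fun p t u hl _ ho => ho.im_pair_rho hl
  obtain ⟨C₂, hC₂, h'⟩ := exists_abs_defGa_le hQ hd hφ h0 A ρ
  have hb := hQ.integral_sq_norm_pos hd
  have hρQ := hρ.integral_mul hQ hd
  set b := ∫ y, ‖y‖ ^ 2 * Q y * Q y with hbdef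
  set m := ∫ y, ‖y‖ ^ 2 * ρ y * Q y with hm
  refine ⟨2 / b * (C₁ + |m| / 4 * C₂), by positivity, fun p β t₀ t₁ t u a => ?_⟩
  have h1 := h p β t₀ t₁ t u a
  have h2 := h' p β t₀ t₁ t u a
  have e1 : linPlus Q ρ = fun x => (-1) * (‖x‖ ^ 2 * Q x) :=
    funext fun x => by rw [hρ.linPlus_self hd]; ring
  have e4 : ∀ j, (∫ y, y j * ρ y * Q y) = 0 := integral_coord_mul_even hQ.neg hρ.neg
  -- L₊ρ = -|y|²Q turns the term in η into a vanishing real pairing. The defect of γ remains besides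
  -- that of θ, and has been estimated already.
  have e5 : p.mainIm Q u (Icc t₀ t₁) t ρ
      = p.defTh (Icc t₀ t₁) t * (b / 2) + p.defGa (Icc t₀ t₁) t * (m / 4) := by
    simp only [mainIm, e1, hρQ, e4]
    rw [pair_const_mul_left, Complex.re_ofReal_mul,
      (a.orth t a.mem).re_pair_sq_norm_mul (a.lam_pos t a.mem)]
    simp only [mul_zero, Finset.sum_const_zero, sub_zero]
    ring
  rw [e5] at h1
  have hb2 := half_pos hb
  have h3 : |p.defGa (Icc t₀ t₁) t * (m / 4)| ≤ |m| / 4 * C₂ * p.rest Q u (Icc t₀ t₁) t := by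
    rw [abs_mul, abs_div, abs_of_pos (show (0 : ℝ) < 4 by norm_num), mul_comm, mul_assoc]
    exact mul_le_mul_of_nonneg_left h2 (by positivity)
  have h4 : |p.defTh (Icc t₀ t₁) t| * (b / 2)
      ≤ (C₁ + |m| / 4 * C₂) * p.rest Q u (Icc t₀ t₁) t := by
    rw [← abs_of_pos hb2, ← abs_mul]
    rw [abs_le] at h1 h3 ⊢
    constructor <;> linarith [h1.1, h1.2, h3.1, h3.2]
  rw [← le_div_iff₀ hb2] at h4
  refine h4.trans_eq ?_
  field_simp

/-- The modulation estimate, before absorption. -/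
theorem exists_modEq_le_rest (hQ : IsGroundState Q) (hd : d = 1 ∨ d = 2) (hφ : ∀ k, IsCbInfty (φ k))
    (h0 : ∀ k, FlatAtOrigin (φ k)) (A : ℝ) (hρ : IsRho Q ρ) : ∃ C : ℝ, 0 ≤ C ∧
    ∀ (p : ModPath d) (β : Fin N → ℝ → ℝ) (t₀ t₁ t : ℝ) (u : ℝ → E d → ℂ),
      Admissible φ A Q ρ p β t₀ t₁ t u →
      p.modEq (Icc t₀ t₁) t ≤ C * p.rest Q u (Icc t₀ t₁) t := by
  obtain ⟨C₁, hC₁, h1⟩ := exists_abs_defLam_le hQ hd hφ h0 A ρ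
  obtain ⟨C₂, hC₂, h2⟩ := exists_abs_defGa_le hQ hd hφ h0 A ρ
  obtain ⟨C₃, hC₃, h3⟩ := exists_abs_defTh_le hQ hd hφ h0 A hρ
  choose C₄ hC₄ h4 using exists_abs_defAl_le hQ hd hφ h0 A ρ
  choose C₅ hC₅ h5 using exists_abs_defBe_le hQ hd hφ h0 A ρ
  refine ⟨C₁ + C₂ + (∑ j, C₄ j) + (∑ j, C₅ j) + C₃, ?_, fun p β t₀ t₁ t u a => ?_⟩
  · have := Finset.sum_nonneg fun j (_ : j ∈ Finset.univ) => hC₄ j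
    have := Finset.sum_nonneg fun j (_ : j ∈ Finset.univ) => hC₅ j
    positivity
  · rw [modEq_eq, add_mul, add_mul, add_mul, add_mul, Finset.sum_mul, Finset.sum_mul]
    exact add_le_add (add_le_add (add_le_add (add_le_add (h1 _ _ _ _ _ _ a) (h2 _ _ _ _ _ _ a))
      ((norm_le_sum_abs _).trans (Finset.sum_le_sum fun j _ => h4 j _ _ _ _ _ _ a)))
      ((norm_le_sum_abs _).trans (Finset.sum_le_sum fun j _ => h5 j _ _ _ _ _ _ a)))
      (h3 _ _ _ _ _ _ a)

end ModPath

/-! ### Mass of the terminal datum, absorption, and conclusion. -/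

lemma l2Norm_pseudoConformal (hQ : IsWeight Q) {T t : ℝ} (ht : t < T) :
    l2Norm (pseudoConformal Q T t) = l2Norm (fun y => (Q y : ℂ)) := by
  have hr : 0 < T - t := sub_pos.mpr ht
  have h := l2Norm_comp_affine hQ.memLp (inv_pos.mpr hr) 0
  simp only [add_zero] at h
  have e : l2Norm (pseudoConformal Q T t)
      = l2Norm fun x => (((T - t) ^ (-(d : ℝ) / 2) : ℝ) : ℂ) * (Q ((T - t)⁻¹ • x) : ℂ) := by
    refine l2Norm_congr_norm fun x => ?_
    rw [pseudoConformal, norm_mul, Complex.norm_exp_ofReal_mul_I, mul_one, Complex.ofReal_mul]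
  rw [e, l2Norm_const_mul, h, Complex.norm_real, Real.norm_eq_abs, abs_of_pos (by positivity),
    ← mul_assoc, Real.inv_rpow hr.le, mul_inv_cancel₀ (by positivity), one_mul]

end RNLS

theorem proposition3p3 {d : ℕ} (hd : d = 1 ∨ d = 2) {N : ℕ}
    (Q ρ : E d → ℝ) (hQ : IsGroundState Q) (hρ : IsRho Q ρ)
    (φ : Fin N → E d → ℝ) (hφ : ∀ k, IsCbInfty (φ k))
    (hA0 : ∀ k, AsymptoticallyFlat (φ k)) (hA1 : ∀ k, FlatAtOrigin (φ k))
    {Ω : Type*} [MeasurableSpace Ω] (P : Measure Ω) [IsProbabilityMeasure P]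
    (B : Fin N → ℝ≥0 → Ω → ℝ) (hB : ∀ k, IsBrownianReal (B k) P)
    (hBind : iIndepFun (fun (k : Fin N) (ω : Ω) (t : ℝ≥0) => B k t ω) P) :
    ∀ᵐ ω ∂P, ∀ T : ℝ, 0 < T →
      ∃ δ : ℝ, 0 < δ ∧ ∃ C : ℝ, 0 < C ∧
        ∀ τ : ℕ → ℝ, Monotone τ → (∀ n, τ n < T) → Tendsto τ atTop (𝓝 T) →
        ∀ (n : ℕ) (tstar : ℝ), 0 ≤ tstar → tstar < τ n →
        ∀ u : ℝ → E d → ℂ,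
          IsSolutionOn φ (fun k t => B k t.toNNReal ω) tstar (τ n) u →
          u (τ n) =ᵐ[volume] pseudoConformal Q T (τ n) →
        ∀ p : ModPath d, p.Decomposes Q ρ u tstar (τ n) →
          (∀ t ∈ Icc tstar (τ n), p.size t + l2Norm (p.eps Q u t) ≤ δ) →
          ∀ t ∈ Icc tstar (τ n), p.DiffWithinAt (Icc tstar (τ n)) t →
            p.modEq (Icc tstar (τ n)) t ≤
              C * (p.size t ^ 2 * l2Norm (p.eps Q u t) + l2Norm (p.eps Q u t) ^ 2
                + ∑ k ∈ Finset.Icc 3 (1 + crit d), h1Norm (p.eps Q u t) ^ k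
                + p.size t ^ 6) := by
  have hcont : ∀ᵐ ω ∂P, ∀ k, Continuous fun t => B k t ω := ae_all_iff.mpr fun k => (hB k).cont
  filter_upwards [hcont] with ω hω T hT
  set β : Fin N → ℝ → ℝ := fun k t => B k t.toNNReal ω with hβdef
  have hβ : ∀ k, Continuous (β k) := fun k => (hω k).comp continuous_real_toNNReal
  -- The paths enter the constants only through this bound on [0, T]. It is fixed before the
  -- sequence, the index and the solution, which makes C and δ uniform.
  obtain ⟨A, hA⟩ : ∃ A : ℝ, ∀ k, ∀ s ∈ Icc 0 T, |β k s| ≤ A := by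
    choose A hA using fun k => isCompact_Icc.exists_bound_of_continuousOn
      (s := Icc 0 T) (hβ k).continuousOn
    refine ⟨∑ k, |A k|, fun k s hs => (hA k s hs).trans ((le_abs_self _).trans ?_)⟩
    exact Finset.single_le_sum (f := fun k => |A k|) (fun k _ => abs_nonneg _) (Finset.mem_univ k)
  obtain ⟨C, hC, hmod⟩ := ModPath.exists_modEq_le_rest hQ hd hφ hA1 A hρ
  -- The bound one gives P ≤ 1 and ‖ε‖ ≤ 1; the other makes C(P + ‖ε‖) ≤ 1/2, so the error
  -- proportional to Mod is absorbed by the left side and C doubles. The added ones keep the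
  -- constants meaningful when C = 0.
  refine ⟨min 1 (1 / (2 * (C + 1))), by positivity, 2 * C + 1, by positivity, ?_⟩
  intro τ _ hτ _ n tstar h0 htn u hu huT p hp hsize t ht hdiff
  have hst := hsize t ht
  have hP := ModPath.size_nonneg (p := p) (t := t)
  have hε := l2Norm_nonneg (p.eps Q u t)
  have hδ1 := hst.trans (min_le_left _ _)
  have hδ2 := hst.trans (min_le_right _ _)
  -- Mass is conserved back from the final time, where the solution is the pseudo-conformal profile,
  -- which has the mass of Q.
  have hmass : ∀ s ∈ Icc tstar (τ n), l2Norm (u s) = l2Norm (fun y => (Q y : ℂ)) := fun s hs => by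
    rw [hu.l2Norm_eq hd hφ (fun k => (hβ k).continuousOn) hs, l2Norm_congr huT,
      l2Norm_pseudoConformal (hQ.isProfile hd).isWeight (hτ n)]
  have h := hmod p β tstar (τ n) t u
    { lt := htn
      sol := hu
      cont := fun k => (hβ k).continuousOn
      bdd := fun k s hs => hA k s ⟨h0.trans hs.1, hs.2.trans (hτ n).le⟩
      lam_pos := hp.lam_pos
      orth := hp.orth
      mass := hmass
      mem := ht
      diff := hdiff
      size_le := by linarith
      eps_le := by linarith }
  have hM := ModPath.modEq_nonneg (p := p) (I := Icc tstar (τ n)) (t := t)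
  have hG := ModPath.good_nonneg (p := p) (Q := Q) (u := u) (t := t)
  have hsmall : C * ((p.size t + l2Norm (p.eps Q u t)) * p.modEq (Icc tstar (τ n)) t)
      ≤ p.modEq (Icc tstar (τ n)) t / 2 := by
    rw [← mul_assoc]
    have : C * (p.size t + l2Norm (p.eps Q u t)) ≤ 1 / 2 := by
      refine (mul_le_mul_of_nonneg_left hδ2 hC).trans ?_
      rw [mul_one_div, div_le_div_iff₀ (by positivity) (by norm_num)]
      linarith
    linarith [mul_le_mul_of_nonneg_right this hM]
  have hkey : p.modEq (Icc tstar (τ n)) t ≤ 2 * C * p.good Q u t := by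
    unfold ModPath.rest at h
    rw [mul_add] at h
    linarith
  -- The exact cancellations leave no term of this form; being nonnegative, it is simply added to
  -- the bound.
  have hslack : 0 ≤ p.size t ^ 2 * l2Norm (p.eps Q u t) := by positivity
  have hfin : p.size t ^ 2 * l2Norm (p.eps Q u t) + l2Norm (p.eps Q u t) ^ 2
      + ∑ k ∈ Finset.Icc 3 (1 + crit d), h1Norm (p.eps Q u t) ^ k + p.size t ^ 6
      = p.size t ^ 2 * l2Norm (p.eps Q u t) + p.good Q u t := by
    unfold ModPath.good; ring
  rw [hfin]
  have hs := mul_nonneg (show (0 : ℝ) ≤ 2 * C + 1 by positivity) hslack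
  linarith
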